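/- **Setting.** An integrable system with $n$ degrees of freedom over a (Hausdorff, paracompact) base space $O$ is a symplectic manifold $(M^{2n},\omega)$ with a proper surjective map $\pi:M\to O$ such that every $x\in O$ has an open neighbourhood $W$ over which the fibers of $\pi$ are the connected components of the common level sets of $n$ Poisson-commuting, functionally independent smooth functions on $\pi^{-1}(W)$. The *strata* of a fiber are the orbits of the flows of the Hamiltonian vector fields of functions $f\circ\pi$. Let $C^\infty$ be the sheaf on $O$ of functions $f$ with $f\circ\pi$ smooth, $\mathcal I\subset C^\infty$ the subsheaf of integral affine functions ($f\circ\pi$ has a $1$-periodic Hamiltonian flow, i.e. generates a system-preserving $\mathbb S^1$-action), $\mathcal Z^1=C^\infty/\mathbb R$ the sheaf of closed $1$-forms on $O$ (locally $df$), and $\mathcal R=\mathcal I/\mathbb R\subset\mathcal Z^1$ the affine monodromy sheaf, so that $\mathcal Z^1/\mathcal R=C^\infty/\mathcal I$. Let $A_t(W)$ be the group of homeomorphisms of $\pi^{-1}(W)$ that preserve each stratum of each fiber and induce the identity on the fundamental group of each stratum and on $H_1(\pi^{-1}(x),\mathbb Z)$ for each $x\in W$. Let $\hat{\mathcal A}_t\to\mathcal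 A_t$ be formed by the elements of $A_t$ together with a continuous choice of homotopy classes of paths, inside the strata, from the points to their images. A *rough symplectic equivalence* over $V$ from one system to another (both restricted to $V$) is an open covering $(U_i)$ of $V$ with fibration-preserving smooth symplectomorphisms $\Phi_i$ over the identity of $U_i$ such that $\Phi_i^{-1}\Phi_j\in A_t(U_i\cap U_j)$. We use the following hypotheses. (H7) A symplectomorphism of $\pi^{-1}(W)$ onto itself which preserves every stratum of every fiber is, near each fiber, the time-one map of a Hamiltonian vector field $X_{f\circ\pi}$ with $f\in C^\infty$. Under (H7) the transition maps $\Phi_i^{-1}\Phi_j$ define a Čech class in $H^1(V,\mathcal Z^1/\mathcal R)$, the *Lagrangian class* of the second system with respect to the first. (H6) $C^\infty$ is fine (has partitions of unity on the base subordinate to every open covering). (H3) Near every point of the base, each continuous choice of classes in the fundamental groups of the strata comes from a section of $\mathcal I$. **Proposition.** Let $O_1,O_2$ be open subsets of a Hausdorff space, with $O_1\cup O_2$ paracompact. Let $S_1,S_2,S_0$ be integrable systems with $n$ degrees of freedom over $O_1$, $O_2$, $O_1\cap O_2$ satisfying (H7), and let $\Psi_1:S_0\to S_1$ and $\Psi_2:S_0\to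 S_2$ be rough symplectic equivalences over $O_1\cap O_2$ ($S_0$ is the common reference system). The Lagrangian classes $\mu_1,\mu_2$ of $S_1,S_2$ with respect to $S_0$, defined by $\Psi_1,\Psi_2$, exist and are unique. Put $\mu_L=\mu_2-\mu_1\in H^1(O_1\cap O_2,\mathcal Z^1/\mathcal R)$. 1. There are an integrable system $S$ over $O_1\cup O_2$ and rough symplectic equivalences $\Theta_i:S_i\to S$ over $O_i$ ($i=1,2$), such that $\Theta_1\Psi_1$ and $\Theta_2\Psi_2$ agree locally over $O_1\cap O_2$ up to elements of $A_t$, if and only if $\mu_L$ lies in the sum of the images of $H^1(O_1,\mathcal Z^1/\mathcal R)$ and $H^1(O_2,\mathcal Z^1/\mathcal R)$ in $H^1(O_1\cap O_2,\mathcal Z^1/\mathcal R)$ under restriction. 2. Assume moreover that $S_0,S_1,S_2$ satisfy (H6), that $S_0$ satisfies (H3), and that $S_1,S_2$ are topologically equivalent over $O_1\cap O_2$ compatibly with $\Psi_1,\Psi_2$: there is a homeomorphism $h$ over the identity of $O_1\cap O_2$ such that locally $\Psi_2^{-1}h\Psi_1$ belongs to the image of $\hat{\mathcal A}_t\to\mathcal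 A_t$. Let $\hat d:H^1(\cdot,\mathcal R)\to H^1(\cdot,\mathcal Z^1)\to H^2(\cdot,\mathbb R)$, where the second map is the connecting homomorphism of $0\to\mathbb R\to C^\infty\to\mathcal Z^1\to0$. Then this connecting homomorphism is bijective over $O_1\cap O_2$, and $H^1(O_1\cap O_2,\mathcal Z^1)\to H^1(O_1\cap O_2,\mathcal Z^1/\mathcal R)$ induces an injection $$\iota:H^2(O_1\cap O_2,\mathbb R)/\hat dH^1(O_1\cap O_2,\mathcal R)\to H^1(O_1\cap O_2,\mathcal Z^1/\mathcal R),$$ which sends the sum of the images of $H^2(O_i,\mathbb R)/\hat dH^1(O_i,\mathcal R)$, $i=1,2$, into the sum of the images of $H^1(O_i,\mathcal Z^1/\mathcal R)$. There is an element $o$ with $\iota(o)=\mu_L$, and the obstruction to gluing is the class of $o$ in the quotient of $H^2(O_1\cap O_2,\mathbb R)/\hat dH^1(O_1\cap O_2,\mathcal R)$ by the sum of the images of $H^2(O_i,\mathbb R)/\hat dH^1(O_i,\mathcal R)$: if this class vanishes, then the systems glue as in 1. 3. Without prescribing the rough equivalences: there is an integrable system over $O_1\cup O_2$ which is roughly symplectically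 equivalent to $S_1$ over $O_1$ and to $S_2$ over $O_2$ if and only if, for some choice of rough symplectic equivalences $S_0\to S_1$ and $S_0\to S_2$ over $O_1\cap O_2$, the difference of the Lagrangian classes lies in the sum of the images of $H^1(O_1,\mathcal Z^1/\mathcal R)$ and $H^1(O_2,\mathcal Z^1/\mathcal R)$. -/

import Mathlib

open Set Filter Topology Manifold TopologicalSpace
open scoped ContDiff

universe u

/-! ### Čech cohomology in degrees one and two

All sheaves below are subquotients of the sheaf of real functions on a space `X`.
A sheaf `A / B` is given by two presheaves `B ⊆ A` of groups of functions.  An element of `A W` is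
a total function `X → ℝ` of which only the values on `W` matter, so that every presheaf `B`
used below as a denominator contains the functions that vanish on `W`. -/

/-- A presheaf of additive groups of real functions on `X`; restriction maps are inclusions. -/
structure FunPresheaf (X : Type u) [TopologicalSpace X] where
  sec : Opens X → AddSubgroup (X → ℝ)
  anti : ∀ {V W : Opens X}, V ≤ W → sec W ≤ sec V

/-- An open covering of `U`, indexed by the points of `U`, with `x ∈ N x ⊆ U`.  (Such coverings are
cofinal among all open coverings of `U`.) -/
def IsPointCover {X : Type u} [TopologicalSpace X] (U : Opens X) (N : X → Opens X) : Prop :=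
  ∀ x ∈ U, x ∈ N x ∧ N x ≤ U

theorem IsPointCover.inf {X : Type u} [TopologicalSpace X] {U V : Opens X} {N M : X → Opens X}
    (hN : IsPointCover U N) (hM : ∀ x ∈ V, x ∈ M x ∧ M x ≤ V) (hVU : V ≤ U) :
    IsPointCover V (fun x => N x ⊓ M x) := fun x hx =>
  ⟨⟨(hN x (hVU hx)).1, (hM x hx).1⟩, inf_le_right.trans (hM x hx).2⟩

theorem isPointCover_const {X : Type u} [TopologicalSpace X] (U : Opens X) :
    IsPointCover U (fun _ => U) := fun _ hx => ⟨hx, le_rfl⟩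

/-- The Čech differential from degree zero to degree one. -/
def cechD0 (X : Type u) : (X → X → ℝ) →+ (X → X → X → ℝ) where
  toFun c x y := c y - c x
  map_zero' := by ext; simp
  map_add' a b := by ext; simp; ring

/-- The Čech differential from degree one to degree two. -/
def cechD1 (X : Type u) : (X → X → X → ℝ) →+ (X → X → X → X → ℝ) where
  toFun a x y z := a y z - a x z + a x y
  map_zero' := by ext; simp
  map_add' a b := by ext; simp; ring

/-- The Čech differential from degree two to degree three. -/
def cechD2 (X : Type u) : (X → X → X → X → ℝ) →+ (X → X → X → X → X → ℝ) where
  toFun b x y z w := b y z w - b x z w + b x y w - b x y z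
  map_zero' := by ext; simp
  map_add' a b := by ext; simp; ring

theorem cechD1_cechD0 {X : Type u} (c : X → X → ℝ) : cechD1 X (cechD0 X c) = 0 := by
  ext; simp [cechD0, cechD1]

theorem cechD2_cechD1 {X : Type u} (a : X → X → X → ℝ) : cechD2 X (cechD1 X a) = 0 := by
  ext; simp [cechD1, cechD2]; ring

section Cech

variable {X : Type u} [TopologicalSpace X]

/-- Čech 1-cocycles on `U` with coefficients in `A / B`, for some covering of `U`. -/
def cechZ1 (A B : FunPresheaf X) (U : Opens X) : AddSubgroup (X → X → X → ℝ) where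
  carrier := {a | ∃ N, IsPointCover U N ∧ (∀ x ∈ U, ∀ y ∈ U, a x y ∈ A.sec (N x ⊓ N y)) ∧
    ∀ x ∈ U, ∀ y ∈ U, ∀ z ∈ U, cechD1 X a x y z ∈ B.sec (N x ⊓ N y ⊓ N z)}
  zero_mem' := ⟨fun _ => U, isPointCover_const U, fun _ _ _ _ => zero_mem _,
    fun x _ y _ z _ => by rw [map_zero]; exact zero_mem _⟩
  add_mem' := by
    rintro a b ⟨N, hN, ha, ha'⟩ ⟨M, hM, hb, hb'⟩
    refine ⟨_, hN.inf hM le_rfl, fun x hx y hy => ?_, fun x hx y hy z hz => ?_⟩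
    · exact add_mem (A.anti (inf_le_inf inf_le_left inf_le_left) (ha x hx y hy))
        (A.anti (inf_le_inf inf_le_right inf_le_right) (hb x hx y hy))
    · rw [map_add]
      exact add_mem
        (B.anti (inf_le_inf (inf_le_inf inf_le_left inf_le_left) inf_le_left)
          (ha' x hx y hy z hz))
        (B.anti (inf_le_inf (inf_le_inf inf_le_right inf_le_right) inf_le_right)
          (hb' x hx y hy z hz))
  neg_mem' := by
    rintro a ⟨N, hN, ha, ha'⟩
    refine ⟨N, hN, fun x hx y hy => neg_mem (ha x hx y hy), fun x hx y hy z hz => ?_⟩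
    rw [map_neg]
    exact neg_mem (ha' x hx y hy z hz)

/-- Čech 1-coboundaries on `U` with coefficients in `A / B`, for some covering of `U`. -/
def cechB1 (A B : FunPresheaf X) (U : Opens X) : AddSubgroup (X → X → X → ℝ) where
  carrier := {a | ∃ N, IsPointCover U N ∧ ∃ c : X → X → ℝ, (∀ x ∈ U, c x ∈ A.sec (N x)) ∧
    ∀ x ∈ U, ∀ y ∈ U, (a - cechD0 X c) x y ∈ B.sec (N x ⊓ N y)}
  zero_mem' := ⟨fun _ => U, isPointCover_const U, 0, fun _ _ => zero_mem _,
    fun x _ y _ => by rw [map_zero, sub_zero]; exact zero_mem _⟩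
  add_mem' := by
    rintro a b ⟨N, hN, c, hc, ha⟩ ⟨M, hM, d, hd, hb⟩
    refine ⟨_, hN.inf hM le_rfl, c + d, fun x hx => ?_, fun x hx y hy => ?_⟩
    · exact add_mem (A.anti inf_le_left (hc x hx)) (A.anti inf_le_right (hd x hx))
    · rw [map_add, add_sub_add_comm]
      exact add_mem (B.anti (inf_le_inf inf_le_left inf_le_left) (ha x hx y hy))
        (B.anti (inf_le_inf inf_le_right inf_le_right) (hb x hx y hy))
  neg_mem' := by
    rintro a ⟨N, hN, c, hc, ha⟩
    refine ⟨N, hN, -c, fun x hx => neg_mem (hc x hx), fun x hx y hy => ?_⟩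
    rw [map_neg, ← neg_sub']
    exact neg_mem (ha x hx y hy)

/-- Čech 2-cocycles on `U` with coefficients in `A / B`, for some covering of `U`. -/
def cechZ2 (A B : FunPresheaf X) (U : Opens X) : AddSubgroup (X → X → X → X → ℝ) where
  carrier := {a | ∃ N, IsPointCover U N ∧
    (∀ x ∈ U, ∀ y ∈ U, ∀ z ∈ U, a x y z ∈ A.sec (N x ⊓ N y ⊓ N z)) ∧
    ∀ x ∈ U, ∀ y ∈ U, ∀ z ∈ U, ∀ w ∈ U, cechD2 X a x y z w ∈ B.sec (N x ⊓ N y ⊓ N z ⊓ N w)}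
  zero_mem' := ⟨fun _ => U, isPointCover_const U, fun _ _ _ _ _ _ => zero_mem _,
    fun x _ y _ z _ w _ => by rw [map_zero]; exact zero_mem _⟩
  add_mem' := by
    rintro a b ⟨N, hN, ha, ha'⟩ ⟨M, hM, hb, hb'⟩
    refine ⟨_, hN.inf hM le_rfl, fun x hx y hy z hz => ?_, fun x hx y hy z hz w hw => ?_⟩
    · exact add_mem
        (A.anti (inf_le_inf (inf_le_inf inf_le_left inf_le_left) inf_le_left)
          (ha x hx y hy z hz))
        (A.anti (inf_le_inf (inf_le_inf inf_le_right inf_le_right) inf_le_right)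
          (hb x hx y hy z hz))
    · rw [map_add]
      exact add_mem
        (B.anti (inf_le_inf (inf_le_inf (inf_le_inf inf_le_left inf_le_left) inf_le_left)
          inf_le_left) (ha' x hx y hy z hz w hw))
        (B.anti (inf_le_inf (inf_le_inf (inf_le_inf inf_le_right inf_le_right) inf_le_right)
          inf_le_right) (hb' x hx y hy z hz w hw))
  neg_mem' := by
    rintro a ⟨N, hN, ha, ha'⟩
    refine ⟨N, hN, fun x hx y hy z hz => neg_mem (ha x hx y hy z hz),
      fun x hx y hy z hz w hw => ?_⟩
    rw [map_neg]
    exact neg_mem (ha' x hx y hy z hz w hw)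

/-- Čech 2-coboundaries on `U` with coefficients in `A / B`, for some covering of `U`. -/
def cechB2 (A B : FunPresheaf X) (U : Opens X) : AddSubgroup (X → X → X → X → ℝ) where
  carrier := {a | ∃ N, IsPointCover U N ∧ ∃ c : X → X → X → ℝ,
    (∀ x ∈ U, ∀ y ∈ U, c x y ∈ A.sec (N x ⊓ N y)) ∧
    ∀ x ∈ U, ∀ y ∈ U, ∀ z ∈ U, (a - cechD1 X c) x y z ∈ B.sec (N x ⊓ N y ⊓ N z)}
  zero_mem' := ⟨fun _ => U, isPointCover_const U, 0, fun _ _ _ _ => zero_mem _,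
    fun x _ y _ z _ => by rw [map_zero, sub_zero]; exact zero_mem _⟩
  add_mem' := by
    rintro a b ⟨N, hN, c, hc, ha⟩ ⟨M, hM, d, hd, hb⟩
    refine ⟨_, hN.inf hM le_rfl, c + d, fun x hx y hy => ?_, fun x hx y hy z hz => ?_⟩
    · exact add_mem (A.anti (inf_le_inf inf_le_left inf_le_left) (hc x hx y hy))
        (A.anti (inf_le_inf inf_le_right inf_le_right) (hd x hx y hy))
    · rw [map_add, add_sub_add_comm]
      exact add_mem
        (B.anti (inf_le_inf (inf_le_inf inf_le_left inf_le_left) inf_le_left)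
          (ha x hx y hy z hz))
        (B.anti (inf_le_inf (inf_le_inf inf_le_right inf_le_right) inf_le_right)
          (hb x hx y hy z hz))
  neg_mem' := by
    rintro a ⟨N, hN, c, hc, ha⟩
    refine ⟨N, hN, -c, fun x hx y hy => neg_mem (hc x hx y hy), fun x hx y hy z hz => ?_⟩
    rw [map_neg, ← neg_sub']
    exact neg_mem (ha x hx y hy z hz)

/-- `H¹(U, A / B)`: the direct limit, over all open coverings of `U`, of the first Čech cohomology
groups with coefficients in `W ↦ A W / B W`.  As cocycles and coboundaries of coverings increase
under refinement, the limit is a quotient of unions.  On a paracompact Hausdorff `U` this is the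
cohomology of the quotient sheaf. -/
def CechH1 (A B : FunPresheaf X) (U : Opens X) : Type u :=
  cechZ1 A B U ⧸ (cechB1 A B U).addSubgroupOf (cechZ1 A B U)

instance (A B : FunPresheaf X) (U : Opens X) : AddCommGroup (CechH1 A B U) :=
  QuotientAddGroup.Quotient.addCommGroup ((cechB1 A B U).addSubgroupOf (cechZ1 A B U))

/-- The class of a cocycle. -/
def CechH1.mk (A B : FunPresheaf X) (U : Opens X) : cechZ1 A B U →+ CechH1 A B U :=
  QuotientAddGroup.mk' ((cechB1 A B U).addSubgroupOf (cechZ1 A B U))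

/-- `H²(U, A / B)`, in the same way. -/
def CechH2 (A B : FunPresheaf X) (U : Opens X) : Type u :=
  cechZ2 A B U ⧸ (cechB2 A B U).addSubgroupOf (cechZ2 A B U)

instance (A B : FunPresheaf X) (U : Opens X) : AddCommGroup (CechH2 A B U) :=
  QuotientAddGroup.Quotient.addCommGroup ((cechB2 A B U).addSubgroupOf (cechZ2 A B U))

/-- The class of a cocycle. -/
def CechH2.mk (A B : FunPresheaf X) (U : Opens X) : cechZ2 A B U →+ CechH2 A B U :=
  QuotientAddGroup.mk' ((cechB2 A B U).addSubgroupOf (cechZ2 A B U))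

/-- `A / B` on `U` maps to `A' / B'` on `V ⊆ U`: locally on `V`, the inclusions `A ⊆ A'` and
`B ⊆ B'` hold. -/
def FunPresheaf.Compat (A B A' B' : FunPresheaf X) (U V : Opens X) : Prop :=
  V ≤ U ∧ ∀ x ∈ V, ∃ M : Opens X, x ∈ M ∧ ∀ W ≤ M, W ≤ V →
    A.sec W ≤ A'.sec W ∧ B.sec W ≤ B'.sec W

theorem FunPresheaf.Compat.exists_cover {A B A' B' : FunPresheaf X} {U V : Opens X}
    (h : FunPresheaf.Compat A B A' B' U V) : ∃ M, IsPointCover V M ∧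
      ∀ x ∈ V, ∀ W ≤ M x, A.sec W ≤ A'.sec W ∧ B.sec W ≤ B'.sec W := by
  classical
  have h2 : ∀ x, ∃ M : Opens X, x ∈ V → x ∈ M ∧ ∀ W ≤ M, W ≤ V →
      A.sec W ≤ A'.sec W ∧ B.sec W ≤ B'.sec W := by
    intro x
    by_cases hx : x ∈ V
    · obtain ⟨M, hM⟩ := h.2 x hx
      exact ⟨M, fun _ => hM⟩
    · exact ⟨⊥, fun h => absurd h hx⟩
  choose M hM using h2
  exact ⟨fun x => M x ⊓ V, fun x hx => ⟨⟨(hM x hx).1, hx⟩, inf_le_right⟩,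
    fun x hx W hW => (hM x hx).2 W (hW.trans inf_le_left) (hW.trans inf_le_right)⟩

theorem cechZ1_mono {A B A' B' : FunPresheaf X} {U V : Opens X}
    (h : FunPresheaf.Compat A B A' B' U V) : cechZ1 A B U ≤ cechZ1 A' B' V := by
  obtain ⟨M, hM, hM'⟩ := h.exists_cover
  rintro a ⟨N, hN, ha, ha'⟩
  refine ⟨_, hN.inf hM h.1, fun x hx y hy => ?_, fun x hx y hy z hz => ?_⟩
  · exact (hM' x hx _ (inf_le_left.trans inf_le_right)).1
      (A.anti (inf_le_inf inf_le_left inf_le_left) (ha x (h.1 hx) y (h.1 hy)))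
  · exact (hM' x hx _ ((inf_le_left.trans inf_le_left).trans inf_le_right)).2
      (B.anti (inf_le_inf (inf_le_inf inf_le_left inf_le_left) inf_le_left)
        (ha' x (h.1 hx) y (h.1 hy) z (h.1 hz)))

theorem cechB1_mono {A B A' B' : FunPresheaf X} {U V : Opens X}
    (h : FunPresheaf.Compat A B A' B' U V) : cechB1 A B U ≤ cechB1 A' B' V := by
  obtain ⟨M, hM, hM'⟩ := h.exists_cover
  rintro a ⟨N, hN, c, hc, ha⟩
  refine ⟨_, hN.inf hM h.1, c, fun x hx => ?_, fun x hx y hy => ?_⟩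
  · exact (hM' x hx _ inf_le_right).1 (A.anti inf_le_left (hc x (h.1 hx)))
  · exact (hM' x hx _ (inf_le_left.trans inf_le_right)).2
      (B.anti (inf_le_inf inf_le_left inf_le_left) (ha x (h.1 hx) y (h.1 hy)))

theorem cechZ2_mono {A B A' B' : FunPresheaf X} {U V : Opens X}
    (h : FunPresheaf.Compat A B A' B' U V) : cechZ2 A B U ≤ cechZ2 A' B' V := by
  obtain ⟨M, hM, hM'⟩ := h.exists_cover
  rintro a ⟨N, hN, ha, ha'⟩
  refine ⟨_, hN.inf hM h.1, fun x hx y hy z hz => ?_, fun x hx y hy z hz w hw => ?_⟩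
  · exact (hM' x hx _ ((inf_le_left.trans inf_le_left).trans inf_le_right)).1
      (A.anti (inf_le_inf (inf_le_inf inf_le_left inf_le_left) inf_le_left)
        (ha x (h.1 hx) y (h.1 hy) z (h.1 hz)))
  · exact (hM' x hx _ (((inf_le_left.trans inf_le_left).trans inf_le_left).trans inf_le_right)).2
      (B.anti (inf_le_inf (inf_le_inf (inf_le_inf inf_le_left inf_le_left) inf_le_left)
        inf_le_left) (ha' x (h.1 hx) y (h.1 hy) z (h.1 hz) w (h.1 hw)))

theorem cechB2_mono {A B A' B' : FunPresheaf X} {U V : Opens X}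
    (h : FunPresheaf.Compat A B A' B' U V) : cechB2 A B U ≤ cechB2 A' B' V := by
  obtain ⟨M, hM, hM'⟩ := h.exists_cover
  rintro a ⟨N, hN, c, hc, ha⟩
  refine ⟨_, hN.inf hM h.1, c, fun x hx y hy => ?_, fun x hx y hy z hz => ?_⟩
  · exact (hM' x hx _ (inf_le_left.trans inf_le_right)).1
      (A.anti (inf_le_inf inf_le_left inf_le_left) (hc x (h.1 hx) y (h.1 hy)))
  · exact (hM' x hx _ ((inf_le_left.trans inf_le_left).trans inf_le_right)).2
      (B.anti (inf_le_inf (inf_le_inf inf_le_left inf_le_left) inf_le_left)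
        (ha x (h.1 hx) y (h.1 hy) z (h.1 hz)))

/-- The map `H¹(U, A / B) → H¹(V, A' / B')` induced by restriction to `V ⊆ U` and by the map of
coefficients; on representing cochains it is the identity. -/
def CechH1.map {A B A' B' : FunPresheaf X} {U V : Opens X}
    (h : FunPresheaf.Compat A B A' B' U V) : CechH1 A B U →+ CechH1 A' B' V :=
  QuotientAddGroup.map ((cechB1 A B U).addSubgroupOf (cechZ1 A B U))
    ((cechB1 A' B' V).addSubgroupOf (cechZ1 A' B' V)) (AddSubgroup.inclusion (cechZ1_mono h))
    (fun _ ha => cechB1_mono h ha)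

/-- The map `H²(U, A / B) → H²(V, A' / B')` induced by restriction to `V ⊆ U` and by the map of
coefficients. -/
def CechH2.map {A B A' B' : FunPresheaf X} {U V : Opens X}
    (h : FunPresheaf.Compat A B A' B' U V) : CechH2 A B U →+ CechH2 A' B' V :=
  QuotientAddGroup.map ((cechB2 A B U).addSubgroupOf (cechZ2 A B U))
    ((cechB2 A' B' V).addSubgroupOf (cechZ2 A' B' V)) (AddSubgroup.inclusion (cechZ2_mono h))
    (fun _ ha => cechB2_mono h ha)

variable (X) in
/-- Functions that vanish on `W`, i.e. the zero sheaf. -/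
def zeroSheaf : FunPresheaf X where
  sec W :=
    { carrier := {f | ∀ x ∈ W, f x = 0}
      zero_mem' := fun _ _ => rfl
      add_mem' := fun {f g} hf hg x hx => by simp [hf x hx, hg x hx]
      neg_mem' := fun {f} hf x hx => by simp [hf x hx] }
  anti h _ hf x hx := hf x (h hx)

variable (X) in
/-- The constant sheaf `ℝ`: functions that are locally constant on `W`. -/
def constSheaf : FunPresheaf X where
  sec W :=
    { carrier := {f | ∀ x ∈ W, ∀ᶠ y in 𝓝 x, f y = f x}
      zero_mem' := fun _ _ => Eventually.of_forall fun _ => rfl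
      add_mem' := fun {f g} hf hg x hx => by
        filter_upwards [hf x hx, hg x hx] with y h1 h2
        simp [h1, h2]
      neg_mem' := fun {f} hf x hx => by
        filter_upwards [hf x hx] with y h1
        simp [h1] }
  anti h _ hf x hx := hf x (h hx)

/-- `H²(U, ℝ)`. -/
abbrev RealH2 (U : Opens X) : Type u := CechH2 (constSheaf X) (zeroSheaf X) U

/-- The restriction map `H²(U, ℝ) → H²(V, ℝ)`. -/
def RealH2.res {U V : Opens X} (h : V ≤ U) : RealH2 U →+ RealH2 V :=
  CechH2.map ⟨h, fun _ _ => ⟨⊤, trivial, fun _ _ _ => ⟨le_rfl, le_rfl⟩⟩⟩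

/-- The connecting homomorphism `H¹(U, A / ℝ) → H²(U, ℝ)` of `0 → ℝ → A → A / ℝ → 0`. -/
def cechConnecting (A : FunPresheaf X) (U : Opens X) :
    CechH1 A (constSheaf X) U →+ RealH2 U :=
  QuotientAddGroup.map
    ((cechB1 A (constSheaf X) U).addSubgroupOf (cechZ1 A (constSheaf X) U))
    ((cechB2 (constSheaf X) (zeroSheaf X) U).addSubgroupOf
      (cechZ2 (constSheaf X) (zeroSheaf X) U))
    (((cechD1 X).comp (cechZ1 A (constSheaf X) U).subtype).codRestrict
      (cechZ2 (constSheaf X) (zeroSheaf X) U) (by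
        rintro ⟨a, N, hN, _, ha⟩
        refine ⟨N, hN, ha, fun x _ y _ z _ w _ => ?_⟩
        have h : cechD2 X (cechD1 X a) x y z w = 0 := by rw [cechD2_cechD1]; rfl
        show cechD2 X (cechD1 X a) x y z w ∈ _
        rw [h]
        exact zero_mem _))
    (by
      rintro ⟨a, _⟩ ⟨N, hN, c, _, ha⟩
      refine ⟨N, hN, a - cechD0 X c, ha, fun x _ y _ z _ => ?_⟩
      have h : (cechD1 X a - cechD1 X (a - cechD0 X c)) x y z = 0 := by
        rw [map_sub, cechD1_cechD0]; simp
      show (cechD1 X a - cechD1 X (a - cechD0 X c)) x y z ∈ _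
      rw [h]
      exact zero_mem _)

end Cech

/-! ### Integrable systems -/

/-- The model space `ℝ²ⁿ`. -/
abbrev PhaseSpace (n : ℕ) : Type := EuclideanSpace ℝ (Fin (2 * n))

/-- The differential of a real function at a point of a manifold. -/
noncomputable def dAt {n : ℕ} {M : Type u} [TopologicalSpace M] [ChartedSpace (PhaseSpace n) M]
    (f : M → ℝ) (p : M) : TangentSpace 𝓘(ℝ, PhaseSpace n) p →L[ℝ] ℝ :=
  mfderiv 𝓘(ℝ, PhaseSpace n) 𝓘(ℝ, ℝ) f p

/-- The expression of a differential 2-form in the chart around `p₀`. -/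
noncomputable def formInChart {n : ℕ} {M : Type u} [TopologicalSpace M]
    [ChartedSpace (PhaseSpace n) M]
    (σ : ∀ p : M, TangentSpace 𝓘(ℝ, PhaseSpace n) p [⋀^Fin 2]→L[ℝ] ℝ) (p₀ : M)
    (y : PhaseSpace n) : PhaseSpace n [⋀^Fin 2]→L[ℝ] ℝ :=
  (σ ((chartAt (PhaseSpace n) p₀).symm y)).compContinuousLinearMap
    (mfderiv 𝓘(ℝ, PhaseSpace n) 𝓘(ℝ, PhaseSpace n) (chartAt (PhaseSpace n) p₀).symm y)

/-- A symplectic form: a smooth, closed, nondegenerate differential 2-form. -/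
structure IsSymplecticForm {n : ℕ} {M : Type u} [TopologicalSpace M]
    [ChartedSpace (PhaseSpace n) M]
    (σ : ∀ p : M, TangentSpace 𝓘(ℝ, PhaseSpace n) p [⋀^Fin 2]→L[ℝ] ℝ) : Prop where
  smooth : ∀ p₀, ContDiffOn ℝ ∞ (formInChart σ p₀) (chartAt (PhaseSpace n) p₀).target
  closed : ∀ p₀, ∀ y ∈ (chartAt (PhaseSpace n) p₀).target, extDeriv (formInChart σ p₀) y = 0
  nondegenerate : ∀ p u, (∀ v, σ p ![u, v] = 0) → u = 0

/-- `F₁, …, Fₙ` is a moment map that defines the fibration `proj` over `W`: smooth functions on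
`proj⁻¹(W)` which commute for the Poisson bracket, are functionally independent (independent
differentials on a dense set), and such that the fibers of `proj` over `W` are the connected
components of the common level sets. -/
structure IsMomentMap {n : ℕ} {X M : Type u} [TopologicalSpace X] [TopologicalSpace M]
    [ChartedSpace (PhaseSpace n) M]
    (σ : ∀ p : M, TangentSpace 𝓘(ℝ, PhaseSpace n) p [⋀^Fin 2]→L[ℝ] ℝ) (proj : M → X)
    (W : Opens X) (F : Fin n → M → ℝ) : Prop where
  smooth : ∀ i, ContMDiffOn 𝓘(ℝ, PhaseSpace n) 𝓘(ℝ, ℝ) ∞ (F i) (proj ⁻¹' W)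
  commute : ∀ i j, ∀ p ∈ proj ⁻¹' (W : Set X), ∀ u,
    (∀ v, σ p ![u, v] = dAt (n := n) (F i) p v) → dAt (n := n) (F j) p u = 0
  independent : proj ⁻¹' (W : Set X) ⊆
    closure {p | proj p ∈ W ∧ LinearIndependent ℝ (fun i => dAt (n := n) (F i) p)}
  fiber : ∀ p ∈ proj ⁻¹' (W : Set X), proj ⁻¹' {proj p} =
    connectedComponentIn (proj ⁻¹' (W : Set X) ∩ {q | ∀ i, F i q = F i p}) p

/-- An integrable system with `n` degrees of freedom over the base space `U`: a symplectic manifold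
of dimension `2n` with a proper map onto `U` (so that `U` has the quotient topology and the fibers
are compact), defined by a moment map near each fiber.  The base space is paracompact. -/
structure IntegrableSystem (n : ℕ) {X : Type u} [TopologicalSpace X] (U : Opens X) where
  carrier : Type u
  [topology : TopologicalSpace carrier]
  [charts : ChartedSpace (PhaseSpace n) carrier]
  [manifold : IsManifold 𝓘(ℝ, PhaseSpace n) ∞ carrier]
  [t2 : T2Space carrier]
  form : ∀ p : carrier, TangentSpace 𝓘(ℝ, PhaseSpace n) p [⋀^Fin 2]→L[ℝ] ℝ
  symplectic : IsSymplecticForm form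
  proj : carrier → X
  proj_mem : ∀ p, proj p ∈ (U : Set X)
  proj_onto : ∀ x ∈ U, ∃ p, proj p = x
  proper : IsProperMap (Set.codRestrict proj (U : Set X) proj_mem)
  paracompact : ParacompactSpace U
  moment : ∀ x ∈ U, ∃ W : Opens X, x ∈ W ∧ W ≤ U ∧ ∃ F : Fin n → carrier → ℝ,
    IsMomentMap form proj W F

attribute [instance] IntegrableSystem.topology IntegrableSystem.charts IntegrableSystem.manifold
  IntegrableSystem.t2

/-- Two paths `γ, γ'` are homotopic with fixed end points within the set `P`. -/
def HomotopicIn {M : Type u} [TopologicalSpace M] (P : Set M) (γ γ' : unitInterval → M) : Prop :=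
  ∃ K : C(unitInterval × unitInterval, M), (∀ t, K (0, t) = γ t) ∧ (∀ t, K (1, t) = γ' t) ∧
    (∀ s, K (s, 0) = γ 0) ∧ (∀ s, K (s, 1) = γ 1) ∧ ∀ s t, K (s, t) ∈ P

/-- The map induced on first singular homology with integral coefficients. -/
noncomputable def homologyMap {F : Type u} [TopologicalSpace F] (g : C(F, F)) :
    ((AlgebraicTopology.singularHomologyFunctor AddCommGrpCat.{u} 1).obj
      (AddCommGrpCat.of (ULift.{u} ℤ))).obj (TopCat.of F) ⟶
    ((AlgebraicTopology.singularHomologyFunctor AddCommGrpCat.{u} 1).obj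
      (AddCommGrpCat.of (ULift.{u} ℤ))).obj (TopCat.of F) :=
  ((AlgebraicTopology.singularHomologyFunctor AddCommGrpCat.{u} 1).obj
    (AddCommGrpCat.of (ULift.{u} ℤ))).map (TopCat.ofHom g)

namespace IntegrableSystem

variable {n : ℕ} {X : Type u} [TopologicalSpace X] {U : Opens X} (S : IntegrableSystem n U)

theorem continuous_proj : Continuous S.proj :=
  continuous_subtype_val.comp S.proper.continuous

/-- The part of the phase space over `W`. -/
abbrev part (W : Opens X) : Set S.carrier := S.proj ⁻¹' (W : Set X)

/-- The sheaf `C^∞` of smooth functions on the base space. -/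
def smoothSheaf : FunPresheaf X where
  sec W :=
    { carrier := {f | ContMDiffOn 𝓘(ℝ, PhaseSpace n) 𝓘(ℝ, ℝ) ∞ (f ∘ S.proj) (S.part W)}
      zero_mem' := contMDiffOn_const (c := (0 : ℝ))
      add_mem' := fun {f g} hf hg => ContMDiffOn.add (f := f ∘ S.proj) (g := g ∘ S.proj) hf hg
      neg_mem' := fun {f} hf => ContMDiffOn.neg (f := f ∘ S.proj) hf }
  anti h f hf := ContMDiffOn.mono (f := f ∘ S.proj) hf (preimage_mono h)

/-- `γ` is an integral curve, inside a fiber, of the Hamiltonian vector field `X` of `f ∘ proj`, which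
is given by `i_X form = d(f ∘ proj)`. -/
def IsFlowLine (f : X → ℝ) (γ : ℝ → S.carrier) : Prop :=
  (∀ t, S.proj (γ t) = S.proj (γ 0)) ∧
  ∀ t, ∃ w : TangentSpace 𝓘(ℝ, PhaseSpace n) (γ t),
    HasMFDerivAt 𝓘(ℝ, ℝ) 𝓘(ℝ, PhaseSpace n) γ t ((1 : ℝ →L[ℝ] ℝ).smulRight w) ∧
    ∀ v, S.form (γ t) ![w, v] = dAt (n := n) (f ∘ S.proj) (γ t) v

/-- On the part over `W`, `φ` is the time one map of the Hamiltonian vector field of `f ∘ proj`. -/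
def IsTimeOneMap (f : X → ℝ) (W : Opens X) (φ : S.carrier → S.carrier) : Prop :=
  ∀ p ∈ S.part W, ∃ γ, S.IsFlowLine f γ ∧ γ 0 = p ∧ γ 1 = φ p

/-- Integral affine functions on `W`: smooth functions on the base whose Hamiltonian vector field
has a one-periodic flow, that is, which generate a system-preserving circle action. -/
def IsIntegralAffine (W : Opens X) (f : X → ℝ) : Prop :=
  f ∈ S.smoothSheaf.sec W ∧ S.IsTimeOneMap f W id

/-- The sheaf of integral affine functions.  (Sums of integral affine functions are integral
affine, since functions on the base commute; the closure is taken only to have a subgroup by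
construction.) -/
def affineSheaf : FunPresheaf X where
  sec W := AddSubgroup.closure {f | S.IsIntegralAffine W f}
  anti h := AddSubgroup.closure_mono fun _ hf =>
    ⟨S.smoothSheaf.anti h hf.1, fun p hp => hf.2 p (h hp)⟩

/-- The stratum through `p` of the fiber through `p`: the orbit of the Poisson action, i.e. the
points reached from `p` by the flows of Hamiltonian vector fields of functions on the base. -/
def stratum (p : S.carrier) : Set S.carrier :=
  {q | ∃ W : Opens X, S.proj p ∈ W ∧ ∃ f ∈ S.smoothSheaf.sec W, ∃ γ, S.IsFlowLine f γ ∧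
    γ 0 = p ∧ γ 1 = q}

/-- Membership in the group `A_t(W)`, for a homeomorphism `φ` of the part over `W`: it preserves
each stratum of each fiber, and it induces the identity on the (abelian) fundamental group of each
stratum and on the first homology group of each fiber. -/
structure IsAdmissible (W : Opens X) (φ : S.carrier → S.carrier) : Prop where
  stratum_mem : ∀ p ∈ S.part W, φ p ∈ S.stratum p
  loops : ∀ p ∈ S.part W, ∀ γ : C(unitInterval, S.carrier), γ 0 = γ 1 →
    (∀ t, γ t ∈ S.stratum p) → ∃ K : C(unitInterval × unitInterval, S.carrier),
      (∀ t, K (0, t) = γ t) ∧ (∀ t, K (1, t) = φ (γ t)) ∧ (∀ s, K (s, 0) = K (s, 1)) ∧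
      ∀ s t, K (s, t) ∈ S.stratum p
  homology : ∀ x ∈ W, ∀ g : C({p // S.proj p = x}, {p // S.proj p = x}),
    (∀ p, (g p : S.carrier) = φ p) → homologyMap g = CategoryTheory.CategoryStruct.id _

/-- A continuous association of homotopy classes of paths from `p` to `φ p`, inside the stratum
of `p`, for `p` over `W`; the class at `p` is that of the path `l p`.  Continuity: along every
curve `ψ` over `W` the classes are realized by a continuous family of paths. -/
structure IsPathLift (W : Opens X) (φ : S.carrier → S.carrier)
    (l : S.carrier → C(unitInterval, S.carrier)) : Prop where
  source : ∀ p ∈ S.part W, l p 0 = p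
  target : ∀ p ∈ S.part W, l p 1 = φ p
  mem : ∀ p ∈ S.part W, ∀ t, l p t ∈ S.stratum p
  continuous : ∀ ψ : C(unitInterval, S.carrier), (∀ t, ψ t ∈ S.part W) →
    ∃ H : C(unitInterval × unitInterval, S.carrier),
      ∀ t, HomotopicIn (S.stratum (ψ t)) (fun s => H (t, s)) (l (ψ t))

/-- Hypothesis on the affine monodromy: near every point of the base, each continuous association
of classes in the fundamental groups of the strata comes from a system-preserving symplectic circle
action. -/
def AffineMonodromyHyp : Prop :=
  ∀ W ≤ U, ∀ l, S.IsPathLift W id l → ∀ x ∈ W, ∃ V : Opens X, x ∈ V ∧ V ≤ W ∧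
    ∃ f, S.IsIntegralAffine V f ∧ ∀ p ∈ S.part V, ∃ γ, S.IsFlowLine f γ ∧ γ 0 = p ∧ γ 1 = p ∧
      HomotopicIn (S.stratum p) (fun t => γ t) (l p)

/-- Hypothesis that `C^∞` is a fine sheaf: smooth partitions of unity on the base space subordinate
to open coverings. -/
def FineHyp : Prop :=
  ∀ (ι : Type u) (V : ι → Opens X), (∀ x ∈ U, ∃ i, x ∈ V i) → ∃ ρ : ι → X → ℝ,
    (∀ i, ρ i ∈ S.smoothSheaf.sec U) ∧
    (∀ i, ∀ x ∈ U, x ∉ V i → ∀ᶠ y in 𝓝 x, ρ i y = 0) ∧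
    (∀ x ∈ U, ∃ t ∈ 𝓝 x, {i | ∃ y ∈ t, ρ i y ≠ 0}.Finite) ∧
    ∀ x ∈ U, ∑ᶠ i, ρ i x = 1

/-- Hypothesis on local symplectomorphisms: a symplectomorphism of the part over `W` which
preserves every stratum of every fiber is, near each fiber, the time one map of a symplectic vector
field tangent to the fibration (the Hamiltonian vector field of a function on the base). -/
def SymplectomorphismHyp : Prop :=
  ∀ W ≤ U, ∀ φ : OpenPartialHomeomorph S.carrier S.carrier,
    φ.source = S.part W → φ.target = S.part W →
    ContMDiffOn 𝓘(ℝ, PhaseSpace n) 𝓘(ℝ, PhaseSpace n) ∞ φ φ.source →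
    ContMDiffOn 𝓘(ℝ, PhaseSpace n) 𝓘(ℝ, PhaseSpace n) ∞ φ.symm φ.target →
    (∀ p ∈ φ.source, ∀ u v, S.form (φ p)
      ![mfderiv 𝓘(ℝ, PhaseSpace n) 𝓘(ℝ, PhaseSpace n) φ p u,
        mfderiv 𝓘(ℝ, PhaseSpace n) 𝓘(ℝ, PhaseSpace n) φ p v] = S.form p ![u, v]) →
    (∀ p ∈ φ.source, φ p ∈ S.stratum p) →
    ∀ x ∈ W, ∃ V : Opens X, x ∈ V ∧ V ≤ W ∧ ∃ f ∈ S.smoothSheaf.sec V, S.IsTimeOneMap f V φ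

/-- Coefficients of `H¹(·, 𝒵¹/ℛ)`.  Closed 1-forms on the base are local differentials of smooth
functions, so `𝒵¹ = C^∞/ℝ`; symplectic circle actions are generated by integral affine functions,
so `ℛ = 𝓘/ℝ`, with `𝓘` the sheaf of these; hence `𝒵¹/ℛ = C^∞/𝓘`. -/
abbrev H1ZmodR (V : Opens X) : Type u := CechH1 S.smoothSheaf S.affineSheaf V

/-- `H¹(V, 𝒵¹)`. -/
abbrev H1Z (V : Opens X) : Type u := CechH1 S.smoothSheaf (constSheaf X) V

/-- `H¹(V, ℛ)`. -/
abbrev H1R (V : Opens X) : Type u := CechH1 S.affineSheaf (constSheaf X) V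

/-- The homomorphism `H¹(V, 𝒵¹) → H²(V, ℝ)` which arises from `0 → ℝ → C^∞ → 𝒵¹ → 0`. -/
def connectingZ (V : Opens X) : S.H1Z V →+ RealH2 V := cechConnecting _ V

/-- `d̂ : H¹(V, ℛ) → H²(V, ℝ)`, the composition of `H¹(V, ℛ) → H¹(V, 𝒵¹)` with `connectingZ`. -/
def dhat (V : Opens X) : S.H1R V →+ RealH2 V := cechConnecting _ V

/-- `H²(V, ℝ) / d̂ H¹(V, ℛ)`. -/
def H2modR (V : Opens X) : Type u := RealH2 V ⧸ (S.dhat V).range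

instance (V : Opens X) : AddCommGroup (S.H2modR V) :=
  QuotientAddGroup.Quotient.addCommGroup (S.dhat V).range

/-- The projection `H²(V, ℝ) → H²(V, ℝ) / d̂ H¹(V, ℛ)`. -/
def H2modR.mk (V : Opens X) : RealH2 V →+ S.H2modR V := QuotientAddGroup.mk' (S.dhat V).range

theorem const_le_affine (W : Opens X) :
    (constSheaf X).sec W ≤ S.affineSheaf.sec W := by
  intro f hf
  have hev : ∀ p ∈ S.part W, f ∘ S.proj =ᶠ[𝓝 p] fun _ => f (S.proj p) := fun p hp =>
    S.continuous_proj.continuousAt.eventually (hf (S.proj p) hp)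
  refine AddSubgroup.subset_closure ⟨fun p hp => ?_, fun p hp => ⟨fun _ => p, ⟨fun _ => rfl,
    fun t => ⟨0, ?_, fun v => ?_⟩⟩, rfl, rfl⟩⟩
  · exact ((contMDiffAt_const (c := f (S.proj p))).congr_of_eventuallyEq
      (hev p hp)).contMDiffWithinAt
  · have h := hasMFDerivAt_const (I := 𝓘(ℝ, ℝ)) (I' := 𝓘(ℝ, PhaseSpace n)) p t
    refine h.congr_mfderiv ?_
    ext
    simp
    rfl
  · have h1 : dAt (n := n) (f ∘ S.proj) p = 0 := by
      unfold dAt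
      rw [(hev p hp).mfderiv_eq]
      exact mfderiv_const
    have h2 : S.form p ![0, v] = 0 := (S.form p).map_coord_zero 0 rfl
    show S.form p ![0, v] = dAt (n := n) (f ∘ S.proj) p v
    rw [h1, h2]
    rfl

/-- The homomorphism `H¹(V, 𝒵¹) → H¹(V, 𝒵¹/ℛ)`. -/
def toZmodR (V : Opens X) : S.H1Z V →+ S.H1ZmodR V :=
  CechH1.map ⟨le_rfl, fun _ _ => ⟨⊤, trivial, fun W _ _ => ⟨le_rfl, S.const_le_affine W⟩⟩⟩

end IntegrableSystem

/-! ### Rough symplectic equivalence -/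

/-- A rough symplectic equivalence over `V`, covering the identity of `V`, between the restrictions
to `V` of two systems: an open covering of `V` (indexed by the points of `V`) and, over its members,
fibration-preserving symplectomorphisms whose mutual comparisons are admissible. -/
structure RoughEquiv {n : ℕ} {X : Type u} [TopologicalSpace X] {U U' : Opens X}
    (S : IntegrableSystem n U) (T : IntegrableSystem n U') (V : Opens X) where
  nbhd : X → Opens X
  cover : IsPointCover V nbhd
  map : X → OpenPartialHomeomorph S.carrier T.carrier
  source : ∀ x ∈ V, (map x).source = S.part (nbhd x)
  target : ∀ x ∈ V, (map x).target = T.part (nbhd x)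
  proj_map : ∀ x ∈ V, ∀ p ∈ (map x).source, T.proj (map x p) = S.proj p
  smooth : ∀ x ∈ V, ContMDiffOn 𝓘(ℝ, PhaseSpace n) 𝓘(ℝ, PhaseSpace n) ∞ (map x) (map x).source
  smooth_symm : ∀ x ∈ V,
    ContMDiffOn 𝓘(ℝ, PhaseSpace n) 𝓘(ℝ, PhaseSpace n) ∞ (map x).symm (map x).target
  symplectic : ∀ x ∈ V, ∀ p ∈ (map x).source, ∀ u v, T.form (map x p)
    ![mfderiv 𝓘(ℝ, PhaseSpace n) 𝓘(ℝ, PhaseSpace n) (map x) p u,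
      mfderiv 𝓘(ℝ, PhaseSpace n) 𝓘(ℝ, PhaseSpace n) (map x) p v] = S.form p ![u, v]
  admissible : ∀ x ∈ V, ∀ y ∈ V,
    S.IsAdmissible (nbhd x ⊓ nbhd y) ((map x).symm ∘ map y)

namespace RoughEquiv

variable {n : ℕ} {X : Type u} [TopologicalSpace X] {U U' V : Opens X}
  {S : IntegrableSystem n U} {T : IntegrableSystem n U'}

/-- `c ∈ H¹(V, 𝒵¹/ℛ)` is the Lagrangian class of `T` with respect to `S`: it is represented, on
some covering, by functions `a x y` whose time one maps are the transition symplectomorphisms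
`Φ_x⁻¹ ∘ Φ_y` of `S`. -/
def IsLagrangianClass (Φ : RoughEquiv S T V) (c : S.H1ZmodR V) : Prop :=
  ∃ N, IsPointCover V N ∧ (∀ x ∈ V, N x ≤ Φ.nbhd x) ∧
    ∃ a : cechZ1 S.smoothSheaf S.affineSheaf V, c = CechH1.mk _ _ _ a ∧
      ∀ x ∈ V, ∀ y ∈ V, (a : X → X → X → ℝ) x y ∈ S.smoothSheaf.sec (N x ⊓ N y) ∧
        S.IsTimeOneMap ((a : X → X → X → ℝ) x y) (N x ⊓ N y) ((Φ.map x).symm ∘ Φ.map y)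

theorem smooth_le (Φ : RoughEquiv S T V) {x : X} (hx : x ∈ V) {W : Opens X}
    (hW : W ≤ Φ.nbhd x) : T.smoothSheaf.sec W ≤ S.smoothSheaf.sec W := by
  intro f hf
  have hs : S.part W ⊆ (Φ.map x).source := by
    rw [Φ.source x hx]
    exact preimage_mono hW
  have h1 : ContMDiffOn 𝓘(ℝ, PhaseSpace n) 𝓘(ℝ, ℝ) ∞ ((f ∘ T.proj) ∘ Φ.map x) (S.part W) := by
    refine ContMDiffOn.comp (t := T.part W) hf ((Φ.smooth x hx).mono hs) fun p hp => ?_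
    show T.proj (Φ.map x p) ∈ W
    rw [Φ.proj_map x hx p (hs hp)]
    exact hp
  refine ContMDiffOn.congr h1 fun p hp => ?_
  simp [Φ.proj_map x hx p (hs hp)]

theorem affine_le (Φ : RoughEquiv S T V) {x : X} (hx : x ∈ V) {W : Opens X}
    (hW : W ≤ Φ.nbhd x) : T.affineSheaf.sec W ≤ S.affineSheaf.sec W := by
  refine AddSubgroup.closure_mono fun f hf => ⟨Φ.smooth_le hx hW hf.1, fun p hp => ?_⟩
  have hps : p ∈ (Φ.map x).source := by
    rw [Φ.source x hx]
    exact hW hp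
  have hpW : T.proj (Φ.map x p) ∈ W := by
    rw [Φ.proj_map x hx p hps]
    exact hp
  obtain ⟨γ, ⟨hγ, hγ'⟩, h0, h1⟩ := hf.2 (Φ.map x p) hpW
  have ht : ∀ t, γ t ∈ (Φ.map x).target := fun t => by
    rw [Φ.target x hx]
    apply hW
    rw [hγ t, h0]
    exact hpW
  have hproj : ∀ q ∈ (Φ.map x).target, S.proj ((Φ.map x).symm q) = T.proj q := fun q hq => by
    rw [← Φ.proj_map x hx _ ((Φ.map x).map_target hq), (Φ.map x).right_inv hq]
  have hmd : (Φ.map x).MDifferentiable 𝓘(ℝ, PhaseSpace n) 𝓘(ℝ, PhaseSpace n) :=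
    ⟨(Φ.smooth x hx).mdifferentiableOn (by simp), (Φ.smooth_symm x hx).mdifferentiableOn (by simp)⟩
  refine ⟨fun t => (Φ.map x).symm (γ t), ⟨fun t => ?_, fun t => ?_⟩, ?_, ?_⟩
  · simp only [hproj _ (ht _)]
    exact hγ t
  · obtain ⟨w, hw, hw'⟩ := hγ' t
    have hsd := (hmd.mdifferentiableAt_symm (ht t)).hasMFDerivAt
    refine ⟨mfderiv 𝓘(ℝ, PhaseSpace n) 𝓘(ℝ, PhaseSpace n) (Φ.map x).symm (γ t) w, ?_, fun v => ?_⟩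
    · have h := hsd.comp t hw
      refine h.congr_mfderiv ?_
      ext
      exact map_smul (mfderiv 𝓘(ℝ, PhaseSpace n) 𝓘(ℝ, PhaseSpace n) (Φ.map x).symm (γ t))
        (1 : ℝ) w
    · have hq := (Φ.map x).map_target (ht t)
      rw [← Φ.symplectic x hx _ hq]
      have key : ∀ q' (w' : PhaseSpace n), q' = γ t → w' = w → ∀ u : PhaseSpace n,
          T.form q' ![w', u] = dAt (n := n) (f ∘ T.proj) q' u := by
        rintro _ _ rfl rfl u
        exact hw' u
      have hw2 : mfderiv 𝓘(ℝ, PhaseSpace n) 𝓘(ℝ, PhaseSpace n) (Φ.map x)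
          ((Φ.map x).symm (γ t))
          (mfderiv 𝓘(ℝ, PhaseSpace n) 𝓘(ℝ, PhaseSpace n) (Φ.map x).symm (γ t) w) = w :=
        congrArg (fun L => L w) (hmd.comp_symm_deriv (ht t))
      refine (key _ _ ((Φ.map x).right_inv (ht t)) hw2 _).trans ?_
      have hmem : Φ.map x ((Φ.map x).symm (γ t)) ∈ T.part W := by
        show T.proj _ ∈ W
        rw [(Φ.map x).right_inv (ht t), hγ t, h0]
        exact hpW
      have hd : MDifferentiableAt 𝓘(ℝ, PhaseSpace n) 𝓘(ℝ, ℝ) (f ∘ T.proj)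
          (Φ.map x ((Φ.map x).symm (γ t))) :=
        (ContMDiffOn.contMDiffAt (f := f ∘ T.proj) hf.1
          ((W.isOpen.preimage T.continuous_proj).mem_nhds hmem)).mdifferentiableAt (by simp)
      have hev : f ∘ S.proj =ᶠ[𝓝 ((Φ.map x).symm (γ t))] (f ∘ T.proj) ∘ Φ.map x := by
        filter_upwards [(Φ.map x).open_source.mem_nhds hq] with p' hp'
        simp [Φ.proj_map x hx p' hp']
      unfold dAt
      rw [hev.mfderiv_eq]
      exact (mfderiv_comp_apply _ hd (hmd.mdifferentiableAt hq) v).symm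
  · simp only [h0]
    exact (Φ.map x).left_inv hps
  · simp only [h1]
    exact (Φ.map x).left_inv hps

/-- The restriction map `H¹(U', 𝒵¹/ℛ) → H¹(V, 𝒵¹/ℛ)`; over `V` the sheaves of the two roughly
equivalent systems are identified (they are the same sheaves of functions on the base). -/
def resZmodR (Φ : RoughEquiv S T V) (h : V ≤ U') : T.H1ZmodR U' →+ S.H1ZmodR V :=
  CechH1.map ⟨h, fun x hx => ⟨Φ.nbhd x, (Φ.cover x hx).1,
    fun _ hW _ => ⟨Φ.smooth_le hx hW, Φ.affine_le hx hW⟩⟩⟩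

/-- The restriction map `H¹(U', ℛ) → H¹(V, ℛ)`. -/
def resR (Φ : RoughEquiv S T V) (h : V ≤ U') : T.H1R U' →+ S.H1R V :=
  CechH1.map ⟨h, fun x hx => ⟨Φ.nbhd x, (Φ.cover x hx).1,
    fun _ hW _ => ⟨Φ.affine_le hx hW, le_rfl⟩⟩⟩

theorem res_dhat (Φ : RoughEquiv S T V) (h : V ≤ U') (c : T.H1R U') :
    RealH2.res h (T.dhat U' c) = S.dhat V (Φ.resR h c) := by
  obtain ⟨a, rfl⟩ := QuotientAddGroup.mk_surjective c
  rfl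

/-- The restriction map `H²(U', ℝ) / d̂ H¹(U', ℛ) → H²(V, ℝ) / d̂ H¹(V, ℛ)`. -/
def resH2modR (Φ : RoughEquiv S T V) (h : V ≤ U') : T.H2modR U' →+ S.H2modR V :=
  QuotientAddGroup.map (T.dhat U').range (S.dhat V).range (RealH2.res h) (by
    rintro _ ⟨c, rfl⟩
    exact ⟨Φ.resR h c, (Φ.res_dhat h c).symm⟩)

end RoughEquiv

/-! ### Gluing -/

section Glue

variable {n : ℕ} {X : Type u} [TopologicalSpace X] {O₁ O₂ : Opens X}
  {S₁ : IntegrableSystem n O₁} {S₂ : IntegrableSystem n O₂} {S₀ : IntegrableSystem n (O₁ ⊓ O₂)}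

/-- The two systems glue: there is a system over `O₁ ∪ O₂` which is roughly symplectically
equivalent to `S₁` over `O₁` and to `S₂` over `O₂`, in such a way that the rough equivalences
`S₀ → S₁ → S` and `S₀ → S₂ → S` over `O₁ ∩ O₂` agree locally up to admissible
automorphisms. -/
def Glues (Ψ₁ : RoughEquiv S₀ S₁ (O₁ ⊓ O₂)) (Ψ₂ : RoughEquiv S₀ S₂ (O₁ ⊓ O₂)) : Prop :=
  ∃ (S : IntegrableSystem n (O₁ ⊔ O₂)) (Θ₁ : RoughEquiv S₁ S O₁) (Θ₂ : RoughEquiv S₂ S O₂),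
    ∀ x ∈ O₁ ⊓ O₂, ∃ W : Opens X, x ∈ W ∧
      W ≤ Ψ₁.nbhd x ⊓ Ψ₂.nbhd x ⊓ (Θ₁.nbhd x ⊓ Θ₂.nbhd x) ∧
      S₀.IsAdmissible W ((Ψ₂.map x).symm ∘ (Θ₂.map x).symm ∘ Θ₁.map x ∘ Ψ₁.map x)

/-- The sum of the images of `H¹(O₁, 𝒵¹/ℛ)` and `H¹(O₂, 𝒵¹/ℛ)` in `H¹(O₁ ∩ O₂, 𝒵¹/ℛ)`. -/
def sumOfImages (Ψ₁ : RoughEquiv S₀ S₁ (O₁ ⊓ O₂)) (Ψ₂ : RoughEquiv S₀ S₂ (O₁ ⊓ O₂)) :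
    AddSubgroup (S₀.H1ZmodR (O₁ ⊓ O₂)) :=
  (Ψ₁.resZmodR inf_le_left).range ⊔ (Ψ₂.resZmodR inf_le_right).range

/-- The sum of the images of `H²(Oᵢ, ℝ) / d̂ H¹(Oᵢ, ℛ)`, `i = 1, 2`, in
`H²(O₁ ∩ O₂, ℝ) / d̂ H¹(O₁ ∩ O₂, ℛ)`. -/
def sumOfImagesH2 (Ψ₁ : RoughEquiv S₀ S₁ (O₁ ⊓ O₂)) (Ψ₂ : RoughEquiv S₀ S₂ (O₁ ⊓ O₂)) :
    AddSubgroup (S₀.H2modR (O₁ ⊓ O₂)) :=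
  (Ψ₁.resH2modR inf_le_left).range ⊔ (Ψ₂.resH2modR inf_le_right).range

/-- `S₁` and `S₂` are topologically equivalent over `O₁ ∩ O₂`, compatibly with the rough
equivalences: there is a homeomorphism `h` over the identity of `O₁ ∩ O₂` such that locally
`Ψ₂⁻¹ ∘ h ∘ Ψ₁` belongs to the image of `Â_t → A_t`.  Here an element of `Â_t` is an admissible
homeomorphism together with a continuous choice of homotopy classes of paths, in the strata,
from the points to their images. -/
def TopEquivOverlap (Ψ₁ : RoughEquiv S₀ S₁ (O₁ ⊓ O₂)) (Ψ₂ : RoughEquiv S₀ S₂ (O₁ ⊓ O₂)) : Prop :=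
  ∃ h : OpenPartialHomeomorph S₁.carrier S₂.carrier,
    h.source = S₁.part (O₁ ⊓ O₂) ∧ h.target = S₂.part (O₁ ⊓ O₂) ∧
    (∀ p ∈ h.source, S₂.proj (h p) = S₁.proj p) ∧
    ∀ x ∈ O₁ ⊓ O₂, ∃ W : Opens X, x ∈ W ∧ W ≤ Ψ₁.nbhd x ⊓ Ψ₂.nbhd x ∧
      S₀.IsAdmissible W ((Ψ₂.map x).symm ∘ h ∘ Ψ₁.map x) ∧
      ∃ l, S₀.IsPathLift W ((Ψ₂.map x).symm ∘ h ∘ Ψ₁.map x) l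

end Glue

/-!
The argument rests on the correspondence between functions on the base and their time one maps.

*Flows.*  The Hamiltonian vector field of a function `f ∘ proj` is tangent to the fibers, because it
annihilates the moment maps, the common level sets of which have the fibers as components
(`eventually_proj_eq`).  As the fibers are compact, its flow is complete (`exists_isFlowLine`); it
depends smoothly on the initial value and preserves the symplectic form (`contMDiffAt_flow`,
`isSymplecticAt_flow`).  The flows of two functions on the base commute: `flow (f + g)` is the
composition of `flow f` and `flow g` (`flow_add`).  Hence the integral affine functions are exactly
those with trivial time one map, and two functions have the same time one map if and only if they
differ by an integral affine one (`sub_mem_affineSheaf_iff`).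

*Lagrangian classes.*  By the hypothesis on symplectomorphisms, the transition maps of a rough
equivalence are locally time one maps of functions, which are unique up to integral affine
functions.  To obtain a cocycle on a covering indexed by points, the local functions have to be
chosen uniformly on the overlaps, which a covering lemma for paracompact spaces allows
(`exists_refinement`).  This gives existence and uniqueness of the Lagrangian class
(`RoughEquiv.exists_isLagrangianClass`, `RoughEquiv.IsLagrangianClass.unique`).

*Gluing.*  Given rough equivalences `Θ₁`, `Θ₂` of the two systems to a system over the union,
`μ₂ - μ₁` is the difference of the restrictions of their Lagrangian classes (`sub_mem_sumOfImages`).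
Conversely, if `μ₂ - μ₁` is the sum of the restrictions of `l₁` and `l₂`, then the two systems, cut
into pieces and twisted by the time one maps of `l₁` and `-l₂`, fit together with the local
equivalences over the overlap: all cocycle identities of the transition maps hold because the
functions involved add up to integral affine ones (`PairGluing.toSystemGluing`).  A cocycle of local
systems is glued by taking, over each point of the base, the fiber of a selected member, with the
smooth structure and the form that make the inclusions of the members symplectic
(`SystemGluing.system`).

*Fine sheaves.*  Averaging with a partition of unity shows that the connecting homomorphism is
bijective (`FineHyp.connectingZ_bijective`), and `ι` is its inverse followed by the map from
`H¹(𝒵¹)` to `H¹(𝒵¹/ℛ)`; it is injective by exactness at `H¹(𝒵¹)` (`toZmodR_eq_zero_iff`).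

*Topologically equivalent systems.*  It remains to lift `μ₂ - μ₁` to a class with coefficients in
closed 1-forms (`exists_toZmodR_eq`).  At a regular point, the stratum is covered by `ℝⁿ` under the
joint flow of a moment map (`isCoveringMap_orbitMap`), so that every path in it has a displacement
in `ℝⁿ`, which depends on its homotopy class only; likewise, the differential of a function on the
base is given by a vector of coefficients, by which its flow moves the point.  Let `l x` be the path
lift of the local comparison of the topological equivalence with the rough ones at `x`.  Over an
overlap, the comparisons at `x` and at `y` differ by time one maps, so the paths `l x` and `l y`,
closed up by the corresponding flow lines, form a continuous family of loops, which by the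
hypothesis on the affine monodromy comes from an integral affine function.  After correction by the
latter, the cocycle of `μ₂ - μ₁` is represented by functions whose differential at regular points is
the difference of the displacements of `l x` and `l y` (`AffineMonodromyHyp.exists_hasCoeff`).
Differences of this kind add up to zero on triple overlaps, and a function with vanishing
differential at the regular points, which are dense, is locally constant; so the corrected cocycle
is one up to constants, that is, a cocycle of closed 1-forms.
-/

/-! ### Smooth dependence of solutions of differential equations on initial values -/

section SmoothFlow

open Metric Function

/-- `φ` is a local flow of the vector field `v` inside `Ω`, with initial values in `U` and times in
`(-ε, ε)`. -/
structure IsLocalFlow {E : Type*} [NormedAddCommGroup E] [NormedSpace ℝ E] (v : E → E)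
    (Ω U : Set E) (ε : ℝ) (φ : E → ℝ → E) : Prop where
  zero : ∀ x ∈ U, φ x 0 = x
  mem : ∀ x ∈ U, ∀ t ∈ Ioo (-ε) ε, φ x t ∈ Ω
  deriv : ∀ x ∈ U, ∀ t ∈ Ioo (-ε) ε, HasDerivAt (φ x) (v (φ x t)) t

/-- The linearized equation approximates the difference of two solutions to second order.
Here `w` solves the linearization along `y`. -/
theorem norm_sub_sub_le_of_linearized {E : Type*} [NormedAddCommGroup E] [NormedSpace ℝ E]
    {v : E → E} {v' : E → E →L[ℝ] E} {s : Set E} (hs : Convex ℝ s) {K L : ℝ} (hK : 0 < K)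
    (hL : 0 ≤ L) (hv : ∀ x ∈ s, HasFDerivAt v (v' x) x) (hb : ∀ x ∈ s, ‖v' x‖ ≤ K)
    (hl : ∀ x ∈ s, ∀ y ∈ s, ‖v' x - v' y‖ ≤ L * ‖x - y‖) {T : ℝ} {y z w : ℝ → E}
    (hT : 0 ≤ T)
    (hy : ∀ t ∈ Icc 0 T, y t ∈ s ∧ HasDerivAt y (v (y t)) t)
    (hz : ∀ t ∈ Icc 0 T, z t ∈ s ∧ HasDerivAt z (v (z t)) t)
    (hw : ∀ t ∈ Icc 0 T, HasDerivAt w (v' (y t) (w t)) t) (h0 : w 0 = z 0 - y 0) :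
    ‖z T - y T - w T‖ ≤
      L * Real.exp (K * T) ^ 2 / K * (Real.exp (K * T) - 1) * ‖z 0 - y 0‖ ^ 2 := by
  have hlip : LipschitzOnWith K.toNNReal v s :=
    hs.lipschitzOnWith_of_nnnorm_hasFDerivWithin_le (fun x hx => (hv x hx).hasFDerivWithinAt)
      fun x hx => by
        rw [← NNReal.coe_le_coe, coe_nnnorm, Real.coe_toNNReal _ hK.le]; exact hb x hx
  have hyc : ContinuousOn y (Icc 0 T) := fun t ht => (hy t ht).2.continuousAt.continuousWithinAt
  have hzc : ContinuousOn z (Icc 0 T) := fun t ht => (hz t ht).2.continuousAt.continuousWithinAt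
  have hwc : ContinuousOn w (Icc 0 T) := fun t ht => (hw t ht).continuousAt.continuousWithinAt
  have hδ : ∀ t ∈ Icc 0 T, ‖z t - y t‖ ≤ ‖z 0 - y 0‖ * Real.exp (K * T) := by
    intro t ht
    have h := dist_le_of_trajectories_ODE_of_mem (v := fun _ => v) (s := fun _ => s)
      (δ := ‖z 0 - y 0‖) (fun _ _ => hlip) hzc
      (fun t ht => (hz t (Ico_subset_Icc_self ht)).2.hasDerivWithinAt)
      (fun t ht => (hz t (Ico_subset_Icc_self ht)).1) hyc
      (fun t ht => (hy t (Ico_subset_Icc_self ht)).2.hasDerivWithinAt)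
      (fun t ht => (hy t (Ico_subset_Icc_self ht)).1) (dist_eq_norm _ _).le t ht
    rw [dist_eq_norm, Real.coe_toNNReal _ hK.le, sub_zero] at h
    refine h.trans ?_
    have := ht.2
    gcongr
  -- Grönwall's inequality: `z - y` solves the linearized equation up to an error which is
  -- quadratic in the distance of `y` and `z`.
  have key := dist_le_of_approx_trajectories_ODE_of_mem
    (v := fun t x => v' (y t) x) (s := fun _ => univ) (K := K.toNNReal)
    (f := fun t => z t - y t) (f' := fun t => v (z t) - v (y t)) (g := w)
    (g' := fun t => v' (y t) (w t)) (δ := 0) (εg := 0)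
    (εf := L * (‖z 0 - y 0‖ * Real.exp (K * T)) ^ 2)
    (fun t ht => by
      refine ((v' (y t)).lipschitz.weaken ?_).lipschitzOnWith
      rw [← NNReal.coe_le_coe, coe_nnnorm, Real.coe_toNNReal _ hK.le]
      exact hb _ (hy t (Ico_subset_Icc_self ht)).1)
    (hzc.sub hyc)
    (fun t ht => ((hz t (Ico_subset_Icc_self ht)).2.sub
      (hy t (Ico_subset_Icc_self ht)).2).hasDerivWithinAt)
    (fun t ht => by
      have hyt := (hy t (Ico_subset_Icc_self ht)).1
      have hzt := (hz t (Ico_subset_Icc_self ht)).1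
      have hseg : segment ℝ (y t) (z t) ⊆ s := hs.segment_subset hyt hzt
      have h := (convex_segment (𝕜 := ℝ) (y t) (z t)).norm_image_sub_le_of_norm_hasFDerivWithin_le'
        (f := v) (f' := v') (φ := v' (y t)) (C := L * ‖z t - y t‖)
        (fun x hx => (hv x (hseg hx)).hasFDerivWithinAt)
        (fun x hx => (hl x (hseg hx) _ hyt).trans (by
          gcongr
          exact norm_sub_le_of_mem_segment hx))
        (left_mem_segment _ _ _) (right_mem_segment _ _ _)
      rw [dist_eq_norm]
      refine h.trans ?_
      have := hδ t (Ico_subset_Icc_self ht)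
      rw [mul_assoc, ← sq]
      gcongr)
    (fun _ _ => trivial) hwc
    (fun t ht => (hw t (Ico_subset_Icc_self ht)).hasDerivWithinAt)
    (fun t ht => by rw [dist_self]) (fun _ _ => trivial) (by simp [h0]) T ⟨hT, le_rfl⟩
  rw [Real.coe_toNNReal _ hK.le, gronwallBound_of_K_ne_0 hK.ne', dist_eq_norm] at key
  refine key.trans (le_of_eq ?_)
  simp only [zero_mul, zero_add, add_zero, sub_zero]
  ring

/-- A map which is approximated to second order by a linear map is differentiable. -/
theorem hasFDerivAt_of_norm_sub_le_sq {E F : Type*} [NormedAddCommGroup E] [NormedSpace ℝ E]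
    [NormedAddCommGroup F] [NormedSpace ℝ F] {f : E → F} {f' : E →L[ℝ] F} {x : E} {C : ℝ}
    (h : ∀ᶠ y in 𝓝 x, ‖f y - f x - f' (y - x)‖ ≤ C * ‖y - x‖ ^ 2) : HasFDerivAt f f' x := by
  refine .of_isLittleO ?_
  have h1 : (fun y => f y - f x - f' (y - x)) =O[𝓝 x] fun y => ‖y - x‖ ^ 2 := by
    refine Asymptotics.IsBigO.of_bound C ?_
    filter_upwards [h] with y hy
    simpa using hy
  refine h1.trans_isLittleO ?_
  have h2 : Tendsto (fun y => y - x) (𝓝 x) (𝓝 0) := by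
    have : Tendsto (fun y => y - x) (𝓝 x) (𝓝 (x - x)) :=
      (continuous_id.sub continuous_const).tendsto x
    simpa using this
  exact (Asymptotics.isLittleO_norm_pow_id one_lt_two).comp_tendsto h2

/-- Solutions of the linearized equation are derivatives of the flow with respect to the initial
value, at nonnegative times. -/
theorem hasFDerivAt_flow_of_nonneg {E : Type*} [NormedAddCommGroup E] [NormedSpace ℝ E]
    {v : E → E} {v' : E → E →L[ℝ] E} {s U : Set E} (hs : Convex ℝ s) {K L : ℝ} (hK : 0 < K)
    (hL : 0 ≤ L) (hv : ∀ x ∈ s, HasFDerivAt v (v' x) x) (hb : ∀ x ∈ s, ‖v' x‖ ≤ K)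
    (hl : ∀ x ∈ s, ∀ y ∈ s, ‖v' x - v' y‖ ≤ L * ‖x - y‖) {ε : ℝ} {φ : E → ℝ → E}
    {J : E → ℝ → E →L[ℝ] E} (hU : IsOpen U) (hφ : IsLocalFlow v s U ε φ)
    (hJ0 : ∀ x ∈ U, J x 0 = ContinuousLinearMap.id ℝ E)
    (hJ : ∀ x ∈ U, ∀ t ∈ Ioo (-ε) ε, HasDerivAt (J x) ((v' (φ x t)).comp (J x t)) t)
    {x : E} (hx : x ∈ U) {t : ℝ} (ht : t ∈ Ioo (-ε) ε) (ht0 : 0 ≤ t) :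
    HasFDerivAt (fun y => φ y t) (J x t) x := by
  have hI : ∀ r ∈ Icc 0 t, r ∈ Ioo (-ε) ε := fun r hr =>
    ⟨by linarith [hr.1, ht.2], by linarith [hr.2, ht.2]⟩
  refine hasFDerivAt_of_norm_sub_le_sq
    (C := L * Real.exp (K * t) ^ 2 / K * (Real.exp (K * t) - 1)) ?_
  filter_upwards [hU.mem_nhds hx] with z hz
  have h := norm_sub_sub_le_of_linearized hs hK hL hv hb hl (T := t) (y := φ x) (z := φ z)
    (w := fun r => J x r (z - x)) ht0
    (fun r hr => ⟨hφ.mem x hx r (hI r hr), hφ.deriv x hx r (hI r hr)⟩)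
    (fun r hr => ⟨hφ.mem z hz r (hI r hr), hφ.deriv z hz r (hI r hr)⟩)
    (fun r hr => by
      have := (hJ x hx r (hI r hr)).clm_apply (hasDerivAt_const r (z - x))
      simpa using this)
    (by simp [hJ0 x hx, hφ.zero x hx, hφ.zero z hz])
  rwa [hφ.zero x hx, hφ.zero z hz] at h

/-- Solutions of the linearized equation are derivatives of the flow with respect to the initial
value. -/
theorem hasFDerivAt_flow {E : Type*} [NormedAddCommGroup E] [NormedSpace ℝ E]
    {v : E → E} {v' : E → E →L[ℝ] E} {s U : Set E} (hs : Convex ℝ s) {K L : ℝ} (hK : 0 < K)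
    (hL : 0 ≤ L) (hv : ∀ x ∈ s, HasFDerivAt v (v' x) x) (hb : ∀ x ∈ s, ‖v' x‖ ≤ K)
    (hl : ∀ x ∈ s, ∀ y ∈ s, ‖v' x - v' y‖ ≤ L * ‖x - y‖) {ε : ℝ} {φ : E → ℝ → E}
    {J : E → ℝ → E →L[ℝ] E} (hU : IsOpen U) (hφ : IsLocalFlow v s U ε φ)
    (hJ0 : ∀ x ∈ U, J x 0 = ContinuousLinearMap.id ℝ E)
    (hJ : ∀ x ∈ U, ∀ t ∈ Ioo (-ε) ε, HasDerivAt (J x) ((v' (φ x t)).comp (J x t)) t)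
    {x : E} (hx : x ∈ U) {t : ℝ} (ht : t ∈ Ioo (-ε) ε) :
    HasFDerivAt (fun y => φ y t) (J x t) x := by
  rcases le_total 0 t with h0 | h0
  · exact hasFDerivAt_flow_of_nonneg hs hK hL hv hb hl hU hφ hJ0 hJ hx ht h0
  -- negative times are positive times for the flow of `-v`
  have hneg : ∀ r ∈ Ioo (-ε) ε, -r ∈ Ioo (-ε) ε := fun r hr =>
    ⟨by linarith [hr.2], by linarith [hr.1]⟩
  have h := hasFDerivAt_flow_of_nonneg (v := fun x => -v x) (v' := fun x => -v' x)
    (φ := fun x r => φ x (-r)) (J := fun x r => J x (-r)) (ε := ε) (U := U) (t := -t) hs hK hL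
    (fun x hx => (hv x hx).neg) (fun x hx => by rw [norm_neg]; exact hb x hx)
    (fun x hx y hy => by
      rw [← neg_sub', norm_neg]; exact hl x hx y hy) hU
    ⟨fun x hx => by simpa using hφ.zero x hx, fun x hx r hr => hφ.mem x hx _ (hneg r hr),
      fun x hx r hr => by
        have := (hφ.deriv x hx _ (hneg r hr)).scomp r (hasDerivAt_neg r)
        simpa using! this⟩
    (fun x hx => by simpa using hJ0 x hx)
    (fun x hx r hr => by
      have := (hJ x hx _ (hneg r hr)).scomp r (hasDerivAt_neg r)
      simpa using! this)
    hx (hneg t ht) (by linarith)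
  simpa using h

/-- Passing from a `C^k` local flow of the field together with its linearization to a `C^(k+1)`
local flow of the field. -/
theorem exists_localFlow_succ {E : Type u} [NormedAddCommGroup E] [NormedSpace ℝ E] {v : E → E}
    {Ω : Set E} (hΩ : IsOpen Ω) (hv : ContDiffOn ℝ ∞ v Ω) {x₀ : E} (hx₀ : x₀ ∈ Ω) {k : ℕ}
    (ih : ∃ ε > 0, ∃ U, IsOpen U ∧ (x₀, ContinuousLinearMap.id ℝ E) ∈ U ∧
      ∃ φ : E × (E →L[ℝ] E) → ℝ → E × (E →L[ℝ] E),
        IsLocalFlow (fun z : E × (E →L[ℝ] E) => (v z.1, (fderiv ℝ v z.1).comp z.2))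
          (Ω ×ˢ univ) U ε φ ∧ ContDiffOn ℝ k (uncurry φ) (U ×ˢ Ioo (-ε) ε)) :
    ∃ ε > 0, ∃ U, IsOpen U ∧ x₀ ∈ U ∧ ∃ (φ : E → ℝ → E) (J : E → ℝ → E →L[ℝ] E),
      IsLocalFlow v Ω U ε φ ∧ ContDiffOn ℝ (k + 1) (uncurry φ) (U ×ˢ Ioo (-ε) ε) ∧
      (∀ x ∈ U, J x 0 = ContinuousLinearMap.id ℝ E) ∧
      (∀ x ∈ U, ∀ t ∈ Ioo (-ε) ε,
        HasDerivAt (J x) ((fderiv ℝ v (φ x t)).comp (J x t)) t) ∧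
      ∀ x ∈ U, ∀ t ∈ Ioo (-ε) ε, HasFDerivAt (fun y => φ y t) (J x t) x := by
  obtain ⟨ε, hε, U, hU, hxU, Φ, hΦ, hΦk⟩ := ih
  have hv' : ContDiffOn ℝ ∞ (fderiv ℝ v) Ω := hv.fderiv_of_isOpen hΩ (by simp)
  -- a ball in which the field has a bounded and Lipschitz derivative
  obtain ⟨L, sL, hsL, hL⟩ := ((hv'.contDiffAt (hΩ.mem_nhds hx₀)).of_le
    (n := ∞) (m := 1) (by simp)).exists_lipschitzOnWith
  have hbd : ∀ᶠ x in 𝓝 x₀, ‖fderiv ℝ v x‖ < ‖fderiv ℝ v x₀‖ + 1 :=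
    ((hv'.continuousOn.continuousAt (hΩ.mem_nhds hx₀)).norm).eventually_lt_const (by simp)
  obtain ⟨r, hr, hball⟩ := Metric.mem_nhds_iff.mp
    (inter_mem (inter_mem hsL hbd) (hΩ.mem_nhds hx₀))
  have hc0 : ContinuousAt (uncurry Φ) ((x₀, ContinuousLinearMap.id ℝ E), 0) :=
    (hΦk.continuousOn).continuousAt ((hU.prod isOpen_Ioo).mem_nhds ⟨hxU, by simpa using hε⟩)
  have hc : ContinuousAt (fun z : E × ℝ => (Φ (z.1, ContinuousLinearMap.id ℝ E) z.2).1)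
      (x₀, 0) := by
    have hm : Continuous fun z : E × ℝ => ((z.1, ContinuousLinearMap.id ℝ E), z.2) := by fun_prop
    exact continuous_fst.continuousAt.comp
      (ContinuousAt.comp (f := fun z : E × ℝ => ((z.1, ContinuousLinearMap.id ℝ E), z.2))
        (x := (x₀, 0)) hc0 hm.continuousAt)
  have hmem : ∀ᶠ z in 𝓝 (x₀, (0 : ℝ)), (Φ (z.1, ContinuousLinearMap.id ℝ E) z.2).1 ∈ ball x₀ r := by
    refine hc.eventually_mem (isOpen_ball.mem_nhds ?_)
    rw [hΦ.zero _ hxU]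
    exact mem_ball_self hr
  obtain ⟨U₁, hU₁, I, hI, hUI⟩ := mem_nhds_prod_iff.mp hmem
  obtain ⟨δ, hδ, hδI⟩ := Metric.mem_nhds_iff.mp hI
  obtain ⟨U₂, hU₂U, hU₂, hxU₂⟩ := _root_.mem_nhds_iff.mp hU₁
  set V : Set E := U₂ ∩ (fun x => (x, ContinuousLinearMap.id ℝ E)) ⁻¹' U with hV
  have hVo : IsOpen V := hU₂.inter (hU.preimage (by fun_prop))
  have hVU : ∀ x ∈ V, (x, ContinuousLinearMap.id ℝ E) ∈ U := fun x hx => hx.2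
  set φ : E → ℝ → E := fun x t => (Φ (x, ContinuousLinearMap.id ℝ E) t).1
  set J : E → ℝ → E →L[ℝ] E := fun x t => (Φ (x, ContinuousLinearMap.id ℝ E) t).2
  set η := min ε δ with hη
  have hηε : ∀ t ∈ Ioo (-η) η, t ∈ Ioo (-ε) ε := fun t ht =>
    ⟨by linarith [ht.1, min_le_left ε δ], by linarith [ht.2, min_le_left ε δ]⟩
  have hηδ : ∀ t ∈ Ioo (-η) η, t ∈ I := fun t ht => hδI (by
    rw [Real.ball_eq_Ioo]
    exact ⟨by linarith [ht.1, min_le_right ε δ], by linarith [ht.2, min_le_right ε δ]⟩)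
  have hflow : IsLocalFlow v (ball x₀ r) V η φ :=
    ⟨fun x hx => by simp [φ, hΦ.zero _ (hVU x hx)], fun x hx t ht =>
      hUI (show (x, t) ∈ U₁ ×ˢ I from ⟨hU₂U hx.1, hηδ t ht⟩),
      fun x hx t ht => (hΦ.deriv _ (hVU x hx) t (hηε t ht)).fst⟩
  have hJd : ∀ x ∈ V, ∀ t ∈ Ioo (-η) η,
      HasDerivAt (J x) ((fderiv ℝ v (φ x t)).comp (J x t)) t := fun x hx t ht =>
    (hΦ.deriv _ (hVU x hx) t (hηε t ht)).snd
  have hJ0 : ∀ x ∈ V, J x 0 = ContinuousLinearMap.id ℝ E := fun x hx => by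
    simp [J, hΦ.zero _ (hVU x hx)]
  have hfd : ∀ x ∈ V, ∀ t ∈ Ioo (-η) η, HasFDerivAt (fun y => φ y t) (J x t) x :=
    fun x hx t ht => hasFDerivAt_flow (convex_ball x₀ r)
      (K := ‖fderiv ℝ v x₀‖ + 1) (L := L) (by positivity) L.2
      (fun y hy => ((hv.differentiableOn (by simp)) y (hball hy).2 |>.differentiableAt
        (hΩ.mem_nhds (hball hy).2)).hasFDerivAt)
      (fun y hy => (le_of_lt (hball hy).1.2))
      (fun y hy z hz => hL.norm_sub_le (hball hy).1.1 (hball hz).1.1) hVo hflow hJ0 hJd hx ht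
  have hpair : ContDiffOn ℝ k (fun z : E × ℝ => Φ (z.1, ContinuousLinearMap.id ℝ E) z.2)
      (V ×ˢ Ioo (-η) η) :=
    hΦk.comp (s := V ×ˢ Ioo (-η) η)
      (f := fun z : E × ℝ => ((z.1, ContinuousLinearMap.id ℝ E), z.2))
      (by fun_prop) fun z hz => ⟨hVU _ hz.1, hηε _ hz.2⟩
  have hφk : ContDiffOn ℝ k (uncurry φ) (V ×ˢ Ioo (-η) η) := contDiff_fst.comp_contDiffOn hpair
  have hJk : ContDiffOn ℝ k (uncurry J) (V ×ˢ Ioo (-η) η) := contDiff_snd.comp_contDiffOn hpair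
  have hopen : IsOpen (V ×ˢ Ioo (-η) η) := hVo.prod isOpen_Ioo
  have hvφ : ContDiffOn ℝ k (fun z => v (uncurry φ z)) (V ×ˢ Ioo (-η) η) :=
    (hv.of_le (by exact_mod_cast le_top)).comp hφk
      fun z hz => (hball (hflow.mem _ hz.1 _ hz.2)).2
  -- The derivative of the flow in the initial value and in time; it is made of `J` and `v ∘ φ`,
  -- hence of class `C^k`.
  let D : E × ℝ → (E × ℝ →L[ℝ] E) := fun z => (uncurry J z).coprod
    ((1 : ℝ →L[ℝ] ℝ).smulRight (v (uncurry φ z)))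
  have hD : ∀ z ∈ V ×ˢ Ioo (-η) η, HasFDerivAt (uncurry φ) (D z) z := by
    intro z hz
    have hn : ∀ᶠ y in 𝓝 z, y ∈ V ×ˢ Ioo (-η) η := hopen.mem_nhds hz
    refine (hasStrictFDerivAt_uncurry_coprod (f := φ) (u := z) (f₁ := J)
      (f₂ := fun x t => (1 : ℝ →L[ℝ] ℝ).smulRight (v (φ x t))) ?_ ?_ ?_ ?_).hasFDerivAt
    · filter_upwards [hn] with y hy using hfd _ hy.1 _ hy.2
    · filter_upwards [hn] with y hy using (hflow.deriv _ hy.1 _ hy.2).hasFDerivAt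
    · exact hJk.continuousOn.continuousAt hn
    · have h1 := hvφ.continuousOn.continuousAt hn
      exact ((ContinuousLinearMap.smulRightL ℝ ℝ E (1 : ℝ →L[ℝ] ℝ)).continuous.continuousAt).comp h1
  refine ⟨η, lt_min hε hδ, V, hVo, ⟨hxU₂, hxU⟩, φ, J,
    ⟨hflow.zero, fun x hx t ht => (hball (hflow.mem x hx t ht)).2, hflow.deriv⟩, ?_, hJ0, hJd, hfd⟩
  rw [contDiffOn_succ_iff_fderiv_of_isOpen hopen]
  refine ⟨fun z hz => (hD z hz).differentiableAt.differentiableWithinAt, by simp, ?_⟩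
  refine ContDiffOn.congr (f := D) ?_ fun z hz => (hD z hz).fderiv
  have h1 : ContDiffOn ℝ k (fun z => (1 : ℝ →L[ℝ] ℝ).smulRight (v (uncurry φ z)))
      (V ×ˢ Ioo (-η) η) :=
    (ContinuousLinearMap.smulRightL ℝ ℝ E (1 : ℝ →L[ℝ] ℝ)).contDiff.comp_contDiffOn hvφ
  have h2 : D = fun z => (uncurry J z).comp (ContinuousLinearMap.fst ℝ E ℝ) +
      ((1 : ℝ →L[ℝ] ℝ).smulRight (v (uncurry φ z))).comp (ContinuousLinearMap.snd ℝ E ℝ) := by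
    ext z <;> simp [D]
  rw [h2]
  exact (hJk.clm_comp contDiffOn_const).add (h1.clm_comp contDiffOn_const)

/-- The vector field on `E × End E` that combines `v` with its linearization is smooth; its flow
consists of the flow of `v` and of the derivative of that flow. -/
theorem contDiffOn_linearized {E : Type u} [NormedAddCommGroup E] [NormedSpace ℝ E] {v : E → E}
    {Ω : Set E} (hΩ : IsOpen Ω) (hv : ContDiffOn ℝ ∞ v Ω) :
    ContDiffOn ℝ ∞ (fun z : E × (E →L[ℝ] E) => (v z.1, (fderiv ℝ v z.1).comp z.2))
      (Ω ×ˢ univ) := by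
  have hv' : ContDiffOn ℝ ∞ (fderiv ℝ v) Ω := hv.fderiv_of_isOpen hΩ (by simp)
  exact (hv.comp contDiffOn_fst fun z hz => hz.1).prodMk
    ((hv'.comp contDiffOn_fst fun z hz => hz.1).clm_comp contDiffOn_snd)

theorem exists_localFlow_contDiffOn (k : ℕ) {E : Type u} [NormedAddCommGroup E] [NormedSpace ℝ E]
    [CompleteSpace E] {v : E → E} {Ω : Set E} (hΩ : IsOpen Ω) (hv : ContDiffOn ℝ ∞ v Ω) {x₀ : E}
    (hx₀ : x₀ ∈ Ω) :
    ∃ ε > 0, ∃ U, IsOpen U ∧ x₀ ∈ U ∧ ∃ φ : E → ℝ → E,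
      IsLocalFlow v Ω U ε φ ∧ ContDiffOn ℝ k (uncurry φ) (U ×ˢ Ioo (-ε) ε) := by
  induction k generalizing E with
  | zero =>
    obtain ⟨ε, hε, a, r, L, K, hr, h⟩ := IsPicardLindelof.of_contDiffAt_one
      ((hv.contDiffAt (hΩ.mem_nhds hx₀)).of_le (n := ∞) (m := 1) (by simp))
    obtain ⟨α, hα, hαc⟩ := (h 0).exists_forall_mem_closedBall_eq_hasDerivWithinAt_continuousOn
    simp only [zero_sub, zero_add] at hα hαc
    have hb : Ioo (-ε) ε ∈ 𝓝 (0 : ℝ) := Ioo_mem_nhds (by linarith) hε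
    have hc : ContinuousAt α (x₀, 0) := hαc.continuousAt (prod_mem_nhds
      (closedBall_mem_nhds _ (by exact_mod_cast hr)) (Icc_mem_nhds (by linarith) hε))
    have hmem : ∀ᶠ z in 𝓝 (x₀, (0 : ℝ)), α z ∈ Ω := hc.eventually_mem (hΩ.mem_nhds (by
      rw [(hα x₀ (mem_closedBall_self r.2)).1]; exact hx₀))
    obtain ⟨U₁, hU₁, I, hI, hUI⟩ := mem_nhds_prod_iff.mp hmem
    obtain ⟨δ, hδ, hδI⟩ := Metric.mem_nhds_iff.mp hI
    obtain ⟨U₂, hU₂U, hU₂, hxU₂⟩ := _root_.mem_nhds_iff.mp hU₁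
    have hηε : ∀ t ∈ Ioo (-(min ε δ)) (min ε δ), t ∈ Ioo (-ε) ε := fun t ht =>
      ⟨by linarith [ht.1, min_le_left ε δ], by linarith [ht.2, min_le_left ε δ]⟩
    have hηδ : ∀ t ∈ Ioo (-(min ε δ)) (min ε δ), t ∈ I := fun t ht => hδI (by
      rw [Real.ball_eq_Ioo]
      exact ⟨by linarith [ht.1, min_le_right ε δ], by linarith [ht.2, min_le_right ε δ]⟩)
    refine ⟨min ε δ, lt_min hε hδ, U₂ ∩ ball x₀ r, hU₂.inter isOpen_ball,
      ⟨hxU₂, mem_ball_self (by exact_mod_cast hr)⟩, fun x t => α (x, t), ⟨fun x hx => ?_,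
        fun x hx t ht => ?_, fun x hx t ht => ?_⟩, ?_⟩
    · exact (hα x (ball_subset_closedBall hx.2)).1
    · exact hUI (show (x, t) ∈ U₁ ×ˢ I from ⟨hU₂U hx.1, hηδ t ht⟩)
    · exact ((hα x (ball_subset_closedBall hx.2)).2 t (Ioo_subset_Icc_self (hηε t ht))).hasDerivAt
        (Icc_mem_nhds (hηε t ht).1 (hηε t ht).2)
    · rw [Nat.cast_zero, contDiffOn_zero]
      exact hαc.mono (prod_mono (inter_subset_right.trans ball_subset_closedBall)
        fun t ht => Ioo_subset_Icc_self (hηε t ht))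
  | succ k ih =>
    obtain ⟨ε, hε, U, hU, hx, φ, _, h1, h2, _⟩ := exists_localFlow_succ hΩ hv hx₀
      (ih (E := E × (E →L[ℝ] E)) (hΩ.prod isOpen_univ) (contDiffOn_linearized hΩ hv)
        (x₀ := (x₀, ContinuousLinearMap.id ℝ E)) ⟨hx₀, trivial⟩)
    exact ⟨ε, hε, U, hU, hx, φ, h1, by exact_mod_cast h2⟩

/-- **Smooth dependence on initial values**: a smooth vector field has, near every point and for
every `k`, a local flow of class `C^(k+1)`, whose derivative with respect to the initial value
solves the linearized equation. -/
theorem exists_localFlow_fderiv (k : ℕ) {E : Type u} [NormedAddCommGroup E] [NormedSpace ℝ E]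
    [CompleteSpace E] {v : E → E} {Ω : Set E} (hΩ : IsOpen Ω) (hv : ContDiffOn ℝ ∞ v Ω) {x₀ : E}
    (hx₀ : x₀ ∈ Ω) :
    ∃ ε > 0, ∃ U, IsOpen U ∧ x₀ ∈ U ∧ ∃ (φ : E → ℝ → E) (J : E → ℝ → E →L[ℝ] E),
      IsLocalFlow v Ω U ε φ ∧ ContDiffOn ℝ (k + 1) (uncurry φ) (U ×ˢ Ioo (-ε) ε) ∧
      (∀ x ∈ U, J x 0 = ContinuousLinearMap.id ℝ E) ∧
      (∀ x ∈ U, ∀ t ∈ Ioo (-ε) ε,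
        HasDerivAt (J x) ((fderiv ℝ v (φ x t)).comp (J x t)) t) ∧
      ∀ x ∈ U, ∀ t ∈ Ioo (-ε) ε, HasFDerivAt (fun y => φ y t) (J x t) x :=
  exists_localFlow_succ hΩ hv hx₀ (exists_localFlow_contDiffOn k (E := E × (E →L[ℝ] E))
    (hΩ.prod isOpen_univ) (contDiffOn_linearized hΩ hv)
    (x₀ := (x₀, ContinuousLinearMap.id ℝ E)) ⟨hx₀, trivial⟩)

end SmoothFlow

/-! ### Local Hamiltonian flows -/

section LocalHamiltonian

open Metric Function

theorem alternating_swap {E : Type*} [AddCommGroup E] [Module ℝ E] [TopologicalSpace E]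
    (η : E [⋀^Fin 2]→L[ℝ] ℝ) (u w : E) : η ![u, w] = -η ![w, u] := by
  have h := η.toAlternatingMap.map_swap ![w, u] (i := 0) (j := 1) (by decide)
  refine Eq.trans ?_ h
  show η _ = η _
  congr 1
  ext i
  fin_cases i <;> rfl

section Linear

variable {E : Type*} [NormedAddCommGroup E] [NormedSpace ℝ E]


/-- Evaluation of 2-forms at two vectors. -/
noncomputable def evalForm (u w : E) : (E [⋀^Fin 2]→L[ℝ] ℝ) →L[ℝ] ℝ :=
  (ContinuousMultilinearMap.apply ℝ (fun _ : Fin 2 => E) ℝ ![u, w]).comp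
    (ContinuousAlternatingMap.toContinuousMultilinearMapCLM ℝ)

variable [FiniteDimensional ℝ E]

/-- The bilinear map underlying an alternating 2-form. -/
noncomputable def bilin (η : E [⋀^Fin 2]→L[ℝ] ℝ) : E →L[ℝ] E →L[ℝ] ℝ :=
  LinearMap.toContinuousBilinearMap (LinearMap.mk₂ ℝ (fun u w => η ![u, w])
    (fun u u' w => by simpa using η.vecCons_add ![w] u u')
    (fun c u w => by simpa using η.vecCons_smul ![w] c u)
    (fun u w w' => by
      rw [alternating_swap, alternating_swap η u w, alternating_swap η u w',
        η.vecCons_add ![u] w w', neg_add])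
    (fun c u w => by
      rw [alternating_swap, alternating_swap η u w, η.vecCons_smul ![u] c w, smul_neg]))

@[simp] theorem bilin_apply (η : E [⋀^Fin 2]→L[ℝ] ℝ) (u w : E) : bilin η u w = η ![u, w] := rfl

theorem ContDiffOn.bilin {η : E → E [⋀^Fin 2]→L[ℝ] ℝ} {Ω : Set E} {k : ℕ∞ω}
    (h : ContDiffOn ℝ k η Ω) : ContDiffOn ℝ k (fun y => bilin (η y)) Ω := by
  rw [contDiffOn_clm_apply]
  intro u
  rw [contDiffOn_clm_apply]
  intro w
  exact (evalForm u w).contDiff.comp_contDiffOn h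

/-- The Hamiltonian vector field of a smooth function on an open subset of a vector space, for a
smooth nondegenerate 2-form, is smooth. -/
theorem exists_hamiltonian_field {η : E → E [⋀^Fin 2]→L[ℝ] ℝ} {H : E → ℝ} {Ω : Set E}
    (hΩ : IsOpen Ω) (hη : ContDiffOn ℝ ∞ η Ω) (hH : ContDiffOn ℝ ∞ H Ω)
    (hnd : ∀ y ∈ Ω, ∀ u, (∀ w, η y ![u, w] = 0) → u = 0) :
    ∃ v : E → E, ContDiffOn ℝ ∞ v Ω ∧ ∀ y ∈ Ω, ∀ u, η y ![v y, u] = fderiv ℝ H y u := by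
  have hinj : ∀ y ∈ Ω, Injective (bilin (η y)) := fun y hy =>
    (injective_iff_map_eq_zero _).2 fun u hu => hnd y hy u fun w => by
      rw [← bilin_apply, hu]; rfl
  have hfin : Module.finrank ℝ E = Module.finrank ℝ (E →L[ℝ] ℝ) := by
    rw [← (LinearMap.toContinuousLinearMap (𝕜 := ℝ) (E := E) (F' := ℝ)).finrank_eq]
    exact (Subspace.dual_finrank_eq (K := ℝ) (V := E)).symm
  have he : ∀ y ∈ Ω, ∃ e : E ≃L[ℝ] (E →L[ℝ] ℝ), (e : E →L[ℝ] (E →L[ℝ] ℝ)) = bilin (η y) :=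
    fun y hy => ⟨(LinearEquiv.ofInjectiveOfFinrankEq (bilin (η y)).toLinearMap (hinj y hy)
      hfin).toContinuousLinearEquiv, by ext; rfl⟩
  refine ⟨fun y => (bilin (η y)).inverse (fderiv ℝ H y), ?_, fun y hy u => ?_⟩
  · refine ContDiffOn.clm_apply (fun y hy => ?_) (hH.fderiv_of_isOpen hΩ (by simp))
    obtain ⟨e, he'⟩ := he y hy
    have h := contDiffAt_map_inverse (𝕜 := ℝ) (n := ∞) e
    rw [he'] at h
    exact ContDiffAt.comp_contDiffWithinAt (f := fun y => bilin (η y)) y h (hη.bilin y hy)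
  · obtain ⟨e, he'⟩ := he y hy
    simp only
    rw [← bilin_apply, ← he', ContinuousLinearMap.inverse_equiv]
    simp

/-- The flow of a Hamiltonian vector field preserves a closed 2-form: the derivative of the
pulled back form vanishes, by Cartan's formula. -/
theorem form_preserved_of_closed {η : E → E [⋀^Fin 2]→L[ℝ] ℝ} {H : E → ℝ} {Ω : Set E}
    (hΩ : IsOpen Ω) (hη : ContDiffOn ℝ ∞ η Ω) (hH : ContDiffOn ℝ ∞ H Ω)
    (hcl : ∀ y ∈ Ω, extDeriv η y = 0) {v : E → E} (hv : ContDiffOn ℝ ∞ v Ω)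
    (hvH : ∀ y ∈ Ω, ∀ u, η y ![v y, u] = fderiv ℝ H y u) {ε : ℝ} {φ : ℝ → E}
    {J : ℝ → E →L[ℝ] E} (hφΩ : ∀ t ∈ Ioo (-ε) ε, φ t ∈ Ω)
    (hφ : ∀ t ∈ Ioo (-ε) ε, HasDerivAt φ (v (φ t)) t)
    (hJ : ∀ t ∈ Ioo (-ε) ε, HasDerivAt J ((fderiv ℝ v (φ t)).comp (J t)) t)
    (hJ0 : J 0 = ContinuousLinearMap.id ℝ E) {t : ℝ} (ht : t ∈ Ioo (-ε) ε) (a b : E) :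
    η (φ t) ![J t a, J t b] = η (φ 0) ![a, b] := by
  set B : E → E →L[ℝ] E →L[ℝ] ℝ := fun y => bilin (η y) with hB
  have hBs : ContDiffOn ℝ ∞ B Ω := hη.bilin
  have hBd : ∀ y ∈ Ω, HasFDerivAt B (fderiv ℝ B y) y := fun y hy =>
    ((hBs.differentiableOn (by simp)) y hy |>.differentiableAt (hΩ.mem_nhds hy)).hasFDerivAt
  have hηd : ∀ y ∈ Ω, DifferentiableAt ℝ η y := fun y hy =>
    (hη.differentiableOn (by simp)) y hy |>.differentiableAt (hΩ.mem_nhds hy)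
  have hvd : ∀ y ∈ Ω, HasFDerivAt v (fderiv ℝ v y) y := fun y hy =>
    ((hv.differentiableOn (by simp)) y hy |>.differentiableAt (hΩ.mem_nhds hy)).hasFDerivAt
  have hBe : ∀ y ∈ Ω, ∀ u w c : E, fderiv ℝ (fun y => η y ![u, w]) y c = fderiv ℝ B y c u w := by
    intro y hy u w c
    have h1 := (((hBd y hy).clm_apply (hasFDerivAt_const u y)).clm_apply
      (hasFDerivAt_const w y)).fderiv
    have h2 : (fun y => η y ![u, w]) = fun y => B y u w := rfl
    rw [h2, h1]
    simp
  -- the differentiated form of `η(v, ·) = dH`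
  have hsym : ∀ y ∈ Ω, ∀ u w : E, fderiv ℝ B y w (v y) u + B y (fderiv ℝ v y w) u =
      fderiv ℝ (fderiv ℝ H) y w u := by
    intro y hy u w
    have h1 := ((hBd y hy).clm_apply (hvd y hy)).clm_apply (hasFDerivAt_const u y)
    have hH' : HasFDerivAt (fderiv ℝ H) (fderiv ℝ (fderiv ℝ H) y) y :=
      (((hH.fderiv_of_isOpen (m := ∞) hΩ (by simp)).differentiableOn (by simp)) y hy
        |>.differentiableAt (hΩ.mem_nhds hy)).hasFDerivAt
    have h2 := hH'.clm_apply (hasFDerivAt_const u y)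
    have h3 : (fun y => B y (v y) u) =ᶠ[𝓝 y] fun y => fderiv ℝ H y u := by
      filter_upwards [hΩ.mem_nhds hy] with z hz using hvH z hz u
    have h4 := (h2.congr_of_eventuallyEq h3).unique h1
    have h5 := congrArg (fun L => L w) h4
    simp at h5
    rw [h5]
    exact add_comm _ _
  have hHsym : ∀ y ∈ Ω, ∀ u w : E,
      fderiv ℝ (fderiv ℝ H) y w u = fderiv ℝ (fderiv ℝ H) y u w := fun y hy u w =>
    ((hH.contDiffAt (hΩ.mem_nhds hy)).isSymmSndFDerivAt (by
      rw [minSmoothness_of_isRCLikeNormedField]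
      exact WithTop.coe_le_coe.2 (le_top : (2 : ℕ∞) ≤ ⊤))) w u
  have hclosed : ∀ y ∈ Ω, ∀ u w c : E,
      fderiv ℝ B y u w c - fderiv ℝ B y w u c + fderiv ℝ B y c u w = 0 := by
    intro y hy u w c
    have h := congrArg (fun L => L ![u, w, c]) (hcl y hy)
    simp only [extDeriv_apply (hηd y hy)] at h
    rw [Fin.sum_univ_three] at h
    have e0 : (0 : Fin 3).removeNth ![u, w, c] = ![w, c] := by ext i; fin_cases i <;> rfl
    have e1 : (1 : Fin 3).removeNth ![u, w, c] = ![u, c] := by ext i; fin_cases i <;> rfl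
    have e2 : (2 : Fin 3).removeNth ![u, w, c] = ![u, w] := by ext i; fin_cases i <;> rfl
    rw [e0, e1, e2, hBe y hy, hBe y hy, hBe y hy] at h
    simp at h
    linarith
  have hskew : ∀ y ∈ Ω, ∀ u w c : E, fderiv ℝ B y c u w = -fderiv ℝ B y c w u := by
    intro y hy u w c
    rw [← hBe y hy, ← hBe y hy]
    have : (fun y => η y ![u, w]) = fun y => -η y ![w, u] := by
      ext z; exact alternating_swap _ _ _
    rw [this, fderiv_fun_neg]
    rfl
  -- Cartan's formula: `hsym` and `hHsym` say that `d(ι_v η) = 0`.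
  have hderiv : ∀ t ∈ Ioo (-ε) ε, HasDerivAt (fun t => B (φ t) (J t a) (J t b)) 0 t := by
    intro t ht
    have hy := hφΩ t ht
    have hBt : HasDerivAt (fun t => B (φ t)) (fderiv ℝ B (φ t) (v (φ t))) t :=
      HasFDerivAt.comp_hasDerivAt (l := B) (f := φ) t (hBd _ hy) (hφ t ht)
    have hJa : ∀ c, HasDerivAt (fun t => J t c) (fderiv ℝ v (φ t) (J t c)) t := fun c => by
      simpa using (hJ t ht).clm_apply (hasDerivAt_const t c)
    have h := (hBt.clm_apply (hJa a)).clm_apply (hJa b)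
    refine h.congr_deriv ?_
    have s1 := hsym _ hy (J t a) (J t b)
    have s2 := hsym _ hy (J t b) (J t a)
    have s3 := hHsym _ hy (J t a) (J t b)
    have c1 := hclosed _ hy (v (φ t)) (J t a) (J t b)
    have k1 := hskew _ hy (v (φ t)) (J t a) (J t b)
    have w1 : B (φ t) (J t a) (fderiv ℝ v (φ t) (J t b)) =
        -B (φ t) (fderiv ℝ v (φ t) (J t b)) (J t a) := alternating_swap _ _ _
    simp only [add_apply]
    linarith
  have hε : (0 : ℝ) ∈ Ioo (-ε) ε := ⟨by linarith [ht.1, ht.2], by linarith [ht.1, ht.2]⟩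
  have hconst := (convex_Ioo (-ε) ε).is_const_of_fderivWithin_eq_zero (𝕜 := ℝ)
    (f := fun t => B (φ t) (J t a) (J t b))
    (fun s hs => (hderiv s hs).differentiableAt.differentiableWithinAt)
    (fun s hs => by
      rw [fderivWithin_of_isOpen isOpen_Ioo hs]
      ext
      simp [(hderiv s hs).deriv]) ht hε
  simpa [hB, hJ0] using hconst

end Linear

end LocalHamiltonian

section LocalHamiltonian

open Metric Function

variable {n : ℕ} {M : Type u} [TopologicalSpace M] [ChartedSpace (PhaseSpace n) M]

/-- At time `t` the curve `γ` satisfies Hamilton's equation for the function `H`. -/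
def IsHamCurveAt (σ : ∀ p : M, TangentSpace 𝓘(ℝ, PhaseSpace n) p [⋀^Fin 2]→L[ℝ] ℝ) (H : M → ℝ)
    (γ : ℝ → M) (t : ℝ) : Prop :=
  ∃ w : TangentSpace 𝓘(ℝ, PhaseSpace n) (γ t),
    HasMFDerivAt 𝓘(ℝ, ℝ) 𝓘(ℝ, PhaseSpace n) γ t ((1 : ℝ →L[ℝ] ℝ).smulRight w) ∧
    ∀ v, σ (γ t) ![w, v] = dAt (n := n) H (γ t) v

theorem formInChart_apply (σ : ∀ p : M, TangentSpace 𝓘(ℝ, PhaseSpace n) p [⋀^Fin 2]→L[ℝ] ℝ)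
    (p₀ : M) (y a b : PhaseSpace n) :
    formInChart σ p₀ y ![a, b] = σ ((chartAt (PhaseSpace n) p₀).symm y)
      ![mfderiv 𝓘(ℝ, PhaseSpace n) 𝓘(ℝ, PhaseSpace n) (chartAt (PhaseSpace n) p₀).symm y a,
        mfderiv 𝓘(ℝ, PhaseSpace n) 𝓘(ℝ, PhaseSpace n) (chartAt (PhaseSpace n) p₀).symm y b] := by
  refine congrArg (σ ((chartAt (PhaseSpace n) p₀).symm y)) (funext fun i => ?_)
  fin_cases i <;> rfl

theorem IsHamCurveAt.congr {σ : ∀ p : M, TangentSpace 𝓘(ℝ, PhaseSpace n) p [⋀^Fin 2]→L[ℝ] ℝ}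
    {H : M → ℝ} {γ γ' : ℝ → M} {t : ℝ} (h : IsHamCurveAt σ H γ t) (he : γ' =ᶠ[𝓝 t] γ) :
    IsHamCurveAt σ H γ' t := by
  obtain ⟨w, hw, hv⟩ := h
  have ht : γ t = γ' t := he.eq_of_nhds.symm
  have key : ∀ (q : M) (hq : γ t = q),
      ∃ w' : TangentSpace 𝓘(ℝ, PhaseSpace n) q, (w' : PhaseSpace n) = w ∧
        ∀ v, σ q ![w', v] = dAt (n := n) H q v := by
    rintro _ rfl
    exact ⟨w, rfl, hv⟩
  obtain ⟨w', hw', hv'⟩ := key _ ht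
  refine ⟨w', ?_, hv'⟩
  refine (hw.congr_of_eventuallyEq he).congr_mfderiv ?_
  rw [hw']
  rfl

theorem IsHamCurveAt.continuousAt
    {σ : ∀ p : M, TangentSpace 𝓘(ℝ, PhaseSpace n) p [⋀^Fin 2]→L[ℝ] ℝ}
    {H : M → ℝ} {γ : ℝ → M} {t : ℝ} (h : IsHamCurveAt σ H γ t) : ContinuousAt γ t := by
  obtain ⟨w, hw, _⟩ := h
  exact hw.continuousAt

/-- The derivative of a function along a curve that satisfies Hamilton's equation. -/
theorem IsHamCurveAt.hasDerivAt_comp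
    {σ : ∀ p : M, TangentSpace 𝓘(ℝ, PhaseSpace n) p [⋀^Fin 2]→L[ℝ] ℝ}
    {H G : M → ℝ} {γ : ℝ → M} {t : ℝ} (h : IsHamCurveAt σ H γ t)
    (hG : MDifferentiableAt 𝓘(ℝ, PhaseSpace n) 𝓘(ℝ, ℝ) G (γ t)) :
    ∃ w : TangentSpace 𝓘(ℝ, PhaseSpace n) (γ t),
      (∀ v, σ (γ t) ![w, v] = dAt (n := n) H (γ t) v) ∧
      HasDerivAt (fun s => G (γ s)) (dAt (n := n) G (γ t) w) t := by
  obtain ⟨w, hw, hv⟩ := h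
  refine ⟨w, hv, ?_⟩
  have h1 : HasMFDerivAt 𝓘(ℝ, ℝ) 𝓘(ℝ, ℝ) (fun s => G (γ s)) t
      ((1 : ℝ →L[ℝ] ℝ).smulRight (dAt (n := n) G (γ t) w)) := by
    refine (hG.hasMFDerivAt.comp t hw).congr_mfderiv ?_
    ext
    exact map_smul (dAt (n := n) G (γ t)) (1 : ℝ) w
  have h2 : HasFDerivAt (fun s => G (γ s))
      ((1 : ℝ →L[ℝ] ℝ).smulRight (dAt (n := n) G (γ t) w : ℝ)) t := h1.hasFDerivAt
  simpa using h2.hasDerivAt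

variable [IsManifold 𝓘(ℝ, PhaseSpace n) ∞ M]

theorem mdifferentiable_chartAt (p₀ : M) : (chartAt (PhaseSpace n) p₀).MDifferentiable
    𝓘(ℝ, PhaseSpace n) 𝓘(ℝ, PhaseSpace n) := by
  have : IsManifold 𝓘(ℝ, PhaseSpace n) 1 M := .of_le (n := ∞) (by simp)
  exact mdifferentiable_chart p₀

theorem contDiffOn_comp_chart_symm {H : M → ℝ} {Ω : Set M}
    (hH : ContMDiffOn 𝓘(ℝ, PhaseSpace n) 𝓘(ℝ, ℝ) ∞ H Ω) (p₀ : M) :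
    ContDiffOn ℝ ∞ (H ∘ (chartAt (PhaseSpace n) p₀).symm)
      ((chartAt (PhaseSpace n) p₀).target ∩ (chartAt (PhaseSpace n) p₀).symm ⁻¹' Ω) := by
  rw [← contMDiffOn_iff_contDiffOn]
  exact hH.comp ((contMDiffOn_chart_symm (x := p₀)).mono inter_subset_left) inter_subset_right

theorem dAt_chart_symm {H : M → ℝ} {p₀ : M} {y : PhaseSpace n}
    (hy : y ∈ (chartAt (PhaseSpace n) p₀).target)
    (hH : MDifferentiableAt 𝓘(ℝ, PhaseSpace n) 𝓘(ℝ, ℝ) H ((chartAt (PhaseSpace n) p₀).symm y))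
    (a : PhaseSpace n) :
    dAt (n := n) H ((chartAt (PhaseSpace n) p₀).symm y)
      (mfderiv 𝓘(ℝ, PhaseSpace n) 𝓘(ℝ, PhaseSpace n) (chartAt (PhaseSpace n) p₀).symm y a) =
      fderiv ℝ (H ∘ (chartAt (PhaseSpace n) p₀).symm) y a := by
  rw [← mfderiv_eq_fderiv]
  exact (mfderiv_comp_apply _ hH ((mdifferentiable_chartAt p₀).mdifferentiableAt_symm hy) a).symm

/-- In the chart at `p₀`, Hamilton's equation is the differential equation of a smooth vector
field. -/
theorem exists_chart_field {σ : ∀ p : M, TangentSpace 𝓘(ℝ, PhaseSpace n) p [⋀^Fin 2]→L[ℝ] ℝ}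
    (hσ : IsSymplecticForm σ) {H : M → ℝ} {Ω : Set M} (hΩ : IsOpen Ω)
    (hH : ContMDiffOn 𝓘(ℝ, PhaseSpace n) 𝓘(ℝ, ℝ) ∞ H Ω) (p₀ : M) :
    ∃ v : PhaseSpace n → PhaseSpace n,
      ContDiffOn ℝ ∞ v
        ((chartAt (PhaseSpace n) p₀).target ∩ (chartAt (PhaseSpace n) p₀).symm ⁻¹' Ω) ∧
      (∀ y ∈ (chartAt (PhaseSpace n) p₀).target ∩ (chartAt (PhaseSpace n) p₀).symm ⁻¹' Ω, ∀ a,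
        formInChart σ p₀ y ![v y, a] = fderiv ℝ (H ∘ (chartAt (PhaseSpace n) p₀).symm) y a) ∧
      (∀ γ : ℝ → M, ∀ t, γ t ∈ (chartAt (PhaseSpace n) p₀).source ∩ Ω → IsHamCurveAt σ H γ t →
        HasDerivAt (chartAt (PhaseSpace n) p₀ ∘ γ) (v (chartAt (PhaseSpace n) p₀ (γ t))) t) ∧
      ∀ y : ℝ → PhaseSpace n, ∀ t,
        y t ∈ (chartAt (PhaseSpace n) p₀).target ∩ (chartAt (PhaseSpace n) p₀).symm ⁻¹' Ω →
        HasDerivAt y (v (y t)) t → IsHamCurveAt σ H ((chartAt (PhaseSpace n) p₀).symm ∘ y) t := by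
  set e := chartAt (PhaseSpace n) p₀
  have he := mdifferentiable_chartAt (n := n) p₀
  have hΩ' : IsOpen (e.target ∩ e.symm ⁻¹' Ω) := e.isOpen_inter_preimage_symm hΩ
  have hHd : ∀ y ∈ e.target ∩ e.symm ⁻¹' Ω,
      MDifferentiableAt 𝓘(ℝ, PhaseSpace n) 𝓘(ℝ, ℝ) H (e.symm y) := fun y hy =>
    (hH.contMDiffAt (hΩ.mem_nhds hy.2)).mdifferentiableAt (by simp)
  have hnd : ∀ y ∈ e.target, ∀ u, (∀ w, formInChart σ p₀ y ![u, w] = 0) → u = 0 := by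
    intro y hy u hu
    have h0 := hσ.nondegenerate (e.symm y)
      (mfderiv 𝓘(ℝ, PhaseSpace n) 𝓘(ℝ, PhaseSpace n) e.symm y u) fun w => by
        obtain ⟨a, rfl⟩ : ∃ a : PhaseSpace n,
          mfderiv 𝓘(ℝ, PhaseSpace n) 𝓘(ℝ, PhaseSpace n) e.symm y a = w :=
          he.symm.mfderiv_surjective hy w
        exact (formInChart_apply σ p₀ y u a).symm.trans (hu a)
    exact (map_eq_zero_iff _ (he.symm.mfderiv_injective hy)).1 h0
  obtain ⟨v, hv, hvH⟩ := exists_hamiltonian_field hΩ' ((hσ.smooth p₀).mono inter_subset_left)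
    (contDiffOn_comp_chart_symm hH p₀) fun y hy => hnd y hy.1
  refine ⟨v, hv, hvH, ?_, ?_⟩
  · rintro γ t ⟨hγe, hγΩ⟩ ⟨w, hw, hwH⟩
    have hy : e (γ t) ∈ e.target ∩ e.symm ⁻¹' Ω :=
      ⟨e.map_source hγe, by rw [mem_preimage, e.left_inv hγe]; exact hγΩ⟩
    set w' : PhaseSpace n := mfderiv 𝓘(ℝ, PhaseSpace n) 𝓘(ℝ, PhaseSpace n) e (γ t) w with hw'
    have hgoal : w' = v (e (γ t)) := by
      refine sub_eq_zero.1 (hnd _ hy.1 _ fun a => ?_)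
      have hlin : formInChart σ p₀ (e (γ t)) ![w' - v (e (γ t)), a] =
          formInChart σ p₀ (e (γ t)) ![w', a] - formInChart σ p₀ (e (γ t)) ![v (e (γ t)), a] := by
        simp only [← bilin_apply, map_sub, sub_apply]
      rw [hlin, hvH _ hy, formInChart_apply, ← dAt_chart_symm hy.1 (hHd _ hy), sub_eq_zero]
      have hinv : mfderiv 𝓘(ℝ, PhaseSpace n) 𝓘(ℝ, PhaseSpace n) e.symm (e (γ t)) w' = w :=
        congrArg (fun L => L w) (he.symm_comp_deriv hγe)
      -- `e.symm (e (γ t))` and `γ t` are equal only propositionally, so the tangent vectors are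
      -- compared as elements of the model space.
      have key : ∀ q (z : PhaseSpace n), q = γ t → z = w → ∀ u : PhaseSpace n,
          σ q ![z, u] = dAt (n := n) H q u := by
        rintro _ _ rfl rfl u
        exact hwH u
      exact key _ _ (e.left_inv hγe) hinv _
    rw [← hgoal]
    have h1 : HasMFDerivAt 𝓘(ℝ, ℝ) 𝓘(ℝ, PhaseSpace n) (e ∘ γ) t
        ((1 : ℝ →L[ℝ] ℝ).smulRight w') := by
      refine ((he.mdifferentiableAt hγe).hasMFDerivAt.comp t hw).congr_mfderiv ?_
      ext1
      exact map_smul (mfderiv 𝓘(ℝ, PhaseSpace n) 𝓘(ℝ, PhaseSpace n) e (γ t)) (1 : ℝ) w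
    have h2 : HasFDerivAt (e ∘ γ) ((1 : ℝ →L[ℝ] ℝ).smulRight w') t := h1.hasFDerivAt
    simpa using h2.hasDerivAt
  · intro y t hy hyd
    refine ⟨mfderiv 𝓘(ℝ, PhaseSpace n) 𝓘(ℝ, PhaseSpace n) e.symm (y t) (v (y t)), ?_,
      fun u => ?_⟩
    · have h1 := (he.mdifferentiableAt_symm hy.1).hasMFDerivAt.comp t
        hyd.hasFDerivAt.hasMFDerivAt
      refine h1.congr_mfderiv ?_
      ext
      show mfderiv 𝓘(ℝ, PhaseSpace n) 𝓘(ℝ, PhaseSpace n) e.symm (y t) ((1 : ℝ) • v (y t)) =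
        (1 : ℝ) • mfderiv 𝓘(ℝ, PhaseSpace n) 𝓘(ℝ, PhaseSpace n) e.symm (y t) (v (y t))
      exact map_smul _ _ _
    · obtain ⟨a, rfl⟩ : ∃ a : PhaseSpace n,
        mfderiv 𝓘(ℝ, PhaseSpace n) 𝓘(ℝ, PhaseSpace n) e.symm (y t) a = u :=
        he.symm.mfderiv_surjective hy.1 u
      exact (formInChart_apply σ p₀ (y t) (v (y t)) a).symm.trans
        ((hvH _ hy a).trans (dAt_chart_symm hy.1 (hHd _ hy) a).symm)

/-- Curves that satisfy Hamilton's equation are locally unique. -/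
theorem IsHamCurveAt.eventuallyEq
    {σ : ∀ p : M, TangentSpace 𝓘(ℝ, PhaseSpace n) p [⋀^Fin 2]→L[ℝ] ℝ}
    (hσ : IsSymplecticForm σ) {H : M → ℝ} {Ω : Set M} (hΩ : IsOpen Ω)
    (hH : ContMDiffOn 𝓘(ℝ, PhaseSpace n) 𝓘(ℝ, ℝ) ∞ H Ω) {γ γ' : ℝ → M} {t : ℝ}
    (hγ : ∀ᶠ s in 𝓝 t, IsHamCurveAt σ H γ s) (hγ' : ∀ᶠ s in 𝓝 t, IsHamCurveAt σ H γ' s)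
    (ht : γ t ∈ Ω) (h : γ t = γ' t) : γ =ᶠ[𝓝 t] γ' := by
  obtain ⟨v, hv, -, hc, -⟩ := exists_chart_field hσ hΩ hH (γ t)
  set e := chartAt (PhaseSpace n) (γ t)
  have hΩ' : IsOpen (e.target ∩ e.symm ⁻¹' Ω) := e.isOpen_inter_preimage_symm hΩ
  have hs : γ t ∈ e.source := mem_chart_source _ _
  have hy : e (γ t) ∈ e.target ∩ e.symm ⁻¹' Ω :=
    ⟨e.map_source hs, by rw [mem_preimage, e.left_inv hs]; exact ht⟩
  obtain ⟨K, s, hsn, hK⟩ := ((hv.contDiffAt (hΩ'.mem_nhds hy)).of_le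
    (n := ∞) (m := 1) (by simp)).exists_lipschitzOnWith
  have hin : ∀ g : ℝ → M, g t = γ t → (∀ᶠ s in 𝓝 t, IsHamCurveAt σ H g s) →
      ∀ᶠ r in 𝓝 t, (HasDerivAt (e ∘ g) (v ((e ∘ g) r)) r ∧ (e ∘ g) r ∈ s) ∧ g r ∈ e.source := by
    intro g hg hgc
    have hcont := hgc.self_of_nhds.continuousAt
    have h1 : ∀ᶠ r in 𝓝 t, g r ∈ e.source ∩ Ω := hcont.eventually_mem
      ((e.open_source.inter hΩ).mem_nhds (by rw [hg]; exact ⟨hs, ht⟩))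
    have h2 : ∀ᶠ r in 𝓝 t, e (g r) ∈ s := by
      have h3 : ContinuousAt (fun r => e (g r)) t :=
        ContinuousAt.comp (g := e) (e.continuousAt (by rw [hg]; exact hs)) hcont
      exact h3.eventually_mem (by rw [hg]; exact hsn)
    filter_upwards [hgc, h1, h2] with r hr1 hr2 hr3
    exact ⟨⟨hc g r hr2 hr1, hr3⟩, hr2.1⟩
  have hA := hin γ rfl hγ
  have hB := hin γ' h.symm hγ'
  have key := ODE_solution_unique_of_eventually (v := fun _ => v) (s := fun _ => s) (K := K)
    (t₀ := t) (f := e ∘ γ) (g := e ∘ γ') (Eventually.of_forall fun _ => hK)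
    (hA.mono fun _ h => h.1) (hB.mono fun _ h => h.1) (by simp [h])
  filter_upwards [key, hA, hB] with r h1 h2 h3
  exact e.injOn h2.2 h3.2 h1

/-- Local existence, smooth dependence on initial values, and invariance of the symplectic form, for
Hamilton's equation. -/
theorem exists_local_ham_flow
    {σ : ∀ p : M, TangentSpace 𝓘(ℝ, PhaseSpace n) p [⋀^Fin 2]→L[ℝ] ℝ}
    (hσ : IsSymplecticForm σ) {H : M → ℝ} {Ω : Set M} (hΩ : IsOpen Ω)
    (hH : ContMDiffOn 𝓘(ℝ, PhaseSpace n) 𝓘(ℝ, ℝ) ∞ H Ω) {p₀ : M} (hp₀ : p₀ ∈ Ω) (k : ℕ) :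
    ∃ ε > 0, ∃ U : Set M, IsOpen U ∧ p₀ ∈ U ∧ ∃ θ : ℝ → M → M,
      (∀ q ∈ U, θ 0 q = q) ∧
      (∀ q ∈ U, ∀ t ∈ Ioo (-ε) ε, θ t q ∈ Ω ∧ IsHamCurveAt σ H (fun s => θ s q) t) ∧
      ContMDiffOn (𝓘(ℝ, ℝ).prod 𝓘(ℝ, PhaseSpace n)) 𝓘(ℝ, PhaseSpace n) (k + 1)
        (fun z : ℝ × M => θ z.1 z.2) (Ioo (-ε) ε ×ˢ U) ∧
      ∀ q ∈ U, ∀ t ∈ Ioo (-ε) ε, ∀ a b, σ (θ t q)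
        ![mfderiv 𝓘(ℝ, PhaseSpace n) 𝓘(ℝ, PhaseSpace n) (θ t) q a,
          mfderiv 𝓘(ℝ, PhaseSpace n) 𝓘(ℝ, PhaseSpace n) (θ t) q b] = σ q ![a, b] := by
  obtain ⟨v, hv, hvH, -, hc⟩ := exists_chart_field hσ hΩ hH p₀
  have he := mdifferentiable_chartAt (n := n) p₀
  have hcs := contMDiffOn_chart_symm (I := 𝓘(ℝ, PhaseSpace n)) (n := ∞) (x := p₀)
  have hce := contMDiffOn_chart (I := 𝓘(ℝ, PhaseSpace n)) (n := ∞) (x := p₀)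
  set e := chartAt (PhaseSpace n) p₀
  have hΩ' : IsOpen (e.target ∩ e.symm ⁻¹' Ω) := e.isOpen_inter_preimage_symm hΩ
  have hs : p₀ ∈ e.source := mem_chart_source _ _
  have hy : e p₀ ∈ e.target ∩ e.symm ⁻¹' Ω :=
    ⟨e.map_source hs, by rw [mem_preimage, e.left_inv hs]; exact hp₀⟩
  obtain ⟨ε, hε, V, hV, hpV, φ, J, hφ, hφk, hJ0, hJ, hφJ⟩ := exists_localFlow_fderiv k hΩ' hv hy
  have hUe : ∀ q ∈ e.source ∩ e ⁻¹' V, e q ∈ V := fun q hq => hq.2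
  refine ⟨ε, hε, e.source ∩ e ⁻¹' V, e.isOpen_inter_preimage hV, ⟨hs, hpV⟩,
    fun t q => e.symm (φ (e q) t), fun q hq => ?_, fun q hq t ht => ⟨?_, ?_⟩, ?_, ?_⟩
  · show e.symm (φ (e q) 0) = q
    rw [hφ.zero _ hq.2, e.left_inv hq.1]
  · exact (hφ.mem _ hq.2 t ht).2
  · exact hc (φ (e q)) t (hφ.mem _ hq.2 t ht) (hφ.deriv _ hq.2 t ht)
  · have h1 : ContMDiffOn (𝓘(ℝ, ℝ).prod 𝓘(ℝ, PhaseSpace n)) (𝓘(ℝ, PhaseSpace n).prod 𝓘(ℝ, ℝ))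
        (k + 1) (fun z : ℝ × M => (e z.2, z.1)) (Ioo (-ε) ε ×ˢ (e.source ∩ e ⁻¹' V)) := by
      refine ContMDiffOn.prodMk ?_ contMDiffOn_fst
      refine ContMDiffOn.comp (t := e.source) (hce.of_le (by exact_mod_cast le_top))
        contMDiffOn_snd fun z hz => hz.2.1
    have h2 : ContMDiffOn (𝓘(ℝ, PhaseSpace n).prod 𝓘(ℝ, ℝ)) 𝓘(ℝ, PhaseSpace n) (k + 1)
        (uncurry φ) (V ×ˢ Ioo (-ε) ε) := by
      rw [← modelWithCornersSelf_prod, chartedSpaceSelf_prod]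
      exact hφk.contMDiffOn
    exact ContMDiffOn.comp (t := e.target) (hcs.of_le (by exact_mod_cast le_top))
      (h2.comp h1 fun z hz => ⟨hz.2.2, hz.1⟩) fun z hz => (hφ.mem _ hz.2.2 _ hz.1).1
  · intro q hq t ht a b
    have hyt := hφ.mem _ hq.2 t ht
    have hd : HasMFDerivAt 𝓘(ℝ, PhaseSpace n) 𝓘(ℝ, PhaseSpace n)
        (fun q => e.symm (φ (e q) t)) q _ :=
      (he.mdifferentiableAt_symm hyt.1).hasMFDerivAt.comp q
        ((hφJ _ hq.2 t ht).hasMFDerivAt.comp q (he.mdifferentiableAt hq.1).hasMFDerivAt)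
    set a' : PhaseSpace n := mfderiv 𝓘(ℝ, PhaseSpace n) 𝓘(ℝ, PhaseSpace n) e q a with ha'
    set b' : PhaseSpace n := mfderiv 𝓘(ℝ, PhaseSpace n) 𝓘(ℝ, PhaseSpace n) e q b with hb'
    have h1 := form_preserved_of_closed hΩ' ((hσ.smooth p₀).mono inter_subset_left)
      (contDiffOn_comp_chart_symm hH p₀) (fun y hy => hσ.closed p₀ y hy.1) hv hvH
      (hφ.mem _ hq.2) (hφ.deriv _ hq.2) (hJ _ hq.2) (hJ0 _ hq.2) ht a' b'
    rw [formInChart_apply, formInChart_apply, hφ.zero _ hq.2] at h1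
    have hD : ∀ c : PhaseSpace n, (mfderiv 𝓘(ℝ, PhaseSpace n) 𝓘(ℝ, PhaseSpace n)
        (fun q => e.symm (φ (e q) t)) q c : PhaseSpace n) =
        mfderiv 𝓘(ℝ, PhaseSpace n) 𝓘(ℝ, PhaseSpace n) e.symm (φ (e q) t) (J (e q) t
          (mfderiv 𝓘(ℝ, PhaseSpace n) 𝓘(ℝ, PhaseSpace n) e q c)) := fun c => by
      rw [hd.mfderiv]; rfl
    have hl : ∀ c d c' d' : PhaseSpace n, c = c' → d = d' →
        σ (e.symm (φ (e q) t)) ![c, d] = σ (e.symm (φ (e q) t)) ![c', d'] := by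
      rintro _ _ _ _ rfl rfl; rfl
    refine (hl _ _ _ _ (hD a) (hD b)).trans (Eq.trans h1 ?_)
    have key : ∀ q' (a' b' : PhaseSpace n), q' = q → a' = a → b' = b →
        σ q' ![a', b'] = σ q ![a, b] := by
      rintro _ _ _ rfl rfl rfl; rfl
    exact key _ _ _ (e.left_inv hq.1)
      (congrArg (fun L => L a) (he.symm_comp_deriv hq.1))
      (congrArg (fun L => L b) (he.symm_comp_deriv hq.1))

end LocalHamiltonian

/-! ### Global flows of functions on the base -/

/-- A local action of `ℝ`, defined for times in `(-ε, ε)`, extends to all times: with `h = ε / 2`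
and `k = ⌊t / h⌋`, time `t` acts as time `t - k h` after `k` times the time `h`. -/
theorem exists_extend_local_action {α β : Type*} (θ : ℝ → α → α) {ε : ℝ} (hε : 0 < ε)
    (h0 : ∀ a, θ 0 a = a)
    (hadd : ∀ s t, |s| < ε → |t| < ε → |s + t| < ε → ∀ a, θ s (θ t a) = θ (s + t) a)
    (g : α → β) (hg : ∀ s a, |s| < ε → g (θ s a) = g a) :
    ∃ Θ : ℝ → α → α, (∀ a, Θ 0 a = a) ∧
      (∀ t s a, |s| < ε / 2 → Θ (t + s) a = θ s (Θ t a)) ∧ ∀ t a, g (Θ t a) = g a := by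
  set h := ε / 2 with hh
  have hh0 : 0 < h := by positivity
  have habs : |h| < ε := by rw [abs_of_pos hh0]; linarith
  have habs' : |-h| < ε := by rw [abs_neg]; exact habs
  let e : Equiv.Perm α :=
    { toFun := θ h
      invFun := θ (-h)
      left_inv := fun a => by
        rw [hadd _ _ habs' habs (by simpa using hε), neg_add_cancel, h0]
      right_inv := fun a => by
        rw [hadd _ _ habs habs' (by simpa using hε), add_neg_cancel, h0] }
  have he : ∀ a, e a = θ h a := fun _ => rfl
  have he' : ∀ a, e⁻¹ a = θ (-h) a := fun _ => rfl
  let Θ : ℝ → α → α := fun t a => θ (t - ⌊t / h⌋ * h) ((e ^ ⌊t / h⌋) a)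
  have key : ∀ (k : ℤ) (r : ℝ) (a : α), -h ≤ r → r < 2 * h →
      Θ (k * h + r) a = θ r ((e ^ k) a) := by
    intro k r a hr1 hr2
    have hfl : ⌊(k * h + r) / h⌋ = k + ⌊r / h⌋ := by
      rw [add_div, mul_div_cancel_right₀ _ hh0.ne', Int.floor_intCast_add]
    have hj : ⌊r / h⌋ = -1 ∨ ⌊r / h⌋ = 0 ∨ ⌊r / h⌋ = 1 := by
      have h1 : -1 ≤ ⌊r / h⌋ := Int.le_floor.2 (by
        rw [le_div_iff₀ hh0]; push_cast; linarith)
      have h2 : ⌊r / h⌋ < 2 := Int.floor_lt.2 (by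
        rw [div_lt_iff₀ hh0]; push_cast; linarith)
      omega
    have hr : |r| < ε := abs_lt.2 ⟨by linarith, by linarith⟩
    simp only [Θ, hfl]
    rcases hj with hj | hj | hj
    · have hj' := Int.lt_floor_add_one (r / h)
      rw [hj, div_lt_iff₀ hh0] at hj'
      push_cast at hj'
      have hlt : |r + h| < ε := abs_lt.2 ⟨by linarith, by linarith⟩
      rw [hj, show (k + -1 : ℤ) = -1 + k by ring, zpow_add, Equiv.Perm.mul_apply, zpow_neg_one,
        he', show (k * h + r - ((-1 + k : ℤ) : ℝ) * h) = r + h by push_cast; ring,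
        hadd _ _ hlt habs' (by simpa using hr)]
      congr 1
      ring
    · rw [hj, add_zero, show k * h + r - k * h = r by ring]
    · have hj' := Int.floor_le (r / h)
      rw [hj, le_div_iff₀ hh0] at hj'
      push_cast at hj'
      have hlt : |r - h| < ε := abs_lt.2 ⟨by linarith, by linarith⟩
      rw [hj, show (k + 1 : ℤ) = 1 + k by ring, zpow_add, Equiv.Perm.mul_apply, zpow_one,
        he, show (k * h + r - ((1 + k : ℤ) : ℝ) * h) = r - h by push_cast; ring,
        hadd _ _ hlt habs (by simpa using hr)]
      congr 1
      ring
  have hge : ∀ a, g (e a) = g a := fun a => hg _ _ habs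
  have hge' : ∀ a, g (e⁻¹ a) = g a := fun a => hg _ _ habs'
  have hgk : ∀ (k : ℤ) a, g ((e ^ k) a) = g a := by
    intro k a
    induction k using Int.induction_on with
    | zero => simp
    | succ i ih => rw [add_comm, zpow_add, Equiv.Perm.mul_apply, zpow_one, hge, ih]
    | pred i ih =>
      rw [sub_eq_add_neg, add_comm, zpow_add, Equiv.Perm.mul_apply, zpow_neg_one, hge', ih]
  have hfr : ∀ t : ℝ, 0 ≤ t - ⌊t / h⌋ * h ∧ t - ⌊t / h⌋ * h < h := fun t => by
    have h1 := Int.floor_le (t / h)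
    have h2 := Int.lt_floor_add_one (t / h)
    rw [le_div_iff₀ hh0] at h1
    rw [div_lt_iff₀ hh0] at h2
    constructor <;> linarith
  refine ⟨Θ, fun a => by simp [Θ, h0], fun t s a hs => ?_, fun t a => ?_⟩
  · obtain ⟨h1, h2⟩ := hfr t
    have hs' := abs_lt.1 hs
    have e1 : t + s = ⌊t / h⌋ * h + (s + (t - ⌊t / h⌋ * h)) := by ring
    rw [e1, key _ _ _ (by linarith) (by linarith)]
    exact (hadd _ _ (by linarith) (abs_lt.2 ⟨by linarith, by linarith⟩)
      (abs_lt.2 ⟨by linarith, by linarith⟩) _).symm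
  · obtain ⟨h1, h2⟩ := hfr t
    exact (hg _ _ (abs_lt.2 ⟨by linarith, by linarith⟩)).trans (hgk _ _)

theorem eq_of_hasDerivAt_zero {g : ℝ → ℝ} {a b : ℝ} (h : ∀ s ∈ Ioo a b, HasDerivAt g 0 s) {s t : ℝ}
    (hs : s ∈ Ioo a b) (ht : t ∈ Ioo a b) : g s = g t :=
  (convex_Ioo a b).is_const_of_fderivWithin_eq_zero (𝕜 := ℝ)
    (fun r hr => (h r hr).differentiableAt.differentiableWithinAt)
    (fun r hr => by
      rw [fderivWithin_of_isOpen isOpen_Ioo hr]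
      ext
      simp [(h r hr).deriv]) hs ht

section HamCurve

variable {n : ℕ} {M : Type u} [TopologicalSpace M] [ChartedSpace (PhaseSpace n) M]
  {σ : ∀ p : M, TangentSpace 𝓘(ℝ, PhaseSpace n) p [⋀^Fin 2]→L[ℝ] ℝ}

theorem IsHamCurveAt.comp_add_const {H : M → ℝ} {γ : ℝ → M} {s t : ℝ}
    (h : IsHamCurveAt σ H γ (s + t)) : IsHamCurveAt σ H (fun r => γ (r + t)) s := by
  obtain ⟨w, hw, hv⟩ := h
  refine ⟨w, ?_, hv⟩
  have h1 : HasMFDerivAt 𝓘(ℝ, ℝ) 𝓘(ℝ, ℝ) (fun r : ℝ => r + t) s (ContinuousLinearMap.id ℝ ℝ) :=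
    ((hasFDerivAt_id (𝕜 := ℝ) s).add_const t).hasMFDerivAt
  have h2 : HasMFDerivAt 𝓘(ℝ, ℝ) 𝓘(ℝ, PhaseSpace n) γ ((fun r : ℝ => r + t) s)
    ((1 : ℝ →L[ℝ] ℝ).smulRight w) := hw
  exact (h2.comp s h1).congr_mfderiv (by ext; rfl)

/-- Curves that satisfy Hamilton's equation on an interval are determined by one value. -/
theorem IsHamCurveAt.eqOn [IsManifold 𝓘(ℝ, PhaseSpace n) ∞ M] [T2Space M]
    (hσ : IsSymplecticForm σ) {H : M → ℝ} {Ω : Set M} (hΩ : IsOpen Ω)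
    (hH : ContMDiffOn 𝓘(ℝ, PhaseSpace n) 𝓘(ℝ, ℝ) ∞ H Ω) {γ γ' : ℝ → M} {I : Set ℝ}
    (hI : IsOpen I) (hI' : IsPreconnected I)
    (hγ : ∀ s ∈ I, γ s ∈ Ω ∧ IsHamCurveAt σ H γ s) (hγ' : ∀ s ∈ I, IsHamCurveAt σ H γ' s)
    {t : ℝ} (ht : t ∈ I) (h : γ t = γ' t) : EqOn γ γ' I := by
  intro s hs
  have key := hI'.induction₂ (fun a b => γ a = γ' a ↔ γ b = γ' b) (fun x hx => ?_)
    (fun x y z _ _ _ h1 h2 => h1.trans h2) (fun x y _ _ h => h.symm) ht hs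
  · exact key.1 h
  · by_cases hxe : γ x = γ' x
    · have h1 := IsHamCurveAt.eventuallyEq hσ hΩ hH (t := x)
        (by filter_upwards [hI.mem_nhds hx] with r hr using (hγ r hr).2)
        (by filter_upwards [hI.mem_nhds hx] with r hr using hγ' r hr) (hγ x hx).1 hxe
      filter_upwards [h1.filter_mono nhdsWithin_le_nhds] with r hr
      simp [hxe, hr]
    · have h1 : ∀ᶠ r in 𝓝 x, γ r ≠ γ' r :=
        ((hγ x hx).2.continuousAt.ne_iff_eventually_ne (hγ' x hx).continuousAt).1 hxe
      filter_upwards [h1.filter_mono nhdsWithin_le_nhds] with r hr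
      simp [hxe, hr]

end HamCurve

namespace IntegrableSystem

variable {n : ℕ} {X : Type u} [TopologicalSpace X] {U : Opens X} (S : IntegrableSystem n U)

theorem isOpen_part (W : Opens X) : IsOpen (S.part W) := W.isOpen.preimage S.continuous_proj

/-- The tube lemma: a neighbourhood of a fiber contains the part over a neighbourhood of its base
point. -/
theorem exists_part_subset {x : X} (hx : x ∈ U) {O : Set S.carrier} (hO : IsOpen O)
    (h : ∀ p, S.proj p = x → p ∈ O) : ∃ V : Opens X, x ∈ V ∧ V ≤ U ∧ S.part V ⊆ O := by
  have h1 := S.proper.isClosedMap.eventually_nhds_fiber (p := fun p => p ∈ O) ⟨x, hx⟩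
    (fun p hp => hO.mem_nhds (h p (congrArg Subtype.val hp)))
  obtain ⟨t, ht, htO, hxt⟩ := eventually_nhds_iff.1 h1
  obtain ⟨V, hV, rfl⟩ := isOpen_induced_iff.1 htO
  refine ⟨⟨V, hV⟩ ⊓ U, ⟨hxt, hx⟩, inf_le_right, fun p hp => ?_⟩
  exact ht ⟨S.proj p, S.proj_mem p⟩ hp.1 p rfl

theorem isCompact_fiber {x : X} (hx : x ∈ U) : IsCompact {p | S.proj p = x} := by
  have h := S.proper.isCompact_preimage (K := {⟨x, hx⟩}) isCompact_singleton
  convert h using 1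
  ext p
  simp [Subtype.ext_iff]

variable {S}

/-- A connected set on which a moment map is constant lies in one fiber. -/
theorem proj_eq_of_isPreconnected {W : Opens X} {F : Fin n → S.carrier → ℝ}
    (hF : IsMomentMap S.form S.proj W F) {K : Set S.carrier} (hK : IsPreconnected K)
    (hKW : K ⊆ S.part W) {p q : S.carrier} (hp : p ∈ K) (hq : q ∈ K)
    (hc : ∀ r ∈ K, ∀ i, F i r = F i p) : S.proj q = S.proj p := by
  have h := hK.subset_connectedComponentIn hp (F := S.part W ∩ {q | ∀ i, F i q = F i p})
    fun r hr => ⟨hKW hr, hc r hr⟩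
  rw [← hF.fiber p (hKW hp)] at h
  exact h hq

theorem exists_ham_vector {W : Opens X} {H : S.carrier → ℝ}
    (hH : ContMDiffOn 𝓘(ℝ, PhaseSpace n) 𝓘(ℝ, ℝ) ∞ H (S.part W)) {p : S.carrier}
    (hp : p ∈ S.part W) :
    ∃ w : TangentSpace 𝓘(ℝ, PhaseSpace n) p, ∀ v, S.form p ![w, v] = dAt (n := n) H p v := by
  obtain ⟨ε, hε, V, hV, hpV, θ, h0, hθ, -⟩ :=
    exists_local_ham_flow S.symplectic (S.isOpen_part W) hH hp 0
  obtain ⟨-, w, -, hw⟩ := hθ p hpV 0 ⟨by linarith, hε⟩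
  exact ⟨w, h0 p hpV ▸ hw⟩

theorem ham_vector_unique {p : S.carrier} {w w' : TangentSpace 𝓘(ℝ, PhaseSpace n) p}
    (h : ∀ v, S.form p ![w, v] = S.form p ![w', v]) : w = w' := by
  refine sub_eq_zero.1 (S.symplectic.nondegenerate p _ fun v => ?_)
  have h1 := h v
  have h2 : ∀ u u' : PhaseSpace n, bilin (E := PhaseSpace n) (S.form p) (u - u') v =
      bilin (E := PhaseSpace n) (S.form p) u v - bilin (E := PhaseSpace n) (S.form p) u' v :=
    fun u u' => by rw [map_sub]; rfl
  exact (h2 w w').trans (sub_eq_zero.2 h1)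

theorem mdifferentiableAt_of_contMDiffOn {W : Opens X} {H : S.carrier → ℝ}
    (hH : ContMDiffOn 𝓘(ℝ, PhaseSpace n) 𝓘(ℝ, ℝ) ∞ H (S.part W)) {p : S.carrier}
    (hp : p ∈ S.part W) : MDifferentiableAt 𝓘(ℝ, PhaseSpace n) 𝓘(ℝ, ℝ) H p :=
  (hH.contMDiffAt ((S.isOpen_part W).mem_nhds hp)).mdifferentiableAt (by simp)

/-- The Hamiltonian vector fields of the components of a moment map are tangent to the fibers:
their integral curves stay in the common level sets, which have the fibers as components. -/
theorem dAt_comp_proj_ham {W W' : Opens X} {F : Fin n → S.carrier → ℝ}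
    (hF : IsMomentMap S.form S.proj W F) {f : X → ℝ} (hf : f ∈ S.smoothSheaf.sec W')
    {p : S.carrier} (hp : p ∈ S.part W) (hp' : p ∈ S.part W') (i : Fin n)
    {w : TangentSpace 𝓘(ℝ, PhaseSpace n) p}
    (hw : ∀ v, S.form p ![w, v] = dAt (n := n) (F i) p v) :
    dAt (n := n) (f ∘ S.proj) p w = 0 := by
  obtain ⟨ε, hε, V, hV, hpV, θ, h0, hθ, -⟩ := exists_local_ham_flow S.symplectic
    (S.isOpen_part (W ⊓ W')) ((hF.smooth i).mono fun q hq => hq.1) ⟨hp, hp'⟩ 0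
  have hε0 : (0 : ℝ) ∈ Ioo (-ε) ε := ⟨by linarith, hε⟩
  have hFc : ∀ j, ∀ s ∈ Ioo (-ε) ε, F j (θ s p) = F j (θ 0 p) := fun j s hs =>
    eq_of_hasDerivAt_zero (g := fun s => F j (θ s p)) (fun r hr => by
      obtain ⟨u, hu, hd⟩ := (hθ p hpV r hr).2.hasDerivAt_comp
        (mdifferentiableAt_of_contMDiffOn (hF.smooth j) (hθ p hpV r hr).1.1)
      exact hd.congr_deriv (hF.commute i j _ (hθ p hpV r hr).1.1 u hu)) hs hε0
  have hpr : ∀ s ∈ Ioo (-ε) ε, S.proj (θ s p) = S.proj (θ 0 p) := fun s hs =>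
    proj_eq_of_isPreconnected hF
      (isPreconnected_Ioo.image (fun s => θ s p)
        fun r hr => (hθ p hpV r hr).2.continuousAt.continuousWithinAt)
      (by rintro _ ⟨r, hr, rfl⟩; exact (hθ p hpV r hr).1.1) (mem_image_of_mem _ hε0)
      (mem_image_of_mem _ hs) (by rintro _ ⟨r, hr, rfl⟩ j; exact hFc j r hr)
  obtain ⟨u, hu, hd⟩ := (hθ p hpV 0 hε0).2.hasDerivAt_comp
    (mdifferentiableAt_of_contMDiffOn hf (hθ p hpV 0 hε0).1.2)
  have hd0 : HasDerivAt (fun s => (f ∘ S.proj) (θ s p)) 0 0 := by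
    refine (hasDerivAt_const (0 : ℝ) ((f ∘ S.proj) (θ 0 p))).congr_of_eventuallyEq ?_
    filter_upwards [Ioo_mem_nhds hε0.1 hε0.2] with s hs
    simp [hpr s hs]
  have h1 := hd.unique hd0
  have key : ∀ q (hq : q = p) (u : TangentSpace 𝓘(ℝ, PhaseSpace n) q),
      (∀ v, S.form q ![u, v] = dAt (n := n) (F i) q v) → dAt (n := n) (f ∘ S.proj) q u = 0 →
      dAt (n := n) (f ∘ S.proj) p w = 0 := by
    rintro _ rfl u hu h
    rw [← ham_vector_unique (w := u) (w' := w) fun v => (hu v).trans (hw v).symm]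
    exact h
  exact key _ (h0 p hpV) u hu h1

/-- Solutions of Hamilton's equation for functions on the base stay, locally, in one fiber. -/
theorem eventually_proj_eq {W : Opens X} {f : X → ℝ} (hf : f ∈ S.smoothSheaf.sec W)
    {γ : ℝ → S.carrier}
    {t : ℝ} (ht : γ t ∈ S.part W) (hγ : ∀ᶠ s in 𝓝 t, IsHamCurveAt S.form (f ∘ S.proj) γ s) :
    ∀ᶠ s in 𝓝 t, S.proj (γ s) = S.proj (γ t) := by
  obtain ⟨W', hxW', -, F, hF⟩ := S.moment (S.proj (γ t)) (S.proj_mem _)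
  have h1 : ∀ᶠ s in 𝓝 t, γ s ∈ S.part (W ⊓ W') := hγ.self_of_nhds.continuousAt.eventually_mem
    ((S.isOpen_part _).mem_nhds ⟨ht, hxW'⟩)
  obtain ⟨δ, hδ, hI⟩ := Metric.eventually_nhds_iff_ball.1 (h1.and hγ)
  rw [Real.ball_eq_Ioo] at hI
  have ht0 : t ∈ Ioo (t - δ) (t + δ) := ⟨by linarith, by linarith⟩
  -- The moment map is constant along the curve, since `dF(X_f) = -df(X_F) = 0`.
  have hFc : ∀ j, ∀ s ∈ Ioo (t - δ) (t + δ), F j (γ s) = F j (γ t) := fun j s hs =>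
    eq_of_hasDerivAt_zero (g := fun s => F j (γ s)) (fun r hr => by
      obtain ⟨u, hu, hd⟩ := (hI r hr).2.hasDerivAt_comp
        (mdifferentiableAt_of_contMDiffOn (hF.smooth j) (hI r hr).1.2)
      refine hd.congr_deriv ?_
      obtain ⟨w, hw⟩ := exists_ham_vector (hF.smooth j) (hI r hr).1.2
      rw [← hw u, alternating_swap, hu w, dAt_comp_proj_ham hF hf (hI r hr).1.2 (hI r hr).1.1 j hw,
        neg_zero]) hs ht0
  filter_upwards [Ioo_mem_nhds ht0.1 ht0.2] with s hs
  exact proj_eq_of_isPreconnected hF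
    (isPreconnected_Ioo.image γ fun r hr => (hI r hr).2.continuousAt.continuousWithinAt)
    (by rintro _ ⟨r, hr, rfl⟩; exact (hI r hr).1.2) (mem_image_of_mem _ ht0)
    (mem_image_of_mem _ hs) (by rintro _ ⟨r, hr, rfl⟩ j; exact hFc j r hr)

theorem proj_eq_of_isHamCurveAt {W : Opens X} {f : X → ℝ} (hf : f ∈ S.smoothSheaf.sec W)
    {γ : ℝ → S.carrier} {I : Set ℝ} (hI : IsOpen I) (hI' : IsPreconnected I)
    (hγ : ∀ s ∈ I, γ s ∈ S.part W ∧ IsHamCurveAt S.form (f ∘ S.proj) γ s) {s t : ℝ} (hs : s ∈ I)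
    (ht : t ∈ I) : S.proj (γ s) = S.proj (γ t) :=
  hI'.induction₂ (fun a b => S.proj (γ a) = S.proj (γ b))
    (fun x hx => by
      have h := eventually_proj_eq hf (hγ x hx).1
        (by filter_upwards [hI.mem_nhds hx] with r hr using (hγ r hr).2)
      filter_upwards [h.filter_mono nhdsWithin_le_nhds] with r hr using hr.symm)
    (fun _ _ _ _ _ _ h1 h2 => h1.trans h2) (fun _ _ _ _ h => h.symm) hs ht

/-- Local flows of a function on the base, uniformly near a fiber. -/
theorem exists_flow_near_fiber {W : Opens X} {f : X → ℝ} (hf : f ∈ S.smoothSheaf.sec W) {x : X}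
    (hxW : x ∈ W) (hx : x ∈ U) (k : ℕ) :
    ∃ ε > 0, ∃ V : Opens X, x ∈ V ∧ V ≤ W ∧ ∃ θ : ℝ → S.carrier → S.carrier,
      (∀ q ∈ S.part V, θ 0 q = q) ∧
      (∀ q ∈ S.part V, ∀ t ∈ Ioo (-ε) ε, S.proj (θ t q) = S.proj q ∧
        IsHamCurveAt S.form (f ∘ S.proj) (fun s => θ s q) t) ∧
      ContMDiffOn (𝓘(ℝ, ℝ).prod 𝓘(ℝ, PhaseSpace n)) 𝓘(ℝ, PhaseSpace n) (k + 1)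
        (fun z : ℝ × S.carrier => θ z.1 z.2) (Ioo (-ε) ε ×ˢ S.part V) ∧
      ∀ q ∈ S.part V, ∀ t ∈ Ioo (-ε) ε, ∀ a b, S.form (θ t q)
        ![mfderiv 𝓘(ℝ, PhaseSpace n) 𝓘(ℝ, PhaseSpace n) (θ t) q a,
          mfderiv 𝓘(ℝ, PhaseSpace n) 𝓘(ℝ, PhaseSpace n) (θ t) q b] = S.form q ![a, b] := by
  classical
  -- Finitely many local flows cover the compact fiber, and agree on the overlaps by uniqueness.
  have hloc := fun p : {p // S.proj p = x} => exists_local_ham_flow S.symplectic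
    (S.isOpen_part W) hf
    (p₀ := p) (show S.proj p ∈ W by rw [p.2]; exact hxW) k
  choose ε hε O hO hpO θ h0 hθ hθk hθs using hloc
  obtain ⟨T, hT⟩ := (S.isCompact_fiber hx).elim_finite_subcover O hO
    fun p hp => mem_iUnion.2 ⟨⟨p, hp⟩, hpO _⟩
  obtain ⟨δ, hδ, hδε⟩ : ∃ δ > 0, ∀ p ∈ T, δ ≤ ε p := by
    rcases T.eq_empty_or_nonempty with rfl | hne
    · exact ⟨1, one_pos, by simp⟩
    · exact ⟨T.inf' hne ε, (Finset.lt_inf'_iff hne).2 fun p _ => hε p,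
        fun p hp => Finset.inf'_le _ hp⟩
  obtain ⟨V, hxV, -, hVO⟩ := S.exists_part_subset hx (O := ⋃ p ∈ T, O p)
    (isOpen_biUnion fun p _ => hO p) fun p hp => hT hp
  have hsub : ∀ p ∈ T, Ioo (-δ) δ ⊆ Ioo (-ε p) (ε p) := fun p hp =>
    Ioo_subset_Ioo (neg_le_neg (hδε p hp)) (hδε p hp)
  have hidx : ∀ q, ∃ p, q ∈ S.part (V ⊓ W) → p ∈ T ∧ q ∈ O p := by
    obtain ⟨p₀, hp₀⟩ := S.proj_onto x hx
    intro q
    by_cases hq : q ∈ S.part (V ⊓ W)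
    · obtain ⟨p, hp, hqp⟩ := mem_iUnion₂.1 (hVO hq.1)
      exact ⟨p, fun _ => ⟨hp, hqp⟩⟩
    · exact ⟨⟨p₀, hp₀⟩, fun h => absurd h hq⟩
  choose ι hι using hidx
  have hagree : ∀ q ∈ S.part (V ⊓ W), ∀ p ∈ T, q ∈ O p → ∀ t ∈ Ioo (-δ) δ,
      θ (ι q) t q = θ p t q := fun q hq p hp hqp t ht => by
    refine IsHamCurveAt.eqOn S.symplectic (S.isOpen_part W) hf isOpen_Ioo isPreconnected_Ioo
      (γ := fun t => θ (ι q) t q) (γ' := fun t => θ p t q) (t := 0)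
      (fun s hs => hθ _ _ (hι q hq).2 _ (hsub _ (hι q hq).1 hs))
      (fun s hs => (hθ _ _ hqp _ (hsub _ hp hs)).2) ⟨by linarith, hδ⟩ ?_ ht
    simp only [h0 _ _ (hι q hq).2, h0 _ _ hqp]
  have hd0 : (0 : ℝ) ∈ Ioo (-δ) δ := ⟨by linarith, hδ⟩
  have hnear : ∀ q ∈ S.part (V ⊓ W), ∀ᶠ q' in 𝓝 q, q' ∈ S.part (V ⊓ W) ∧ q' ∈ O (ι q) :=
    fun q hq => ((S.isOpen_part _).mem_nhds hq |> fun h => inter_mem h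
      ((hO _).mem_nhds (hι q hq).2))
  refine ⟨δ, hδ, V ⊓ W, ⟨hxV, hxW⟩, inf_le_right, fun t q => θ (ι q) t q,
    fun q hq => h0 _ _ (hι q hq).2, fun q hq t ht => ⟨?_, ?_⟩, ?_, ?_⟩
  · have h1 := proj_eq_of_isHamCurveAt hf isOpen_Ioo isPreconnected_Ioo
      (γ := fun t => θ (ι q) t q)
      (fun s hs => hθ _ _ (hι q hq).2 _ (hsub _ (hι q hq).1 hs)) ht hd0
    rw [h1, h0 _ _ (hι q hq).2]
  · exact (hθ _ _ (hι q hq).2 _ (hsub _ (hι q hq).1 ht)).2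
  · rintro ⟨t, q⟩ ⟨ht, hq⟩
    have h1 : ContMDiffAt (𝓘(ℝ, ℝ).prod 𝓘(ℝ, PhaseSpace n)) 𝓘(ℝ, PhaseSpace n) (k + 1)
        (fun z : ℝ × S.carrier => θ (ι q) z.1 z.2) (t, q) :=
      (hθk (ι q)).contMDiffAt (prod_mem_nhds
        (Ioo_mem_nhds (hsub _ (hι q hq).1 ht).1 (hsub _ (hι q hq).1 ht).2)
        ((hO _).mem_nhds (hι q hq).2))
    refine (h1.congr_of_eventuallyEq ?_).contMDiffWithinAt
    filter_upwards [prod_mem_nhds (Ioo_mem_nhds ht.1 ht.2) (hnear q hq)] with z hz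
    exact hagree _ hz.2.1 _ (hι q hq).1 hz.2.2 _ hz.1
  · intro q hq t ht a b
    have h1 : (fun q' => θ (ι q') t q') =ᶠ[𝓝 q] θ (ι q) t := by
      filter_upwards [hnear q hq] with q' hq'
      exact hagree _ hq'.1 _ (hι q hq).1 hq'.2 _ ht
    have h2 := hθs _ _ (hι q hq).2 _ (hsub _ (hι q hq).1 ht) a b
    rw [h1.mfderiv_eq]
    exact h2

end IntegrableSystem

section Symplectic

variable {n : ℕ} {M N P : Type u} [TopologicalSpace M] [ChartedSpace (PhaseSpace n) M]
  [TopologicalSpace N] [ChartedSpace (PhaseSpace n) N]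
  [TopologicalSpace P] [ChartedSpace (PhaseSpace n) P]

/-- The map `g` is differentiable at `p` and pulls the form `τ` back to `σ` there. -/
def IsSymplecticAt (σ : ∀ p : M, TangentSpace 𝓘(ℝ, PhaseSpace n) p [⋀^Fin 2]→L[ℝ] ℝ)
    (τ : ∀ p : N, TangentSpace 𝓘(ℝ, PhaseSpace n) p [⋀^Fin 2]→L[ℝ] ℝ) (g : M → N) (p : M) : Prop :=
  MDifferentiableAt 𝓘(ℝ, PhaseSpace n) 𝓘(ℝ, PhaseSpace n) g p ∧
  ∀ a b, τ (g p) ![mfderiv 𝓘(ℝ, PhaseSpace n) 𝓘(ℝ, PhaseSpace n) g p a,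
    mfderiv 𝓘(ℝ, PhaseSpace n) 𝓘(ℝ, PhaseSpace n) g p b] = σ p ![a, b]

variable {σ : ∀ p : M, TangentSpace 𝓘(ℝ, PhaseSpace n) p [⋀^Fin 2]→L[ℝ] ℝ}
  {τ : ∀ p : N, TangentSpace 𝓘(ℝ, PhaseSpace n) p [⋀^Fin 2]→L[ℝ] ℝ}
  {υ : ∀ p : P, TangentSpace 𝓘(ℝ, PhaseSpace n) p [⋀^Fin 2]→L[ℝ] ℝ}

theorem IsSymplecticAt.comp {g : N → P} {h : M → N} {p : M} (hg : IsSymplecticAt τ υ g (h p))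
    (hh : IsSymplecticAt σ τ h p) : IsSymplecticAt σ υ (g ∘ h) p := by
  refine ⟨hg.1.comp p hh.1, fun a b => ?_⟩
  rw [mfderiv_comp p hg.1 hh.1]
  exact (hg.2 _ _).trans (hh.2 a b)

theorem IsSymplecticAt.congr {g h : M → N} {p : M} (hg : IsSymplecticAt σ τ g p)
    (he : h =ᶠ[𝓝 p] g) : IsSymplecticAt σ τ h p := by
  refine ⟨hg.1.congr_of_eventuallyEq he, fun a b => ?_⟩
  have key : ∀ q, q = g p → τ q ![mfderiv 𝓘(ℝ, PhaseSpace n) 𝓘(ℝ, PhaseSpace n) g p a,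
    mfderiv 𝓘(ℝ, PhaseSpace n) 𝓘(ℝ, PhaseSpace n) g p b] = σ p ![a, b] := by
    rintro _ rfl
    exact hg.2 a b
  rw [he.mfderiv_eq]
  exact key _ he.eq_of_nhds

theorem isSymplecticAt_id (p : M) : IsSymplecticAt σ σ id p :=
  ⟨mdifferentiableAt_id, fun a b => by rw [mfderiv_id]; rfl⟩

/-- A symplectic map between manifolds of the same dimension is a local diffeomorphism. -/
theorem IsSymplecticAt.surjective (hσ : IsSymplecticForm σ) {g : M → N} {p : M}
    (hg : IsSymplecticAt σ τ g p) :
    Function.Surjective (mfderiv 𝓘(ℝ, PhaseSpace n) 𝓘(ℝ, PhaseSpace n) g p) := by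
  let L : PhaseSpace n →L[ℝ] PhaseSpace n :=
    mfderiv 𝓘(ℝ, PhaseSpace n) 𝓘(ℝ, PhaseSpace n) g p
  have h1 : Function.Injective L.toLinearMap := by
    refine (injective_iff_map_eq_zero _).2 fun a ha => hσ.nondegenerate p a fun b => ?_
    refine (hg.2 a b).symm.trans ?_
    have key : ∀ z : PhaseSpace n, z = 0 → τ (g p) ![z,
        mfderiv 𝓘(ℝ, PhaseSpace n) 𝓘(ℝ, PhaseSpace n) g p b] = 0 := by
      rintro _ rfl
      exact (τ (g p)).map_coord_zero 0 rfl
    exact key _ ha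
  have h2 : Function.Surjective L.toLinearMap := LinearMap.injective_iff_surjective.1 h1
  exact h2

/-- A symplectic map sends Hamiltonian vectors to Hamiltonian vectors. -/
theorem IsSymplecticAt.map_ham (hσ : IsSymplecticForm σ) {g : M → N} {p : M}
    (hg : IsSymplecticAt σ τ g p) {H : M → ℝ} {K : N → ℝ}
    (hK : MDifferentiableAt 𝓘(ℝ, PhaseSpace n) 𝓘(ℝ, ℝ) K (g p)) (hHK : K ∘ g =ᶠ[𝓝 p] H)
    {w : TangentSpace 𝓘(ℝ, PhaseSpace n) p} (hw : ∀ v, σ p ![w, v] = dAt (n := n) H p v) (v) :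
    τ (g p) ![mfderiv 𝓘(ℝ, PhaseSpace n) 𝓘(ℝ, PhaseSpace n) g p w, v] =
      dAt (n := n) K (g p) v := by
  obtain ⟨u, rfl⟩ := hg.surjective hσ v
  rw [hg.2, hw]
  unfold dAt
  rw [← hHK.mfderiv_eq]
  exact mfderiv_comp_apply _ hK hg.1 u

theorem IsHamCurveAt.comp_symplectic (hσ : IsSymplecticForm σ) {g : M → N} {γ : ℝ → M} {t : ℝ}
    (hg : IsSymplecticAt σ τ g (γ t)) {H : M → ℝ} {K : N → ℝ}
    (hK : MDifferentiableAt 𝓘(ℝ, PhaseSpace n) 𝓘(ℝ, ℝ) K (g (γ t)))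
    (hHK : K ∘ g =ᶠ[𝓝 (γ t)] H) (h : IsHamCurveAt σ H γ t) : IsHamCurveAt τ K (g ∘ γ) t := by
  obtain ⟨w, hw, hv⟩ := h
  refine ⟨mfderiv 𝓘(ℝ, PhaseSpace n) 𝓘(ℝ, PhaseSpace n) g (γ t) w, ?_,
    hg.map_ham hσ hK hHK hv⟩
  refine (hg.1.hasMFDerivAt.comp t hw).congr_mfderiv ?_
  ext
  exact map_smul (mfderiv 𝓘(ℝ, PhaseSpace n) 𝓘(ℝ, PhaseSpace n) g (γ t)) (1 : ℝ) w

end Symplectic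

namespace IntegrableSystem

variable {n : ℕ} {X : Type u} [TopologicalSpace X] {U : Opens X} {S : IntegrableSystem n U}

/-- The flow of a function on the base is complete: near a fiber, the local flow exists for a
uniform time and does not leave the fibers, so that it can be iterated. -/
theorem exists_isFlowLine {W : Opens X} {f : X → ℝ} (hf : f ∈ S.smoothSheaf.sec W) {p : S.carrier}
    (hp : p ∈ S.part W) : ∃ γ, S.IsFlowLine f γ ∧ γ 0 = p := by
  obtain ⟨ε, hε, V, hxV, hVW, θ, h0, hθ, -⟩ := exists_flow_near_fiber hf hp (S.proj_mem p) 0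
  have hV : ∀ q ∈ S.part V, ∀ t, |t| < ε → θ t q ∈ S.part V := fun q hq t ht => by
    show S.proj _ ∈ V
    rw [(hθ q hq t (abs_lt.1 ht)).1]
    exact hq
  have hadd : ∀ s t, |s| < ε → |t| < ε → |s + t| < ε → ∀ q ∈ S.part V,
      θ s (θ t q) = θ (s + t) q := by
    intro s t hs ht hst q hq
    refine IsHamCurveAt.eqOn S.symplectic (S.isOpen_part W) hf
      (γ := fun r => θ r (θ t q)) (γ' := fun r => θ (r + t) q) (t := 0)
      (I := Ioo (-ε) ε ∩ Ioo (-ε - t) (ε - t)) (isOpen_Ioo.inter isOpen_Ioo)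
      (by rw [Ioo_inter_Ioo]; exact isPreconnected_Ioo)
      (fun r hr => ⟨hVW ((hθ _ (hV q hq t ht) r hr.1).1.symm ▸ hV q hq t ht : _ ∈ V), ?_⟩)
      (fun r hr => ?_) ?_ ?_ ?_
    · exact (hθ _ (hV q hq t ht) r hr.1).2
    · exact IsHamCurveAt.comp_add_const (γ := fun r => θ r q)
        (hθ q hq (r + t) ⟨by linarith [hr.2.1], by linarith [hr.2.2]⟩).2
    · have := abs_lt.1 ht
      exact ⟨⟨by linarith, hε⟩, by linarith, by linarith⟩
    · simp only [zero_add, h0 _ (hV q hq t ht)]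
    · have := abs_lt.1 hs
      have := abs_lt.1 hst
      exact ⟨⟨by linarith, by linarith⟩, by linarith, by linarith⟩
  obtain ⟨Θ, hΘ0, hΘ, hΘp⟩ := exists_extend_local_action (α := S.part V)
    (fun s a => if h : |s| < ε then ⟨θ s a, hV a a.2 s h⟩ else a) hε
    (fun a => by simp [hε, h0 a a.2])
    (fun s t hs ht hst a => by simp [hs, ht, hst, hadd s t hs ht hst a a.2])
    (fun a => S.proj a) (fun s a hs => by simp [hs, (hθ a a.2 s (abs_lt.1 hs)).1])
  refine ⟨fun t => Θ t ⟨p, hxV⟩, ⟨fun t => ?_, fun t => ?_⟩, by simp [hΘ0]⟩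
  · rw [hΘp, hΘp]
  · have h1 := (hθ (Θ t ⟨p, hxV⟩) (Θ t ⟨p, hxV⟩).2 0 ⟨by linarith, hε⟩).2
    rw [← add_neg_cancel t] at h1
    refine IsHamCurveAt.congr h1.comp_add_const ?_
    filter_upwards [Ioo_mem_nhds (show t - ε / 2 < t by linarith) (show t < t + ε / 2 by linarith)]
      with r hr
    have h2 : |r + -t| < ε / 2 := abs_lt.2 ⟨by linarith [hr.1], by linarith [hr.2]⟩
    have h3 := hΘ t (r + -t) ⟨p, hxV⟩ h2
    rw [show t + (r + -t) = r by ring] at h3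
    rw [h3, dif_pos (by linarith)]

theorem IsFlowLine.eq {W : Opens X} {f : X → ℝ} (hf : f ∈ S.smoothSheaf.sec W)
    {γ γ' : ℝ → S.carrier}
    (hγ : S.IsFlowLine f γ) (hγ' : S.IsFlowLine f γ') (h : γ 0 = γ' 0) (h0 : γ 0 ∈ S.part W) :
    γ = γ' := funext fun t =>
  IsHamCurveAt.eqOn S.symplectic (S.isOpen_part W) hf isOpen_univ isPreconnected_univ
    (fun s _ => ⟨show S.proj _ ∈ W by rw [hγ.1 s]; exact h0, hγ.2 s⟩) (fun s _ => hγ'.2 s)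
    (mem_univ 0) h (mem_univ t)

theorem IsFlowLine.comp_add_const {f : X → ℝ} {γ : ℝ → S.carrier} (hγ : S.IsFlowLine f γ) (t : ℝ) :
    S.IsFlowLine f fun s => γ (s + t) :=
  ⟨fun s => by simp only [hγ.1 (s + t), hγ.1 (0 + t)], fun s =>
    IsHamCurveAt.comp_add_const (hγ.2 (s + t))⟩

variable (S) in
open Classical in
/-- The flow of the Hamiltonian vector field of `f ∘ proj` (the identity where it is not defined for
all times). -/
noncomputable def flow (f : X → ℝ) (t : ℝ) (p : S.carrier) : S.carrier :=
  if h : ∃ γ, S.IsFlowLine f γ ∧ γ 0 = p then h.choose t else p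

section Flow

variable {W : Opens X} {f g : X → ℝ} {p : S.carrier}

theorem isFlowLine_flow (hf : f ∈ S.smoothSheaf.sec W) (hp : p ∈ S.part W) :
    S.IsFlowLine f fun t => S.flow f t p := by
  have h := exists_isFlowLine hf hp
  simp only [flow, dif_pos h]
  exact h.choose_spec.1

theorem flow_zero : S.flow f 0 p = p := by
  unfold flow
  split_ifs with h
  · exact h.choose_spec.2
  · rfl

theorem IsFlowLine.eq_flow (hf : f ∈ S.smoothSheaf.sec W) {γ : ℝ → S.carrier}
    (hγ : S.IsFlowLine f γ) (h0 : γ 0 ∈ S.part W) (t : ℝ) : γ t = S.flow f t (γ 0) :=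
  congrFun (hγ.eq hf (isFlowLine_flow hf h0) flow_zero.symm h0) t

theorem proj_flow (hf : f ∈ S.smoothSheaf.sec W) (hp : p ∈ S.part W) (t : ℝ) :
    S.proj (S.flow f t p) = S.proj p := by
  have h := (isFlowLine_flow hf hp).1 t
  simpa only [flow_zero] using h

theorem flow_mem_part (hf : f ∈ S.smoothSheaf.sec W) (hp : p ∈ S.part W) (t : ℝ) :
    S.flow f t p ∈ S.part W := by
  show S.proj _ ∈ W
  rw [proj_flow hf hp]
  exact hp

theorem flow_add_time (hf : f ∈ S.smoothSheaf.sec W) (hp : p ∈ S.part W) (s t : ℝ) :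
    S.flow f (s + t) p = S.flow f s (S.flow f t p) := by
  have h := ((isFlowLine_flow hf hp).comp_add_const t).eq_flow hf
    (by simpa using flow_mem_part hf hp t) s
  simpa using h

/-- The local flows near a fiber are the flow. -/
theorem exists_flow_contMDiffOn (hf : f ∈ S.smoothSheaf.sec W) {x : X} (hxW : x ∈ W) (hx : x ∈ U)
    (k : ℕ) : ∃ ε > 0, ∃ V : Opens X, x ∈ V ∧ V ≤ W ∧
      ContMDiffOn (𝓘(ℝ, ℝ).prod 𝓘(ℝ, PhaseSpace n)) 𝓘(ℝ, PhaseSpace n) (k + 1)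
        (fun z : ℝ × S.carrier => S.flow f z.1 z.2) (Ioo (-ε) ε ×ˢ S.part V) ∧
      ∀ q ∈ S.part V, ∀ t ∈ Ioo (-ε) ε, IsSymplecticAt S.form S.form (S.flow f t) q := by
  obtain ⟨ε, hε, V, hxV, hVW, θ, h0, hθ, hθk, hθs⟩ := exists_flow_near_fiber hf hxW hx k
  have hε0 : (0 : ℝ) ∈ Ioo (-ε) ε := ⟨by linarith, hε⟩
  have heq : ∀ q ∈ S.part V, ∀ t ∈ Ioo (-ε) ε, S.flow f t q = θ t q := fun q hq t ht => by
    refine (IsHamCurveAt.eqOn S.symplectic (S.isOpen_part W) hf isOpen_Ioo isPreconnected_Ioo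
      (γ := fun t => θ t q) (γ' := fun t => S.flow f t q) (t := 0)
      (fun s hs => ⟨?_, (hθ q hq s hs).2⟩)
      (fun s hs => (isFlowLine_flow hf (hVW hq)).2 s) hε0 ?_ ht).symm
    · show S.proj _ ∈ W
      rw [(hθ q hq s hs).1]
      exact hVW hq
    · simp only [h0 q hq, flow_zero]
  refine ⟨ε, hε, V, hxV, hVW, hθk.congr fun z hz => heq _ hz.2 _ hz.1, fun q hq t ht => ?_⟩
  have h1 : ContMDiffAt 𝓘(ℝ, PhaseSpace n) 𝓘(ℝ, PhaseSpace n) (k + 1) (θ t) q := by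
    have h2 := hθk.contMDiffAt (x := (t, q))
      (prod_mem_nhds (Ioo_mem_nhds ht.1 ht.2) ((S.isOpen_part V).mem_nhds hq))
    exact h2.comp q (contMDiffAt_const.prodMk contMDiffAt_id)
  have h3 : IsSymplecticAt S.form S.form (θ t) q :=
    ⟨h1.mdifferentiableAt (by simp), hθs q hq t ht⟩
  refine h3.congr ?_
  filter_upwards [(S.isOpen_part V).mem_nhds hq] with q' hq'
  exact heq q' hq' t ht

/-- Smoothness of the flow at all times follows from that at small times by iteration. -/
theorem contMDiffAt_flow (hf : f ∈ S.smoothSheaf.sec W) (hp : p ∈ S.part W) (t : ℝ) :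
    ContMDiffAt (𝓘(ℝ, ℝ).prod 𝓘(ℝ, PhaseSpace n)) 𝓘(ℝ, PhaseSpace n) ∞
      (fun z : ℝ × S.carrier => S.flow f z.1 z.2) (t, p) := by
  refine contMDiffAt_infty.2 fun k => ?_
  obtain ⟨ε, hε, V, hxV, hVW, hk, -⟩ := exists_flow_contMDiffOn hf hp (S.proj_mem p) k
  have hfV := S.smoothSheaf.anti hVW hf
  have key : ∀ m : ℕ, ∀ t, |t| < (m + 1) * ε → ∀ q ∈ S.part V,
      ContMDiffAt (𝓘(ℝ, ℝ).prod 𝓘(ℝ, PhaseSpace n)) 𝓘(ℝ, PhaseSpace n) (k + 1)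
        (fun z : ℝ × S.carrier => S.flow f z.1 z.2) (t, q) := by
    have base : ∀ t, |t| < ε → ∀ q ∈ S.part V,
      ContMDiffAt (𝓘(ℝ, ℝ).prod 𝓘(ℝ, PhaseSpace n)) 𝓘(ℝ, PhaseSpace n) (k + 1)
        (fun z : ℝ × S.carrier => S.flow f z.1 z.2) (t, q) := fun t ht q hq => by
      have ht' := abs_lt.1 ht
      exact hk.contMDiffAt
        (prod_mem_nhds (Ioo_mem_nhds ht'.1 ht'.2) ((S.isOpen_part V).mem_nhds hq))
    intro m
    induction m with
    | zero => intro t ht; exact base t (by simpa using ht)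
    | succ m ih =>
      intro t ht q hq
      have hm : (0 : ℝ) < m + 2 := by positivity
      push_cast at ht
      set r := t / (m + 2) with hr
      have htr : t = r * (m + 2) := by rw [hr]; field_simp
      have hr1 : |r| < ε := by
        rw [hr, abs_div, abs_of_pos hm, div_lt_iff₀ hm]
        linarith
      have hs1 : |t - r| < (m + 1) * ε := by
        rw [show t - r = r * (m + 1) by rw [htr]; ring, abs_mul,
          abs_of_pos (show (0 : ℝ) < m + 1 by positivity), mul_comm]
        exact mul_lt_mul_of_pos_left hr1 (by positivity)
      have h1 := ih (t - r) hs1 (S.flow f r q) (flow_mem_part hfV hq r)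
      have h2 := base r hr1 q hq
      have h3 : ContMDiffAt (𝓘(ℝ, ℝ).prod 𝓘(ℝ, PhaseSpace n)) 𝓘(ℝ, PhaseSpace n) (k + 1)
          (fun z : ℝ × S.carrier => S.flow f r z.2) (t, q) :=
        ContMDiffAt.comp (t, q) (g := fun z : ℝ × S.carrier => S.flow f z.1 z.2) h2
          (contMDiffAt_const.prodMk contMDiffAt_snd)
      have h4 : ContMDiffAt (𝓘(ℝ, ℝ).prod 𝓘(ℝ, PhaseSpace n)) 𝓘(ℝ, ℝ) (k + 1)
          (fun z : ℝ × S.carrier => z.1 - r) (t, q) :=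
        contMDiffAt_fst.sub contMDiffAt_const
      have h5 := ContMDiffAt.comp (t, q) (g := fun z : ℝ × S.carrier => S.flow f z.1 z.2) h1
        (h4.prodMk h3)
      refine h5.congr_of_eventuallyEq ?_
      filter_upwards [prod_mem_nhds univ_mem ((S.isOpen_part V).mem_nhds hq)] with z hz
      show _ = S.flow f (z.1 - r) (S.flow f r z.2)
      rw [← flow_add_time hfV hz.2, sub_add_cancel]
  obtain ⟨m, hm⟩ := exists_nat_gt (|t| / ε)
  rw [div_lt_iff₀ hε] at hm
  exact (key m t (by nlinarith) p hxV).of_le (by exact_mod_cast Nat.le_succ k)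

theorem contMDiffAt_flow_right (hf : f ∈ S.smoothSheaf.sec W) (hp : p ∈ S.part W) (t : ℝ) :
    ContMDiffAt 𝓘(ℝ, PhaseSpace n) 𝓘(ℝ, PhaseSpace n) ∞ (S.flow f t) p :=
  (contMDiffAt_flow hf hp t).comp p (contMDiffAt_const.prodMk contMDiffAt_id)

theorem isSymplecticAt_flow (hf : f ∈ S.smoothSheaf.sec W) (hp : p ∈ S.part W) (t : ℝ) :
    IsSymplecticAt S.form S.form (S.flow f t) p := by
  obtain ⟨ε, hε, V, hxV, hVW, -, hs⟩ := exists_flow_contMDiffOn hf hp (S.proj_mem p) 0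
  have hfV := S.smoothSheaf.anti hVW hf
  obtain ⟨m, hm⟩ := exists_nat_gt (|t| / ε)
  have hm0 : (0 : ℝ) < m := lt_of_le_of_lt (by positivity) hm
  rw [div_lt_iff₀ hε] at hm
  have hr : t / m ∈ Ioo (-ε) ε := abs_lt.1 (by
    rw [abs_div, abs_of_pos hm0, div_lt_iff₀ hm0]; linarith)
  have key : ∀ j : ℕ, ∀ q ∈ S.part V, IsSymplecticAt S.form S.form (S.flow f (j * (t / m))) q := by
    intro j
    induction j with
    | zero =>
      intro q hq
      refine (isSymplecticAt_id q).congr (Eventually.of_forall fun q => ?_)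
      simp [flow_zero]
    | succ j ih =>
      intro q hq
      refine ((ih _ (flow_mem_part hfV hq (t / m))).comp (hs q hq _ hr)).congr ?_
      filter_upwards [(S.isOpen_part V).mem_nhds hq] with q' hq'
      show _ = S.flow f (j * (t / m)) (S.flow f (t / m) q')
      rw [← flow_add_time hfV hq']
      congr 1
      push_cast
      ring
  have h := key m p hxV
  rwa [mul_div_cancel₀ _ hm0.ne'] at h

/-- The flow of `f` is symplectic and preserves `g ∘ proj`, hence the Hamiltonian vector field of
`g`. Applied to the flow lines of `g`, at the same time, it gives flow lines of `f + g`. -/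
theorem IsFlowLine.map_flow (hf : f ∈ S.smoothSheaf.sec W) (hg : g ∈ S.smoothSheaf.sec W)
    (hp : p ∈ S.part W) : S.IsFlowLine (f + g) fun t => S.flow f t (S.flow g t p) := by
  have hη := isFlowLine_flow hg hp
  have hm : ∀ t, S.flow g t p ∈ S.part W := flow_mem_part hg hp
  refine ⟨fun t => ?_, fun t => ?_⟩
  · simp only [proj_flow hf (hm _), proj_flow hg hp]
  obtain ⟨w, hw, hwv⟩ := hη.2 t
  obtain ⟨u, hu, huv⟩ := (isFlowLine_flow hf (hm t)).2 t
  have hmf := flow_mem_part hf (hm t) t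
  have hΦ := (contMDiffAt_flow hf (hm t) t).mdifferentiableAt (by simp)
  have hsy := isSymplecticAt_flow hf (hm t) t
  have hd := fun v => hsy.map_ham S.symplectic (K := g ∘ S.proj) (H := g ∘ S.proj)
    (mdifferentiableAt_of_contMDiffOn hg hmf) (by
      filter_upwards [(S.isOpen_part W).mem_nhds (hm t)] with q hq
      simp [proj_flow hf hq]) hwv v
  refine ⟨(u + mfderiv 𝓘(ℝ, PhaseSpace n) 𝓘(ℝ, PhaseSpace n) (S.flow f t) (S.flow g t p) w :
    PhaseSpace n), ?_, fun v => ?_⟩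
  · have h1 : HasMFDerivAt 𝓘(ℝ, ℝ) (𝓘(ℝ, ℝ).prod 𝓘(ℝ, PhaseSpace n))
        (fun s => (s, S.flow g s p)) t
        ((ContinuousLinearMap.id ℝ ℝ).prod ((1 : ℝ →L[ℝ] ℝ).smulRight w)) :=
      (hasMFDerivAt_id t).prodMk hw
    have h2 := hΦ.hasMFDerivAt.comp t h1
    refine h2.congr_mfderiv ?_
    refine ContinuousLinearMap.ext_ring ?_
    have h3 := mfderiv_prod_eq_add_apply hΦ
      (v := (((1 : ℝ), (1 : ℝ) • (w : PhaseSpace n)) : ℝ × PhaseSpace n))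
    have h4 : mfderiv 𝓘(ℝ, ℝ) 𝓘(ℝ, PhaseSpace n) (fun z => S.flow f z (S.flow g t p)) t
        (1 : ℝ) = u := by
      rw [hu.mfderiv]
      exact one_smul ℝ (u : PhaseSpace n)
    refine h3.trans ?_
    refine Eq.trans ?_ (one_smul ℝ (u + mfderiv 𝓘(ℝ, PhaseSpace n) 𝓘(ℝ, PhaseSpace n)
      (S.flow f t) (S.flow g t p) w : PhaseSpace n)).symm
    refine congrArg₂ (fun a b : PhaseSpace n => a + b) h4 ?_
    exact congrArg (mfderiv 𝓘(ℝ, PhaseSpace n) 𝓘(ℝ, PhaseSpace n)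
      (S.flow f t) (S.flow g t p)) (one_smul ℝ (w : PhaseSpace n))
  · have h1 : dAt (n := n) ((f + g) ∘ S.proj) (S.flow f t (S.flow g t p)) v =
        dAt (n := n) (f ∘ S.proj) (S.flow f t (S.flow g t p)) v +
          dAt (n := n) (g ∘ S.proj) (S.flow f t (S.flow g t p)) v := by
      have h2 := mfderiv_add (mdifferentiableAt_of_contMDiffOn hf hmf)
        (mdifferentiableAt_of_contMDiffOn hg hmf)
      exact congrArg (fun L => L v) h2
    have h2 : ∀ a b : PhaseSpace n, bilin (E := PhaseSpace n)
        (S.form (S.flow f t (S.flow g t p))) (a + b) v =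
        bilin (E := PhaseSpace n) (S.form (S.flow f t (S.flow g t p))) a v +
        bilin (E := PhaseSpace n) (S.form (S.flow f t (S.flow g t p))) b v :=
      fun a b => by rw [map_add]; rfl
    exact (h2 _ _).trans ((congrArg₂ (· + ·) (huv v) (hd v)).trans h1.symm)

/-- The flows of functions on the base commute: the flow of a sum is the composition of flows. -/
theorem flow_add (hf : f ∈ S.smoothSheaf.sec W) (hg : g ∈ S.smoothSheaf.sec W) (hp : p ∈ S.part W)
    (t : ℝ) : S.flow (f + g) t p = S.flow f t (S.flow g t p) := by
  have h0 : S.flow f 0 (S.flow g 0 p) = p := by rw [flow_zero, flow_zero]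
  have h := (IsFlowLine.map_flow hf hg hp).eq_flow (add_mem hf hg) (by rw [h0]; exact hp) t
  simpa only [h0] using h.symm

theorem flow_const (hf : f ∈ (constSheaf X).sec W) (hp : p ∈ S.part W) (t : ℝ) :
    S.flow f t p = p := by
  have hsm : f ∈ S.smoothSheaf.sec W := fun q hq => ContMDiffAt.contMDiffWithinAt <|
    (contMDiffAt_const (c := f (S.proj q))).congr_of_eventuallyEq
      (S.continuous_proj.continuousAt.eventually (hf (S.proj q) hq))
  have h : S.IsFlowLine f fun _ => p := by
    refine ⟨fun _ => rfl, fun t => ⟨0, ?_, fun v => ?_⟩⟩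
    · refine (hasMFDerivAt_const (I := 𝓘(ℝ, ℝ)) (I' := 𝓘(ℝ, PhaseSpace n)) p t).congr_mfderiv ?_
      ext
      simp
      rfl
    · have hev : f ∘ S.proj =ᶠ[𝓝 p] fun _ => f (S.proj p) :=
        S.continuous_proj.continuousAt.eventually (hf (S.proj p) hp)
      have h1 : dAt (n := n) (f ∘ S.proj) p = 0 := by
        unfold dAt
        rw [hev.mfderiv_eq]
        exact mfderiv_const
      refine ((S.form p).map_coord_zero 0 rfl).trans ?_
      rw [h1]
      rfl
  exact (h.eq_flow hsm hp t).symm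

theorem flow_neg_flow (hf : f ∈ S.smoothSheaf.sec W) (hp : p ∈ S.part W) (t : ℝ) :
    S.flow (-f) t (S.flow f t p) = p := by
  rw [← flow_add (neg_mem hf) hf hp, neg_add_cancel]
  exact flow_const (zero_mem ((constSheaf X).sec W)) hp t

theorem flow_flow_neg (hf : f ∈ S.smoothSheaf.sec W) (hp : p ∈ S.part W) (t : ℝ) :
    S.flow f t (S.flow (-f) t p) = p := by
  rw [← flow_add hf (neg_mem hf) hp, add_neg_cancel]
  exact flow_const (zero_mem ((constSheaf X).sec W)) hp t

end Flow

end IntegrableSystem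

/-! ### Time one maps, strata and admissible maps -/

namespace IntegrableSystem

variable {n : ℕ} {X : Type u} [TopologicalSpace X] {U : Opens X} {S : IntegrableSystem n U}
  {W : Opens X} {f g : X → ℝ} {p q : S.carrier}

theorem smul_mem_smoothSheaf (c : ℝ) (hf : f ∈ S.smoothSheaf.sec W) :
    c • f ∈ S.smoothSheaf.sec W := by
  have hf' : ContMDiffOn 𝓘(ℝ, PhaseSpace n) 𝓘(ℝ, ℝ) ∞ (f ∘ S.proj) (S.part W) := hf
  have hc : ContMDiffOn 𝓘(ℝ, PhaseSpace n) 𝓘(ℝ, ℝ) ∞ (fun _ : S.carrier => c) (S.part W) :=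
    contMDiffOn_const
  exact hc.smul hf'

theorem isTimeOneMap_iff (hf : f ∈ S.smoothSheaf.sec W) {φ : S.carrier → S.carrier} :
    S.IsTimeOneMap f W φ ↔ ∀ p ∈ S.part W, φ p = S.flow f 1 p := by
  refine forall₂_congr fun p hp => ⟨?_, fun h => ⟨fun t => S.flow f t p, isFlowLine_flow hf hp,
    flow_zero, h.symm⟩⟩
  rintro ⟨γ, hγ, rfl, h1⟩
  rw [← h1, hγ.eq_flow hf hp]

theorem isIntegralAffine_iff : S.IsIntegralAffine W f ↔
    f ∈ S.smoothSheaf.sec W ∧ ∀ p ∈ S.part W, S.flow f 1 p = p :=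
  and_congr_right fun hf => (isTimeOneMap_iff hf).trans
    (forall₂_congr fun _ _ => ⟨Eq.symm, Eq.symm⟩)

/-- Sums of integral affine functions are integral affine, since the flows commute. -/
theorem mem_affineSheaf_iff : f ∈ S.affineSheaf.sec W ↔
    f ∈ S.smoothSheaf.sec W ∧ ∀ p ∈ S.part W, S.flow f 1 p = p := by
  refine ⟨fun h => ?_, fun h => AddSubgroup.subset_closure (isIntegralAffine_iff.2 h)⟩
  induction h using AddSubgroup.closure_induction with
  | mem f hf => exact isIntegralAffine_iff.1 hf
  | zero => exact ⟨zero_mem _, fun p hp => flow_const (zero_mem ((constSheaf X).sec W)) hp 1⟩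
  | add f g _ _ hf hg =>
    exact ⟨add_mem hf.1 hg.1, fun p hp => by rw [flow_add hf.1 hg.1 hp, hg.2 p hp, hf.2 p hp]⟩
  | neg f _ hf =>
    refine ⟨neg_mem hf.1, fun p hp => ?_⟩
    have h := flow_neg_flow hf.1 hp 1
    rwa [hf.2 p hp] at h

theorem affine_le_smooth : S.affineSheaf.sec W ≤ S.smoothSheaf.sec W := fun _ h =>
  (mem_affineSheaf_iff.1 h).1

/-- Two functions have the same time one map if and only if they differ by an integral affine
function. -/
theorem sub_mem_affineSheaf_iff (hf : f ∈ S.smoothSheaf.sec W) (hg : g ∈ S.smoothSheaf.sec W) :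
    f - g ∈ S.affineSheaf.sec W ↔ ∀ p ∈ S.part W, S.flow f 1 p = S.flow g 1 p := by
  rw [mem_affineSheaf_iff]
  refine ⟨fun h p hp => ?_, fun h => ⟨sub_mem hf hg, fun p hp => ?_⟩⟩
  · rw [← sub_add_cancel f g, flow_add h.1 hg hp, h.2 _ (flow_mem_part hg hp 1)]
  · have h1 := h _ (flow_mem_part (neg_mem hg) hp 1)
    rw [flow_flow_neg hg hp] at h1
    rw [sub_eq_add_neg, flow_add hf (neg_mem hg) hp, h1]

theorem IsFlowLine.comp_mul {γ : ℝ → S.carrier} (hγ : S.IsFlowLine f γ)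
    (hf : f ∈ S.smoothSheaf.sec W) (h0 : γ 0 ∈ S.part W) (c : ℝ) :
    S.IsFlowLine (c • f) fun t => γ (c * t) := by
  refine ⟨fun t => by simp only [hγ.1 (c * t), hγ.1 (c * 0)], fun t => ?_⟩
  obtain ⟨w, hw, hv⟩ := hγ.2 (c * t)
  refine ⟨(c • w : PhaseSpace n), ?_, fun v => ?_⟩
  · have h1 : HasMFDerivAt 𝓘(ℝ, ℝ) 𝓘(ℝ, ℝ) (fun r : ℝ => c * r) t
        (c • ContinuousLinearMap.id ℝ ℝ) :=
      ((hasFDerivAt_id (𝕜 := ℝ) t).const_mul c).hasMFDerivAt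
    refine (HasMFDerivAt.comp t (g := γ) (f := fun r : ℝ => c * r) hw h1).congr_mfderiv ?_
    refine ContinuousLinearMap.ext_ring ?_
    have key : ((c * 1 : ℝ) • (w : PhaseSpace n)) = (1 : ℝ) • (c • (w : PhaseSpace n)) := by
      rw [mul_one, one_smul]
    exact key
  · have hm : γ (c * t) ∈ S.part W := by
      show S.proj _ ∈ W
      rw [hγ.1]
      exact h0
    have h1 : dAt (n := n) ((c • f) ∘ S.proj) (γ (c * t)) =
        c • dAt (n := n) (f ∘ S.proj) (γ (c * t)) :=
      const_smul_mfderiv (mdifferentiableAt_of_contMDiffOn hf hm) c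
    rw [h1]
    have h2 : ∀ a : PhaseSpace n, bilin (E := PhaseSpace n) (S.form (γ (c * t))) (c • a) v =
        c • bilin (E := PhaseSpace n) (S.form (γ (c * t))) a v := fun a => by
      rw [map_smul]; rfl
    exact (h2 w).trans (congrArg (c • ·) (hv v))

theorem flow_smul (hf : f ∈ S.smoothSheaf.sec W) (hp : p ∈ S.part W) (c t : ℝ) :
    S.flow (c • f) t p = S.flow f (c * t) p := by
  have h0 : S.flow f (c * 0) p = p := by rw [mul_zero, flow_zero]
  have h := ((isFlowLine_flow hf hp).comp_mul hf (by simpa [flow_zero] using hp) c).eq_flow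
    (smul_mem_smoothSheaf c hf) (by simpa only [h0] using hp) t
  simpa only [h0] using h.symm

theorem mem_stratum_iff : q ∈ S.stratum p ↔
    ∃ W : Opens X, S.proj p ∈ W ∧ ∃ f ∈ S.smoothSheaf.sec W, S.flow f 1 p = q := by
  constructor
  · rintro ⟨W, hp, f, hf, γ, hγ, rfl, rfl⟩
    exact ⟨W, hp, f, hf, (hγ.eq_flow hf hp 1).symm⟩
  · rintro ⟨W, hp, f, hf, rfl⟩
    exact ⟨W, hp, f, hf, _, isFlowLine_flow hf hp, flow_zero, rfl⟩

theorem flow_mem_stratum (hf : f ∈ S.smoothSheaf.sec W) (hp : p ∈ S.part W) (t : ℝ) :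
    S.flow f t p ∈ S.stratum p :=
  mem_stratum_iff.2 ⟨W, hp, t • f, smul_mem_smoothSheaf t hf, by rw [flow_smul hf hp, mul_one]⟩

theorem proj_eq_of_mem_stratum (h : q ∈ S.stratum p) : S.proj q = S.proj p := by
  obtain ⟨W, hp, f, hf, rfl⟩ := mem_stratum_iff.1 h
  exact proj_flow hf hp 1

theorem mem_stratum_self : p ∈ S.stratum p := by
  have h := flow_mem_stratum (p := p) (W := ⊤) (zero_mem (S.smoothSheaf.sec ⊤)) trivial 0
  rwa [flow_zero] at h

theorem mem_stratum_symm (h : q ∈ S.stratum p) : p ∈ S.stratum q := by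
  obtain ⟨W, hp, f, hf, rfl⟩ := mem_stratum_iff.1 h
  refine mem_stratum_iff.2 ⟨W, flow_mem_part hf hp 1, -f, neg_mem hf, flow_neg_flow hf hp 1⟩

theorem mem_stratum_trans {r : S.carrier} (h : q ∈ S.stratum p) (h' : r ∈ S.stratum q) :
    r ∈ S.stratum p := by
  obtain ⟨W, hp, f, hf, rfl⟩ := mem_stratum_iff.1 h
  obtain ⟨W', hp', g, hg, rfl⟩ := mem_stratum_iff.1 h'
  have hp2 : S.proj p ∈ W' := by rw [← proj_flow hf hp 1]; exact hp'
  have hf' := S.smoothSheaf.anti (inf_le_left : W ⊓ W' ≤ W) hf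
  have hg' := S.smoothSheaf.anti (inf_le_right : W ⊓ W' ≤ W') hg
  exact mem_stratum_iff.2 ⟨W ⊓ W', ⟨hp, hp2⟩, g + f, add_mem hg' hf', flow_add hg' hf' ⟨hp, hp2⟩ 1⟩

theorem stratum_eq (h : q ∈ S.stratum p) : S.stratum q = S.stratum p :=
  Set.ext fun _ => ⟨mem_stratum_trans h, mem_stratum_trans (mem_stratum_symm h)⟩

theorem continuousOn_flow (hf : f ∈ S.smoothSheaf.sec W) :
    ContinuousOn (fun z : ℝ × S.carrier => S.flow f z.1 z.2) (univ ×ˢ S.part W) := fun z hz =>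
  (contMDiffAt_flow hf hz.2 z.1).continuousAt.continuousWithinAt

theorem homologyMap_eq_of_homotopy {F : Type u} [TopologicalSpace F] {g h : C(F, F)}
    (H : ContinuousMap.Homotopy g h) : homologyMap g = homologyMap h :=
  TopCat.Homotopy.congr_homologyMap_singularChainComplexFunctor (f := TopCat.ofHom g)
    (g := TopCat.ofHom h) H _ 1

theorem homologyMap_id {F : Type u} [TopologicalSpace F] :
    homologyMap (ContinuousMap.id F) = CategoryTheory.CategoryStruct.id _ := by
  unfold homologyMap
  exact CategoryTheory.Functor.map_id _ _

/-- A map which is a time one map near each fiber is admissible: the flow is a homotopy from the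
identity, inside the strata. -/
theorem isAdmissible_of_local_flow {φ : S.carrier → S.carrier}
    (h : ∀ x ∈ W, x ∈ U → ∃ V : Opens X, x ∈ V ∧ ∃ f ∈ S.smoothSheaf.sec V,
      ∀ p ∈ S.part V, φ p = S.flow f 1 p) : S.IsAdmissible W φ where
  stratum_mem p hp := by
    obtain ⟨V, hxV, f, hf, hφ⟩ := h _ hp (S.proj_mem p)
    rw [hφ p hxV]
    exact flow_mem_stratum hf hxV 1
  loops p hp γ h01 hγ := by
    obtain ⟨V, hxV, f, hf, hφ⟩ := h _ hp (S.proj_mem p)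
    have hγV : ∀ t, γ t ∈ S.part V := fun t => by
      show S.proj _ ∈ V
      rw [proj_eq_of_mem_stratum (hγ t)]
      exact hxV
    refine ⟨⟨fun z => S.flow f z.1 (γ z.2), ?_⟩, fun t => ?_, fun t => ?_, fun s => ?_,
      fun s t => ?_⟩
    · refine (continuousOn_flow hf).comp_continuous (f := fun z : unitInterval × unitInterval =>
        ((z.1 : ℝ), γ z.2)) (by fun_prop) fun z => ⟨mem_univ _, hγV _⟩
    · simp [flow_zero]
    · simp [hφ _ (hγV t)]
    · simp [h01]
    · exact mem_stratum_trans (hγ t) (flow_mem_stratum hf (hγV t) _)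
  homology x hx g hg := by
    by_cases hxU : x ∈ U
    · obtain ⟨V, hxV, f, hf, hφ⟩ := h x hx hxU
      have hV : ∀ p : {p // S.proj p = x}, (p : S.carrier) ∈ S.part V := fun p => by
        show S.proj _ ∈ V
        rw [p.2]
        exact hxV
      let H : ContinuousMap.Homotopy (ContinuousMap.id {p // S.proj p = x}) g :=
        { toFun := fun z => ⟨S.flow f z.1 z.2, by rw [proj_flow hf (hV _), z.2.2]⟩
          continuous_toFun := by
            refine Continuous.subtype_mk ((continuousOn_flow hf).comp_continuous
              (f := fun z : unitInterval × {p // S.proj p = x} => ((z.1 : ℝ), (z.2 : S.carrier)))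
              (by fun_prop) fun z => ⟨mem_univ _, hV _⟩) _
          map_zero_left := fun p => by simp [flow_zero]
          map_one_left := fun p => by
            refine Subtype.ext ?_
            rw [hg, hφ _ (hV p)]
            simp }
      rw [← homologyMap_eq_of_homotopy H, homologyMap_id]
    · have hg' : g = ContinuousMap.id _ := by
        ext p
        exact absurd (p.2 ▸ S.proj_mem p) hxU
      rw [hg', homologyMap_id]

end IntegrableSystem

/-! ### Symplectic equivalences over an open set of the base -/

/-- Mutually inverse fibration-preserving symplectomorphisms between the parts over `W` of two
systems, over the identity of `W`. -/
structure IsSymplecto {n : ℕ} {X : Type u} [TopologicalSpace X] {U U' : Opens X}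
    (S : IntegrableSystem n U) (T : IntegrableSystem n U') (W : Opens X)
    (g : S.carrier → T.carrier) (g' : T.carrier → S.carrier) : Prop where
  proj : ∀ p ∈ S.part W, T.proj (g p) = S.proj p
  proj_inv : ∀ q ∈ T.part W, S.proj (g' q) = T.proj q
  left_inv : ∀ p ∈ S.part W, g' (g p) = p
  right_inv : ∀ q ∈ T.part W, g (g' q) = q
  smooth : ContMDiffOn 𝓘(ℝ, PhaseSpace n) 𝓘(ℝ, PhaseSpace n) ∞ g (S.part W)
  smooth_inv : ContMDiffOn 𝓘(ℝ, PhaseSpace n) 𝓘(ℝ, PhaseSpace n) ∞ g' (T.part W)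
  symplectic : ∀ p ∈ S.part W, IsSymplecticAt S.form T.form g p

namespace IsSymplecto

variable {n : ℕ} {X : Type u} [TopologicalSpace X] {U U' U'' : Opens X}
  {S : IntegrableSystem n U} {T : IntegrableSystem n U'} {R : IntegrableSystem n U''}
  {W : Opens X} {g : S.carrier → T.carrier} {g' : T.carrier → S.carrier}
  {h : T.carrier → R.carrier} {h' : R.carrier → T.carrier}

theorem mapsTo (H : IsSymplecto S T W g g') : MapsTo g (S.part W) (T.part W) := fun p hp => by
  show T.proj _ ∈ W
  rw [H.proj p hp]
  exact hp

theorem mapsTo_inv (H : IsSymplecto S T W g g') : MapsTo g' (T.part W) (S.part W) := fun p hp => by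
  show S.proj _ ∈ W
  rw [H.proj_inv p hp]
  exact hp

theorem injOn (H : IsSymplecto S T W g g') : InjOn g (S.part W) := LeftInvOn.injOn H.left_inv

theorem mono (H : IsSymplecto S T W g g') {V : Opens X} (hV : V ≤ W) : IsSymplecto S T V g g' where
  proj p hp := H.proj p (hV hp)
  proj_inv p hp := H.proj_inv p (hV hp)
  left_inv p hp := H.left_inv p (hV hp)
  right_inv p hp := H.right_inv p (hV hp)
  smooth := H.smooth.mono (preimage_mono hV)
  smooth_inv := H.smooth_inv.mono (preimage_mono hV)
  symplectic p hp := H.symplectic p (hV hp)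

theorem symm (H : IsSymplecto S T W g g') : IsSymplecto T S W g' g where
  proj := H.proj_inv
  proj_inv := H.proj
  left_inv := H.right_inv
  right_inv := H.left_inv
  smooth := H.smooth_inv
  smooth_inv := H.smooth
  symplectic q hq := by
    have hd : MDifferentiableAt 𝓘(ℝ, PhaseSpace n) 𝓘(ℝ, PhaseSpace n) g' q :=
      (H.smooth_inv.contMDiffAt ((T.isOpen_part W).mem_nhds hq)).mdifferentiableAt (by simp)
    have hs := H.symplectic _ (H.mapsTo_inv hq)
    refine ⟨hd, fun a b => (hs.2 _ _).symm.trans ?_⟩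
    have hid : g ∘ g' =ᶠ[𝓝 q] id := by
      filter_upwards [(T.isOpen_part W).mem_nhds hq] with r hr using H.right_inv r hr
    have hc : ∀ a : TangentSpace 𝓘(ℝ, PhaseSpace n) q,
        mfderiv 𝓘(ℝ, PhaseSpace n) 𝓘(ℝ, PhaseSpace n) g (g' q)
          (mfderiv 𝓘(ℝ, PhaseSpace n) 𝓘(ℝ, PhaseSpace n) g' q a) = (a : PhaseSpace n) := fun a => by
      refine (mfderiv_comp_apply q hs.1 hd a).symm.trans ?_
      rw [hid.mfderiv_eq, mfderiv_id]
      rfl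
    have key : ∀ r (u v : PhaseSpace n), r = q → u = a → v = b →
        T.form r ![u, v] = T.form q ![a, b] := by
      rintro _ _ _ rfl rfl rfl
      rfl
    exact key _ _ _ (H.right_inv q hq) (hc a) (hc b)

theorem trans (H : IsSymplecto S T W g g') (K : IsSymplecto T R W h h') :
    IsSymplecto S R W (h ∘ g) (g' ∘ h') where
  proj p hp := (K.proj _ (H.mapsTo hp)).trans (H.proj p hp)
  proj_inv p hp := (H.proj_inv _ (K.mapsTo_inv hp)).trans (K.proj_inv p hp)
  left_inv p hp := by simp [K.left_inv _ (H.mapsTo hp), H.left_inv p hp]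
  right_inv p hp := by simp [H.right_inv _ (K.mapsTo_inv hp), K.right_inv p hp]
  smooth := K.smooth.comp H.smooth H.mapsTo
  smooth_inv := H.smooth_inv.comp K.smooth_inv K.mapsTo_inv
  symplectic p hp := (K.symplectic _ (H.mapsTo hp)).comp (H.symplectic p hp)

/-- To be mutually inverse symplectomorphisms is a local property over the base. -/
theorem of_local (H : ∀ x ∈ W, ∃ (V : Opens X) (k : S.carrier → T.carrier)
    (k' : T.carrier → S.carrier), x ∈ V ∧ IsSymplecto S T V k k' ∧ EqOn g k (S.part V) ∧
      EqOn g' k' (T.part V)) : IsSymplecto S T W g g' where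
  proj p hp := by
    obtain ⟨V, k, k', hx, hk, e, e'⟩ := H _ hp
    rw [e hx, hk.proj p hx]
  proj_inv p hp := by
    obtain ⟨V, k, k', hx, hk, e, e'⟩ := H _ hp
    rw [e' hx, hk.proj_inv p hx]
  left_inv p hp := by
    obtain ⟨V, k, k', hx, hk, e, e'⟩ := H _ hp
    rw [e hx, e' (hk.mapsTo hx), hk.left_inv p hx]
  right_inv p hp := by
    obtain ⟨V, k, k', hx, hk, e, e'⟩ := H _ hp
    rw [e' hx, e (hk.mapsTo_inv hx), hk.right_inv p hx]
  smooth p hp := by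
    obtain ⟨V, k, k', hx, hk, e, e'⟩ := H _ hp
    have hV := (S.isOpen_part V).mem_nhds hx
    exact ((hk.smooth.contMDiffAt hV).congr_of_eventuallyEq
      (e.eventuallyEq_of_mem hV)).contMDiffWithinAt
  smooth_inv p hp := by
    obtain ⟨V, k, k', hx, hk, e, e'⟩ := H _ hp
    have hV := (T.isOpen_part V).mem_nhds hx
    exact ((hk.smooth_inv.contMDiffAt hV).congr_of_eventuallyEq
      (e'.eventuallyEq_of_mem hV)).contMDiffWithinAt
  symplectic p hp := by
    obtain ⟨V, k, k', hx, hk, e, e'⟩ := H _ hp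
    exact (hk.symplectic p hx).congr (e.eventuallyEq_of_mem ((S.isOpen_part V).mem_nhds hx))

theorem congr (H : IsSymplecto S T W g g') {k : S.carrier → T.carrier} {k' : T.carrier → S.carrier}
    (e : EqOn k g (S.part W)) (e' : EqOn k' g' (T.part W)) : IsSymplecto S T W k k' :=
  of_local fun _ hx => ⟨W, g, g', hx, H, e, e'⟩

theorem flow {f : X → ℝ} (hf : f ∈ S.smoothSheaf.sec W) (t : ℝ) :
    IsSymplecto S S W (S.flow f t) (S.flow (-f) t) where
  proj _ hp := IntegrableSystem.proj_flow hf hp t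
  proj_inv _ hp := IntegrableSystem.proj_flow (neg_mem hf) hp t
  left_inv _ hp := IntegrableSystem.flow_neg_flow hf hp t
  right_inv _ hp := IntegrableSystem.flow_flow_neg hf hp t
  smooth _ hp := (IntegrableSystem.contMDiffAt_flow_right hf hp t).contMDiffWithinAt
  smooth_inv _ hp := (IntegrableSystem.contMDiffAt_flow_right (neg_mem hf) hp t).contMDiffWithinAt
  symplectic _ hp := IntegrableSystem.isSymplecticAt_flow hf hp t

theorem smooth_le (H : IsSymplecto S T W g g') : T.smoothSheaf.sec W ≤ S.smoothSheaf.sec W := by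
  intro f hf
  have h1 : ContMDiffOn 𝓘(ℝ, PhaseSpace n) 𝓘(ℝ, ℝ) ∞ ((f ∘ T.proj) ∘ g) (S.part W) :=
    ContMDiffOn.comp (t := T.part W) hf H.smooth H.mapsTo
  refine ContMDiffOn.congr h1 fun p hp => ?_
  simp [H.proj p hp]

theorem smooth_eq (H : IsSymplecto S T W g g') : T.smoothSheaf.sec W = S.smoothSheaf.sec W :=
  le_antisymm H.smooth_le H.symm.smooth_le

/-- Symplectic equivalences intertwine the flows of functions on the base. -/
theorem map_flow (H : IsSymplecto S T W g g') {f : X → ℝ} (hf : f ∈ T.smoothSheaf.sec W)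
    {p : S.carrier} (hp : p ∈ S.part W) (t : ℝ) : g (S.flow f t p) = T.flow f t (g p) := by
  have hfS := H.smooth_le hf
  have hfl := IntegrableSystem.isFlowLine_flow hfS hp
  have hm := IntegrableSystem.flow_mem_part hfS hp
  have h : T.IsFlowLine f fun t => g (S.flow f t p) := by
    refine ⟨fun t => ?_, fun t => ?_⟩
    · rw [H.proj _ (hm t), H.proj _ (hm 0)]
      exact hfl.1 t
    · exact IsHamCurveAt.comp_symplectic (γ := fun t => S.flow f t p) S.symplectic
        (H.symplectic _ (hm t))
        (IntegrableSystem.mdifferentiableAt_of_contMDiffOn hf (H.mapsTo (hm t))) (by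
          filter_upwards [(S.isOpen_part W).mem_nhds (hm t)] with q hq
          simp [H.proj q hq]) (hfl.2 t)
  have h2 := h.eq_flow hf (H.mapsTo (hm 0)) t
  simpa only [IntegrableSystem.flow_zero] using h2

theorem affine_le (H : IsSymplecto S T W g g') : T.affineSheaf.sec W ≤ S.affineSheaf.sec W := by
  intro f hf
  obtain ⟨hf, hf1⟩ := IntegrableSystem.mem_affineSheaf_iff.1 hf
  have hfS := H.smooth_le hf
  refine IntegrableSystem.mem_affineSheaf_iff.2 ⟨hfS, fun p hp => ?_⟩
  rw [← H.left_inv _ (IntegrableSystem.flow_mem_part hfS hp 1), H.map_flow hf hp,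
    hf1 _ (H.mapsTo hp), H.left_inv p hp]

theorem affine_eq (H : IsSymplecto S T W g g') : T.affineSheaf.sec W = S.affineSheaf.sec W :=
  le_antisymm H.affine_le H.symm.affine_le

/-- The homeomorphism between the parts over `W`. -/
def toOpenPartialHomeomorph (H : IsSymplecto S T W g g') :
    OpenPartialHomeomorph S.carrier T.carrier where
  toFun := g
  invFun := g'
  source := S.part W
  target := T.part W
  map_source' := H.mapsTo
  map_target' := H.mapsTo_inv
  left_inv' := H.left_inv
  right_inv' := H.right_inv
  open_source := S.isOpen_part W
  open_target := T.isOpen_part W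
  continuousOn_toFun := H.smooth.continuousOn
  continuousOn_invFun := H.smooth_inv.continuousOn

/-- Under the hypothesis on symplectomorphisms, one which preserves the strata is a time one map
near each fiber. -/
theorem exists_flow {k k' : S.carrier → S.carrier} (H : IsSymplecto S S W k k')
    (hS : S.SymplectomorphismHyp) (hst : ∀ p ∈ S.part W, k p ∈ S.stratum p) {x : X} (hx : x ∈ W)
    (hxU : x ∈ U) :
    ∃ V : Opens X, x ∈ V ∧ V ≤ W ∧ ∃ f ∈ S.smoothSheaf.sec V,
      ∀ p ∈ S.part V, k p = S.flow f 1 p := by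
  have H' := H.mono (inf_le_left : W ⊓ U ≤ W)
  obtain ⟨V, hxV, hV, f, hf, hφ⟩ := hS (W ⊓ U) inf_le_right H'.toOpenPartialHomeomorph rfl rfl
    H'.smooth H'.smooth_inv (fun p hp => (H'.symplectic p hp).2) (fun p hp => hst p hp.1) x
    ⟨hx, hxU⟩
  exact ⟨V, hxV, hV.trans inf_le_left, f, hf, (IntegrableSystem.isTimeOneMap_iff hf).1 hφ⟩

end IsSymplecto

namespace RoughEquiv

variable {n : ℕ} {X : Type u} [TopologicalSpace X] {U U' V : Opens X}
  {S : IntegrableSystem n U} {T : IntegrableSystem n U'}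

theorem isSymplecto (Φ : RoughEquiv S T V) {x : X} (hx : x ∈ V) :
    IsSymplecto S T (Φ.nbhd x) (Φ.map x) (Φ.map x).symm where
  proj p hp := Φ.proj_map x hx p (by rwa [Φ.source x hx])
  proj_inv q hq := by
    have hq' : q ∈ (Φ.map x).target := by rwa [Φ.target x hx]
    rw [← Φ.proj_map x hx _ ((Φ.map x).map_target hq'), (Φ.map x).right_inv hq']
  left_inv p hp := (Φ.map x).left_inv (by rwa [Φ.source x hx])
  right_inv p hp := (Φ.map x).right_inv (by rwa [Φ.target x hx])
  smooth := by
    have h := Φ.smooth x hx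
    rwa [Φ.source x hx] at h
  smooth_inv := by
    have h := Φ.smooth_symm x hx
    rwa [Φ.target x hx] at h
  symplectic p hp := by
    have h := Φ.smooth x hx
    rw [Φ.source x hx] at h
    exact ⟨(h.contMDiffAt ((S.isOpen_part _).mem_nhds hp)).mdifferentiableAt (by simp),
      Φ.symplectic x hx p (by rwa [Φ.source x hx])⟩

/-- A rough equivalence from a family of symplectic equivalences over the members of a covering. -/
def ofIsSymplecto (N : X → Opens X) (hN : IsPointCover V N) (g : X → S.carrier → T.carrier)
    (g' : X → T.carrier → S.carrier) (H : ∀ x ∈ V, IsSymplecto S T (N x) (g x) (g' x))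
    (hadm : ∀ x ∈ V, ∀ y ∈ V, S.IsAdmissible (N x ⊓ N y) (g' x ∘ g y)) : RoughEquiv S T V :=
  have H' : ∀ x, IsSymplecto S T (⨆ _ : x ∈ V, N x) (g x) (g' x) := fun x =>
    IsSymplecto.of_local fun y hy => by
      obtain ⟨hx, hy⟩ := Opens.mem_iSup.1 hy
      exact ⟨N x, g x, g' x, hy, H x hx, fun _ _ => rfl, fun _ _ => rfl⟩
  { nbhd := N
    cover := hN
    map := fun x => (H' x).toOpenPartialHomeomorph
    source := fun x hx => by
      show S.part _ = _
      rw [iSup_pos hx]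
    target := fun x hx => by
      show T.part _ = _
      rw [iSup_pos hx]
    proj_map := fun x _ => (H' x).proj
    smooth := fun x _ => (H' x).smooth
    smooth_symm := fun x _ => (H' x).smooth_inv
    symplectic := fun x _ p hp => ((H' x).symplectic p hp).2
    admissible := hadm }

end RoughEquiv

/-! ### Refinement of coverings -/

/-- A relation between the indices of a covering of a paracompact space which holds locally on the
overlaps, and can be composed through a third index, holds on the overlaps of a refinement.
If `W` is a shrinking of a locally finite refinement of the covering, then the new neighbourhood of
`x` is to be inside some `W j`, to miss the closures of those `W j` which do not contain `x`, and to
be small with respect to the others: two members that meet can then be compared through `j`. -/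
theorem exists_refinement {X : Type u} [TopologicalSpace X] [T2Space X] {U : Opens X}
    (hU : ParacompactSpace U) {N : X → Opens X} (hN : IsPointCover U N)
    (Good : X → X → Opens X → Prop)
    (hmono : ∀ x y V V', V ≤ V' → Good x y V' → Good x y V) (hbot : ∀ x y, Good x y ⊥)
    (hloc : ∀ x ∈ U, ∀ y ∈ U, ∀ z ∈ N x ⊓ N y, ∃ V : Opens X, z ∈ V ∧ Good x y V)
    (htrans : ∀ x ∈ U, ∀ y ∈ U, ∀ j ∈ U, ∀ V, V ≤ N x → V ≤ N y → V ≤ N j → Good x j V →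
      Good y j V → Good x y V) :
    ∃ N', IsPointCover U N' ∧ (∀ x, N' x ≤ N x) ∧ ∀ x ∈ U, ∀ y ∈ U, Good x y (N' x ⊓ N' y) := by
  classical
  obtain ⟨v, hvo, hvu, hvf, hvN⟩ := precise_refinement (X := U)
    (fun j : U => Subtype.val ⁻¹' (N j : Set X))
    (fun j => (N j).isOpen.preimage continuous_subtype_val)
    (eq_univ_of_forall fun x => mem_iUnion.2 ⟨x, (hN x x.2).1⟩)
  obtain ⟨w, hwu, hwo, hwv⟩ := exists_iUnion_eq_closure_subset hvo
    (fun x => hvf.point_finite x) hvu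
  have hwf : LocallyFinite fun j => closure (w j) := hvf.subset hwv
  have hV : ∀ x j : U, ∃ V : Opens X, x ∈ closure (w j) → x.1 ∈ V ∧ Good x j V ∧ V ≤ N j := by
    intro x j
    by_cases h : x ∈ closure (w j)
    · have hxj : x.1 ∈ N j := hvN j (hwv j h)
      obtain ⟨V, hxV, hV⟩ := hloc x x.2 j j.2 x ⟨(hN x x.2).1, hxj⟩
      exact ⟨V ⊓ N j, fun _ => ⟨⟨hxV, hxj⟩, hmono _ _ _ _ inf_le_left hV, inf_le_right⟩⟩
    · exact ⟨⊤, fun h' => absurd h' h⟩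
  choose V hV using hV
  choose i hi using fun x : U => mem_iUnion.1 (hwu ▸ mem_univ x)
  have hN' : ∀ x : U, ∃ N' : Opens X, x.1 ∈ N' ∧ N' ≤ N x ∧
      (∀ y : U, y.1 ∈ N' → y ∈ w (i x)) ∧
      (∀ j, x ∈ closure (w j) → N' ≤ V x j) ∧
        ∀ y : U, y.1 ∈ N' → ∀ j, y ∈ w j → x ∈ closure (w j) := by
    intro x
    have hfin := hwf.point_finite x
    set T : Set U := ⋃ j ∈ {j | x ∉ closure (w j)}, closure (w j)
    have hT : IsClosed T := by
      have h := LocallyFinite.isClosed_iUnion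
        (f := fun j : {j | x ∉ closure (w j)} => closure (w j))
        (hwf.comp_injective Subtype.val_injective) fun _ => isClosed_closure
      rwa [iUnion_coe_set] at h
    obtain ⟨O, hO, hOe⟩ := isOpen_induced_iff.1 ((hwo (i x)).inter hT.isOpen_compl)
    have hxT : x ∉ T := by simp [T]
    let A : Opens X := ⟨O ∩ ⋂ j ∈ {j | x ∈ closure (w j)}, (V x j : Set X),
      hO.inter (hfin.isOpen_biInter fun j _ => (V x j).isOpen)⟩
    have hOy : ∀ y : U, y.1 ∈ O → y ∈ w (i x) ∩ Tᶜ := fun y hy => by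
      rw [← hOe]; exact hy
    have hxO : x.1 ∈ O := by
      have h : x ∈ w (i x) ∩ Tᶜ := ⟨hi x, hxT⟩
      rw [← hOe] at h
      exact h
    refine ⟨A ⊓ N x, ⟨⟨hxO, mem_iInter₂.2 fun j hj => (hV x j hj).1⟩, (hN x x.2).1⟩, inf_le_right,
      fun y hy => (hOy y hy.1.1).1, fun j hj z hz => mem_iInter₂.1 hz.1.2 j hj, fun y hy j hj => ?_⟩
    by_contra hx
    exact (hOy y hy.1.1).2 (mem_iUnion₂.2 ⟨j, hx, subset_closure hj⟩)
  choose N' hxN' hN'N hN'w hN'V hN'c using hN'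
  refine ⟨fun x => if hx : x ∈ U then N' ⟨x, hx⟩ else ⊥, fun x hx => ?_, fun x => ?_,
    fun x hx y hy => ?_⟩
  · simp only [dif_pos hx]
    exact ⟨hxN' ⟨x, hx⟩, (hN'N ⟨x, hx⟩).trans (hN x hx).2⟩
  · by_cases hx : x ∈ U
    · simp only [dif_pos hx]
      exact hN'N ⟨x, hx⟩
    · simp [dif_neg hx]
  · simp only [dif_pos hx, dif_pos hy]
    rcases eq_or_ne (N' ⟨x, hx⟩ ⊓ N' ⟨y, hy⟩) ⊥ with he | he
    · rw [he]
      exact hbot x y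
    · obtain ⟨z, hz⟩ : ∃ z, z ∈ N' ⟨x, hx⟩ ⊓ N' ⟨y, hy⟩ := by
        by_contra h
        push Not at h
        exact he (Opens.ext (eq_empty_of_forall_notMem h))
      have hzU : z ∈ U := (hN x hx).2 (hN'N ⟨x, hx⟩ hz.1)
      set j := i ⟨x, hx⟩
      have hxj : (⟨x, hx⟩ : U) ∈ closure (w j) := subset_closure (hi _)
      have hyj : (⟨y, hy⟩ : U) ∈ closure (w j) :=
        hN'c ⟨y, hy⟩ ⟨z, hzU⟩ hz.2 j (hN'w ⟨x, hx⟩ ⟨z, hzU⟩ hz.1)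
      refine htrans x hx y hy j j.2 _ (inf_le_left.trans (hN'N _)) (inf_le_right.trans (hN'N _))
        ?_ ?_ ?_
      · exact inf_le_left.trans ((hN'V _ j hxj).trans (hV _ j hxj).2.2)
      · exact hmono _ _ _ _ (inf_le_left.trans (hN'V _ j hxj)) (hV _ j hxj).2.1
      · exact hmono _ _ _ _ (inf_le_right.trans (hN'V _ j hyj)) (hV _ j hyj).2.1

section Cech

variable {X : Type u} [TopologicalSpace X] {A B A' B' : FunPresheaf X} {U V : Opens X}

theorem CechH1.mk_surjective : Function.Surjective (CechH1.mk A B U) :=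
  QuotientAddGroup.mk'_surjective _

theorem CechH1.mk_eq_iff {a b : cechZ1 A B U} :
    CechH1.mk A B U a = CechH1.mk A B U b ↔ (a : X → X → X → ℝ) - b ∈ cechB1 A B U := by
  rw [← sub_eq_zero, ← map_sub]
  exact QuotientAddGroup.eq_zero_iff _

end Cech

/-! ### Lagrangian classes -/

namespace IntegrableSystem

variable {n : ℕ} {X : Type u} [TopologicalSpace X] {U U' U'' : Opens X}

/-- Over `V`, the map `h` is `g` composed with the time one map of the smooth function `a`. -/
def FlowRel (S : IntegrableSystem n U) {M : Type*} (V : Opens X) (g h : S.carrier → M)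
    (a : X → ℝ) : Prop :=
  a ∈ S.smoothSheaf.sec V ∧ ∀ p ∈ S.part V, h p = g (S.flow a 1 p)

namespace FlowRel

variable {S : IntegrableSystem n U} {T : IntegrableSystem n U'} {M : Type*} {V V' : Opens X}
  {g h k : S.carrier → M} {a b : X → ℝ}

theorem mono (H : S.FlowRel V g h a) (hV : V' ≤ V) : S.FlowRel V' g h a :=
  ⟨S.smoothSheaf.anti hV H.1, fun p hp => H.2 p (hV hp)⟩

theorem trans (H : S.FlowRel V g h a) (K : S.FlowRel V h k b) : S.FlowRel V g k (a + b) :=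
  ⟨add_mem H.1 K.1, fun p hp => by
    rw [K.2 p hp, H.2 _ (flow_mem_part K.1 hp 1), flow_add H.1 K.1 hp]⟩

theorem symm (H : S.FlowRel V g h a) : S.FlowRel V h g (-a) :=
  ⟨neg_mem H.1, fun p hp => by
    rw [H.2 _ (flow_mem_part (neg_mem H.1) hp 1), flow_flow_neg H.1 hp]⟩

theorem sub_mem_affine (H : S.FlowRel V g h a) (K : S.FlowRel V g h b)
    (hg : InjOn g (S.part V)) : a - b ∈ S.affineSheaf.sec V :=
  (sub_mem_affineSheaf_iff H.1 K.1).2 fun p hp =>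
    hg (flow_mem_part H.1 hp 1) (flow_mem_part K.1 hp 1) ((H.2 p hp).symm.trans (K.2 p hp))

theorem comp {l : X → ℝ} {ψ ψ' : S.carrier → T.carrier} {ψi : T.carrier → S.carrier}
    {θ θ' : T.carrier → M} (hψ : IsSymplecto S T V ψ ψi) (H : S.FlowRel V ψ ψ' a)
    (K : T.FlowRel V θ θ' l) : S.FlowRel V (θ ∘ ψ) (θ' ∘ ψ') (l + a) := by
  have hl := hψ.smooth_le K.1
  refine ⟨add_mem hl H.1, fun p hp => ?_⟩
  have hm := flow_mem_part H.1 hp 1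
  show θ' (ψ' p) = θ (ψ _)
  rw [H.2 p hp, K.2 _ (hψ.mapsTo hm), flow_add hl H.1 hp, hψ.map_flow K.1 hm]

theorem bot (hM : S.part ⊥ = ∅) : S.FlowRel ⊥ g h 0 :=
  ⟨zero_mem _, fun p hp => by rw [hM] at hp; exact hp.elim⟩

theorem iff_inv {φ ψ : S.carrier → T.carrier} {φi ψi : T.carrier → S.carrier}
    (hφ : IsSymplecto S T V φ φi) (hψ : IsSymplecto S T V ψ ψi)
    (ha : a ∈ S.smoothSheaf.sec V) :
    S.FlowRel V φ ψ a ↔ ∀ p ∈ S.part V, (φi ∘ ψ) p = S.flow a 1 p := by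
  refine ⟨fun H p hp => ?_, fun H => ⟨ha, fun p hp => ?_⟩⟩
  · show φi (ψ p) = _
    rw [H.2 p hp, hφ.left_inv _ (flow_mem_part ha hp 1)]
  · rw [← H p hp]
    exact (hφ.right_inv _ (hψ.mapsTo hp)).symm

/-- Under the hypothesis on symplectomorphisms, two symplectic equivalences whose comparison
preserves the strata differ by time one maps near each fiber. -/
theorem exists_of_stratum {φ ψ : S.carrier → T.carrier} {φi ψi : T.carrier → S.carrier}
    (hS : S.SymplectomorphismHyp) (hφ : IsSymplecto S T V φ φi) (hψ : IsSymplecto S T V ψ ψi)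
    (hst : ∀ p ∈ S.part V, (φi ∘ ψ) p ∈ S.stratum p) {x : X} (hx : x ∈ V) (hxU : x ∈ U) :
    ∃ V' : Opens X, x ∈ V' ∧ V' ≤ V ∧ ∃ a, S.FlowRel V' φ ψ a := by
  obtain ⟨V', hxV', hV', f, hf, hfl⟩ := (hψ.trans hφ.symm).exists_flow hS hst hx hxU
  exact ⟨V', hxV', hV', f, (iff_inv (hφ.mono hV') (hψ.mono hV') hf).2 hfl⟩

end FlowRel

/-- Symplectic equivalences over the members of a covering, which differ by time one maps near each
fiber, define a cocycle. -/
theorem exists_cocycle [T2Space X] {S : IntegrableSystem n U} {T : IntegrableSystem n U'}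
    {V : Opens X} (hV : ParacompactSpace V) {N : X → Opens X} (hN : IsPointCover V N)
    {g : X → S.carrier → T.carrier} {g' : X → T.carrier → S.carrier}
    (hg : ∀ x ∈ V, IsSymplecto S T (N x) (g x) (g' x))
    (hloc : ∀ x ∈ V, ∀ y ∈ V, ∀ z ∈ N x ⊓ N y, ∃ V' : Opens X, z ∈ V' ∧
      ∃ a, S.FlowRel V' (g x) (g y) a) :
    ∃ N', IsPointCover V N' ∧ (∀ x, N' x ≤ N x) ∧ ∃ a : cechZ1 S.smoothSheaf S.affineSheaf V,
      ∀ x ∈ V, ∀ y ∈ V, S.FlowRel (N' x ⊓ N' y) (g x) (g y) ((a : X → X → X → ℝ) x y) := by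
  have hbot : S.part ⊥ = ∅ := by simp [part]
  obtain ⟨N', hN', hN'N, hgood⟩ := exists_refinement hV hN
    (fun x y V => ∃ a, S.FlowRel V (g x) (g y) a)
    (fun x y V V' hVV' ⟨a, ha⟩ => ⟨a, ha.mono hVV'⟩) (fun x y => ⟨0, FlowRel.bot hbot⟩) hloc
    (fun x _ y _ j _ V _ _ _ ⟨a, ha⟩ ⟨b, hb⟩ => ⟨a + -b, ha.trans hb.symm⟩)
  choose! a ha using hgood
  refine ⟨N', hN', hN'N, ⟨a, N', hN', fun x hx y hy => (ha x hx y hy).1,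
    fun x hx y hy z hz => ?_⟩, ha⟩
  have h1 := (ha x hx y hy).mono (V' := N' x ⊓ N' y ⊓ N' z) inf_le_left
  have h2 := (ha y hy z hz).mono (V' := N' x ⊓ N' y ⊓ N' z) (inf_le_inf_right _ inf_le_right)
  have h3 := (ha x hx z hz).mono (V' := N' x ⊓ N' y ⊓ N' z) (inf_le_inf_right _ inf_le_left)
  have h4 := (h1.trans h2).sub_mem_affine h3 (((hg x hx).mono
    ((inf_le_left.trans inf_le_left).trans (hN'N x))).injOn)
  have e : cechD1 X a x y z = a x y + a y z - a x z := by
    show a y z - a x z + a x y = _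
    ring
  rw [e]
  exact h4

end IntegrableSystem

open IntegrableSystem

namespace RoughEquiv

variable {n : ℕ} {X : Type u} [TopologicalSpace X] {U U' V : Opens X}
  {S : IntegrableSystem n U} {T : IntegrableSystem n U'}

theorem isLagrangianClass_iff (Φ : RoughEquiv S T V) (c : S.H1ZmodR V) :
    Φ.IsLagrangianClass c ↔ ∃ N, IsPointCover V N ∧ (∀ x ∈ V, N x ≤ Φ.nbhd x) ∧
      ∃ a : cechZ1 S.smoothSheaf S.affineSheaf V, c = CechH1.mk _ _ _ a ∧
        ∀ x ∈ V, ∀ y ∈ V,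
          S.FlowRel (N x ⊓ N y) (Φ.map x) (Φ.map y) ((a : X → X → X → ℝ) x y) := by
  refine exists_congr fun N => and_congr_right fun _ => and_congr_right fun hNΦ =>
    exists_congr fun a => and_congr_right fun _ => forall₄_congr fun x hx y hy => ?_
  have h1 := (Φ.isSymplecto hx).mono ((inf_le_left : N x ⊓ N y ≤ N x).trans (hNΦ x hx))
  have h2 := (Φ.isSymplecto hy).mono ((inf_le_right : N x ⊓ N y ≤ N y).trans (hNΦ y hy))
  constructor
  · rintro ⟨ha, h⟩
    exact (FlowRel.iff_inv h1 h2 ha).2 ((isTimeOneMap_iff ha).1 h)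
  · intro h
    exact ⟨h.1, (isTimeOneMap_iff h.1).2 ((FlowRel.iff_inv h1 h2 h.1).1 h)⟩

theorem exists_isLagrangianClass [T2Space X] (Φ : RoughEquiv S T V) (hV : ParacompactSpace V)
    (hVU : V ≤ U) (hS : S.SymplectomorphismHyp) : ∃ c, Φ.IsLagrangianClass c := by
  obtain ⟨N, hN, hNΦ, a, ha⟩ := exists_cocycle hV Φ.cover (g := fun x => Φ.map x)
    (g' := fun x => (Φ.map x).symm) (fun x hx => Φ.isSymplecto hx) fun x hx y hy z hz => by
      obtain ⟨V', hzV', -, a, ha⟩ := FlowRel.exists_of_stratum hS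
        ((Φ.isSymplecto hx).mono inf_le_left) ((Φ.isSymplecto hy).mono inf_le_right)
        (Φ.admissible x hx y hy).stratum_mem hz (hVU ((Φ.cover x hx).2 hz.1))
      exact ⟨V', hzV', a, ha⟩
  exact ⟨_, (Φ.isLagrangianClass_iff _).2 ⟨N, hN, fun x _ => hNΦ x, a, rfl, ha⟩⟩

theorem IsLagrangianClass.unique {Φ : RoughEquiv S T V} {c c' : S.H1ZmodR V}
    (h : Φ.IsLagrangianClass c) (h' : Φ.IsLagrangianClass c') : c = c' := by
  obtain ⟨N, hN, hNΦ, a, rfl, ha⟩ := (Φ.isLagrangianClass_iff _).1 h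
  obtain ⟨N', hN', hNΦ', a', rfl, ha'⟩ := (Φ.isLagrangianClass_iff _).1 h'
  refine CechH1.mk_eq_iff.2 ⟨_, hN.inf hN' le_rfl, 0, fun x _ => zero_mem _, fun x hx y hy => ?_⟩
  rw [map_zero, sub_zero]
  refine ((ha x hx y hy).mono (inf_le_inf inf_le_left inf_le_left)).sub_mem_affine
    ((ha' x hx y hy).mono (inf_le_inf inf_le_right inf_le_right)) ?_
  exact ((Φ.isSymplecto hx).mono
    ((inf_le_left.trans inf_le_left).trans (hNΦ x hx))).injOn

end RoughEquiv

section Glue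

variable {n : ℕ} {X : Type u} [TopologicalSpace X] {O₁ O₂ : Opens X}
  {S₁ : IntegrableSystem n O₁} {S₂ : IntegrableSystem n O₂} {S₀ : IntegrableSystem n (O₁ ⊓ O₂)}

/-- If `Θ₁ Ψ₁` and `Θ₂ Ψ₂` differ by the time one maps of functions `c x`, then `μ₂ - μ₁` differs by
the coboundary of `c` from the difference of the Lagrangian classes of `Θ₁` and `Θ₂`. -/
theorem sub_mem_sumOfImages [T2Space X] {Ψ₁ : RoughEquiv S₀ S₁ (O₁ ⊓ O₂)}
    {Ψ₂ : RoughEquiv S₀ S₂ (O₁ ⊓ O₂)} {U : Opens X} {S : IntegrableSystem n U}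
    (Θ₁ : RoughEquiv S₁ S O₁) (Θ₂ : RoughEquiv S₂ S O₂)
    (h₁ : S₁.SymplectomorphismHyp) (h₂ : S₂.SymplectomorphismHyp)
    (hc : ∀ x ∈ O₁ ⊓ O₂, ∃ W : Opens X, x ∈ W ∧
      W ≤ Ψ₁.nbhd x ⊓ Ψ₂.nbhd x ⊓ (Θ₁.nbhd x ⊓ Θ₂.nbhd x) ∧
      ∃ c, S₀.FlowRel W (Θ₂.map x ∘ Ψ₂.map x) (Θ₁.map x ∘ Ψ₁.map x) c)
    {μ₁ μ₂ : S₀.H1ZmodR (O₁ ⊓ O₂)} (hμ₁ : Ψ₁.IsLagrangianClass μ₁)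
    (hμ₂ : Ψ₂.IsLagrangianClass μ₂) : μ₂ - μ₁ ∈ sumOfImages Ψ₁ Ψ₂ := by
  obtain ⟨ν₁, hν₁⟩ := Θ₁.exists_isLagrangianClass S₁.paracompact le_rfl h₁
  obtain ⟨ν₂, hν₂⟩ := Θ₂.exists_isLagrangianClass S₂.paracompact le_rfl h₂
  obtain ⟨N₁, hN₁, hNΨ₁, a₁, rfl, ha₁⟩ := (Ψ₁.isLagrangianClass_iff _).1 hμ₁
  obtain ⟨N₂, hN₂, hNΨ₂, a₂, rfl, ha₂⟩ := (Ψ₂.isLagrangianClass_iff _).1 hμ₂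
  obtain ⟨M₁, hM₁, hMΘ₁, l₁, rfl, hl₁⟩ := (Θ₁.isLagrangianClass_iff _).1 hν₁
  obtain ⟨M₂, hM₂, hMΘ₂, l₂, rfl, hl₂⟩ := (Θ₂.isLagrangianClass_iff _).1 hν₂
  choose! W hxW hW c hc using hc
  refine AddSubgroup.mem_sup.2 ⟨_, ⟨CechH1.mk _ _ _ l₁, rfl⟩, _, ⟨-CechH1.mk _ _ _ l₂, rfl⟩, ?_⟩
  have e₁ : Ψ₁.resZmodR inf_le_left (CechH1.mk _ _ _ l₁) = CechH1.mk _ _ _ ⟨l₁, _⟩ := rfl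
  have e₂ : Ψ₂.resZmodR inf_le_right (CechH1.mk _ _ _ l₂) = CechH1.mk _ _ _ ⟨l₂, _⟩ := rfl
  rw [map_neg, e₁, e₂, ← sub_eq_add_neg, ← map_sub, ← map_sub, CechH1.mk_eq_iff]
  refine ⟨fun x => N₁ x ⊓ N₂ x ⊓ (M₁ x ⊓ M₂ x) ⊓ W x, fun x hx =>
    ⟨⟨⟨⟨(hN₁ x hx).1, (hN₂ x hx).1⟩, (hM₁ x hx.1).1, (hM₂ x hx.2).1⟩, hxW x hx⟩,
      (inf_le_left.trans inf_le_left).trans (inf_le_left.trans (hN₁ x hx).2)⟩, c, fun x hx =>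
    ((hc x hx).mono inf_le_right).1, fun x hx y hy => ?_⟩
  set V := N₁ x ⊓ N₂ x ⊓ (M₁ x ⊓ M₂ x) ⊓ W x ⊓ (N₁ y ⊓ N₂ y ⊓ (M₁ y ⊓ M₂ y) ⊓ W y) with hV
  have i1 : V ≤ N₁ x ⊓ N₁ y := fun z hz => ⟨hz.1.1.1.1, hz.2.1.1.1⟩
  have i2 : V ≤ N₂ x ⊓ N₂ y := fun z hz => ⟨hz.1.1.1.2, hz.2.1.1.2⟩
  have i3 : V ≤ M₁ x ⊓ M₁ y := fun z hz => ⟨hz.1.1.2.1, hz.2.1.2.1⟩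
  have i4 : V ≤ M₂ x ⊓ M₂ y := fun z hz => ⟨hz.1.1.2.2, hz.2.1.2.2⟩
  have i5 : V ≤ W x := fun z hz => hz.1.2
  have i6 : V ≤ W y := fun z hz => hz.2.2
  have s1 := (Ψ₁.isSymplecto hx).mono ((i1.trans inf_le_left).trans (hNΨ₁ x hx))
  have s2 := (Ψ₂.isSymplecto hx).mono ((i2.trans inf_le_left).trans (hNΨ₂ x hx))
  have s4 := (Θ₂.isSymplecto hx.2).mono ((i4.trans inf_le_left).trans (hMΘ₂ x hx.2))
  have r1 := FlowRel.comp s1 ((ha₁ x hx y hy).mono i1) ((hl₁ x hx.1 y hy.1).mono i3)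
  have r2 := FlowRel.comp s2 ((ha₂ x hx y hy).mono i2) ((hl₂ x hx.2 y hy.2).mono i4)
  have r3 := ((hc x hx).mono i5).trans r1
  have r4 := r2.trans ((hc y hy).mono i6)
  have h := r3.sub_mem_affine r4 (s2.trans s4).injOn
  have key : ∀ a₁ a₂ l₁ l₂ : X → X → X → ℝ, (l₁ - l₂ - (a₂ - a₁) - cechD0 X c) x y =
      c x + (l₁ x y + a₁ x y) - (l₂ x y + a₂ x y + c y) := by
    intro a₁ a₂ l₁ l₂
    show l₁ x y - l₂ x y - (a₂ x y - a₁ x y) - (c y - c x) = _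
    ring
  refine (congrArg (· ∈ S₀.affineSheaf.sec V) (key a₁ a₂ l₁ l₂)).mpr h

theorem Glues.mem_sumOfImages [T2Space X] {Ψ₁ : RoughEquiv S₀ S₁ (O₁ ⊓ O₂)}
    {Ψ₂ : RoughEquiv S₀ S₂ (O₁ ⊓ O₂)} (h : Glues Ψ₁ Ψ₂)
    (h₁ : S₁.SymplectomorphismHyp) (h₂ : S₂.SymplectomorphismHyp) (h₀ : S₀.SymplectomorphismHyp)
    {μ₁ μ₂ : S₀.H1ZmodR (O₁ ⊓ O₂)} (hμ₁ : Ψ₁.IsLagrangianClass μ₁)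
    (hμ₂ : Ψ₂.IsLagrangianClass μ₂) : μ₂ - μ₁ ∈ sumOfImages Ψ₁ Ψ₂ := by
  obtain ⟨S, Θ₁, Θ₂, hΘ⟩ := h
  refine sub_mem_sumOfImages Θ₁ Θ₂ h₁ h₂ (fun x hx => ?_) hμ₁ hμ₂
  obtain ⟨W, hxW, hW, hadm⟩ := hΘ x hx
  have i1 : W ≤ Ψ₁.nbhd x := fun z hz => (hW hz).1.1
  have i2 : W ≤ Ψ₂.nbhd x := fun z hz => (hW hz).1.2
  have i3 : W ≤ Θ₁.nbhd x := fun z hz => (hW hz).2.1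
  have i4 : W ≤ Θ₂.nbhd x := fun z hz => (hW hz).2.2
  obtain ⟨V, hxV, hV, c, hc⟩ := FlowRel.exists_of_stratum h₀
    (((Ψ₂.isSymplecto hx).mono i2).trans ((Θ₂.isSymplecto hx.2).mono i4))
    (((Ψ₁.isSymplecto hx).mono i1).trans ((Θ₁.isSymplecto hx.1).mono i3)) hadm.stratum_mem hxW hx
  exact ⟨V, hxV, hV.trans hW, c, hc⟩

end Glue

/-! ### Gluing of integrable systems -/

/-- Integrable systems over members of a covering of `U`, with transition maps over the overlaps
which satisfy the cocycle condition.  `sel` selects a member of the covering through each point of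
`U`. -/
structure SystemGluing (n : ℕ) {X : Type u} [TopologicalSpace X] (U : Opens X) where
  ι : Type u
  base : ι → Opens X
  sys : ∀ i, IntegrableSystem n (base i)
  N : ι → Opens X
  N_base : ∀ i, N i ≤ base i
  N_le : ∀ i, N i ≤ U
  sel : X → ι
  mem_sel : ∀ x ∈ U, x ∈ N (sel x)
  G : ∀ i j, (sys i).carrier → (sys j).carrier
  symplecto : ∀ i j, IsSymplecto (sys i) (sys j) (N i ⊓ N j) (G i j) (G j i)
  G_self : ∀ i, ∀ p ∈ (sys i).part (N i), G i i p = p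
  G_trans : ∀ i j k, ∀ p ∈ (sys i).part (N i ⊓ N j ⊓ N k), G j k (G i j p) = G i k p
  nonempty_base : ∃ x, x ∈ U

namespace SystemGluing

variable {n : ℕ} {X : Type u} [TopologicalSpace X] {U : Opens X} (D : SystemGluing n U)

/-- The points of the glued system: over `x` these are the points over `x` of the selected system,
so that no quotient is needed. -/
def Carrier : Type u :=
  {z : Σ i, (D.sys i).carrier // D.sel ((D.sys z.1).proj z.2) = z.1 ∧ (D.sys z.1).proj z.2 ∈ U}

instance : Nonempty D.Carrier := by
  obtain ⟨x, hx⟩ := D.nonempty_base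
  obtain ⟨p, hp⟩ := (D.sys (D.sel x)).proj_onto x (D.N_base _ (D.mem_sel x hx))
  exact ⟨⟨⟨D.sel x, p⟩, by simp [hp], by simp [hp, hx]⟩⟩

/-- The projection of the glued system. -/
def proj (s : D.Carrier) : X := (D.sys s.1.1).proj s.1.2

theorem proj_mem_N (s : D.Carrier) : D.proj s ∈ D.N s.1.1 := by
  have h := D.mem_sel _ s.2.2
  rwa [s.2.1] at h

open Classical in
/-- The inclusion of the `i`-th system into the glued system. -/
noncomputable def incl (i : D.ι) (p : (D.sys i).carrier) : D.Carrier :=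
  if h : (D.sys i).proj p ∈ D.N i then
    have hp : (D.sys (D.sel ((D.sys i).proj p))).proj (D.G i (D.sel ((D.sys i).proj p)) p) =
        (D.sys i).proj p :=
      (D.symplecto i _).proj p ⟨h, D.mem_sel _ (D.N_le i h)⟩
    ⟨⟨D.sel ((D.sys i).proj p), D.G i (D.sel ((D.sys i).proj p)) p⟩,
      congrArg D.sel hp, hp.symm ▸ D.N_le i h⟩
  else Classical.arbitrary _

/-- The inverse of `incl`. -/
def inclInv (i : D.ι) (s : D.Carrier) : (D.sys i).carrier := D.G s.1.1 i s.1.2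

variable {D} {i j k : D.ι} {p : (D.sys i).carrier} {s : D.Carrier}

theorem incl_val (hp : p ∈ (D.sys i).part (D.N i)) (hk : D.sel ((D.sys i).proj p) = k) :
    (D.incl i p).1 = ⟨k, D.G i k p⟩ := by
  subst hk
  exact congrArg Subtype.val (dif_pos (show (D.sys i).proj p ∈ D.N i from hp))

theorem proj_incl (hp : p ∈ (D.sys i).part (D.N i)) : D.proj (D.incl i p) = (D.sys i).proj p := by
  unfold proj
  rw [incl_val hp rfl]
  exact (D.symplecto i _).proj p ⟨hp, D.mem_sel _ (D.N_le i hp)⟩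

theorem proj_inclInv (hs : D.proj s ∈ D.N i) : (D.sys i).proj (D.inclInv i s) = D.proj s :=
  (D.symplecto s.1.1 i).proj s.1.2 ⟨D.proj_mem_N s, hs⟩

theorem inclInv_incl (hp : p ∈ (D.sys i).part (D.N i)) :
    D.inclInv j (D.incl i p) = D.G (D.sel ((D.sys i).proj p)) j
      (D.G i (D.sel ((D.sys i).proj p)) p) := by
  unfold inclInv
  rw [incl_val hp rfl]

theorem inclInv_incl_of_mem (hp : p ∈ (D.sys i).part (D.N i ⊓ D.N j)) :
    D.inclInv j (D.incl i p) = D.G i j p := by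
  rw [inclInv_incl hp.1]
  exact D.G_trans _ _ _ _ ⟨⟨hp.1, D.mem_sel _ (D.N_le i hp.1)⟩, hp.2⟩

theorem inclInv_incl_self (hp : p ∈ (D.sys i).part (D.N i)) :
    D.inclInv i (D.incl i p) = p := by
  rw [inclInv_incl_of_mem ⟨hp, hp⟩, D.G_self i p hp]

theorem incl_inclInv (hs : D.proj s ∈ D.N i) : D.incl i (D.inclInv i s) = s := by
  have h := proj_inclInv hs
  have hm : D.inclInv i s ∈ (D.sys i).part (D.N i) := by
    show (D.sys i).proj _ ∈ D.N i
    rw [h]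
    exact hs
  refine Subtype.ext ((incl_val hm (k := s.1.1) (by rw [h]; exact s.2.1)).trans ?_)
  have h2 : D.G i s.1.1 (D.inclInv i s) = s.1.2 :=
    (D.symplecto s.1.1 i).left_inv s.1.2 ⟨D.proj_mem_N s, hs⟩
  rw [h2]

theorem incl_G (hp : p ∈ (D.sys i).part (D.N i ⊓ D.N j)) : D.incl j (D.G i j p) = D.incl i p := by
  have h := (D.symplecto i j).proj p hp
  have hm : D.G i j p ∈ (D.sys j).part (D.N j) := by
    show (D.sys j).proj _ ∈ D.N j
    rw [h]
    exact hp.2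
  refine Subtype.ext ((incl_val hm (k := D.sel ((D.sys i).proj p)) (by rw [h])).trans ?_)
  rw [incl_val hp.1 rfl, D.G_trans _ _ _ _ ⟨hp, D.mem_sel _ (D.N_le i hp.1)⟩]

instance : TopologicalSpace D.Carrier where
  IsOpen O := ∀ i, IsOpen ((D.sys i).part (D.N i) ∩ D.incl i ⁻¹' O)
  isOpen_univ i := by simpa using (D.sys i).isOpen_part (D.N i)
  isOpen_inter O O' h h' i := by
    rw [preimage_inter, inter_inter_distrib_left]
    exact (h i).inter (h' i)
  isOpen_sUnion A h i := by
    rw [preimage_sUnion, inter_iUnion₂]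
    exact isOpen_biUnion fun O hO => h O hO i

theorem continuous_proj : Continuous D.proj :=
  continuous_def.2 fun O hO i => by
    have h : (D.sys i).part (D.N i) ∩ D.incl i ⁻¹' (D.proj ⁻¹' O) =
        (D.sys i).part (D.N i) ∩ (D.sys i).proj ⁻¹' O := by
      ext p
      refine and_congr_right fun hp => ?_
      rw [mem_preimage, mem_preimage, proj_incl hp]
      rfl
    rw [h]
    exact ((D.sys i).isOpen_part _).inter (hO.preimage (D.sys i).continuous_proj)

theorem isOpen_image_incl {O : Set (D.sys i).carrier} (hO : IsOpen O)
    (hOi : O ⊆ (D.sys i).part (D.N i)) : IsOpen (D.incl i '' O) := fun j => by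
  have h : (D.sys j).part (D.N j) ∩ D.incl j ⁻¹' (D.incl i '' O) =
      (D.sys j).part (D.N j ⊓ D.N i) ∩ D.G j i ⁻¹' O := by
    ext q
    constructor
    · rintro ⟨hq, p, hp, hpq⟩
      have hqi : (D.sys j).proj q ∈ D.N i := by
        rw [← proj_incl hq, ← hpq, proj_incl (hOi hp)]
        exact hOi hp
      refine ⟨⟨hq, hqi⟩, ?_⟩
      rw [mem_preimage, ← inclInv_incl_of_mem ⟨hq, hqi⟩, ← hpq, inclInv_incl_self (hOi hp)]
      exact hp
    · rintro ⟨hq, hqO⟩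
      exact ⟨hq.1, _, hqO, incl_G hq⟩
  rw [h]
  exact (D.symplecto j i).smooth.continuousOn.isOpen_inter_preimage
    ((D.sys j).isOpen_part _) hO

variable (D) in
/-- The inclusion of the part over `N i` of the `i`-th system, as a homeomorphism onto an open
set. -/
noncomputable def inclHomeo (i : D.ι) : OpenPartialHomeomorph (D.sys i).carrier D.Carrier where
  toFun := D.incl i
  invFun := D.inclInv i
  source := (D.sys i).part (D.N i)
  target := D.proj ⁻¹' (D.N i : Set X)
  map_source' p hp := by
    rw [mem_preimage, proj_incl hp]
    exact hp
  map_target' s hs := by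
    rw [mem_preimage, proj_inclInv hs]
    exact hs
  left_inv' _ hp := inclInv_incl_self hp
  right_inv' _ hs := incl_inclInv hs
  open_source := (D.sys i).isOpen_part _
  open_target := (D.N i).isOpen.preimage continuous_proj
  continuousOn_toFun := (continuousOn_open_iff ((D.sys i).isOpen_part _)).2 fun O hO => hO i
  continuousOn_invFun := (continuousOn_open_iff ((D.N i).isOpen.preimage continuous_proj)).2
    fun O hO => by
      have h : D.proj ⁻¹' (D.N i : Set X) ∩ D.inclInv i ⁻¹' O =
          D.incl i '' ((D.sys i).part (D.N i) ∩ O) := by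
        ext s
        constructor
        · rintro ⟨hs, hsO⟩
          refine ⟨_, ⟨?_, hsO⟩, incl_inclInv hs⟩
          rw [mem_preimage, proj_inclInv hs]
          exact hs
        · rintro ⟨p, ⟨hp, hpO⟩, rfl⟩
          refine ⟨?_, ?_⟩
          · rw [mem_preimage, proj_incl hp]
            exact hp
          · rw [mem_preimage, inclInv_incl_self hp]
            exact hpO
      rw [h]
      exact isOpen_image_incl (((D.sys i).isOpen_part _).inter hO) inter_subset_left

noncomputable instance : ChartedSpace (PhaseSpace n) D.Carrier where
  atlas := {e | ∃ i, ∃ c ∈ atlas (PhaseSpace n) (D.sys i).carrier, e = (D.inclHomeo i).symm ≫ₕ c}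
  chartAt s := (D.inclHomeo s.1.1).symm ≫ₕ chartAt (PhaseSpace n) s.1.2
  mem_chart_source s := by
    have h := D.proj_mem_N s
    refine ⟨h, ?_⟩
    have e : (D.inclHomeo s.1.1).symm s = s.1.2 := D.G_self _ _ h
    show (D.inclHomeo s.1.1).symm s ∈ (chartAt (PhaseSpace n) s.1.2).source
    rw [e]
    exact mem_chart_source _ _
  chart_mem_atlas s := ⟨_, _, chart_mem_atlas _ _, rfl⟩

instance : IsManifold 𝓘(ℝ, PhaseSpace n) ∞ D.Carrier := by
  refine isManifold_of_contDiffOn _ _ _ ?_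
  rintro _ _ ⟨i, c, hc, rfl⟩ ⟨j, c', hc', rfl⟩
  simp only [modelWithCornersSelf_coe, modelWithCornersSelf_coe_symm, Function.id_comp,
    Function.comp_id, preimage_id, range_id, inter_univ]
  rw [← contMDiffOn_iff_contDiffOn]
  have h1 := contMDiffOn_symm_of_mem_maximalAtlas (I := 𝓘(ℝ, PhaseSpace n)) (n := ∞)
    (IsManifold.subset_maximalAtlas hc)
  have h2 := contMDiffOn_of_mem_maximalAtlas (I := 𝓘(ℝ, PhaseSpace n)) (n := ∞)
    (IsManifold.subset_maximalAtlas hc')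
  have hsub : ∀ y ∈ (((D.inclHomeo i).symm ≫ₕ c).symm ≫ₕ (D.inclHomeo j).symm ≫ₕ c').source,
      y ∈ c.target ∧ c.symm y ∈ (D.sys i).part (D.N i ⊓ D.N j) ∧
        D.G i j (c.symm y) ∈ c'.source := by
    rintro y ⟨⟨hy1, hy2⟩, hy3, hy4⟩
    have hy2' : c.symm y ∈ (D.sys i).part (D.N i) := hy2
    have hy3' : D.proj (D.incl i (c.symm y)) ∈ D.N j := hy3
    rw [proj_incl hy2'] at hy3'
    refine ⟨hy1, ⟨hy2', hy3'⟩, ?_⟩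
    have hy4' : D.inclInv j (D.incl i (c.symm y)) ∈ c'.source := hy4
    rwa [inclInv_incl_of_mem ⟨hy2', hy3'⟩] at hy4'
  have h3 : ContMDiffOn 𝓘(ℝ, PhaseSpace n) 𝓘(ℝ, PhaseSpace n) ∞ (c' ∘ D.G i j ∘ c.symm)
      (((D.inclHomeo i).symm ≫ₕ c).symm ≫ₕ (D.inclHomeo j).symm ≫ₕ c').source :=
    h2.comp ((D.symplecto i j).smooth.comp (h1.mono fun y hy => (hsub y hy).1)
      fun y hy => (hsub y hy).2.1) fun y hy => (hsub y hy).2.2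
  refine h3.congr fun y hy => ?_
  exact congrArg c' (inclInv_incl_of_mem (hsub y hy).2.1)

theorem incl_chart_mem_maximalAtlas {c : OpenPartialHomeomorph (D.sys i).carrier (PhaseSpace n)}
    (hc : c ∈ atlas (PhaseSpace n) (D.sys i).carrier) :
    (D.inclHomeo i).symm ≫ₕ c ∈ IsManifold.maximalAtlas 𝓘(ℝ, PhaseSpace n) ∞ D.Carrier :=
  IsManifold.subset_maximalAtlas ⟨i, c, hc, rfl⟩

theorem contMDiffOn_incl : ContMDiffOn 𝓘(ℝ, PhaseSpace n) 𝓘(ℝ, PhaseSpace n) ∞ (D.incl i)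
    ((D.sys i).part (D.N i)) := fun p hp => by
  set c := chartAt (PhaseSpace n) p
  have h1 := contMDiffOn_symm_of_mem_maximalAtlas (I := 𝓘(ℝ, PhaseSpace n)) (n := ∞)
    (incl_chart_mem_maximalAtlas (D := D) (chart_mem_atlas (PhaseSpace n) p))
  have h2 := contMDiffOn_of_mem_maximalAtlas (I := 𝓘(ℝ, PhaseSpace n)) (n := ∞)
    (IsManifold.subset_maximalAtlas (chart_mem_atlas (PhaseSpace n) p))
  have hO : IsOpen (c.source ∩ (D.sys i).part (D.N i)) :=
    c.open_source.inter ((D.sys i).isOpen_part _)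
  have hpO : p ∈ c.source ∩ (D.sys i).part (D.N i) := ⟨mem_chart_source _ _, hp⟩
  have h3 := h1.comp (h2.mono (inter_subset_left (t := (D.sys i).part (D.N i)))) (by
    rintro q ⟨hq, hq'⟩
    refine ⟨c.map_source hq, ?_⟩
    show c.symm (c q) ∈ (D.sys i).part (D.N i)
    rw [c.left_inv hq]
    exact hq')
  refine (ContMDiffOn.contMDiffAt (h3.congr fun q hq => ?_) (hO.mem_nhds hpO)).contMDiffWithinAt
  show D.incl i q = D.incl i (c.symm (c q))
  rw [c.left_inv hq.1]

theorem contMDiffOn_inclInv : ContMDiffOn 𝓘(ℝ, PhaseSpace n) 𝓘(ℝ, PhaseSpace n) ∞ (D.inclInv i)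
    (D.proj ⁻¹' (D.N i : Set X)) := fun s hs => by
  set c := chartAt (PhaseSpace n) (D.inclInv i s)
  have h1 := contMDiffOn_of_mem_maximalAtlas (I := 𝓘(ℝ, PhaseSpace n)) (n := ∞)
    (incl_chart_mem_maximalAtlas (D := D) (chart_mem_atlas (PhaseSpace n) (D.inclInv i s)))
  have h2 := contMDiffOn_symm_of_mem_maximalAtlas (I := 𝓘(ℝ, PhaseSpace n)) (n := ∞)
    (IsManifold.subset_maximalAtlas (chart_mem_atlas (PhaseSpace n) (D.inclInv i s)))
  have h3 := h2.comp h1 (by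
    rintro t ⟨ht, ht'⟩
    exact c.map_source ht')
  refine (ContMDiffOn.contMDiffAt (h3.congr fun t ht => ?_) (OpenPartialHomeomorph.open_source _
    |>.mem_nhds ?_)).contMDiffWithinAt
  · exact (c.left_inv ht.2).symm
  · exact ⟨hs, mem_chart_source (PhaseSpace n) (D.inclInv i s)⟩

end SystemGluing

namespace SystemGluing

variable {n : ℕ} {X : Type u} [TopologicalSpace X] {U : Opens X} {D : SystemGluing n U}
  {i j k : D.ι} {p : (D.sys i).carrier} {s : D.Carrier}

theorem mdifferentiableAt_incl (hp : p ∈ (D.sys i).part (D.N i)) :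
    MDifferentiableAt 𝓘(ℝ, PhaseSpace n) 𝓘(ℝ, PhaseSpace n) (D.incl i) p :=
  (contMDiffOn_incl.contMDiffAt (((D.sys i).isOpen_part _).mem_nhds hp)).mdifferentiableAt (by simp)

theorem mdifferentiableAt_inclInv (hs : D.proj s ∈ D.N i) :
    MDifferentiableAt 𝓘(ℝ, PhaseSpace n) 𝓘(ℝ, PhaseSpace n) (D.inclInv i) s :=
  (contMDiffOn_inclInv.contMDiffAt
    (((D.N i).isOpen.preimage continuous_proj).mem_nhds hs)).mdifferentiableAt (by simp)

variable (D) in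
/-- The symplectic form of the glued system. -/
noncomputable def form (s : D.Carrier) : TangentSpace 𝓘(ℝ, PhaseSpace n) s [⋀^Fin 2]→L[ℝ] ℝ :=
  ((D.sys s.1.1).form (D.inclInv s.1.1 s)).compContinuousLinearMap
    (mfderiv 𝓘(ℝ, PhaseSpace n) 𝓘(ℝ, PhaseSpace n) (D.inclInv s.1.1) s)

theorem form_apply (s : D.Carrier) (a b : TangentSpace 𝓘(ℝ, PhaseSpace n) s) :
    D.form s ![a, b] = (D.sys s.1.1).form (D.inclInv s.1.1 s)
      ![mfderiv 𝓘(ℝ, PhaseSpace n) 𝓘(ℝ, PhaseSpace n) (D.inclInv s.1.1) s a,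
        mfderiv 𝓘(ℝ, PhaseSpace n) 𝓘(ℝ, PhaseSpace n) (D.inclInv s.1.1) s b] := by
  refine congrArg ((D.sys s.1.1).form (D.inclInv s.1.1 s)) (funext fun l => ?_)
  fin_cases l <;> rfl

theorem isSymplecticAt_incl (hp : p ∈ (D.sys i).part (D.N i)) :
    IsSymplecticAt (D.sys i).form D.form (D.incl i) p := by
  refine ⟨mdifferentiableAt_incl hp, fun a b => ?_⟩
  rw [form_apply]
  set j := (D.incl i p).1.1
  have hj : D.proj (D.incl i p) ∈ D.N j := D.proj_mem_N _
  have hij : p ∈ (D.sys i).part (D.N i ⊓ D.N j) := ⟨hp, by rwa [proj_incl hp] at hj⟩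
  have hev : D.inclInv j ∘ D.incl i =ᶠ[𝓝 p] D.G i j := by
    filter_upwards [((D.sys i).isOpen_part _).mem_nhds hij] with q hq
    exact inclInv_incl_of_mem hq
  have h := ((D.symplecto i j).symplectic p hij).congr hev
  have e : ∀ a : TangentSpace 𝓘(ℝ, PhaseSpace n) p,
      mfderiv 𝓘(ℝ, PhaseSpace n) 𝓘(ℝ, PhaseSpace n) (D.inclInv j ∘ D.incl i) p a =
      mfderiv 𝓘(ℝ, PhaseSpace n) 𝓘(ℝ, PhaseSpace n) (D.inclInv j) (D.incl i p)
        (mfderiv 𝓘(ℝ, PhaseSpace n) 𝓘(ℝ, PhaseSpace n) (D.incl i) p a) := fun a =>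
    mfderiv_comp_apply p (mdifferentiableAt_inclInv hj) (mdifferentiableAt_incl hp) a
  have h2 := h.2 a b
  rw [e a, e b] at h2
  exact h2

theorem surjective_mfderiv_incl (hp : p ∈ (D.sys i).part (D.N i)) :
    Function.Surjective (mfderiv 𝓘(ℝ, PhaseSpace n) 𝓘(ℝ, PhaseSpace n) (D.incl i) p) :=
  (isSymplecticAt_incl hp).surjective (D.sys i).symplectic

/-- In the chart at `s`, the form of the glued system is that of the selected system. -/
theorem formInChart_eq {y : PhaseSpace n} (hy : y ∈ (chartAt (PhaseSpace n) s).target) :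
    formInChart D.form s y = formInChart (D.sys s.1.1).form s.1.2 y := by
  set c := chartAt (PhaseSpace n) s.1.2
  have hy1 : y ∈ c.target := hy.1
  have hy2 : c.symm y ∈ (D.sys s.1.1).part (D.N s.1.1) := hy.2
  have hs := isSymplecticAt_incl hy2
  have hc : MDifferentiableAt 𝓘(ℝ, PhaseSpace n) 𝓘(ℝ, PhaseSpace n) c.symm y :=
    (mdifferentiable_chartAt s.1.2).mdifferentiableAt_symm hy1
  ext v
  have hv : v = ![v 0, v 1] := by
    ext l
    fin_cases l <;> rfl
  rw [hv, formInChart_apply, formInChart_apply]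
  have e : ∀ a : PhaseSpace n, mfderiv 𝓘(ℝ, PhaseSpace n) 𝓘(ℝ, PhaseSpace n)
      (D.incl s.1.1 ∘ c.symm) y a =
      mfderiv 𝓘(ℝ, PhaseSpace n) 𝓘(ℝ, PhaseSpace n) (D.incl s.1.1) (c.symm y)
        (mfderiv 𝓘(ℝ, PhaseSpace n) 𝓘(ℝ, PhaseSpace n) c.symm y a) := fun a =>
    mfderiv_comp_apply y hs.1 hc a
  show D.form (D.incl s.1.1 (c.symm y))
    ![mfderiv 𝓘(ℝ, PhaseSpace n) 𝓘(ℝ, PhaseSpace n) (D.incl s.1.1 ∘ c.symm) y (v 0),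
      mfderiv 𝓘(ℝ, PhaseSpace n) 𝓘(ℝ, PhaseSpace n) (D.incl s.1.1 ∘ c.symm) y (v 1)] = _
  rw [e, e]
  exact hs.2 _ _

theorem isSymplecticForm_form : IsSymplecticForm D.form where
  smooth s := (((D.sys s.1.1).symplectic.smooth s.1.2).mono fun _ hy => hy.1).congr
    fun _ hy => formInChart_eq hy
  closed s y hy := by
    have hev : formInChart D.form s =ᶠ[𝓝 y] formInChart (D.sys s.1.1).form s.1.2 := by
      filter_upwards [(chartAt (PhaseSpace n) s).open_target.mem_nhds hy] with z hz
      exact formInChart_eq hz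
    rw [hev.extDeriv_eq]
    exact (D.sys s.1.1).symplectic.closed s.1.2 y hy.1
  nondegenerate s u hu := by
    obtain ⟨i, p, hp, rfl⟩ : ∃ i, ∃ p ∈ (D.sys i).part (D.N i), D.incl i p = s := by
      refine ⟨s.1.1, _, ?_, incl_inclInv (D.proj_mem_N s)⟩
      show (D.sys s.1.1).proj _ ∈ D.N s.1.1
      rw [proj_inclInv (D.proj_mem_N s)]
      exact D.proj_mem_N s
    obtain ⟨a, rfl⟩ := surjective_mfderiv_incl hp u
    have ha : a = 0 := (D.sys i).symplectic.nondegenerate p a fun b =>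
      ((isSymplecticAt_incl hp).2 a b).symm.trans (hu _)
    rw [ha]
    exact map_zero (mfderiv 𝓘(ℝ, PhaseSpace n) 𝓘(ℝ, PhaseSpace n) (D.incl i) p)

theorem isSymplecticAt_inclInv (hs : D.proj s ∈ D.N i) :
    IsSymplecticAt D.form (D.sys i).form (D.inclInv i) s := by
  have hm : D.inclInv i s ∈ (D.sys i).part (D.N i) := by
    show (D.sys i).proj _ ∈ D.N i
    rw [proj_inclInv hs]
    exact hs
  obtain ⟨p, hp, rfl⟩ : ∃ p ∈ (D.sys i).part (D.N i), D.incl i p = s := ⟨_, hm, incl_inclInv hs⟩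
  refine ⟨mdifferentiableAt_inclInv hs, fun a b => ?_⟩
  obtain ⟨a, rfl⟩ := surjective_mfderiv_incl hp a
  obtain ⟨b, rfl⟩ := surjective_mfderiv_incl hp b
  rw [(isSymplecticAt_incl hp).2]
  have hid : D.inclInv i ∘ D.incl i =ᶠ[𝓝 p] id := by
    filter_upwards [((D.sys i).isOpen_part _).mem_nhds hp] with q hq using inclInv_incl_self hq
  have e : ∀ a : TangentSpace 𝓘(ℝ, PhaseSpace n) p,
      mfderiv 𝓘(ℝ, PhaseSpace n) 𝓘(ℝ, PhaseSpace n) (D.inclInv i) (D.incl i p)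
        (mfderiv 𝓘(ℝ, PhaseSpace n) 𝓘(ℝ, PhaseSpace n) (D.incl i) p a) = (a : PhaseSpace n) :=
    fun a => by
      refine (mfderiv_comp_apply p (mdifferentiableAt_inclInv hs)
        (mdifferentiableAt_incl hp) a).symm.trans ?_
      rw [hid.mfderiv_eq, mfderiv_id]
      rfl
  have key : ∀ r (u v : PhaseSpace n), r = p → u = a → v = b →
      (D.sys i).form r ![u, v] = (D.sys i).form p ![a, b] := by
    rintro _ _ _ rfl rfl rfl
    rfl
  exact key _ _ _ (inclInv_incl_self hp) (e a) (e b)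

theorem t2Space [T2Space X] : T2Space D.Carrier := by
  refine ⟨fun s t hst => ?_⟩
  by_cases h : D.proj s = D.proj t
  · have hs := D.proj_mem_N s
    have ht : D.proj t ∈ D.N s.1.1 := h ▸ hs
    have hne : D.inclInv s.1.1 s ≠ D.inclInv s.1.1 t := fun he => hst (by
      rw [← incl_inclInv hs, he, incl_inclInv ht])
    obtain ⟨O, O', hO, hO', hsO, htO', hd⟩ := t2_separation hne
    refine ⟨_, _, (D.inclHomeo s.1.1).symm.isOpen_inter_preimage hO,
      (D.inclHomeo s.1.1).symm.isOpen_inter_preimage hO', ⟨hs, hsO⟩, ⟨ht, htO'⟩, ?_⟩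
    exact disjoint_left.2 fun r hr hr' => disjoint_left.1 hd hr.2 hr'.2
  · obtain ⟨O, O', hO, hO', hsO, htO', hd⟩ := t2_separation h
    exact ⟨_, _, hO.preimage continuous_proj, hO'.preimage continuous_proj, hsO, htO',
      hd.preimage _⟩

/-- An ultrafilter whose projection converges lives on the part over some `N i`, where it has a
limit by the properness of the `i`-th system. -/
theorem isProperMap_proj : IsProperMap (Set.codRestrict D.proj (U : Set X) fun s => s.2.2) := by
  refine isProperMap_iff_ultrafilter.2 ⟨continuous_proj.codRestrict _, fun 𝒰 y hy => ?_⟩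
  set i := D.sel y
  have hyi : (y : X) ∈ D.N i := D.mem_sel y y.2
  have hy' : Tendsto D.proj 𝒰 (𝓝 (y : X)) := (continuous_subtype_val.tendsto y).comp hy
  have hU : ∀ᶠ s in (𝒰 : Filter D.Carrier), D.proj s ∈ D.N i :=
    hy'.eventually ((D.N i).isOpen.mem_nhds hyi)
  set 𝒱 := 𝒰.map (D.inclInv i)
  have h1 : Tendsto (Set.codRestrict (D.sys i).proj (D.base i : Set X) (D.sys i).proj_mem) 𝒱
      (𝓝 ⟨y, D.N_base i hyi⟩) := by
    rw [tendsto_subtype_rng]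
    show Tendsto (D.sys i).proj (Filter.map (D.inclInv i) 𝒰) _
    rw [tendsto_map'_iff]
    refine hy'.congr' ?_
    filter_upwards [hU] with s hs
    exact (proj_inclInv hs).symm
  obtain ⟨p, hp, hVp⟩ := (isProperMap_iff_ultrafilter.1 (D.sys i).proper).2 h1
  have hpy : (D.sys i).proj p = y := congrArg Subtype.val hp
  have hpi : p ∈ (D.sys i).part (D.N i) := by
    show (D.sys i).proj p ∈ D.N i
    rw [hpy]
    exact hyi
  refine ⟨D.incl i p, Subtype.ext ((proj_incl hpi).trans hpy), ?_⟩
  have h2 : Tendsto (D.incl i) 𝒱 (𝓝 (D.incl i p)) :=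
    ((D.inclHomeo i).continuousAt hpi).tendsto.mono_left hVp
  have h3 : Tendsto (D.incl i ∘ D.inclInv i) 𝒰 (𝓝 (D.incl i p)) := h2.comp tendsto_map
  have h4 : Tendsto id (𝒰 : Filter D.Carrier) (𝓝 (D.incl i p)) := by
    refine h3.congr' ?_
    filter_upwards [hU] with s hs
    exact incl_inclInv hs
  exact h4

/-- A moment map of the system selected at `x` is a moment map of the glued system near `x`. -/
theorem exists_isMomentMap {x : X} (hx : x ∈ U) : ∃ W : Opens X, x ∈ W ∧ W ≤ U ∧
    ∃ F : Fin n → D.Carrier → ℝ, IsMomentMap D.form D.proj W F := by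
  set i := D.sel x
  have hxi : x ∈ D.N i := D.mem_sel x hx
  obtain ⟨W, hxW, -, F, hF⟩ := (D.sys i).moment x (D.N_base i hxi)
  have hN : ∀ s ∈ D.proj ⁻¹' ((W ⊓ D.N i : Opens X) : Set X),
      D.inclInv i s ∈ (D.sys i).part (W ⊓ D.N i) := fun s hs => by
    show (D.sys i).proj _ ∈ W ⊓ D.N i
    rw [proj_inclInv hs.2]
    exact hs
  have hsm : ∀ k, ContMDiffOn 𝓘(ℝ, PhaseSpace n) 𝓘(ℝ, ℝ) ∞ (F k ∘ D.inclInv i)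
      (D.proj ⁻¹' ((W ⊓ D.N i : Opens X) : Set X)) := fun k =>
    (hF.smooth k).comp (contMDiffOn_inclInv.mono fun s hs => hs.2) fun s hs => (hN s hs).1
  have hopen : IsOpen (D.proj ⁻¹' ((W ⊓ D.N i : Opens X) : Set X)) :=
    (W ⊓ D.N i).isOpen.preimage continuous_proj
  have hmd : ∀ k, ∀ s ∈ D.proj ⁻¹' ((W ⊓ D.N i : Opens X) : Set X),
      MDifferentiableAt 𝓘(ℝ, PhaseSpace n) 𝓘(ℝ, ℝ) (F k ∘ D.inclInv i) s := fun k s hs =>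
    ((hsm k).contMDiffAt (hopen.mem_nhds hs)).mdifferentiableAt (by simp)
  have hFd : ∀ k, ∀ p ∈ (D.sys i).part (W ⊓ D.N i),
      MDifferentiableAt 𝓘(ℝ, PhaseSpace n) 𝓘(ℝ, ℝ) (F k) p := fun k p hp =>
    IntegrableSystem.mdifferentiableAt_of_contMDiffOn (hF.smooth k) hp.1
  refine ⟨W ⊓ D.N i, ⟨hxW, hxi⟩, inf_le_right.trans (D.N_le i), fun k => F k ∘ D.inclInv i, hsm,
    fun k l s hs u hu => ?_, fun s hs => ?_, fun s hs => Subset.antisymm ?_ ?_⟩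
  · have hp := hN s hs
    have h1 := (isSymplecticAt_inclInv hs.2).map_ham isSymplecticForm_form (hFd k _ hp)
      (Eventually.of_forall fun _ => rfl) hu
    exact (mfderiv_comp_apply s (hFd l _ hp) (mdifferentiableAt_inclInv hs.2) u).trans
      (hF.commute k l _ hp.1 _ h1)
  -- the differentials are independent at the points of a dense set
  · refine mem_closure_iff.2 fun O hO hsO => ?_
    have hp := hN s hs
    have hO' : IsOpen ((D.sys i).part (W ⊓ D.N i) ∩ ((D.sys i).part (D.N i) ∩ D.incl i ⁻¹' O)) :=
      ((D.sys i).isOpen_part _).inter (hO i)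
    obtain ⟨r, ⟨hr, -, hrO⟩, -, hli⟩ := mem_closure_iff.1 (hF.independent hp.1) _ hO'
      ⟨hp, hp.2, by rw [mem_preimage, incl_inclInv hs.2]; exact hsO⟩
    have hrp : D.proj (D.incl i r) ∈ W ⊓ D.N i := by
      rw [proj_incl hr.2]
      exact hr
    refine ⟨_, hrO, hrp, ?_⟩
    let L : (PhaseSpace n →L[ℝ] ℝ) →ₗ[ℝ] (PhaseSpace n →L[ℝ] ℝ) :=
      { toFun := fun A => A.comp
          (mfderiv 𝓘(ℝ, PhaseSpace n) 𝓘(ℝ, PhaseSpace n) (D.incl i) r :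
            PhaseSpace n →L[ℝ] PhaseSpace n)
        map_add' := fun _ _ => rfl
        map_smul' := fun _ _ => rfl }
    have e : (L ∘ fun k => dAt (n := n) (F k ∘ D.inclInv i) (D.incl i r)) =
        fun k => dAt (n := n) (F k) r := by
      funext k
      have hid : (F k ∘ D.inclInv i) ∘ D.incl i =ᶠ[𝓝 r] F k := by
        filter_upwards [((D.sys i).isOpen_part _).mem_nhds hr.2] with q hq
        exact congrArg (F k) (inclInv_incl_self hq)
      have h1 := mfderiv_comp r (hmd k _ hrp) (mdifferentiableAt_incl hr.2)
      rw [hid.mfderiv_eq] at h1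
      exact h1.symm
    have hli' : LinearIndependent ℝ (fun k => (dAt (n := n) (F k) r : PhaseSpace n →L[ℝ] ℝ)) := hli
    rw [← e] at hli'
    exact LinearIndependent.of_comp L hli'
  -- the fiber is connected, being the image of a fiber of the `i`-th system
  · have hp := hN s hs
    have hconn : IsPreconnected ((D.sys i).proj ⁻¹' {D.proj s}) := by
      have h1 := hF.fiber _ hp.1
      rw [proj_inclInv hs.2] at h1
      rw [h1]
      exact isPreconnected_connectedComponentIn
    have hsub : ∀ q ∈ (D.sys i).proj ⁻¹' {D.proj s}, q ∈ (D.sys i).part (W ⊓ D.N i) ∧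
        ∀ k, F k q = F k (D.inclInv i s) := fun q hq => by
      refine ⟨?_, ?_⟩
      · show (D.sys i).proj q ∈ W ⊓ D.N i
        rw [show (D.sys i).proj q = D.proj s from hq]
        exact hs
      · have h1 : q ∈ (D.sys i).proj ⁻¹' {(D.sys i).proj (D.inclInv i s)} := by
          rw [proj_inclInv hs.2]
          exact hq
        rw [hF.fiber _ hp.1] at h1
        exact (connectedComponentIn_subset _ _ h1).2
    have himg := hconn.image (D.incl i)
      (contMDiffOn_incl.continuousOn.mono fun q hq => (hsub q hq).1.2)
    have hmem : s ∈ D.incl i '' ((D.sys i).proj ⁻¹' {D.proj s}) :=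
      ⟨_, proj_inclInv hs.2, incl_inclInv hs.2⟩
    refine Subset.trans ?_ (himg.subset_connectedComponentIn hmem ?_)
    · intro t ht
      have ht' : D.proj t ∈ D.N i := by
        rw [show D.proj t = D.proj s from ht]
        exact hs.2
      exact ⟨_, (proj_inclInv ht').trans ht, incl_inclInv ht'⟩
    · rintro _ ⟨q, hq, rfl⟩
      obtain ⟨h1, h2⟩ := hsub q hq
      refine ⟨?_, fun k => ?_⟩
      · rw [mem_preimage, proj_incl h1.2]
        exact h1
      · show F k (D.inclInv i (D.incl i q)) = F k (D.inclInv i s)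
        rw [inclInv_incl_self h1.2, h2]
  -- the image of a component in the `i`-th system lies in a component there, that is, in a fiber
  · set C := connectedComponentIn (D.proj ⁻¹' ((W ⊓ D.N i : Opens X) : Set X) ∩
      {q | ∀ k, (F k ∘ D.inclInv i) q = (F k ∘ D.inclInv i) s}) s
    have hC : C ⊆ _ := connectedComponentIn_subset _ _
    have himg : IsPreconnected (D.inclInv i '' C) := isPreconnected_connectedComponentIn.image _
      (contMDiffOn_inclInv.continuousOn.mono fun q hq => (hC hq).1.2)
    have hsC : s ∈ C := mem_connectedComponentIn ⟨hs, fun _ => rfl⟩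
    intro t ht
    have h1 := IntegrableSystem.proj_eq_of_isPreconnected hF himg
      (by rintro _ ⟨q, hq, rfl⟩; exact (hN q (hC hq).1).1) (mem_image_of_mem _ hsC)
      (mem_image_of_mem _ ht) (by rintro _ ⟨q, hq, rfl⟩ k; exact (hC hq).2 k)
    rw [proj_inclInv (hC ht).1.2, proj_inclInv hs.2] at h1
    exact h1

variable (D) in
/-- The glued system. -/
noncomputable def system [T2Space X] (hU : ParacompactSpace U) : IntegrableSystem n U where
  carrier := D.Carrier
  t2 := t2Space
  form := D.form
  symplectic := isSymplecticForm_form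
  proj := D.proj
  proj_mem s := s.2.2
  proj_onto x hx := by
    obtain ⟨p, hp⟩ := (D.sys (D.sel x)).proj_onto x (D.N_base _ (D.mem_sel x hx))
    have hp' : p ∈ (D.sys (D.sel x)).part (D.N (D.sel x)) := by
      show (D.sys (D.sel x)).proj p ∈ D.N (D.sel x)
      rw [hp]
      exact D.mem_sel x hx
    exact ⟨D.incl _ p, (proj_incl hp').trans hp⟩
  proper := isProperMap_proj
  paracompact := hU
  moment _ hx := exists_isMomentMap hx

theorem isSymplecto_incl [T2Space X] (hU : ParacompactSpace U) :
    IsSymplecto (D.sys i) (D.system hU) (D.N i) (D.incl i) (D.inclInv i) where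
  proj _ hp := proj_incl hp
  proj_inv _ hs := proj_inclInv hs
  left_inv _ hp := inclInv_incl_self hp
  right_inv _ hs := incl_inclInv hs
  smooth := contMDiffOn_incl
  smooth_inv := contMDiffOn_inclInv
  symplectic _ hp := isSymplecticAt_incl hp

end SystemGluing

theorem FunPresheaf.restrict {X : Type u} [TopologicalSpace X] (A : FunPresheaf X) {V W : Opens X}
    {f : X → ℝ} (h : f ∈ A.sec W) (hV : V ≤ W) : f ∈ A.sec V := A.anti hV h

namespace IntegrableSystem.FlowRel

variable {n : ℕ} {X : Type u} [TopologicalSpace X] {U U' : Opens X} {S : IntegrableSystem n U}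
  {T : IntegrableSystem n U'} {M : Type*} {V : Opens X} {g h k : S.carrier → M} {a b : X → ℝ}

theorem eqOn_of_sub_mem (H : S.FlowRel V g h a) (K : S.FlowRel V g k b)
    (hab : a - b ∈ S.affineSheaf.sec V) : EqOn h k (S.part V) := fun p hp => by
  rw [H.2 p hp, K.2 p hp, (sub_mem_affineSheaf_iff H.1 K.1).1 hab p hp]

theorem inv {φ ψ : S.carrier → T.carrier} {φi ψi : T.carrier → S.carrier}
    (hφ : IsSymplecto S T V φ φi) (hψ : IsSymplecto S T V ψ ψi) (H : S.FlowRel V φ ψ a) :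
    T.FlowRel V φi ψi (-a) := by
  have ha : a ∈ T.smoothSheaf.sec V := hφ.symm.smooth_le H.1
  refine ⟨neg_mem ha, fun q hq => ?_⟩
  have hw := hψ.mapsTo_inv hq
  have e : T.flow a 1 (φ (ψi q)) = q := by
    rw [← hφ.map_flow ha hw, ← H.2 _ hw, hψ.right_inv q hq]
  rw [hφ.symm.map_flow (neg_mem H.1) hq]
  nth_rewrite 2 [← e]
  rw [hφ.symm.map_flow H.1 (hφ.mapsTo hw), hφ.left_inv _ hw, flow_neg_flow H.1 hw]

/-- Symplectic equivalences which differ by time one maps near each fiber have an admissible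
comparison. -/
theorem isAdmissible {φ ψ : S.carrier → T.carrier} {φi ψi : T.carrier → S.carrier}
    (hφ : IsSymplecto S T V φ φi) (hψ : IsSymplecto S T V ψ ψi)
    (h : ∀ z ∈ V, ∃ V' : Opens X, z ∈ V' ∧ V' ≤ V ∧ ∃ a, S.FlowRel V' φ ψ a) :
    S.IsAdmissible V (φi ∘ ψ) :=
  isAdmissible_of_local_flow fun z hz _ => by
    obtain ⟨V', hzV', hV', a, ha⟩ := h z hz
    exact ⟨V', hzV', a, ha.1, (iff_inv (hφ.mono hV') (hψ.mono hV') ha.1).1 ha⟩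

end IntegrableSystem.FlowRel

/-- Data for gluing two systems over `O₁` and `O₂`: cocycles `m₁`, `m₂`, by which the two systems
are to be twisted, and local symplectic equivalences `T x` between them over the overlap, the
transition functions of which become equal to the difference of the two cocycles after a correction
by the coboundary of `c`. -/
structure PairGluing {n : ℕ} {X : Type u} [TopologicalSpace X] {O₁ O₂ : Opens X}
    (S₁ : IntegrableSystem n O₁) (S₂ : IntegrableSystem n O₂) where
  M₁ : X → Opens X
  cover₁ : IsPointCover O₁ M₁
  m₁ : X → X → X → ℝ
  smooth₁ : ∀ x ∈ O₁, ∀ y ∈ O₁, m₁ x y ∈ S₁.smoothSheaf.sec (M₁ x ⊓ M₁ y)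
  cocycle₁ : ∀ x ∈ O₁, ∀ y ∈ O₁, ∀ z ∈ O₁,
    m₁ y z - m₁ x z + m₁ x y ∈ S₁.affineSheaf.sec (M₁ x ⊓ M₁ y ⊓ M₁ z)
  M₂ : X → Opens X
  cover₂ : IsPointCover O₂ M₂
  m₂ : X → X → X → ℝ
  smooth₂ : ∀ x ∈ O₂, ∀ y ∈ O₂, m₂ x y ∈ S₂.smoothSheaf.sec (M₂ x ⊓ M₂ y)
  cocycle₂ : ∀ x ∈ O₂, ∀ y ∈ O₂, ∀ z ∈ O₂,
    m₂ y z - m₂ x z + m₂ x y ∈ S₂.affineSheaf.sec (M₂ x ⊓ M₂ y ⊓ M₂ z)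
  N : X → Opens X
  cover : IsPointCover (O₁ ⊓ O₂) N
  N_le : ∀ x ∈ O₁ ⊓ O₂, N x ≤ M₁ x ⊓ M₂ x
  T : X → S₁.carrier → S₂.carrier
  Ti : X → S₂.carrier → S₁.carrier
  symplecto : ∀ x ∈ O₁ ⊓ O₂, IsSymplecto S₁ S₂ (N x) (T x) (Ti x)
  a : X → X → X → ℝ
  flowRel : ∀ x ∈ O₁ ⊓ O₂, ∀ y ∈ O₁ ⊓ O₂, S₁.FlowRel (N x ⊓ N y) (T x) (T y) (a x y)
  c : X → X → ℝ
  smooth : ∀ x ∈ O₁ ⊓ O₂, c x ∈ S₁.smoothSheaf.sec (N x)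
  compat : ∀ x ∈ O₁ ⊓ O₂, ∀ y ∈ O₁ ⊓ O₂,
    a x y - m₁ x y + m₂ x y - (c y - c x) ∈ S₁.affineSheaf.sec (N x ⊓ N y)

namespace PairGluing

variable {n : ℕ} {X : Type u} [TopologicalSpace X] {O₁ O₂ : Opens X}
  {S₁ : IntegrableSystem n O₁} {S₂ : IntegrableSystem n O₂} (D : PairGluing S₁ S₂) {x y z z' : X}

/-- The function by whose time one map `T z` is corrected to give the transition map between the
member at `x` of the first covering and the member at `y` of the second one. -/
def b (x y z : X) : X → ℝ := D.m₂ y z - D.c z + D.m₁ z x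

variable {D}

theorem flow_m₁_trans (hx : x ∈ O₁) (hy : y ∈ O₁) (hz : z ∈ O₁) {p : S₁.carrier}
    (hp : p ∈ S₁.part (D.M₁ x ⊓ D.M₁ y ⊓ D.M₁ z)) :
    S₁.flow (D.m₁ z y) 1 (S₁.flow (D.m₁ y x) 1 p) = S₁.flow (D.m₁ z x) 1 p := by
  have hzy := S₁.smoothSheaf.restrict (V := D.M₁ x ⊓ D.M₁ y ⊓ D.M₁ z) (D.smooth₁ z hz y hy)
    (fun _ h => ⟨h.2, h.1.2⟩)
  have hyx := S₁.smoothSheaf.restrict (V := D.M₁ x ⊓ D.M₁ y ⊓ D.M₁ z) (D.smooth₁ y hy x hx)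
    (fun _ h => ⟨h.1.2, h.1.1⟩)
  have hzx := S₁.smoothSheaf.restrict (V := D.M₁ x ⊓ D.M₁ y ⊓ D.M₁ z) (D.smooth₁ z hz x hx)
    (fun _ h => ⟨h.2, h.1.1⟩)
  rw [← flow_add hzy hyx hp]
  refine (sub_mem_affineSheaf_iff (add_mem hzy hyx) hzx).1 ?_ p hp
  have h := S₁.affineSheaf.restrict (V := D.M₁ x ⊓ D.M₁ y ⊓ D.M₁ z) (D.cocycle₁ z hz y hy x hx)
    (fun _ h => ⟨⟨h.2, h.1.2⟩, h.1.1⟩)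
  rwa [show D.m₁ z y + D.m₁ y x - D.m₁ z x = D.m₁ y x - D.m₁ z x + D.m₁ z y by abel]

theorem flow_m₁_self (hx : x ∈ O₁) {p : S₁.carrier} (hp : p ∈ S₁.part (D.M₁ x)) :
    S₁.flow (D.m₁ x x) 1 p = p := by
  have h := S₁.affineSheaf.restrict (V := D.M₁ x) (D.cocycle₁ x hx x hx x hx)
    (fun _ h => ⟨⟨h, h⟩, h⟩)
  rw [sub_self, zero_add] at h
  exact (mem_affineSheaf_iff.1 h).2 p hp

theorem flow_m₂_trans (hx : x ∈ O₂) (hy : y ∈ O₂) (hz : z ∈ O₂) {p : S₂.carrier}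
    (hp : p ∈ S₂.part (D.M₂ x ⊓ D.M₂ y ⊓ D.M₂ z)) :
    S₂.flow (D.m₂ z y) 1 (S₂.flow (D.m₂ y x) 1 p) = S₂.flow (D.m₂ z x) 1 p := by
  have hzy := S₂.smoothSheaf.restrict (V := D.M₂ x ⊓ D.M₂ y ⊓ D.M₂ z) (D.smooth₂ z hz y hy)
    (fun _ h => ⟨h.2, h.1.2⟩)
  have hyx := S₂.smoothSheaf.restrict (V := D.M₂ x ⊓ D.M₂ y ⊓ D.M₂ z) (D.smooth₂ y hy x hx)
    (fun _ h => ⟨h.1.2, h.1.1⟩)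
  have hzx := S₂.smoothSheaf.restrict (V := D.M₂ x ⊓ D.M₂ y ⊓ D.M₂ z) (D.smooth₂ z hz x hx)
    (fun _ h => ⟨h.2, h.1.1⟩)
  rw [← flow_add hzy hyx hp]
  refine (sub_mem_affineSheaf_iff (add_mem hzy hyx) hzx).1 ?_ p hp
  have h := S₂.affineSheaf.restrict (V := D.M₂ x ⊓ D.M₂ y ⊓ D.M₂ z) (D.cocycle₂ z hz y hy x hx)
    (fun _ h => ⟨⟨h.2, h.1.2⟩, h.1.1⟩)
  rwa [show D.m₂ z y + D.m₂ y x - D.m₂ z x = D.m₂ y x - D.m₂ z x + D.m₂ z y by abel]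

theorem flow_m₂_self (hx : x ∈ O₂) {p : S₂.carrier} (hp : p ∈ S₂.part (D.M₂ x)) :
    S₂.flow (D.m₂ x x) 1 p = p := by
  have h := S₂.affineSheaf.restrict (V := D.M₂ x) (D.cocycle₂ x hx x hx x hx)
    (fun _ h => ⟨⟨h, h⟩, h⟩)
  rw [sub_self, zero_add] at h
  exact (mem_affineSheaf_iff.1 h).2 p hp

theorem m₂_smooth (hy : y ∈ O₂) (hz : z ∈ O₁ ⊓ O₂) :
    D.m₂ y z ∈ S₁.smoothSheaf.sec (D.M₂ y ⊓ D.N z) := by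
  rw [← ((D.symplecto z hz).mono inf_le_right).smooth_eq]
  exact S₂.smoothSheaf.restrict (D.smooth₂ y hy z hz.2) (fun _ h => ⟨h.1, (D.N_le z hz h.2).2⟩)

theorem b_smooth (hx : x ∈ O₁) (hy : y ∈ O₂) (hz : z ∈ O₁ ⊓ O₂) :
    D.b x y z ∈ S₁.smoothSheaf.sec (D.M₁ x ⊓ D.M₂ y ⊓ D.N z) :=
  add_mem (sub_mem (S₁.smoothSheaf.restrict (m₂_smooth hy hz) (fun _ h => ⟨h.1.2, h.2⟩))
    (S₁.smoothSheaf.restrict (D.smooth z hz) (fun _ h => h.2)))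
    (S₁.smoothSheaf.restrict (D.smooth₁ z hz.1 x hx) (fun _ h => ⟨(D.N_le z hz h.2).1, h.1.1⟩))

/-- The transition map does not depend on the point `z` at which it is computed. -/
theorem transition_eq (hx : x ∈ O₁) (hy : y ∈ O₂) (hz : z ∈ O₁ ⊓ O₂) (hz' : z' ∈ O₁ ⊓ O₂)
    {p : S₁.carrier} (hp : p ∈ S₁.part (D.M₁ x ⊓ D.M₂ y ⊓ (D.N z ⊓ D.N z'))) :
    D.T z' (S₁.flow (D.b x y z') 1 p) = D.T z (S₁.flow (D.b x y z) 1 p) := by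
  set V := D.M₁ x ⊓ D.M₂ y ⊓ (D.N z ⊓ D.N z') with hV
  have hVz : V ≤ D.M₁ x ⊓ D.M₂ y ⊓ D.N z := fun _ h => ⟨h.1, h.2.1⟩
  have hVz' : V ≤ D.M₁ x ⊓ D.M₂ y ⊓ D.N z' := fun _ h => ⟨h.1, h.2.2⟩
  have hb := S₁.smoothSheaf.restrict (D.b_smooth hx hy hz) hVz
  have hb' := S₁.smoothSheaf.restrict (D.b_smooth hx hy hz') hVz'
  have r1 : S₁.FlowRel V (D.T z) (fun p => D.T z (S₁.flow (D.b x y z) 1 p)) (D.b x y z) :=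
    ⟨hb, fun _ _ => rfl⟩
  have r2 : S₁.FlowRel V (D.T z') (fun p => D.T z' (S₁.flow (D.b x y z') 1 p)) (D.b x y z') :=
    ⟨hb', fun _ _ => rfl⟩
  have r3 := ((D.flowRel z hz z' hz').mono (V' := V) inf_le_right).trans r2
  refine r3.eqOn_of_sub_mem r1 ?_ hp
  have h1 := S₁.affineSheaf.restrict (V := V) (D.cocycle₁ z hz.1 z' hz'.1 x hx)
    (fun _ h => ⟨⟨(D.N_le z hz h.2.1).1, (D.N_le z' hz' h.2.2).1⟩, h.1.1⟩)
  have h2 := S₂.affineSheaf.restrict (V := V) (D.cocycle₂ y hy z hz.2 z' hz'.2)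
    (fun _ h => ⟨⟨h.1.2, (D.N_le z hz h.2.1).2⟩, (D.N_le z' hz' h.2.2).2⟩)
  rw [((D.symplecto z hz).mono (hVz.trans inf_le_right)).affine_eq] at h2
  have h3 := S₁.affineSheaf.restrict (V := V) (D.compat z hz z' hz') inf_le_right
  have h4 := add_mem h3 (sub_mem h1 h2)
  have e : D.a z z' + D.b x y z' - D.b x y z =
      D.a z z' - D.m₁ z z' + D.m₂ z z' - (D.c z' - D.c z) +
      (D.m₁ z' x - D.m₁ z x + D.m₁ z z' - (D.m₂ z z' - D.m₂ y z' + D.m₂ y z)) := by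
    unfold b
    abel
  rw [e]
  exact h4

variable (D) in
/-- The transition maps from the first system to the second one, computed over each point of the
base with the help of the local equivalence at that point. -/
noncomputable def G₁₂ (x y : X) (p : S₁.carrier) : S₂.carrier :=
  D.T (S₁.proj p) (S₁.flow (D.b x y (S₁.proj p)) 1 p)

variable (D) in
/-- The inverse of `G₁₂`. -/
noncomputable def G₂₁ (y x : X) (q : S₂.carrier) : S₁.carrier :=
  S₁.flow (-D.b x y (S₂.proj q)) 1 (D.Ti (S₂.proj q) q)

theorem symplecto_at (hx : x ∈ O₁) (hy : y ∈ O₂) (hz : z ∈ O₁ ⊓ O₂) :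
    IsSymplecto S₁ S₂ (D.M₁ x ⊓ D.M₂ y ⊓ D.N z) (D.T z ∘ S₁.flow (D.b x y z) 1)
      (S₁.flow (-D.b x y z) 1 ∘ D.Ti z) :=
  (IsSymplecto.flow (D.b_smooth hx hy hz) 1).trans ((D.symplecto z hz).mono inf_le_right)

theorem mem_overlap (hx : x ∈ O₁) (hy : y ∈ O₂) (hz : z ∈ D.M₁ x ⊓ D.M₂ y) : z ∈ O₁ ⊓ O₂ :=
  ⟨(D.cover₁ x hx).2 hz.1, (D.cover₂ y hy).2 hz.2⟩

theorem G₁₂_eq (hx : x ∈ O₁) (hy : y ∈ O₂) (hz : z ∈ O₁ ⊓ O₂) {p : S₁.carrier}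
    (hp : p ∈ S₁.part (D.M₁ x ⊓ D.M₂ y ⊓ D.N z)) :
    D.G₁₂ x y p = D.T z (S₁.flow (D.b x y z) 1 p) :=
  have hz' := mem_overlap hx hy hp.1
  transition_eq hx hy hz hz' ⟨hp.1, hp.2, (D.cover _ hz').1⟩

theorem symplecto_G₁₂ (hx : x ∈ O₁) (hy : y ∈ O₂) :
    IsSymplecto S₁ S₂ (D.M₁ x ⊓ D.M₂ y) (D.G₁₂ x y) (D.G₂₁ y x) := by
  refine IsSymplecto.of_local fun z hz => ?_
  have hz' := mem_overlap hx hy hz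
  have H := symplecto_at (D := D) hx hy hz'
  refine ⟨D.M₁ x ⊓ D.M₂ y ⊓ D.N z, _, _, ⟨hz, (D.cover z hz').1⟩, H,
    fun p hp => G₁₂_eq hx hy hz' hp, fun q hq => ?_⟩
  have hq' := mem_overlap hx hy hq.1
  have K := symplecto_at (D := D) hx hy hq'
  have hqK : q ∈ S₂.part (D.M₁ x ⊓ D.M₂ y ⊓ D.N (S₂.proj q)) := ⟨hq.1, (D.cover _ hq').1⟩
  have h1 : D.G₂₁ y x q ∈ S₁.part (D.M₁ x ⊓ D.M₂ y ⊓ D.N z) := by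
    show S₁.proj _ ∈ D.M₁ x ⊓ D.M₂ y ⊓ D.N z
    rw [show S₁.proj (D.G₂₁ y x q) = S₂.proj q from K.proj_inv q hqK]
    exact hq
  have h1' : D.G₂₁ y x q ∈ S₁.part (D.M₁ x ⊓ D.M₂ y ⊓ D.N (S₂.proj q)) := K.mapsTo_inv hqK
  refine H.injOn h1 (H.mapsTo_inv hq) ?_
  rw [H.right_inv q hq]
  exact (G₁₂_eq hx hy hz' h1).symm.trans ((G₁₂_eq hx hy hq' h1').trans (K.right_inv q hqK))

theorem symplecto_m₁ (hx : x ∈ O₁) (hy : y ∈ O₁) :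
    IsSymplecto S₁ S₁ (D.M₁ x ⊓ D.M₁ y) (S₁.flow (D.m₁ y x) 1) (S₁.flow (D.m₁ x y) 1) := by
  have h := S₁.smoothSheaf.restrict (D.smooth₁ y hy x hx) (inf_comm (D.M₁ x) (D.M₁ y)).le
  refine (IsSymplecto.flow h 1).congr (fun _ _ => rfl) fun p hp => ?_
  have e : S₁.flow (D.m₁ x y) 1 (S₁.flow (D.m₁ y x) 1 (S₁.flow (-D.m₁ y x) 1 p)) =
      S₁.flow (-D.m₁ y x) 1 p := by
    have hm := flow_mem_part (neg_mem h) hp 1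
    rw [flow_m₁_trans hx hy hx ⟨hm, hm.1⟩, flow_m₁_self hx hm.1]
  rwa [flow_flow_neg h hp] at e

theorem symplecto_m₂ (hx : x ∈ O₂) (hy : y ∈ O₂) :
    IsSymplecto S₂ S₂ (D.M₂ x ⊓ D.M₂ y) (S₂.flow (D.m₂ y x) 1) (S₂.flow (D.m₂ x y) 1) := by
  have h := S₂.smoothSheaf.restrict (D.smooth₂ y hy x hx) (inf_comm (D.M₂ x) (D.M₂ y)).le
  refine (IsSymplecto.flow h 1).congr (fun _ _ => rfl) fun p hp => ?_
  have e : S₂.flow (D.m₂ x y) 1 (S₂.flow (D.m₂ y x) 1 (S₂.flow (-D.m₂ y x) 1 p)) =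
      S₂.flow (-D.m₂ y x) 1 p := by
    have hm := flow_mem_part (neg_mem h) hp 1
    rw [flow_m₂_trans hx hy hx ⟨hm, hm.1⟩, flow_m₂_self hx hm.1]
  rwa [flow_flow_neg h hp] at e

theorem G₁₂_flow (hx : x ∈ O₁) (hx' : z ∈ O₁) (hy : y ∈ O₂) {p : S₁.carrier}
    (hp : p ∈ S₁.part (D.M₁ x ⊓ D.M₁ z ⊓ D.M₂ y)) :
    D.G₁₂ z y (S₁.flow (D.m₁ z x) 1 p) = D.G₁₂ x y p := by
  have hw := mem_overlap (D := D) hx hy ⟨hp.1.1, hp.2⟩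
  set w := S₁.proj p with hw'
  have hN := (D.cover w hw).1
  set V := D.M₁ x ⊓ D.M₁ z ⊓ D.M₂ y ⊓ D.N w
  have hpV : p ∈ S₁.part V := ⟨hp, hN⟩
  have hm := S₁.smoothSheaf.restrict (V := V) (D.smooth₁ z hx' x hx) (fun _ h => ⟨h.1.1.2, h.1.1.1⟩)
  have hpm := flow_mem_part hm hpV 1
  have hbz := S₁.smoothSheaf.restrict (V := V) (D.b_smooth hx' hy hw)
    (fun _ h => ⟨⟨h.1.1.2, h.1.2⟩, h.2⟩)
  have hbx := S₁.smoothSheaf.restrict (V := V) (D.b_smooth hx hy hw)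
    (fun _ h => ⟨⟨h.1.1.1, h.1.2⟩, h.2⟩)
  rw [G₁₂_eq hx' hy hw ⟨⟨hpm.1.1.2, hpm.1.2⟩, hpm.2⟩, G₁₂_eq hx hy hw ⟨⟨hp.1.1, hp.2⟩, hN⟩,
    ← flow_add hbz hm hpV]
  congr 1
  refine (sub_mem_affineSheaf_iff (add_mem hbz hm) hbx).1 ?_ p hpV
  have h := S₁.affineSheaf.restrict (V := V) (D.cocycle₁ w hw.1 z hx' x hx)
    (fun _ h => ⟨⟨(D.N_le w hw h.2).1, h.1.1.2⟩, h.1.1.1⟩)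
  have e : D.b z y w + D.m₁ z x - D.b x y w = D.m₁ z x - D.m₁ w x + D.m₁ w z := by
    unfold b
    abel
  rwa [e]

theorem flow_G₁₂ (hx : x ∈ O₁) (hy : y ∈ O₂) (hy' : z ∈ O₂) {p : S₁.carrier}
    (hp : p ∈ S₁.part (D.M₁ x ⊓ D.M₂ y ⊓ D.M₂ z)) :
    S₂.flow (D.m₂ z y) 1 (D.G₁₂ x y p) = D.G₁₂ x z p := by
  have hw := mem_overlap (D := D) hx hy hp.1
  set w := S₁.proj p with hw'
  have hN := (D.cover w hw).1
  set V := D.M₁ x ⊓ D.M₂ y ⊓ D.M₂ z ⊓ D.N w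
  have hpV : p ∈ S₁.part V := ⟨hp, hN⟩
  have hT := (D.symplecto w hw).mono (inf_le_right : V ≤ D.N w)
  have hm2 := S₂.smoothSheaf.restrict (V := V) (D.smooth₂ z hy' y hy) (fun _ h => ⟨h.1.2, h.1.1.2⟩)
  have hm := hT.smooth_le hm2
  have hby := S₁.smoothSheaf.restrict (V := V) (D.b_smooth hx hy hw) (fun _ h => ⟨h.1.1, h.2⟩)
  have hbz := S₁.smoothSheaf.restrict (V := V) (D.b_smooth hx hy' hw)
    (fun _ h => ⟨⟨h.1.1.1, h.1.2⟩, h.2⟩)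
  rw [G₁₂_eq hx hy hw ⟨hp.1, hN⟩, G₁₂_eq hx hy' hw ⟨⟨hp.1.1, hp.2⟩, hN⟩,
    ← hT.map_flow hm2 (flow_mem_part hby hpV 1), ← flow_add hm hby hpV]
  congr 1
  refine (sub_mem_affineSheaf_iff (add_mem hm hby) hbz).1 ?_ p hpV
  have h := S₂.affineSheaf.restrict (V := V) (D.cocycle₂ z hy' y hy w hw.2)
    (fun _ h => ⟨⟨h.1.2, h.1.1.2⟩, (D.N_le w hw h.2).2⟩)
  rw [hT.affine_eq] at h
  have e : D.m₂ z y + D.b x y w - D.b x z w = D.m₂ y w - D.m₂ z w + D.m₂ z y := by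
    unfold b
    abel
  rwa [e]

/-- The members of the two families of systems to be glued. -/
def sys (_ : PairGluing S₁ S₂) : (i : O₁ ⊕ O₂) →
    IntegrableSystem n (Sum.elim (fun _ : O₁ => O₁) (fun _ : O₂ => O₂) i)
  | .inl _ => S₁
  | .inr _ => S₂

/-- The base of the systems to be glued. -/
def nbhd (D : PairGluing S₁ S₂) : O₁ ⊕ O₂ → Opens X :=
  Sum.elim (fun x => D.M₁ x) fun y => D.M₂ y

/-- The transition maps between the members of the two coverings. -/
noncomputable def G (D : PairGluing S₁ S₂) : (i j : O₁ ⊕ O₂) →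
    (D.sys i).carrier → (D.sys j).carrier
  | .inl x, .inl y => S₁.flow (D.m₁ y x) 1
  | .inl x, .inr y => D.G₁₂ x y
  | .inr y, .inl x => D.G₂₁ y x
  | .inr x, .inr y => S₂.flow (D.m₂ y x) 1

theorem symplecto_G (D : PairGluing S₁ S₂) (i j : O₁ ⊕ O₂) :
    IsSymplecto (D.sys i) (D.sys j) (D.nbhd i ⊓ D.nbhd j) (D.G i j) (D.G j i) :=
  match i, j with
  | .inl x, .inl y => symplecto_m₁ x.2 y.2
  | .inl x, .inr y => symplecto_G₁₂ x.2 y.2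
  | .inr y, .inl x => (symplecto_G₁₂ x.2 y.2).symm.mono (inf_comm _ _).le
  | .inr x, .inr y => symplecto_m₂ x.2 y.2

theorem G_trans (D : PairGluing S₁ S₂) (i j k : O₁ ⊕ O₂) : ∀ p ∈ (D.sys i).part
    (D.nbhd i ⊓ D.nbhd j ⊓ D.nbhd k), D.G j k (D.G i j p) = D.G i k p := by
  -- A cocycle identity implies those obtained by rotation of the three indices.
  have rot : ∀ {i j k}, (∀ p ∈ (D.sys i).part (D.nbhd i ⊓ D.nbhd j ⊓ D.nbhd k),
      D.G j k (D.G i j p) = D.G i k p) → ∀ p ∈ (D.sys j).part (D.nbhd j ⊓ D.nbhd k ⊓ D.nbhd i),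
      D.G k i (D.G j k p) = D.G j i p := by
    intro i j k h q hq
    have H := (D.symplecto_G i j).mono (V := D.nbhd i ⊓ D.nbhd j ⊓ D.nbhd k) inf_le_left
    have K := (D.symplecto_G i k).mono (V := D.nbhd i ⊓ D.nbhd j ⊓ D.nbhd k)
      (inf_le_inf_right _ inf_le_left)
    have hq' : q ∈ (D.sys j).part (D.nbhd i ⊓ D.nbhd j ⊓ D.nbhd k) := ⟨⟨hq.2, hq.1.1⟩, hq.1.2⟩
    have hp := H.mapsTo_inv hq'
    have h1 := h _ hp
    rw [H.right_inv q hq'] at h1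
    rw [h1, K.left_inv _ hp]
  have h112 : ∀ (x z : O₁) (y : O₂), ∀ p ∈ (D.sys (.inl x)).part
      (D.nbhd (.inl x) ⊓ D.nbhd (.inl z) ⊓ D.nbhd (.inr y)),
      D.G (.inl z) (.inr y) (D.G (.inl x) (.inl z) p) = D.G (.inl x) (.inr y) p :=
    fun x z y p hp => G₁₂_flow x.2 z.2 y.2 hp
  have h122 : ∀ (x : O₁) (y z : O₂), ∀ p ∈ (D.sys (.inl x)).part
      (D.nbhd (.inl x) ⊓ D.nbhd (.inr y) ⊓ D.nbhd (.inr z)),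
      D.G (.inr y) (.inr z) (D.G (.inl x) (.inr y) p) = D.G (.inl x) (.inr z) p :=
    fun x y z p hp => flow_G₁₂ x.2 y.2 z.2 hp
  match i, j, k with
  | .inl x, .inl y, .inl z => exact fun p hp => flow_m₁_trans x.2 y.2 z.2 hp
  | .inl x, .inl y, .inr z => exact h112 x y z
  | .inl x, .inr y, .inl z => exact rot (h112 z x y)
  | .inr x, .inl y, .inl z => exact rot (rot (h112 y z x))
  | .inl x, .inr y, .inr z => exact h122 x y z
  | .inr x, .inl y, .inr z => exact rot (rot (h122 y z x))
  | .inr x, .inr y, .inl z => exact rot (h122 z x y)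
  | .inr x, .inr y, .inr z => exact fun p hp => flow_m₂_trans x.2 y.2 z.2 hp

open Classical in
/-- The gluing data of the members of both coverings. -/
noncomputable def toSystemGluing (D : PairGluing S₁ S₂) (hne : ∃ x, x ∈ O₁ ⊔ O₂) :
    SystemGluing n (O₁ ⊔ O₂) :=
  have hsel : ∀ x ∈ O₁ ⊔ O₂, ∃ i, x ∈ D.nbhd i := fun x hx => by
    rcases hx with hx | hx
    · exact ⟨.inl ⟨x, hx⟩, (D.cover₁ x hx).1⟩
    · exact ⟨.inr ⟨x, hx⟩, (D.cover₂ x hx).1⟩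
  { ι := O₁ ⊕ O₂
    base := Sum.elim (fun _ => O₁) fun _ => O₂
    sys := D.sys
    N := D.nbhd
    N_base := by
      rintro (x | y)
      · exact (D.cover₁ x x.2).2
      · exact (D.cover₂ y y.2).2
    N_le := by
      rintro (x | y)
      · exact (D.cover₁ x x.2).2.trans le_sup_left
      · exact (D.cover₂ y y.2).2.trans le_sup_right
    sel := fun x => if hx : x ∈ O₁ ⊔ O₂ then (hsel x hx).choose
      else (hsel _ hne.choose_spec).choose
    mem_sel := fun x hx => by
      rw [dif_pos hx]
      exact (hsel x hx).choose_spec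
    G := D.G
    symplecto := D.symplecto_G
    G_self := by
      rintro (x | y) p hp
      · exact flow_m₁_self x.2 hp
      · exact flow_m₂_self y.2 hp
    G_trans := D.G_trans
    nonempty_base := hne }

/-- Two systems with gluing data glue to a system over the union of the base spaces. -/
theorem exists_system [T2Space X] (D : PairGluing S₁ S₂) (hne : ∃ x, x ∈ O₁ ⊓ O₂)
    (hO : ParacompactSpace ↥(O₁ ⊔ O₂)) :
    ∃ (S : IntegrableSystem n (O₁ ⊔ O₂)) (E₁ : X → S₁.carrier → S.carrier)
      (E₁i : X → S.carrier → S₁.carrier) (E₂ : X → S₂.carrier → S.carrier)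
      (E₂i : X → S.carrier → S₂.carrier),
      (∀ x ∈ O₁, IsSymplecto S₁ S (D.M₁ x) (E₁ x) (E₁i x)) ∧
      (∀ x ∈ O₂, IsSymplecto S₂ S (D.M₂ x) (E₂ x) (E₂i x)) ∧
      (∀ x ∈ O₁, ∀ y ∈ O₁, S₁.FlowRel (D.M₁ x ⊓ D.M₁ y) (E₁ x) (E₁ y) (D.m₁ x y)) ∧
      (∀ x ∈ O₂, ∀ y ∈ O₂, S₂.FlowRel (D.M₂ x ⊓ D.M₂ y) (E₂ x) (E₂ y) (D.m₂ x y)) ∧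
      ∀ x ∈ O₁ ⊓ O₂, S₁.FlowRel (D.N x) (E₂ x ∘ D.T x) (E₁ x) (D.b x x x) := by
  classical
  obtain ⟨x₀, hx₀⟩ := hne
  let Γ := D.toSystemGluing ⟨x₀, Or.inl hx₀.1⟩
  let i₁ : X → O₁ := fun x => if hx : x ∈ O₁ then ⟨x, hx⟩ else ⟨x₀, hx₀.1⟩
  let i₂ : X → O₂ := fun x => if hx : x ∈ O₂ then ⟨x, hx⟩ else ⟨x₀, hx₀.2⟩
  have hi₁ : ∀ x ∈ O₁, (i₁ x : X) = x := fun x hx => by simp [i₁, hx]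
  have hi₂ : ∀ x ∈ O₂, (i₂ x : X) = x := fun x hx => by simp [i₂, hx]
  have hE₁ : ∀ x ∈ O₁, IsSymplecto S₁ (Γ.system hO) (D.M₁ x) (Γ.incl (.inl (i₁ x)))
      (Γ.inclInv (.inl (i₁ x))) := fun x hx => by
    have h : IsSymplecto S₁ (Γ.system hO) (D.M₁ (i₁ x)) (Γ.incl (.inl (i₁ x)))
      (Γ.inclInv (.inl (i₁ x))) := SystemGluing.isSymplecto_incl (D := Γ) (i := .inl (i₁ x)) hO
    rwa [hi₁ x hx] at h
  have hE₂ : ∀ x ∈ O₂, IsSymplecto S₂ (Γ.system hO) (D.M₂ x) (Γ.incl (.inr (i₂ x)))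
      (Γ.inclInv (.inr (i₂ x))) := fun x hx => by
    have h : IsSymplecto S₂ (Γ.system hO) (D.M₂ (i₂ x)) (Γ.incl (.inr (i₂ x)))
      (Γ.inclInv (.inr (i₂ x))) := SystemGluing.isSymplecto_incl (D := Γ) (i := .inr (i₂ x)) hO
    rwa [hi₂ x hx] at h
  refine ⟨Γ.system hO, fun x => Γ.incl (.inl (i₁ x)), fun x => Γ.inclInv (.inl (i₁ x)),
    fun x => Γ.incl (.inr (i₂ x)), fun x => Γ.inclInv (.inr (i₂ x)), hE₁, hE₂,
    fun x hx y hy => ⟨D.smooth₁ x hx y hy, fun p hp => ?_⟩,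
    fun x hx y hy => ⟨D.smooth₂ x hx y hy, fun p hp => ?_⟩,
    fun x hx => ⟨S₁.smoothSheaf.restrict (b_smooth hx.1 hx.2 hx)
      (fun _ h => ⟨D.N_le x hx h, h⟩), fun p hp => ?_⟩⟩
  · have h := SystemGluing.incl_G (D := Γ) (i := .inl (i₁ y)) (j := .inl (i₁ x)) (p := p) (by
      show S₁.proj p ∈ D.M₁ (i₁ y) ⊓ D.M₁ (i₁ x)
      rw [hi₁ x hx, hi₁ y hy]
      exact ⟨hp.2, hp.1⟩)
    have e : Γ.G (.inl (i₁ y)) (.inl (i₁ x)) p = S₁.flow (D.m₁ (i₁ x) (i₁ y)) 1 p := rfl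
    rw [e, hi₁ x hx, hi₁ y hy] at h
    exact h.symm
  · have h := SystemGluing.incl_G (D := Γ) (i := .inr (i₂ y)) (j := .inr (i₂ x)) (p := p) (by
      show S₂.proj p ∈ D.M₂ (i₂ y) ⊓ D.M₂ (i₂ x)
      rw [hi₂ x hx, hi₂ y hy]
      exact ⟨hp.2, hp.1⟩)
    have e : Γ.G (.inr (i₂ y)) (.inr (i₂ x)) p = S₂.flow (D.m₂ (i₂ x) (i₂ y)) 1 p := rfl
    rw [e, hi₂ x hx, hi₂ y hy] at h
    exact h.symm
  · have h := SystemGluing.incl_G (D := Γ) (i := .inl (i₁ x)) (j := .inr (i₂ x)) (p := p) (by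
      show S₁.proj p ∈ D.M₁ (i₁ x) ⊓ D.M₂ (i₂ x)
      rw [hi₁ x hx.1, hi₂ x hx.2]
      exact D.N_le x hx hp)
    have e : Γ.G (.inl (i₁ x)) (.inr (i₂ x)) p = D.G₁₂ (i₁ x) (i₂ x) p := rfl
    rw [e, hi₁ x hx.1, hi₂ x hx.2, G₁₂_eq hx.1 hx.2 hx ⟨D.N_le x hx hp, hp⟩] at h
    exact h.symm

end PairGluing

section Glue

variable {n : ℕ} {X : Type u} [TopologicalSpace X]

theorem RoughEquiv.exists_flowRel {U U' V : Opens X} {S : IntegrableSystem n U}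
    {T : IntegrableSystem n U'} (Φ : RoughEquiv S T V) (hVU : V ≤ U) (hS : S.SymplectomorphismHyp)
    {x y z : X} (hx : x ∈ V) (hy : y ∈ V) (hz : z ∈ Φ.nbhd x ⊓ Φ.nbhd y) :
    ∃ W : Opens X, z ∈ W ∧ W ≤ Φ.nbhd x ⊓ Φ.nbhd y ∧ ∃ a, S.FlowRel W (Φ.map x) (Φ.map y) a :=
  FlowRel.exists_of_stratum hS ((Φ.isSymplecto hx).mono inf_le_left)
    ((Φ.isSymplecto hy).mono inf_le_right) (Φ.admissible x hx y hy).stratum_mem hz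
    (hVU ((Φ.cover x hx).2 hz.1))

variable {O₁ O₂ : Opens X} {S₁ : IntegrableSystem n O₁} {S₂ : IntegrableSystem n O₂}
  {S₀ : IntegrableSystem n (O₁ ⊓ O₂)}

/-- If the overlap is empty, so are both base spaces: the inverse of a rough equivalence is a map
into the carrier of the reference system. -/
theorem isEmpty_carrier (h : ¬∃ x, x ∈ O₁ ⊓ O₂) {O : Opens X} {S : IntegrableSystem n O}
    {V : Opens X} (Ψ : RoughEquiv S₀ S V) : IsEmpty S.carrier :=
  ⟨fun p => h ⟨_, S₀.proj_mem ((Ψ.map (S.proj p)).symm p)⟩⟩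

theorem glues_of_isEmpty (h : ¬∃ x, x ∈ O₁ ⊓ O₂) (Ψ₁ : RoughEquiv S₀ S₁ (O₁ ⊓ O₂))
    (Ψ₂ : RoughEquiv S₀ S₂ (O₁ ⊓ O₂)) : Glues Ψ₁ Ψ₂ := by
  have e₁ := isEmpty_carrier h Ψ₁
  have e₂ := isEmpty_carrier h Ψ₂
  have hO₁ : ∀ x, x ∉ O₁ := fun x hx => by
    obtain ⟨p, -⟩ := S₁.proj_onto x hx
    exact e₁.elim p
  have hO₂ : ∀ x, x ∉ O₂ := fun x hx => by
    obtain ⟨p, -⟩ := S₂.proj_onto x hx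
    exact e₂.elim p
  have hS : ∀ V : Opens X, V = O₁ → ∃ S : IntegrableSystem n V, IsEmpty S.carrier := by
    rintro _ rfl
    exact ⟨S₁, e₁⟩
  obtain ⟨S, e⟩ := hS (O₁ ⊔ O₂) (Opens.ext (Set.ext fun x =>
    ⟨fun hx => hx.elim (fun h => h) fun h => absurd h (hO₂ x), fun hx => absurd hx (hO₁ x)⟩))
  refine ⟨S, RoughEquiv.ofIsSymplecto (fun _ => ⊥) (fun x hx => absurd hx (hO₁ x))
    (fun _ => isEmptyElim) (fun _ => isEmptyElim) (fun x hx => absurd hx (hO₁ x))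
    (fun x hx => absurd hx (hO₁ x)), RoughEquiv.ofIsSymplecto (fun _ => ⊥)
    (fun x hx => absurd hx (hO₂ x)) (fun _ => isEmptyElim) (fun _ => isEmptyElim)
    (fun x hx => absurd hx (hO₂ x)) (fun x hx => absurd hx (hO₂ x)), fun x hx => absurd ⟨x, hx⟩ h⟩

/-- If `μ₂ - μ₁` is a sum of classes `l₁` and `l₂` on the two base spaces, then the systems, twisted
by `l₁` and `-l₂`, have the same transition functions over the overlap. -/
theorem glues_of_mem_sumOfImages [T2Space X] (hO : ParacompactSpace ↥(O₁ ⊔ O₂))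
    {Ψ₁ : RoughEquiv S₀ S₁ (O₁ ⊓ O₂)} {Ψ₂ : RoughEquiv S₀ S₂ (O₁ ⊓ O₂)}
    {μ₁ μ₂ : S₀.H1ZmodR (O₁ ⊓ O₂)} (hμ₁ : Ψ₁.IsLagrangianClass μ₁)
    (hμ₂ : Ψ₂.IsLagrangianClass μ₂) (h : μ₂ - μ₁ ∈ sumOfImages Ψ₁ Ψ₂) : Glues Ψ₁ Ψ₂ := by
  by_cases hne : ∃ x, x ∈ O₁ ⊓ O₂
  swap
  · exact glues_of_isEmpty hne Ψ₁ Ψ₂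
  obtain ⟨N₁, hN₁, hNΨ₁, a₁, rfl, ha₁⟩ := (Ψ₁.isLagrangianClass_iff _).1 hμ₁
  obtain ⟨N₂, hN₂, hNΨ₂, a₂, rfl, ha₂⟩ := (Ψ₂.isLagrangianClass_iff _).1 hμ₂
  obtain ⟨_, ⟨l₁, rfl⟩, _, ⟨l₂, rfl⟩, h⟩ := AddSubgroup.mem_sup.1 h
  obtain ⟨l₁, rfl⟩ := CechH1.mk_surjective l₁
  obtain ⟨l₂, rfl⟩ := CechH1.mk_surjective l₂
  have e₁ : Ψ₁.resZmodR inf_le_left (CechH1.mk _ _ _ l₁) = CechH1.mk _ _ _ ⟨l₁, _⟩ := rfl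
  have e₂ : Ψ₂.resZmodR inf_le_right (CechH1.mk _ _ _ l₂) = CechH1.mk _ _ _ ⟨l₂, _⟩ := rfl
  rw [e₁, e₂, ← map_add, ← map_sub, eq_comm, CechH1.mk_eq_iff] at h
  obtain ⟨Nc, hNc, c, hc, hac⟩ := h
  obtain ⟨l₁, M₁, hM₁, hl₁, hl₁'⟩ := l₁
  obtain ⟨l₂, M₂, hM₂, hl₂, hl₂'⟩ := l₂
  obtain ⟨a₁, ha₁Z⟩ := a₁
  obtain ⟨a₂, ha₂Z⟩ := a₂
  simp only at ha₁ ha₂ hac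
  let N : X → Opens X := fun x => N₁ x ⊓ N₂ x ⊓ Nc x ⊓ (M₁ x ⊓ M₂ x)
  have hNΨ₁' : ∀ x ∈ O₁ ⊓ O₂, N x ≤ Ψ₁.nbhd x := fun x hx z hz => hNΨ₁ x hx hz.1.1.1
  have hNΨ₂' : ∀ x ∈ O₁ ⊓ O₂, N x ≤ Ψ₂.nbhd x := fun x hx z hz => hNΨ₂ x hx hz.1.1.2
  have s₁ := fun x hx => (Ψ₁.isSymplecto hx).mono (hNΨ₁' x hx)
  have s₂ := fun x hx => (Ψ₂.isSymplecto hx).mono (hNΨ₂' x hx)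
  let D : PairGluing S₁ S₂ :=
    { M₁ := M₁
      cover₁ := hM₁
      m₁ := l₁
      smooth₁ := hl₁
      cocycle₁ := hl₁'
      M₂ := M₂
      cover₂ := hM₂
      m₂ := -l₂
      smooth₂ := fun x hx y hy => neg_mem (hl₂ x hx y hy)
      cocycle₂ := fun x hx y hy z hz => by
        have h := neg_mem (hl₂' x hx y hy z hz)
        have e : -cechD1 X l₂ x y z = (-l₂) y z - (-l₂) x z + (-l₂) x y := by
          show -(l₂ y z - l₂ x z + l₂ x y) = -l₂ y z - -l₂ x z + -l₂ x y
          ring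
        rwa [e] at h
      N := N
      cover := fun x hx => ⟨⟨⟨⟨(hN₁ x hx).1, (hN₂ x hx).1⟩, (hNc x hx).1⟩, (hM₁ x hx.1).1,
        (hM₂ x hx.2).1⟩, fun z hz => (hN₁ x hx).2 hz.1.1.1⟩
      N_le := fun x hx => inf_le_right
      T := fun x => Ψ₂.map x ∘ (Ψ₁.map x).symm
      Ti := fun x => Ψ₁.map x ∘ (Ψ₂.map x).symm
      symplecto := fun x hx => (s₁ x hx).symm.trans (s₂ x hx)
      a := fun x y => a₂ x y + -a₁ x y
      flowRel := fun x hx y hy => by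
        have i₁ : N x ⊓ N y ≤ N₁ x ⊓ N₁ y := fun z hz => ⟨hz.1.1.1.1, hz.2.1.1.1⟩
        have i₂ : N x ⊓ N y ≤ N₂ x ⊓ N₂ y := fun z hz => ⟨hz.1.1.1.2, hz.2.1.1.2⟩
        exact FlowRel.comp ((s₁ x hx).mono inf_le_left).symm
          (FlowRel.inv ((s₁ x hx).mono inf_le_left) ((s₁ y hy).mono inf_le_right)
            ((ha₁ x hx y hy).mono i₁)) ((ha₂ x hx y hy).mono i₂)
      c := c
      smooth := fun x hx => by
        rw [(s₁ x hx).smooth_eq]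
        exact S₀.smoothSheaf.restrict (hc x hx) fun z hz => hz.1.2
      compat := fun x hx y hy => by
        rw [((s₁ x hx).mono (inf_le_left : N x ⊓ N y ≤ N x)).affine_eq]
        have h := S₀.affineSheaf.restrict (V := N x ⊓ N y) (hac x hx y hy)
          fun z hz => ⟨hz.1.1.2, hz.2.1.2⟩
        have e : (a₂ - a₁ - (l₁ + l₂) - cechD0 X c) x y =
            a₂ x y + -a₁ x y - l₁ x y + (-l₂) x y - (c y - c x) := by
          show a₂ x y - a₁ x y - (l₁ x y + l₂ x y) - (c y - c x) =
            a₂ x y + -a₁ x y - l₁ x y + -l₂ x y - (c y - c x)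
          ring
        rw [← e]
        exact h }
  obtain ⟨S, E₁, E₁i, E₂, E₂i, hE₁, hE₂, hr₁, hr₂, hr⟩ := D.exists_system hne hO
  refine ⟨S, RoughEquiv.ofIsSymplecto M₁ hM₁ E₁ E₁i hE₁ fun x hx y hy => ?_,
    RoughEquiv.ofIsSymplecto M₂ hM₂ E₂ E₂i hE₂ fun x hx y hy => ?_, fun x hx => ?_⟩
  · exact FlowRel.isAdmissible ((hE₁ x hx).mono inf_le_left) ((hE₁ y hy).mono inf_le_right)
      fun z hz => ⟨_, hz, le_rfl, _, hr₁ x hx y hy⟩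
  · exact FlowRel.isAdmissible ((hE₂ x hx).mono inf_le_left) ((hE₂ y hy).mono inf_le_right)
      fun z hz => ⟨_, hz, le_rfl, _, hr₂ x hx y hy⟩
  · have iM₁ : N x ≤ M₁ x := fun z hz => hz.2.1
    have iM₂ : N x ≤ M₂ x := fun z hz => hz.2.2
    refine ⟨N x, (D.cover x hx).1, le_inf (le_inf (hNΨ₁' x hx) (hNΨ₂' x hx)) (le_inf iM₁ iM₂), ?_⟩
    have r := FlowRel.comp (s₁ x hx) (⟨zero_mem _, fun p hp => by
      rw [flow_const (zero_mem ((constSheaf X).sec (N x))) hp]⟩ :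
        S₀.FlowRel (N x) (Ψ₁.map x) (Ψ₁.map x) 0) (hr x hx)
    refine FlowRel.isAdmissible (φ := E₂ x ∘ Ψ₂.map x) (φi := (Ψ₂.map x).symm ∘ E₂i x)
      (ψ := E₁ x ∘ Ψ₁.map x) ((s₂ x hx).trans ((hE₂ x hx.2).mono iM₂))
      ((s₁ x hx).trans ((hE₁ x hx.1).mono iM₁)) fun z hz =>
        ⟨N x, hz, le_rfl, _, r.1, fun p hp => (r.2 p hp).trans ?_⟩
    exact congrArg (fun q => E₂ x (Ψ₂.map x q)) ((s₁ x hx).left_inv _ (flow_mem_part r.1 hp 1))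

/-- Rough equivalences to a system over the union of the base spaces determine rough equivalences
from the common reference system, with respect to which the systems glue. -/
theorem exists_roughEquiv_of_glued [T2Space X] (Ψ₁ : RoughEquiv S₀ S₁ (O₁ ⊓ O₂))
    (h₁ : S₁.SymplectomorphismHyp) (h₂ : S₂.SymplectomorphismHyp) (h₀ : S₀.SymplectomorphismHyp)
    {S : IntegrableSystem n (O₁ ⊔ O₂)} (Θ₁ : RoughEquiv S₁ S O₁) (Θ₂ : RoughEquiv S₂ S O₂) :
    ∃ (Φ₂ : RoughEquiv S₀ S₂ (O₁ ⊓ O₂)) (μ₁ μ₂ : S₀.H1ZmodR (O₁ ⊓ O₂)),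
      Ψ₁.IsLagrangianClass μ₁ ∧ Φ₂.IsLagrangianClass μ₂ ∧ μ₂ - μ₁ ∈ sumOfImages Ψ₁ Φ₂ := by
  let N : X → Opens X := fun x => Ψ₁.nbhd x ⊓ (Θ₁.nbhd x ⊓ Θ₂.nbhd x)
  have sΨ := fun x hx => (Ψ₁.isSymplecto (x := x) hx).mono (inf_le_left : N x ≤ _)
  have s₁ := fun x (hx : x ∈ O₁ ⊓ O₂) => (Θ₁.isSymplecto hx.1).mono
    (inf_le_right.trans inf_le_left : N x ≤ _)
  have s₂ := fun x (hx : x ∈ O₁ ⊓ O₂) => (Θ₂.isSymplecto hx.2).mono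
    (inf_le_right.trans inf_le_right : N x ≤ _)
  have sΦ := fun x hx => ((sΨ x hx).trans (s₁ x hx)).trans (s₂ x hx).symm
  have hadm : ∀ x ∈ O₁ ⊓ O₂, ∀ y ∈ O₁ ⊓ O₂, S₀.IsAdmissible (N x ⊓ N y)
      ((((Ψ₁.map x).symm ∘ (Θ₁.map x).symm) ∘ Θ₂.map x) ∘
        ((Θ₂.map y).symm ∘ (Θ₁.map y ∘ Ψ₁.map y))) := fun x hx y hy => by
    refine FlowRel.isAdmissible ((sΦ x hx).mono inf_le_left) ((sΦ y hy).mono inf_le_right)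
      fun z hz => ?_
    obtain ⟨W, hzW, hW, a, ha⟩ := Ψ₁.exists_flowRel le_rfl h₀ hx hy (z := z) ⟨hz.1.1, hz.2.1⟩
    obtain ⟨W₁, hzW₁, hW₁, l₁, hl₁⟩ := Θ₁.exists_flowRel le_rfl h₁ hx.1 hy.1 (z := z)
      ⟨hz.1.2.1, hz.2.2.1⟩
    obtain ⟨W₂, hzW₂, hW₂, l₂, hl₂⟩ := Θ₂.exists_flowRel le_rfl h₂ hx.2 hy.2 (z := z)
      ⟨hz.1.2.2, hz.2.2.2⟩
    let V := W ⊓ W₁ ⊓ W₂ ⊓ (N x ⊓ N y)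
    have iV : V ≤ N x ⊓ N y := inf_le_right
    have r1 := FlowRel.comp ((sΨ x hx).mono (iV.trans inf_le_left))
      (ha.mono (V' := V) fun _ h => h.1.1.1) (hl₁.mono fun _ h => h.1.1.2)
    have r2 := FlowRel.inv ((s₂ x hx).mono (iV.trans inf_le_left))
      ((s₂ y hy).mono (iV.trans inf_le_right)) (hl₂.mono fun _ h => h.1.2)
    exact ⟨V, ⟨⟨⟨hzW, hzW₁⟩, hzW₂⟩, hz⟩, iV, _,
      FlowRel.comp (((sΨ x hx).trans (s₁ x hx)).mono (iV.trans inf_le_left)) r1 r2⟩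
  let Φ₂ : RoughEquiv S₀ S₂ (O₁ ⊓ O₂) := RoughEquiv.ofIsSymplecto N
    (fun x hx => ⟨⟨(Ψ₁.cover x hx).1, (Θ₁.cover x hx.1).1, (Θ₂.cover x hx.2).1⟩,
      inf_le_left.trans (Ψ₁.cover x hx).2⟩) _ _ sΦ hadm
  obtain ⟨μ₁, hμ₁⟩ := Ψ₁.exists_isLagrangianClass S₀.paracompact le_rfl h₀
  obtain ⟨μ₂, hμ₂⟩ := Φ₂.exists_isLagrangianClass S₀.paracompact le_rfl h₀
  refine ⟨Φ₂, μ₁, μ₂, hμ₁, hμ₂, sub_mem_sumOfImages Θ₁ Θ₂ h₁ h₂ (fun x hx => ?_) hμ₁ hμ₂⟩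
  refine ⟨N x, ⟨(Ψ₁.cover x hx).1, (Θ₁.cover x hx.1).1, (Θ₂.cover x hx.2).1⟩,
    le_inf (le_inf inf_le_left le_rfl) inf_le_right, 0, zero_mem _, fun p hp => ?_⟩
  rw [flow_const (zero_mem ((constSheaf X).sec (N x))) hp]
  exact ((s₂ x hx).right_inv _ ((s₁ x hx).mapsTo ((sΨ x hx).mapsTo hp))).symm

end Glue

/-! ### Fine sheaves and the connecting homomorphism -/

theorem constSheaf_congr {X : Type u} [TopologicalSpace X] {W : Opens X} {f g : X → ℝ}
    (hf : f ∈ (constSheaf X).sec W) (h : ∀ x ∈ W, g x = f x) : g ∈ (constSheaf X).sec W :=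
  fun x hx => by
    filter_upwards [hf x hx, W.isOpen.mem_nhds hx] with y hy hyW
    rw [h y hyW, h x hx, hy]

namespace IntegrableSystem

variable {n : ℕ} {X : Type u} [TopologicalSpace X] {U : Opens X} {S : IntegrableSystem n U}

theorem const_le_smooth (W : Opens X) : (constSheaf X).sec W ≤ S.smoothSheaf.sec W := fun _ h =>
  affine_le_smooth (S.const_le_affine W h)

/-- A family of smooth functions on the base subordinate to an open covering, with sum one. -/
structure IsPartition (S : IntegrableSystem n U) (N : X → Opens X) (ρ : X → X → ℝ) : Prop where
  smooth : ∀ i, ρ i ∈ S.smoothSheaf.sec U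
  vanish : ∀ i, ∀ x ∈ U, ¬ (i ∈ U ∧ x ∈ N i) → ∀ᶠ y in 𝓝 x, ρ i y = 0
  finite : ∀ x ∈ U, ∃ t ∈ 𝓝 x, {i | ∃ y ∈ t, ρ i y ≠ 0}.Finite
  sum : ∀ x ∈ U, ∑ᶠ i, ρ i x = 1

theorem FineHyp.exists_partition (h : S.FineHyp) {N : X → Opens X} (hN : IsPointCover U N) :
    ∃ ρ, S.IsPartition N ρ := by
  classical
  obtain ⟨ρ, h1, h2, h3, h4⟩ := h X (fun i => if i ∈ U then N i else ⊥)
    fun x hx => ⟨x, by rw [if_pos hx]; exact (hN x hx).1⟩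
  refine ⟨ρ, h1, fun i x hx hi => h2 i x hx fun hm => hi ?_, h3, h4⟩
  split_ifs at hm with hiU
  · exact ⟨hiU, hm⟩
  · exact hm.elim

namespace IsPartition

variable {N : X → Opens X} {ρ : X → X → ℝ}

/-- The average of a family of functions with respect to a partition of unity. -/
noncomputable def avg (ρ : X → X → ℝ) (g : X → X → ℝ) (p : X) : ℝ := ∑ᶠ w, ρ w p * g w p

theorem avg_smooth (h : S.IsPartition N ρ) {W : Opens X} {g : X → X → ℝ}
    (hg : ∀ w ∈ U, g w ∈ S.smoothSheaf.sec (N w ⊓ W)) : avg ρ g ∈ S.smoothSheaf.sec W := by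
  intro p hp
  refine ContMDiffAt.contMDiffWithinAt ?_
  refine contMDiffAt_finsum (f := fun w (q : S.carrier) => ρ w (S.proj q) * g w (S.proj q)) ?_ ?_
  · intro q
    obtain ⟨t, ht, hf⟩ := h.finite _ (S.proj_mem q)
    refine ⟨_, S.continuous_proj.continuousAt.preimage_mem_nhds ht, hf.subset ?_⟩
    rintro w ⟨r, hr, hrt⟩
    exact ⟨_, hrt, left_ne_zero_of_mul hr⟩
  · intro w
    by_cases hw : w ∈ U ∧ S.proj p ∈ N w
    · have h1 := ContMDiffOn.contMDiffAt (f := ρ w ∘ S.proj) (h.smooth w)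
        ((S.isOpen_part U).mem_nhds (S.proj_mem p))
      have h2 := ContMDiffOn.contMDiffAt (f := g w ∘ S.proj) (hg w hw.1)
        ((S.isOpen_part _).mem_nhds ⟨hw.2, hp⟩)
      exact h1.mul h2
    · refine (contMDiffAt_const (c := (0 : ℝ))).congr_of_eventuallyEq ?_
      filter_upwards [S.continuous_proj.continuousAt.eventually (h.vanish w _ (S.proj_mem p) hw)]
        with q hq
      rw [hq, zero_mul]

theorem finite_support (h : S.IsPartition N ρ) {p : X} (hp : p ∈ U) (α : X → ℝ) :
    (Function.support fun w => ρ w p * α w).Finite := by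
  obtain ⟨t, ht, hf⟩ := h.finite p hp
  exact hf.subset fun w hw => ⟨p, mem_of_mem_nhds ht, left_ne_zero_of_mul hw⟩

theorem avg_sub (h : S.IsPartition N ρ) {p : X} (hp : p ∈ U) (f g : X → X → ℝ) :
    avg ρ (f - g) p = avg ρ f p - avg ρ g p := by
  refine Eq.trans ?_ (finsum_sub_distrib (h.finite_support hp fun w => f w p)
    (h.finite_support hp fun w => g w p))
  exact finsum_congr fun w => mul_sub _ _ _

theorem avg_eq (h : S.IsPartition N ρ) {p : X} (hp : p ∈ U) {f : X → X → ℝ} {c : ℝ}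
    (hf : ∀ w ∈ U, p ∈ N w → f w p = c) : avg ρ f p = c := by
  have h1 : avg ρ f p = ∑ᶠ w, ρ w p * c := finsum_congr fun w => by
    by_cases hw : w ∈ U ∧ p ∈ N w
    · rw [hf w hw.1 hw.2]
    · rw [(h.vanish w p hp hw).self_of_nhds, zero_mul, zero_mul]
  rw [h1, ← finsum_mul, h.sum p hp, one_mul]

end IsPartition

open IsPartition

/-- With smooth partitions of unity, a smooth cocycle `e` is the coboundary of
`x ↦ ∑ w, ρ w * e w x`. -/
theorem IsPartition.cobound_one {N : X → Opens X} {ρ : X → X → ℝ} (h : S.IsPartition N ρ)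
    (hN : IsPointCover U N) {e : X → X → X → ℝ}
    (he : ∀ x ∈ U, ∀ y ∈ U, ∀ z ∈ U, ∀ p ∈ N x ⊓ N y ⊓ N z, cechD1 X e x y z p = 0)
    {x y p : X} (hx : x ∈ U) (hy : y ∈ U) (hp : p ∈ N x ⊓ N y) :
    cechD0 X (fun x => avg ρ fun w => e w x) x y p = e x y p := by
  have hpU : p ∈ U := (hN x hx).2 hp.1
  refine (h.avg_sub hpU (fun w => e w y) fun w => e w x).symm.trans
    (h.avg_eq hpU fun w hw hpw => ?_)
  have := he w hw x hx y hy p ⟨⟨hpw, hp.1⟩, hp.2⟩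
  show e w y p - e w x p = e x y p
  change e x y p - e w y p + e w x p = 0 at this
  linarith

/-- With smooth partitions of unity, a smooth 2-cocycle `b` is the coboundary of
`x y ↦ ∑ w, ρ w * b w x y`. -/
theorem IsPartition.cobound_two {N : X → Opens X} {ρ : X → X → ℝ} (h : S.IsPartition N ρ)
    (hN : IsPointCover U N) {b : X → X → X → X → ℝ}
    (hb : ∀ x ∈ U, ∀ y ∈ U, ∀ z ∈ U, ∀ w ∈ U, ∀ p ∈ N x ⊓ N y ⊓ N z ⊓ N w,
      cechD2 X b x y z w p = 0)
    {x y z p : X} (hx : x ∈ U) (hy : y ∈ U) (hz : z ∈ U) (hp : p ∈ N x ⊓ N y ⊓ N z) :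
    cechD1 X (fun x y => avg ρ fun w => b w x y) x y z p = b x y z p := by
  have hpU : p ∈ U := (hN x hx).2 hp.1.1
  have e1 := h.avg_sub hpU (fun w => b w y z) fun w => b w x z
  have e2 := h.avg_sub hpU (fun w => b w x z - b w y z) fun w => b w x y
  have e3 := h.avg_sub hpU (fun w => b w x z) fun w => b w y z
  have e4 : avg ρ ((fun w => b w x z - b w y z) - fun w => b w x y) p = - b x y z p :=
    h.avg_eq hpU fun w hw hpw => by
      have := hb w hw x hx y hy z hz p ⟨⟨⟨hpw, hp.1.1⟩, hp.1.2⟩, hp.2⟩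
      change b x y z p - b w y z p + b w x z p - b w x y p = 0 at this
      show b w x z p - b w y z p - b w x y p = - b x y z p
      linarith
  have e5 : avg ρ (fun w => b w x z - b w y z) p =
    avg ρ ((fun w => b w x z) - fun w => b w y z) p := rfl
  show avg ρ (fun w => b w y z) p - avg ρ (fun w => b w x z) p + avg ρ (fun w => b w x y) p = _
  linarith

theorem FineHyp.connectingZ_surjective (h : S.FineHyp) :
    Function.Surjective (S.connectingZ U) := by
  intro β
  obtain ⟨⟨b, hb⟩, rfl⟩ := QuotientAddGroup.mk_surjective β
  obtain ⟨N, hN, hbc, hbz⟩ := hb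
  obtain ⟨ρ, hρ⟩ := h.exists_partition hN
  set a : X → X → X → ℝ := fun x y => avg ρ fun w => b w x y
  have key : ∀ x ∈ U, ∀ y ∈ U, ∀ z ∈ U, ∀ p ∈ N x ⊓ N y ⊓ N z, cechD1 X a x y z p = b x y z p :=
    fun x hx y hy z hz p hp => hρ.cobound_two hN hbz hx hy hz hp
  have ha : a ∈ cechZ1 S.smoothSheaf (constSheaf X) U := by
    refine ⟨N, hN, fun x hx y hy => hρ.avg_smooth fun w hw => ?_, fun x hx y hy z hz =>
      constSheaf_congr (hbc x hx y hy z hz) (key x hx y hy z hz)⟩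
    exact S.smoothSheaf.restrict (const_le_smooth _ (hbc w hw x hx y hy))
      fun z hz => ⟨⟨hz.1, hz.2.1⟩, hz.2.2⟩
  refine ⟨CechH1.mk _ _ _ ⟨a, ha⟩, ?_⟩
  refine QuotientAddGroup.eq.2 ⟨N, hN, 0, fun _ _ _ _ => zero_mem _, fun x hx y hy z hz p hp => ?_⟩
  have := key x hx y hy z hz p hp
  simp only [map_zero, sub_zero]
  show - cechD1 X a x y z p + b x y z p = 0
  linarith

theorem FineHyp.connectingZ_injective (h : S.FineHyp) :
    Function.Injective (S.connectingZ U) := by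
  rw [injective_iff_map_eq_zero]
  intro α hα
  obtain ⟨⟨a, ha⟩, rfl⟩ := CechH1.mk_surjective α
  have hα' : cechD1 X a ∈ cechB2 (constSheaf X) (zeroSheaf X) U :=
    (QuotientAddGroup.eq_zero_iff (N := (cechB2 (constSheaf X) (zeroSheaf X) U).addSubgroupOf
      (cechZ2 (constSheaf X) (zeroSheaf X) U)) ⟨cechD1 X a, _⟩).1 hα
  obtain ⟨N₁, hN₁, ha, -⟩ := ha
  obtain ⟨N₂, hN₂, c, hc, hac⟩ := hα'
  obtain ⟨ρ, hρ⟩ := h.exists_partition (hN₁.inf hN₂ le_rfl)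
  refine (QuotientAddGroup.eq_zero_iff _).2 ⟨_, hN₁.inf hN₂ le_rfl,
    fun x => avg ρ fun w => (a - c) w x, fun x hx => hρ.avg_smooth fun w hw => ?_,
    fun x hx y hy => constSheaf_congr (f := c x y)
      ((constSheaf X).restrict (hc x hx y hy) fun z hz => ⟨hz.1.2, hz.2.2⟩) fun p hp => ?_⟩
  · exact sub_mem (S.smoothSheaf.restrict (ha w hw x hx) fun z hz => ⟨hz.1.1, hz.2.1⟩)
      (const_le_smooth _ ((constSheaf X).restrict (hc w hw x hx) fun z hz => ⟨hz.1.2, hz.2.2⟩))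
  · have h1 := hρ.cobound_one (hN₁.inf hN₂ le_rfl) (e := a - c) (fun x hx y hy z hz p hp => by
      rw [map_sub]
      exact hac x hx y hy z hz p ⟨⟨hp.1.1.2, hp.1.2.2⟩, hp.2.2⟩) hx hy hp
    change _ = a x y p - c x y p at h1
    show a x y p - cechD0 X _ x y p = c x y p
    linarith

theorem FineHyp.connectingZ_bijective (h : S.FineHyp) :
    Function.Bijective (S.connectingZ U) :=
  ⟨h.connectingZ_injective, h.connectingZ_surjective⟩

/-- The map `H¹(V, ℛ) → H¹(V, 𝒵¹)`. -/
def affineToZ (S : IntegrableSystem n U) (V : Opens X) : S.H1R V →+ S.H1Z V :=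
  CechH1.map ⟨le_rfl, fun _ _ => ⟨⊤, trivial, fun _ _ _ => ⟨affine_le_smooth, le_rfl⟩⟩⟩

theorem connectingZ_affineToZ (V : Opens X) (c : S.H1R V) :
    S.connectingZ V (S.affineToZ V c) = S.dhat V c := by
  obtain ⟨a, rfl⟩ := CechH1.mk_surjective c
  rfl

/-- Exactness of `H¹(V, ℛ) → H¹(V, 𝒵¹) → H¹(V, 𝒵¹/ℛ)`. -/
theorem toZmodR_eq_zero_iff {V : Opens X} {ζ : S.H1Z V} :
    S.toZmodR V ζ = 0 ↔ ζ ∈ (S.affineToZ V).range := by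
  constructor
  · intro h
    obtain ⟨⟨a, ha⟩, rfl⟩ := CechH1.mk_surjective ζ
    obtain ⟨N₂, hN₂, c, hc, hac⟩ : a ∈ cechB1 S.smoothSheaf S.affineSheaf V :=
      (QuotientAddGroup.eq_zero_iff (N := (cechB1 S.smoothSheaf S.affineSheaf V).addSubgroupOf
        (cechZ1 S.smoothSheaf S.affineSheaf V)) ⟨a, _⟩).1 h
    obtain ⟨N₁, hN₁, ha1, ha2⟩ := ha
    have he : a - cechD0 X c ∈ cechZ1 S.affineSheaf (constSheaf X) V := by
      refine ⟨_, hN₁.inf hN₂ le_rfl, fun x hx y hy => S.affineSheaf.restrict (hac x hx y hy)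
        fun z hz => ⟨hz.1.2, hz.2.2⟩, fun x hx y hy z hz => ?_⟩
      rw [map_sub, cechD1_cechD0, sub_zero]
      exact (constSheaf X).restrict (ha2 x hx y hy z hz) fun z hz => ⟨⟨hz.1.1.1, hz.1.2.1⟩, hz.2.1⟩
    refine ⟨CechH1.mk _ _ _ ⟨_, he⟩, QuotientAddGroup.eq.2 ⟨N₂, hN₂, c, hc, fun x hx y hy => ?_⟩⟩
    have : (-(a - cechD0 X c) + a - cechD0 X c : X → X → X → ℝ) = 0 := by abel
    show (-(a - cechD0 X c) + a - cechD0 X c) x y ∈ _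
    rw [this]
    exact zero_mem _
  · rintro ⟨c, rfl⟩
    obtain ⟨⟨a, N, hN, ha, ha'⟩, rfl⟩ := CechH1.mk_surjective c
    refine (QuotientAddGroup.eq_zero_iff _).2 ⟨N, hN, 0, fun _ _ => zero_mem _, fun x hx y hy => ?_⟩
    rw [map_zero, sub_zero]
    exact ha x hx y hy

/-- The map `H²(U, ℝ) / d̂ H¹(U, ℛ) → H¹(U, 𝒵¹/ℛ)` that `H¹(U, 𝒵¹) → H¹(U, 𝒵¹/ℛ)` induces through
the isomorphism `H¹(U, 𝒵¹) ≅ H²(U, ℝ)`. -/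
noncomputable def H2modR.toZmodR (h : S.FineHyp) : S.H2modR U →+ S.H1ZmodR U :=
  QuotientAddGroup.lift (S.dhat U).range
    ((S.toZmodR U).comp (AddEquiv.ofBijective _ h.connectingZ_bijective).symm.toAddMonoidHom) (by
      rintro _ ⟨c, rfl⟩
      refine toZmodR_eq_zero_iff.2 ⟨c, ?_⟩
      refine ((AddEquiv.symm_apply_eq _).2 ?_).symm
      exact (connectingZ_affineToZ U c).symm)

theorem H2modR.toZmodR_mk (h : S.FineHyp) (ζ : S.H1Z U) :
    H2modR.toZmodR h (H2modR.mk S U (S.connectingZ U ζ)) = S.toZmodR U ζ :=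
  congrArg (S.toZmodR U) ((AddEquiv.ofBijective _ h.connectingZ_bijective).symm_apply_apply ζ)

theorem H2modR.exists_mk (h : S.FineHyp) (d : S.H2modR U) :
    ∃ ζ, d = H2modR.mk S U (S.connectingZ U ζ) := by
  obtain ⟨β, rfl⟩ := QuotientAddGroup.mk_surjective d
  obtain ⟨ζ, rfl⟩ := h.connectingZ_surjective β
  exact ⟨ζ, rfl⟩

theorem H2modR.toZmodR_injective (h : S.FineHyp) : Function.Injective (H2modR.toZmodR h) := by
  rw [injective_iff_map_eq_zero]
  intro d hd
  obtain ⟨ζ, rfl⟩ := H2modR.exists_mk h d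
  rw [H2modR.toZmodR_mk] at hd
  obtain ⟨c, rfl⟩ := toZmodR_eq_zero_iff.1 hd
  exact (QuotientAddGroup.eq_zero_iff _).2 ⟨c, (connectingZ_affineToZ U c).symm⟩

end IntegrableSystem

namespace RoughEquiv

variable {n : ℕ} {X : Type u} [TopologicalSpace X] {U U' : Opens X}
  {S : IntegrableSystem n U} {T : IntegrableSystem n U'}

theorem toZmodR_res (Φ : RoughEquiv S T U) (hU : U ≤ U') (h : S.FineHyp) (h' : T.FineHyp)
    (d : T.H2modR U') :
    H2modR.toZmodR h (Φ.resH2modR hU d) = Φ.resZmodR hU (H2modR.toZmodR h' d) := by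
  obtain ⟨ζ, rfl⟩ := H2modR.exists_mk h' d
  rw [H2modR.toZmodR_mk]
  obtain ⟨a, rfl⟩ := CechH1.mk_surjective ζ
  exact H2modR.toZmodR_mk h (CechH1.map ⟨hU, fun x hx => ⟨Φ.nbhd x, (Φ.cover x hx).1,
    fun _ hW _ => ⟨Φ.smooth_le hx hW, le_rfl⟩⟩⟩ (CechH1.mk _ _ _ a))

end RoughEquiv

theorem toZmodR_mem_sumOfImages {n : ℕ} {X : Type u} [TopologicalSpace X] {O₁ O₂ : Opens X}
    {S₁ : IntegrableSystem n O₁} {S₂ : IntegrableSystem n O₂} {S₀ : IntegrableSystem n (O₁ ⊓ O₂)}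
    (Ψ₁ : RoughEquiv S₀ S₁ (O₁ ⊓ O₂)) (Ψ₂ : RoughEquiv S₀ S₂ (O₁ ⊓ O₂))
    (h₁ : S₁.FineHyp) (h₂ : S₂.FineHyp) (h₀ : S₀.FineHyp) {d : S₀.H2modR (O₁ ⊓ O₂)}
    (hd : d ∈ sumOfImagesH2 Ψ₁ Ψ₂) : H2modR.toZmodR h₀ d ∈ sumOfImages Ψ₁ Ψ₂ := by
  obtain ⟨_, ⟨d₁, rfl⟩, _, ⟨d₂, rfl⟩, rfl⟩ := AddSubgroup.mem_sup.1 hd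
  rw [map_add, Ψ₁.toZmodR_res inf_le_left h₀ h₁, Ψ₂.toZmodR_res inf_le_right h₀ h₂]
  exact add_mem (AddSubgroup.mem_sup_left ⟨_, rfl⟩) (AddSubgroup.mem_sup_right ⟨_, rfl⟩)

/-! ### Regular points -/

namespace IntegrableSystem

variable {n : ℕ} {X : Type u} [TopologicalSpace X] {U : Opens X} {S : IntegrableSystem n U}
  {W W' : Opens X} {f : Fin n → X → ℝ} {g : X → ℝ} {r p q : S.carrier}

/-- The differential at `r` of a function on the base, read in the chart at `r`. -/
noncomputable def covec (S : IntegrableSystem n U) (g : X → ℝ) (r : S.carrier) :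
    PhaseSpace n →L[ℝ] ℝ :=
  fderiv ℝ ((g ∘ S.proj) ∘ (chartAt (PhaseSpace n) r).symm) (chartAt (PhaseSpace n) r r)

theorem differentiableAt_chart (hg : g ∈ S.smoothSheaf.sec W) (hr : r ∈ S.part W) :
    DifferentiableAt ℝ ((g ∘ S.proj) ∘ (chartAt (PhaseSpace n) r).symm)
      (chartAt (PhaseSpace n) r r) := by
  have h := contDiffOn_comp_chart_symm (H := g ∘ S.proj) hg r
  refine (h.contDiffAt (((chartAt (PhaseSpace n) r).isOpen_inter_preimage_symm
    (S.isOpen_part W)).mem_nhds ⟨mem_chart_target _ r, ?_⟩)).differentiableAt (by simp)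
  rw [mem_preimage, (chartAt (PhaseSpace n) r).left_inv (mem_chart_source _ r)]
  exact hr

theorem dAt_eq_covec (hg : g ∈ S.smoothSheaf.sec W) (hr : r ∈ S.part W) :
    dAt (n := n) (g ∘ S.proj) r = S.covec g r := by
  have h : MDifferentiableAt 𝓘(ℝ, PhaseSpace n) 𝓘(ℝ, ℝ) (g ∘ S.proj) r :=
    mdifferentiableAt_of_contMDiffOn hg hr
  unfold dAt covec
  rw [h.mfderiv]
  simp [mfld_simps, writtenInExtChartAt, fderivWithin_univ]
  rfl

theorem sum_mem_smoothSheaf (hf : ∀ i, f i ∈ S.smoothSheaf.sec W) (s : Finset (Fin n))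
    (v : Fin n → ℝ) : ∑ i ∈ s, v i • f i ∈ S.smoothSheaf.sec W :=
  sum_mem fun i _ => smul_mem_smoothSheaf (v i) (hf i)

theorem covec_add {h : X → ℝ} (hg : g ∈ S.smoothSheaf.sec W) (hh : h ∈ S.smoothSheaf.sec W)
    (hr : r ∈ S.part W) : S.covec (g + h) r = S.covec g r + S.covec h r :=
  fderiv_add (differentiableAt_chart hg hr) (differentiableAt_chart hh hr)

theorem covec_smul (c : ℝ) (hg : g ∈ S.smoothSheaf.sec W) (hr : r ∈ S.part W) :
    S.covec (c • g) r = c • S.covec g r :=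
  fderiv_const_smul (differentiableAt_chart hg hr) c

theorem covec_sum (hf : ∀ i, f i ∈ S.smoothSheaf.sec W) (hr : r ∈ S.part W) (v : Fin n → ℝ) :
    S.covec (∑ i, v i • f i) r = ∑ i, v i • S.covec (f i) r := by
  have : ∀ s : Finset (Fin n), S.covec (∑ i ∈ s, v i • f i) r = ∑ i ∈ s, v i • S.covec (f i) r := by
    intro s
    induction s using Finset.cons_induction with
    | empty =>
      simp only [Finset.sum_empty]
      exact fderiv_const_apply (𝕜 := ℝ) (0 : ℝ)
    | cons i s hi ih =>
      rw [Finset.sum_cons, Finset.sum_cons, covec_add (smul_mem_smoothSheaf (v i) (hf i))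
        (sum_mem_smoothSheaf hf s v) hr, covec_smul _ (hf i) hr, ih]
  exact this _

/-- The Hamiltonian vector of a function on the base, read in the chart at `r`. -/
theorem exists_hamiltonian_vector (hg : g ∈ S.smoothSheaf.sec W) (hr : r ∈ S.part W) :
    ∃ v : PhaseSpace n, HasDerivAt (fun t => chartAt (PhaseSpace n) r (S.flow g t r)) v 0 ∧
      ∀ a, formInChart S.form r (chartAt (PhaseSpace n) r r) ![v, a] = S.covec g r a := by
  obtain ⟨v, -, hv, hc, -⟩ := exists_chart_field S.symplectic (S.isOpen_part W) hg r
  have h0 : S.flow g 0 r = r := flow_zero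
  refine ⟨v (chartAt (PhaseSpace n) r r), ?_, hv _ ⟨mem_chart_target _ r, ?_⟩⟩
  · have h := hc (fun t => S.flow g t r) 0 (by
      simp only [h0]; exact ⟨mem_chart_source _ r, hr⟩) ((isFlowLine_flow hg hr).2 0)
    simp only [h0] at h
    exact h
  · rw [mem_preimage, (chartAt (PhaseSpace n) r).left_inv (mem_chart_source _ r)]
    exact hr

theorem covec_eq_zero_of_fixed (hg : g ∈ S.smoothSheaf.sec W) (hr : r ∈ S.part W)
    (h : ∀ t, S.flow g t r = r) : S.covec g r = 0 := by
  obtain ⟨v, hv, hc⟩ := exists_hamiltonian_vector hg hr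
  simp only [h] at hv
  obtain rfl := hv.unique (hasDerivAt_const _ _)
  ext a
  rw [← hc a]
  exact (formInChart S.form r (chartAt (PhaseSpace n) r r)).map_coord_zero 0 rfl

theorem flow_eq_of_covec_eq_zero (hg : g ∈ S.smoothSheaf.sec W) (hr : r ∈ S.part W)
    (h : S.covec g r = 0) (t : ℝ) : S.flow g t r = r := by
  have h1 : dAt (n := n) (g ∘ S.proj) r = 0 := (dAt_eq_covec hg hr).trans h
  have h : S.IsFlowLine g fun _ => r := by
    refine ⟨fun _ => rfl, fun t => ⟨0, ?_, fun v => ?_⟩⟩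
    · refine (hasMFDerivAt_const (I := 𝓘(ℝ, ℝ)) (I' := 𝓘(ℝ, PhaseSpace n)) r t).congr_mfderiv ?_
      ext
      simp
      rfl
    · refine ((S.form r).map_coord_zero 0 rfl).trans ?_
      rw [h1]
      rfl
  exact (h.eq_flow hg hr t).symm

/-- A function on the base with trivial flow is locally constant: its differential vanishes, so that
its composition with the projection is locally constant near each fiber, and the projection is
closed. -/
theorem mem_constSheaf_of_flow (hg : g ∈ S.smoothSheaf.sec W) (hW : W ≤ U)
    (h : ∀ p ∈ S.part W, ∀ t, S.flow g t p = p) : g ∈ (constSheaf X).sec W := by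
  have hd : ∀ p ∈ S.part W, ∀ᶠ q in 𝓝 p, g (S.proj q) = g (S.proj p) := by
    intro p hp
    set e := chartAt (PhaseSpace n) p
    have hO := e.isOpen_inter_preimage_symm (S.isOpen_part W)
    have hz : ∀ y ∈ e.target ∩ e.symm ⁻¹' S.part W, HasFDerivAt ((g ∘ S.proj) ∘ e.symm)
        (0 : PhaseSpace n →L[ℝ] ℝ) y := by
      intro y hy
      have h1 : DifferentiableAt ℝ ((g ∘ S.proj) ∘ e.symm) y :=
        ((contDiffOn_comp_chart_symm (H := g ∘ S.proj) hg p).contDiffAt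
          (hO.mem_nhds hy)).differentiableAt (by simp)
      have h2 : dAt (n := n) (g ∘ S.proj) (e.symm y) = 0 :=
        (dAt_eq_covec hg hy.2).trans (covec_eq_zero_of_fixed hg hy.2 (h _ hy.2))
      have h3 : fderiv ℝ ((g ∘ S.proj) ∘ e.symm) y = 0 := by
        ext a
        rw [← dAt_chart_symm hy.1 (mdifferentiableAt_of_contMDiffOn hg hy.2), h2]
        rfl
      rw [← h3]
      exact h1.hasFDerivAt
    have hy0 : e p ∈ e.target ∩ e.symm ⁻¹' S.part W :=
      ⟨mem_chart_target _ p, by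
        rw [mem_preimage, e.left_inv (mem_chart_source _ p)]; exact hp⟩
    obtain ⟨δ, hδ, hball⟩ := Metric.isOpen_iff.1 hO _ hy0
    have hc : ∀ y ∈ Metric.ball (e p) δ, ((g ∘ S.proj) ∘ e.symm) y =
        ((g ∘ S.proj) ∘ e.symm) (e p) :=
      fun y hy => (convex_ball (e p) δ).is_const_of_fderivWithin_eq_zero (𝕜 := ℝ)
        (fun z hz' => (hz z (hball hz')).differentiableAt.differentiableWithinAt)
        (fun z hz' => by
          rw [fderivWithin_of_isOpen Metric.isOpen_ball hz', (hz z (hball hz')).fderiv])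
        hy (Metric.mem_ball_self hδ)
    filter_upwards [e.open_source.mem_nhds (mem_chart_source _ p),
      (e.continuousAt (mem_chart_source _ p)).preimage_mem_nhds (Metric.ball_mem_nhds _ hδ)]
      with q hq hq'
    have := hc _ hq'
    simp only [Function.comp_apply, e.left_inv hq, e.left_inv (mem_chart_source _ p)] at this
    exact this
  intro x hx
  obtain ⟨V, hxV, hVU, hV⟩ := S.exists_part_subset (hW hx) (O := interior {q | g (S.proj q) = g x})
    isOpen_interior fun p hp => mem_interior_iff_mem_nhds.2 (by
      subst hp
      exact hd p hx)
  filter_upwards [V.isOpen.mem_nhds hxV] with y hy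
  obtain ⟨p, rfl⟩ := S.proj_onto y (hVU hy)
  exact (interior_subset : interior {q | g (S.proj q) = g x} ⊆ _) (hV hy)

/-- Functions on the base which, composed with the projection, form a moment map over `W` up to the
condition on fibers: at the points of a dense set, their differentials are independent. -/
structure IsFrame (S : IntegrableSystem n U) (W : Opens X) (f : Fin n → X → ℝ) : Prop where
  smooth : ∀ i, f i ∈ S.smoothSheaf.sec W
  dense : S.part W ⊆ closure {p | p ∈ S.part W ∧ LinearIndependent ℝ fun i => S.covec (f i) p}

/-- The components of a moment map are constant on the fibers, and so come from functions on the
base. -/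
theorem exists_isFrame {x : X} (hx : x ∈ U) : ∃ W : Opens X, x ∈ W ∧ ∃ f, S.IsFrame W f := by
  classical
  obtain ⟨W, hxW, hWU, F, hF⟩ := S.moment x hx
  have hc : ∀ p q : S.carrier, p ∈ S.part W → S.proj q = S.proj p → ∀ i, F i q = F i p := by
    intro p q hp hq
    have h : q ∈ S.proj ⁻¹' {S.proj p} := hq
    rw [hF.fiber p hp] at h
    exact (connectedComponentIn_subset _ _ h).2
  have : Nonempty S.carrier := ⟨(S.proj_onto x hx).choose⟩
  choose! s hs using S.proj_onto
  have he : ∀ i, ∀ p ∈ S.part W, ((fun y => F i (s y)) ∘ S.proj) p = F i p := fun i p hp =>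
    hc p _ hp (hs _ (S.proj_mem p)) i
  have hsm : ∀ i, (fun y => F i (s y)) ∈ S.smoothSheaf.sec W := fun i =>
    (hF.smooth i).congr fun p hp => he i p hp
  refine ⟨W, hxW, fun i y => F i (s y), hsm, hF.independent.trans (closure_mono ?_)⟩
  rintro p ⟨hp, hi⟩
  refine ⟨hp, ?_⟩
  have h : ∀ i, dAt (n := n) (F i) p = S.covec (fun y => F i (s y)) p := fun i => by
    refine Eq.trans ?_ (dAt_eq_covec (hsm i) hp)
    refine Filter.EventuallyEq.mfderiv_eq ?_
    filter_upwards [(S.isOpen_part W).mem_nhds hp] with q hq using (he i q hq).symm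
  simp only [h] at hi
  exact hi

/-- The joint flow of a family of functions on the base: the action of `ℝⁿ` on a fiber. -/
noncomputable def jointFlow (S : IntegrableSystem n U) (f : Fin n → X → ℝ) (v : Fin n → ℝ)
    (p : S.carrier) : S.carrier := S.flow (∑ i, v i • f i) 1 p

section Joint

theorem jointFlow_zero (p : S.carrier) : S.jointFlow f 0 p = p := by
  unfold jointFlow
  simp only [Pi.zero_apply, zero_smul, Finset.sum_const_zero]
  exact flow_const (W := ⊤) (zero_mem ((constSheaf X).sec ⊤)) trivial 1

variable (hf : ∀ i, f i ∈ S.smoothSheaf.sec W)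
include hf

theorem jointFlow_mem_part (hp : p ∈ S.part W) (v : Fin n → ℝ) : S.jointFlow f v p ∈ S.part W :=
  flow_mem_part (sum_mem_smoothSheaf hf _ v) hp 1

theorem proj_jointFlow (hp : p ∈ S.part W) (v : Fin n → ℝ) :
    S.proj (S.jointFlow f v p) = S.proj p :=
  proj_flow (sum_mem_smoothSheaf hf _ v) hp 1

theorem jointFlow_add (hp : p ∈ S.part W) (v w : Fin n → ℝ) :
    S.jointFlow f (v + w) p = S.jointFlow f v (S.jointFlow f w p) := by
  unfold jointFlow
  rw [← flow_add (sum_mem_smoothSheaf hf _ v) (sum_mem_smoothSheaf hf _ w) hp]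
  simp only [Pi.add_apply, add_smul, Finset.sum_add_distrib]

theorem jointFlow_smul (hp : p ∈ S.part W) (v : Fin n → ℝ) (t : ℝ) :
    S.jointFlow f (t • v) p = S.flow (∑ i, v i • f i) t p := by
  unfold jointFlow
  simp only [Pi.smul_apply, smul_assoc, ← Finset.smul_sum]
  rw [flow_smul (sum_mem_smoothSheaf hf _ v) hp, mul_one]

theorem jointFlow_mem_stratum (hp : p ∈ S.part W) (v : Fin n → ℝ) :
    S.jointFlow f v p ∈ S.stratum p :=
  flow_mem_stratum (sum_mem_smoothSheaf hf _ v) hp 1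

theorem contMDiff_jointFlow (hp : p ∈ S.part W) :
    ContMDiff 𝓘(ℝ, Fin n → ℝ) 𝓘(ℝ, PhaseSpace n) ∞ fun v => S.jointFlow f v p := by
  have key : ∀ s : Finset (Fin n), ContMDiff 𝓘(ℝ, Fin n → ℝ) 𝓘(ℝ, PhaseSpace n) ∞
      fun v : Fin n → ℝ => S.flow (∑ i ∈ s, v i • f i) 1 p := by
    intro s
    induction s using Finset.cons_induction with
    | empty => exact contMDiff_const (c := S.flow 0 1 p)
    | cons i s hi ih =>
      intro v
      have h : (fun v : Fin n → ℝ => S.flow (∑ j ∈ Finset.cons i s hi, v j • f j) 1 p) =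
          (fun z : ℝ × S.carrier => S.flow (f i) z.1 z.2) ∘
            fun v => (v i, S.flow (∑ j ∈ s, v j • f j) 1 p) := by
        ext v
        have hm := flow_mem_part (sum_mem_smoothSheaf hf s v) hp 1
        rw [Finset.sum_cons, flow_add (smul_mem_smoothSheaf (v i) (hf i))
          (sum_mem_smoothSheaf hf s v) hp, flow_smul (hf i) hm, mul_one]
        rfl
      rw [h]
      refine ContMDiffAt.comp v (contMDiffAt_flow (hf i)
        (flow_mem_part (sum_mem_smoothSheaf hf s v) hp 1) (v i)) ?_
      exact ContMDiffAt.prodMk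
        (ContinuousLinearMap.proj (R := ℝ) (φ := fun _ : Fin n => ℝ) i).contMDiff.contMDiffAt (ih v)
  exact key _

end Joint

end IntegrableSystem

theorem finrank_iInf_ker {ι E : Type*} [Fintype ι] [NormedAddCommGroup E] [NormedSpace ℝ E]
    [FiniteDimensional ℝ E] {α : ι → E →L[ℝ] ℝ} (hα : LinearIndependent ℝ α) :
    Fintype.card ι + Module.finrank ℝ (⨅ i, LinearMap.ker (α i).toLinearMap : Submodule ℝ E) =
      Module.finrank ℝ E := by
  have h1 : LinearIndependent ℝ fun i => ((α i).toLinearMap : Module.Dual ℝ E) :=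
    hα.map' (ContinuousLinearMap.coeLM ℝ) (LinearMap.ker_eq_bot.2 ContinuousLinearMap.coe_injective)
  have h2 := Subspace.finrank_add_finrank_dualCoannihilator_eq
    (Submodule.span ℝ (Set.range fun i => ((α i).toLinearMap : Module.Dual ℝ E)))
  rw [finrank_span_eq_card h1] at h2
  suffices h3 : (⨅ i, LinearMap.ker (α i).toLinearMap : Submodule ℝ E) = (Submodule.span ℝ
      (Set.range fun i => ((α i).toLinearMap : Module.Dual ℝ E))).dualCoannihilator by
    rw [← h2, h3]
  ext u
  simp only [Submodule.mem_iInf, LinearMap.mem_ker, Submodule.mem_dualCoannihilator]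
  constructor
  · intro h φ hφ
    induction hφ using Submodule.span_induction with
    | mem φ hφ => obtain ⟨i, rfl⟩ := hφ; exact h i
    | zero => rfl
    | add φ ψ _ _ h1 h2 => simp [h1, h2]
    | smul c φ _ h1 => simp [h1]
  · exact fun h i => h _ (Submodule.subset_span ⟨i, rfl⟩)

/-- A map with injective strict derivative is injective near the point: its composition with a left
inverse of the derivative is invertible by the inverse function theorem. -/
theorem HasStrictFDerivAt.exists_injOn {E F : Type*} [NormedAddCommGroup E] [NormedSpace ℝ E]
    [FiniteDimensional ℝ E] [NormedAddCommGroup F] [NormedSpace ℝ F] [FiniteDimensional ℝ F]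
    {k : E → F} {k' : E →L[ℝ] F} {a : E}
    (hk : HasStrictFDerivAt k k' a) (hinj : Function.Injective k') : ∃ N ∈ 𝓝 a, InjOn k N := by
  obtain ⟨L, hL⟩ := LinearMap.exists_leftInverse_of_injective k'.toLinearMap
    (LinearMap.ker_eq_bot.2 hinj)
  have hd : HasStrictFDerivAt (fun v => L.toContinuousLinearMap (k v))
      ((ContinuousLinearEquiv.refl ℝ E : E →L[ℝ] E)) a := by
    refine (L.toContinuousLinearMap.hasStrictFDerivAt.comp a hk).congr_fderiv ?_
    ext1 v
    exact LinearMap.congr_fun hL v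
  have : CompleteSpace E := FiniteDimensional.complete ℝ E
  refine ⟨_, (hd.toOpenPartialHomeomorph _).open_source.mem_nhds
    hd.mem_toOpenPartialHomeomorph_source, fun x hx y hy hxy =>
      (hd.toOpenPartialHomeomorph _).injOn hx hy ?_⟩
  show L.toContinuousLinearMap (k x) = L.toContinuousLinearMap (k y)
  rw [hxy]

namespace IntegrableSystem

variable {n : ℕ} {X : Type u} [TopologicalSpace X] {U : Opens X} {S : IntegrableSystem n U}
  {W W' : Opens X} {f : Fin n → X → ℝ} {g : X → ℝ} {r p q : S.carrier}

/-- The joint flow through `r`, read in the chart at `r`. -/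
noncomputable def chartFlow (S : IntegrableSystem n U) (f : Fin n → X → ℝ) (r : S.carrier)
    (v : Fin n → ℝ) : PhaseSpace n := chartAt (PhaseSpace n) r (S.jointFlow f v r)

/-- Functions on the base are in involution. -/
theorem covec_hamiltonian_vector {h : X → ℝ} (hr : r ∈ S.part W) (hg : g ∈ S.smoothSheaf.sec W')
    (hr' : r ∈ S.part W') (hh : h ∈ S.smoothSheaf.sec W) {w : PhaseSpace n}
    (hw : HasDerivAt (fun t => chartAt (PhaseSpace n) r (S.flow g t r)) w 0) :
    S.covec h r w = 0 := by
  have h0 : S.flow g 0 r = r := flow_zero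
  have h1 := HasFDerivAt.comp_hasDerivAt (l := (h ∘ S.proj) ∘ (chartAt (PhaseSpace n) r).symm)
    (f := fun t => chartAt (PhaseSpace n) r (S.flow g t r)) (l' := S.covec h r) 0
    (by simp only [h0]; exact (differentiableAt_chart hh hr).hasFDerivAt) hw
  refine h1.unique ((hasDerivAt_const (0 : ℝ) (h (S.proj r))).congr_of_eventuallyEq ?_)
  have h2 : ContinuousAt (fun t => S.flow g t r) 0 := by
    obtain ⟨u, hu, -⟩ := (isFlowLine_flow hg hr').2 0
    exact hu.continuousAt
  filter_upwards [h2.preimage_mem_nhds (by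
    simp only [h0]
    exact (chartAt (PhaseSpace n) r).open_source.mem_nhds (mem_chart_source _ r))] with t ht
  simp only [Function.comp_apply]
  rw [(chartAt (PhaseSpace n) r).left_inv ht, proj_flow hg hr']

section

variable (hf : ∀ i, f i ∈ S.smoothSheaf.sec W) (hr : r ∈ S.part W)
include hf hr

theorem contDiffAt_chartFlow : ContDiffAt ℝ ∞ (S.chartFlow f r) 0 := by
  rw [← contMDiffAt_iff_contDiffAt]
  refine ContMDiffAt.comp (0 : Fin n → ℝ) ?_ (contMDiff_jointFlow hf hr 0)
  rw [jointFlow_zero]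
  exact contMDiffAt_of_mem_maximalAtlas (IsManifold.chart_mem_maximalAtlas r) (mem_chart_source _ r)

theorem hasDerivAt_chartFlow (v : Fin n → ℝ) :
    HasDerivAt (fun t : ℝ => chartAt (PhaseSpace n) r (S.flow (∑ i, v i • f i) t r))
      (fderiv ℝ (S.chartFlow f r) 0 v) 0 := by
  have h := ((contDiffAt_chartFlow hf hr).differentiableAt (by simp)).hasFDerivAt
  have h2 : HasDerivAt (fun t : ℝ => t • v) v 0 := by
    simpa using (hasDerivAt_id (0 : ℝ)).smul_const v
  have h3 := HasFDerivAt.comp_hasDerivAt (l := S.chartFlow f r) (f := fun t : ℝ => t • v)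
    (l' := fderiv ℝ (S.chartFlow f r) 0) 0 (by simpa using h) h2
  refine h3.congr_of_eventuallyEq (Eventually.of_forall fun t => ?_)
  show _ = chartAt (PhaseSpace n) r (S.jointFlow f (t • v) r)
  rw [jointFlow_smul hf hr]

theorem formInChart_fderiv_chartFlow (v : Fin n → ℝ) (a : PhaseSpace n) :
    formInChart S.form r (chartAt (PhaseSpace n) r r) ![fderiv ℝ (S.chartFlow f r) 0 v, a] =
      ∑ i, v i • S.covec (f i) r a := by
  obtain ⟨w, hw, hc⟩ := exists_hamiltonian_vector (sum_mem_smoothSheaf hf _ v) hr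
  rw [(hasDerivAt_chartFlow hf hr v).unique hw, hc a, covec_sum hf hr]
  simp

variable (hi : LinearIndependent ℝ fun i => S.covec (f i) r)
include hi

theorem injective_fderiv_chartFlow : Function.Injective (fderiv ℝ (S.chartFlow f r) 0) := by
  refine (injective_iff_map_eq_zero _).2 fun v hv =>
    funext (Fintype.linearIndependent_iff.1 hi v ?_)
  ext a
  have h := formInChart_fderiv_chartFlow hf hr v a
  rw [hv] at h
  simp only [sum_apply, smul_apply]
  rw [← h]
  exact (formInChart S.form r (chartAt (PhaseSpace n) r r)).map_coord_zero 0 rfl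

/-- At a regular point the orbit of the joint flow is Lagrangian: by dimension, its tangent vectors
are those which annihilate the differentials of the functions on the base. -/
theorem exists_fderiv_chartFlow_eq {w : PhaseSpace n} (hw : ∀ i, S.covec (f i) r w = 0) :
    ∃ v, fderiv ℝ (S.chartFlow f r) 0 v = w := by
  set b := fderiv ℝ (S.chartFlow f r) 0
  have hle : LinearMap.range b.toLinearMap ≤
      ⨅ i, LinearMap.ker (S.covec (f i) r).toLinearMap := by
    rintro _ ⟨v, rfl⟩
    refine (Submodule.mem_iInf _).2 fun i => ?_
    exact covec_hamiltonian_vector hr (sum_mem_smoothSheaf hf _ v) hr (hf i)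
      (hasDerivAt_chartFlow hf hr v)
  have hK := finrank_iInf_ker hi
  have hb : Module.finrank ℝ (LinearMap.range b.toLinearMap) = n := by
    rw [LinearMap.finrank_range_of_inj (injective_fderiv_chartFlow hf hr hi)]
    simp
  have heq := Submodule.eq_of_le_of_finrank_eq hle (by
    have hE : Module.finrank ℝ (PhaseSpace n) = 2 * n := by simp
    rw [hE, Fintype.card_fin] at hK
    omega)
  have hm : w ∈ LinearMap.range b.toLinearMap := by
    rw [heq]
    exact (Submodule.mem_iInf _).2 hw
  exact hm

/-- The flow of a function on the base through a regular point is a one-parameter subgroup of the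
joint flow. -/
theorem exists_flow_eq_jointFlow (hg : g ∈ S.smoothSheaf.sec W') (hr' : r ∈ S.part W') :
    ∃ c, ∀ t : ℝ, S.flow g t r = S.jointFlow f (t • c) r := by
  obtain ⟨w, hw, hwc⟩ := exists_hamiltonian_vector hg hr'
  obtain ⟨c, hc⟩ := exists_fderiv_chartFlow_eq hf hr hi (w := w) fun i =>
    covec_hamiltonian_vector hr hg hr' (hf i) hw
  refine ⟨c, fun t => ?_⟩
  have hF := sum_mem_smoothSheaf hf Finset.univ c
  have hF' := S.smoothSheaf.anti (inf_le_left : W ⊓ W' ≤ W) hF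
  have hg' := S.smoothSheaf.anti (inf_le_right : W ⊓ W' ≤ W') hg
  have hrr : r ∈ S.part (W ⊓ W') := ⟨hr, hr'⟩
  have h0 : S.covec (g - ∑ i, c i • f i) r = 0 := by
    have e : S.covec (g - ∑ i, c i • f i) r = S.covec g r - S.covec (∑ i, c i • f i) r :=
      fderiv_sub (differentiableAt_chart hg hr') (differentiableAt_chart hF hr)
    rw [e, covec_sum hf hr, sub_eq_zero]
    ext a
    rw [← hwc a, ← hc, formInChart_fderiv_chartFlow hf hr]
    simp
  rw [jointFlow_smul hf hr, ← add_sub_cancel (∑ i, c i • f i) g,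
    flow_add hF' (sub_mem hg' hF') hrr, flow_eq_of_covec_eq_zero (sub_mem hg' hF') hrr h0]

/-- At a regular point the joint flow is injective near the origin. -/
theorem eventually_jointFlow_ne : ∀ᶠ v in 𝓝 (0 : Fin n → ℝ), S.jointFlow f v r = r → v = 0 := by
  obtain ⟨N, hN, hinj⟩ := ((contDiffAt_chartFlow hf hr).hasStrictFDerivAt (by simp)).exists_injOn
    (injective_fderiv_chartFlow hf hr hi)
  filter_upwards [hN] with v hv hvr
  refine hinj hv (mem_of_mem_nhds hN) ?_
  unfold chartFlow
  rw [hvr, jointFlow_zero]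

/-- Near a regular point, its fiber is the orbit of small times under the joint flow.  Coordinates
near `r` are given by the functions `f i`, and by a linear function `L` of the chart which
restricts to coordinates of the orbit. -/
theorem eventually_mem_orbit {N : Set (Fin n → ℝ)} (hN : N ∈ 𝓝 0) :
    ∀ᶠ q in 𝓝 r, S.proj q = S.proj r → ∃ v ∈ N, S.jointFlow f v r = q := by
  set e := chartAt (PhaseSpace n) r with he
  have hre : r ∈ e.source := mem_chart_source _ r
  obtain ⟨L, hL⟩ := LinearMap.exists_leftInverse_of_injective
    (fderiv ℝ (S.chartFlow f r) 0).toLinearMap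
    (LinearMap.ker_eq_bot.2 (injective_fderiv_chartFlow hf hr hi))
  set L' : PhaseSpace n →L[ℝ] (Fin n → ℝ) := LinearMap.toContinuousLinearMap L
  have hB := (contDiffAt_chartFlow hf hr).hasStrictFDerivAt (by simp : (∞ : ℕ∞ω) ≠ 0)
  have hB0 : S.chartFlow f r 0 = e r := by unfold chartFlow; rw [jointFlow_zero]
  have hd : HasStrictFDerivAt (fun v => L' (S.chartFlow f r v))
      ((ContinuousLinearEquiv.refl ℝ (Fin n → ℝ) : (Fin n → ℝ) →L[ℝ] (Fin n → ℝ))) 0 := by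
    have h := L'.hasStrictFDerivAt.comp (0 : Fin n → ℝ) hB
    refine h.congr_fderiv ?_
    ext1 v
    exact LinearMap.congr_fun hL v
  have hG : HasStrictFDerivAt
      (fun y => ((fun i => ((f i ∘ S.proj) ∘ e.symm) y : Fin n → ℝ), L' y))
      ((ContinuousLinearMap.pi fun i => S.covec (f i) r).prod L') (e r) := by
    refine HasStrictFDerivAt.prodMk (hasStrictFDerivAt_pi.2 fun i => ?_) L'.hasStrictFDerivAt
    have h := contDiffOn_comp_chart_symm (H := f i ∘ S.proj) (hf i) r
    refine (h.contDiffAt ((e.isOpen_inter_preimage_symm (S.isOpen_part W)).mem_nhds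
      ⟨mem_chart_target _ r, ?_⟩)).hasStrictFDerivAt (by simp)
    rw [mem_preimage, e.left_inv hre]
    exact hr
  obtain ⟨N₁, hN₁, hinj⟩ := hG.exists_injOn ((injective_iff_map_eq_zero _).2 fun w hw => by
    obtain ⟨h1, h2⟩ := Prod.mk.inj hw
    obtain ⟨v, rfl⟩ := exists_fderiv_chartFlow_eq hf hr hi (w := w) fun i => congrFun h1 i
    have h3 : v = 0 := (LinearMap.congr_fun hL v).symm.trans h2
    rw [h3, map_zero])
  have hN' : N ∩ {v | S.jointFlow f v r ∈ e.source} ∩ S.chartFlow f r ⁻¹' N₁ ∈ 𝓝 0 := by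
    refine inter_mem (inter_mem hN ?_) (hB.continuousAt.preimage_mem_nhds (by rwa [hB0]))
    refine (contMDiff_jointFlow hf hr).continuous.continuousAt.preimage_mem_nhds ?_
    rw [jointFlow_zero]
    exact e.open_source.mem_nhds hre
  have himg := image_mem_map (m := fun v => L' (S.chartFlow f r v)) hN'
  rw [hd.map_nhds_eq_of_equiv, hB0] at himg
  filter_upwards [e.open_source.mem_nhds hre, (e.continuousAt hre).preimage_mem_nhds hN₁,
    (L'.continuous.continuousAt.comp (e.continuousAt hre)).preimage_mem_nhds himg]
    with q hq hq1 ⟨v, ⟨⟨hvN, hve⟩, hv1⟩, hv⟩ hqr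
  refine ⟨v, hvN, e.injOn hve hq (hinj hv1 hq1 (Prod.ext (funext fun i => ?_) hv))⟩
  show f i (S.proj (e.symm (S.chartFlow f r v))) = f i (S.proj (e.symm (e q)))
  rw [e.left_inv hq, hqr]
  have h : e.symm (S.chartFlow f r v) = S.jointFlow f v r := e.left_inv hve
  rw [h, proj_jointFlow hf hr]

end

end IntegrableSystem

/-! ### Displacements of paths in regular strata -/

namespace IntegrableSystem

variable {n : ℕ} {X : Type u} [TopologicalSpace X] {U : Opens X} {S : IntegrableSystem n U}
  {W W' : Opens X} {f : Fin n → X → ℝ} {g h : X → ℝ} {r p q : S.carrier}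

/-- `r` is a regular point over `W` for the family `f` of functions on the base. -/
structure IsRegularAt (S : IntegrableSystem n U) (W : Opens X) (f : Fin n → X → ℝ)
    (r : S.carrier) : Prop where
  smooth : ∀ i, f i ∈ S.smoothSheaf.sec W
  mem : r ∈ S.part W
  indep : LinearIndependent ℝ fun i => S.covec (f i) r

/-- The flow of `g` through `r` is the one-parameter subgroup of the joint flow in the direction
`c`; infinitesimally, `dg = ∑ i, c i • df i` at `r`. -/
def HasCoeff (S : IntegrableSystem n U) (f : Fin n → X → ℝ) (r : S.carrier) (g : X → ℝ)
    (c : Fin n → ℝ) : Prop := ∀ t : ℝ, S.flow g t r = S.jointFlow f (t • c) r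

/-- A path in the stratum of `r` which lifts to a path of `ℝⁿ`, under the joint flow through `r`,
of displacement `d`. -/
def HasDisp (S : IntegrableSystem n U) (f : Fin n → X → ℝ) (r : S.carrier)
    (γ : unitInterval → S.carrier) (d : Fin n → ℝ) : Prop :=
  ∃ η : C(unitInterval, Fin n → ℝ), (∀ t, γ t = S.jointFlow f (η t) r) ∧ η 1 - η 0 = d

theorem jointFlow_flow (hf : ∀ i, f i ∈ S.smoothSheaf.sec W) (hr : r ∈ S.part W)
    (hg : g ∈ S.smoothSheaf.sec W') (hr' : r ∈ S.part W') (v : Fin n → ℝ) (t : ℝ) :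
    S.jointFlow f v (S.flow g t r) = S.flow g t (S.jointFlow f v r) := by
  have hF := sum_mem_smoothSheaf hf Finset.univ v
  have hF' := S.smoothSheaf.anti (inf_le_left : W ⊓ W' ≤ W) hF
  have hg' := smul_mem_smoothSheaf t (S.smoothSheaf.anti (inf_le_right : W ⊓ W' ≤ W') hg)
  have hrr : r ∈ S.part (W ⊓ W') := ⟨hr, hr'⟩
  have h1 := flow_add hF' hg' hrr 1
  have h2 := flow_add hg' hF' hrr 1
  have h3 : S.proj (S.jointFlow f v r) = S.proj r := proj_jointFlow hf hr v
  have h4 : S.jointFlow f v r ∈ S.part W' := by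
    show S.proj _ ∈ W'
    rw [h3]
    exact hr'
  rw [add_comm, h2, flow_smul hg hr', mul_one] at h1
  refine h1.symm.trans ((flow_smul hg h4 t 1).trans ?_)
  rw [mul_one]

theorem continuousAt_jointFlow (hf : ∀ i, f i ∈ S.smoothSheaf.sec W) (hr : r ∈ S.part W)
    (v : Fin n → ℝ) : ContinuousAt (S.jointFlow f v) r :=
  (contMDiffAt_flow_right (sum_mem_smoothSheaf hf _ v) hr 1).continuousAt

theorem jointFlow_neg_jointFlow (hf : ∀ i, f i ∈ S.smoothSheaf.sec W) (hr : r ∈ S.part W)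
    (v : Fin n → ℝ) : S.jointFlow f (-v) (S.jointFlow f v r) = r := by
  rw [← jointFlow_add hf hr, neg_add_cancel, jointFlow_zero]

/-- The joint flow through a point, as a map to its stratum. -/
noncomputable def orbitMap (hf : ∀ i, f i ∈ S.smoothSheaf.sec W) (hr : r ∈ S.part W)
    (v : Fin n → ℝ) : S.stratum r := ⟨S.jointFlow f v r, jointFlow_mem_stratum hf hr v⟩

theorem hasDisp_of_hasCoeff {c : Fin n → ℝ} (hc : S.HasCoeff f r g c) :
    S.HasDisp f r (fun t => S.flow g t r) c :=
  ⟨⟨fun t => (t : ℝ) • c, by fun_prop⟩, fun t => hc t, by simp⟩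

namespace IsRegularAt

variable (hr : S.IsRegularAt W f r)
include hr

theorem mem_part_of_mem_stratum (hq : q ∈ S.stratum r) : q ∈ S.part W := by
  show S.proj q ∈ W
  rw [proj_eq_of_mem_stratum hq]
  exact hr.mem

theorem exists_hasCoeff (hg : g ∈ S.smoothSheaf.sec W') (hr' : r ∈ S.part W') :
    ∃ c, S.HasCoeff f r g c :=
  exists_flow_eq_jointFlow hr.smooth hr.mem hr.indep hg hr'

theorem exists_jointFlow_eq (hq : q ∈ S.stratum r) : ∃ v, S.jointFlow f v r = q := by
  obtain ⟨W', hr', g, hg, rfl⟩ := mem_stratum_iff.1 hq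
  obtain ⟨c, hc⟩ := hr.exists_hasCoeff hg hr'
  exact ⟨_, (hc 1).symm⟩

theorem isOpenMap_orbitMap : IsOpenMap (orbitMap hr.smooth hr.mem) := by
  refine isOpenMap_iff_nhds_le.2 fun v s hs => ?_
  rw [mem_map] at hs
  have hN : (fun w => v + w) ⁻¹' (orbitMap hr.smooth hr.mem ⁻¹' s) ∈ 𝓝 (0 : Fin n → ℝ) :=
    (continuous_const.add continuous_id).continuousAt.preimage_mem_nhds (by simpa using hs)
  have h1 := eventually_mem_orbit hr.smooth hr.mem hr.indep hN
  have hm := jointFlow_mem_part hr.smooth hr.mem v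
  have h2 := (continuousAt_jointFlow hr.smooth hm (-v)).tendsto
  rw [jointFlow_neg_jointFlow hr.smooth hr.mem] at h2
  have h3 := (continuous_subtype_val (p := (· ∈ S.stratum r))).continuousAt
    (x := orbitMap hr.smooth hr.mem v)
  filter_upwards [h3.tendsto.eventually (h2.eventually h1)] with q hq
  have hqW := hr.mem_part_of_mem_stratum q.2
  obtain ⟨w, hw, hwq⟩ := hq ((proj_jointFlow hr.smooth hqW _).trans (proj_eq_of_mem_stratum q.2))
  have : orbitMap hr.smooth hr.mem (v + w) = q := Subtype.ext (by
    show S.jointFlow f (v + w) r = q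
    rw [jointFlow_add hr.smooth hr.mem, hwq, ← jointFlow_add hr.smooth hqW, add_neg_cancel,
      jointFlow_zero])
  rw [← this]
  exact hw

/-- The stratum of a regular point is covered by `ℝⁿ` under the joint flow. -/
theorem isCoveringMap_orbitMap : IsCoveringMap (orbitMap hr.smooth hr.mem) := by
  have hstab : ∀ v w, S.jointFlow f v r = S.jointFlow f w r ↔ S.jointFlow f (w + -v) r = r := by
    intro v w
    constructor
    · intro h
      rw [add_comm, jointFlow_add hr.smooth hr.mem, ← h, jointFlow_neg_jointFlow hr.smooth hr.mem]
    · intro h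
      have := jointFlow_add hr.smooth hr.mem v (w + -v)
      rw [h, add_comm w, add_neg_cancel_left] at this
      exact this.symm
  let G : AddSubgroup (Fin n → ℝ) :=
    { carrier := {v | S.jointFlow f v r = r}
      zero_mem' := jointFlow_zero r
      add_mem' := fun {v w} hv hw => by
        show S.jointFlow f (v + w) r = r
        rw [jointFlow_add hr.smooth hr.mem, show S.jointFlow f w r = r from hw]
        exact hv
      neg_mem' := fun {v} hv => by
        have h := jointFlow_neg_jointFlow hr.smooth hr.mem v
        rwa [show S.jointFlow f v r = r from hv] at h }
  have hG : IsDiscrete (G : Set (Fin n → ℝ)) := by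
    refine IsDiscrete.of_nhdsWithin fun v hv T hT => ?_
    have h : Tendsto (fun w => w + -v) (𝓝 v) (𝓝 0) := by
      have : Continuous fun w : Fin n → ℝ => w + -v := by fun_prop
      simpa using this.tendsto v
    rw [mem_nhdsWithin_iff_eventually]
    filter_upwards [h.eventually (eventually_jointFlow_ne hr.smooth hr.mem hr.indep)] with w hw hwG
    have := hw (add_mem hwG (neg_mem hv))
    rw [add_neg_eq_zero.1 this]
    exact hT
  have hsurj : Function.Surjective (orbitMap hr.smooth hr.mem) := fun q => by
    obtain ⟨v, hv⟩ := hr.exists_jointFlow_eq q.2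
    exact ⟨v, Subtype.ext hv⟩
  have hcont : Continuous (orbitMap hr.smooth hr.mem) :=
    (contMDiff_jointFlow hr.smooth hr.mem).continuous.subtype_mk _
  refine (IsQuotientMap.isAddQuotientCoveringMap_of_addSubgroup
    (hr.isOpenMap_orbitMap.isQuotientMap hcont hsurj) G hG fun {v w} => ?_).isCoveringMap
  exact Subtype.ext_iff.trans (hstab v w)

theorem exists_hasDisp {γ : unitInterval → S.carrier} (hγ : Continuous γ)
    (hm : ∀ t, γ t ∈ S.stratum r) : ∃ d, S.HasDisp f r γ d := by
  obtain ⟨v, hv⟩ := hr.exists_jointFlow_eq (hm 0)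
  have hc := hr.isCoveringMap_orbitMap
  have h0 : (⟨fun t => ⟨γ t, hm t⟩, hγ.subtype_mk hm⟩ : C(unitInterval, S.stratum r)) 0 =
    orbitMap hr.smooth hr.mem v := Subtype.ext hv.symm
  exact ⟨_, hc.liftPath _ v h0, fun t =>
    (congrArg Subtype.val (congrFun (hc.liftPath_lifts _ v h0) t)).symm, rfl⟩

theorem jointFlow_add_sub {v w : Fin n → ℝ} (h : S.jointFlow f v r = S.jointFlow f w r)
    (z : Fin n → ℝ) : S.jointFlow f (z + (w - v)) r = S.jointFlow f z r := by
  have hw : S.jointFlow f (w - v) r = r := by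
    rw [sub_eq_neg_add, jointFlow_add hr.smooth hr.mem, ← h,
      jointFlow_neg_jointFlow hr.smooth hr.mem]
  rw [jointFlow_add hr.smooth hr.mem, hw]

/-- Homotopic paths have the same displacement, by the homotopy lifting property. -/
theorem hasDisp_unique {γ γ' : unitInterval → S.carrier} {d d' : Fin n → ℝ}
    (H : HomotopicIn (S.stratum r) γ γ') (hd : S.HasDisp f r γ d) (hd' : S.HasDisp f r γ' d') :
    d = d' := by
  obtain ⟨η, hη, rfl⟩ := hd
  obtain ⟨η', hη', rfl⟩ := hd'
  obtain ⟨K, hK0, hK1, hKs, hKe, hK⟩ := H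
  have hc := hr.isCoveringMap_orbitMap
  have e0 : γ 0 = γ' 0 := (hKs 1).symm.trans (hK1 0)
  have e1 : γ 1 = γ' 1 := (hKe 1).symm.trans (hK1 1)
  set η'' : C(unitInterval, Fin n → ℝ) := η' + ContinuousMap.const _ (η 0 - η' 0) with hη''
  have hη2 : ∀ t, γ' t = S.jointFlow f (η'' t) r := fun t => by
    rw [hη' t]
    exact (hr.jointFlow_add_sub ((hη' 0).symm.trans (e0.symm.trans (hη 0))) _).symm
  let p : C(Fin n → ℝ, S.stratum r) := ⟨orbitMap hr.smooth hr.mem, hc.continuous⟩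
  have hrel : (p.comp η).HomotopicRel (p.comp η'') {0, 1} := by
    refine ⟨{ toFun := fun z => ⟨K z, hK z.1 z.2⟩
              continuous_toFun := K.continuous.subtype_mk _
              map_zero_left := fun t => Subtype.ext ((hK0 t).trans (hη t))
              map_one_left := fun t => Subtype.ext ((hK1 t).trans (hη2 t))
              prop' := fun t z hz => Subtype.ext ?_ }⟩
    rcases hz with rfl | rfl
    · exact (hKs t).trans (hη 0)
    · exact (hKe t).trans (hη 1)
  have h00 : η'' 0 = η 0 := by simp [hη'']
  have h1 := hc.liftPath_apply_one_eq_of_homotopicRel hrel (η 0) rfl (by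
    show p (η'' 0) = _
    rw [h00]; rfl)
  have h2 := (hc.eq_liftPath_iff' (γ := p.comp η) (e := η 0) rfl (Γ := η)).2 ⟨rfl, rfl⟩
  have h3 := (hc.eq_liftPath_iff' (γ := p.comp η'') (e := η 0) (by
    show p (η'' 0) = _
    rw [h00]; rfl) (Γ := η'')).2 ⟨rfl, h00⟩
  rw [← h2, ← h3] at h1
  rw [h1]
  simp only [hη'', ContinuousMap.add_apply, ContinuousMap.const_apply]
  abel

theorem hasDisp_flow {γ : unitInterval → S.carrier} {d c : Fin n → ℝ} (hd : S.HasDisp f r γ d)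
    (hg : g ∈ S.smoothSheaf.sec W') (hr' : r ∈ S.part W') (hc : S.HasCoeff f r g c)
    {τ : unitInterval → ℝ} (hτ : Continuous τ) :
    S.HasDisp f r (fun t => S.flow g (τ t) (γ t)) (d + (τ 1 - τ 0) • c) := by
  obtain ⟨η, hη, rfl⟩ := hd
  refine ⟨⟨fun t => η t + τ t • c, by fun_prop⟩, fun t => ?_, ?_⟩
  · show S.flow g (τ t) (γ t) = S.jointFlow f (η t + τ t • c) r
    rw [hη t]
    rw [jointFlow_add hr.smooth hr.mem, ← hc (τ t), jointFlow_flow hr.smooth hr.mem hg hr']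
  · show η 1 + τ 1 • c - (η 0 + τ 0 • c) = _
    rw [sub_smul]
    abel

theorem hasCoeff_sub {c d : Fin n → ℝ} (hg : g ∈ S.smoothSheaf.sec W')
    (hh : h ∈ S.smoothSheaf.sec W') (hr' : r ∈ S.part W') (hc : S.HasCoeff f r g c)
    (hd : S.HasCoeff f r h d) : S.HasCoeff f r (g - h) (c - d) := by
  intro t
  have hm : S.jointFlow f (t • (-d)) r ∈ S.part W' := by
    show S.proj _ ∈ W'
    rw [proj_jointFlow hr.smooth hr.mem]
    exact hr'
  have hneg : S.flow (-h) t r = S.jointFlow f (t • (-d)) r := by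
    have h1 := flow_smul hh hr' (-1) t
    rw [neg_one_smul, neg_one_mul, hd (-t)] at h1
    rw [h1, neg_smul, smul_neg]
  rw [sub_eq_add_neg, flow_add hg (neg_mem hh) hr', hneg,
    ← jointFlow_flow hr.smooth hr.mem hg hr', hc t, ← jointFlow_add hr.smooth hr.mem,
      sub_eq_add_neg,
    smul_add, add_comm (t • c)]

theorem of_mem_stratum (hq : q ∈ S.stratum r) : S.IsRegularAt W f q := by
  have hqW := hr.mem_part_of_mem_stratum hq
  refine ⟨hr.smooth, hqW, Fintype.linearIndependent_iff.2 fun v hv => ?_⟩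
  have hF := sum_mem_smoothSheaf hr.smooth Finset.univ v
  obtain ⟨w, rfl⟩ := hr.exists_jointFlow_eq hq
  rw [← covec_sum hr.smooth hqW] at hv
  refine Fintype.linearIndependent_iff.1 hr.indep v ?_
  rw [← covec_sum hr.smooth hr.mem]
  refine covec_eq_zero_of_fixed hF hr.mem fun t => ?_
  have h1 := flow_eq_of_covec_eq_zero hF hqW hv t
  rw [← jointFlow_flow hr.smooth hr.mem hF hr.mem] at h1
  have h2 := congrArg (S.jointFlow f (-w)) h1
  rwa [jointFlow_neg_jointFlow hr.smooth hr.mem,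
    jointFlow_neg_jointFlow hr.smooth (flow_mem_part hF hr.mem t)] at h2

theorem hasDisp_of_mem_stratum (hq : q ∈ S.stratum r) {γ : unitInterval → S.carrier}
    {d : Fin n → ℝ} (hd : S.HasDisp f q γ d) : S.HasDisp f r γ d := by
  obtain ⟨v, rfl⟩ := hr.exists_jointFlow_eq hq
  obtain ⟨η, hη, rfl⟩ := hd
  refine ⟨η + ContinuousMap.const _ v, fun t => ?_, by simp⟩
  rw [hη t, ← jointFlow_add hr.smooth hr.mem]
  rfl

theorem hasCoeff_of_mem_stratum (hq : q ∈ S.stratum r) {c : Fin n → ℝ}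
    (hg : g ∈ S.smoothSheaf.sec W') (hr' : r ∈ S.part W')
    (hc : S.HasCoeff f q g c) : S.HasCoeff f r g c := by
  obtain ⟨v, rfl⟩ := hr.exists_jointFlow_eq hq
  intro t
  have h1 := hc t
  rw [← jointFlow_flow hr.smooth hr.mem hg hr', ← jointFlow_add hr.smooth hr.mem, add_comm,
    jointFlow_add hr.smooth hr.mem] at h1
  have h2 := congrArg (S.jointFlow f (-v)) h1
  rwa [jointFlow_neg_jointFlow hr.smooth (jointFlow_mem_part hr.smooth hr.mem _),
    jointFlow_neg_jointFlow hr.smooth] at h2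
  show S.proj _ ∈ W
  rw [proj_flow hg hr']
  exact hr.mem

end IsRegularAt

/-- A smooth function on the base with vanishing differential at the regular points is locally
constant. -/
theorem mem_constSheaf_of_hasCoeff (hg : g ∈ S.smoothSheaf.sec W) (hW : W ≤ U)
    (h : ∀ W' f r, S.IsRegularAt W' f r → r ∈ S.part W → S.HasCoeff f r g 0) :
    g ∈ (constSheaf X).sec W := by
  refine mem_constSheaf_of_flow hg hW fun p hp t => ?_
  obtain ⟨W', hpW', f, hf⟩ := exists_isFrame (S := S) (S.proj_mem p)
  have h1 := hf.dense hpW'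
  have hc : ContinuousAt (S.flow g t) p := (contMDiffAt_flow_right hg hp t).continuousAt
  by_contra hne
  have h2 : ∀ᶠ q in 𝓝 p, S.flow g t q ≠ q :=
    (hc.ne_iff_eventually_ne continuousAt_id).1 hne
  obtain ⟨q, ⟨hq, hqW⟩, hqr⟩ := mem_closure_iff_nhds.1 h1 _
    (h2.and ((S.isOpen_part W).mem_nhds hp))
  refine hq ?_
  rw [h W' f q ⟨hf.smooth, hqr.1, hqr.2⟩ hqW t, smul_zero, jointFlow_zero]

end IntegrableSystem

/-! ### Families of loops in the strata -/

section BiPath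

variable {M : Type*}

/-- Two paths with a common end, the second one run backwards after the first one. -/
noncomputable def biPath (γ γ' : unitInterval → M) (t : unitInterval) : M :=
  if (t : ℝ) ≤ 1 / 2 then γ (projIcc 0 1 zero_le_one (2 * t))
  else γ' (projIcc 0 1 zero_le_one (2 - 2 * t))

theorem biPath_zero (γ γ' : unitInterval → M) : biPath γ γ' 0 = γ 0 := by
  simp only [biPath, Icc.coe_zero, mul_zero, projIcc_left]
  rw [if_pos (by norm_num)]
  rfl

theorem biPath_one (γ γ' : unitInterval → M) : biPath γ γ' 1 = γ' 0 := by
  simp only [biPath, Icc.coe_one, mul_one, sub_self, projIcc_left]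
  rw [if_neg (by norm_num)]
  rfl

theorem biPath_mem {P : Set M} {γ γ' : unitInterval → M} (h : ∀ t, γ t ∈ P) (h' : ∀ t, γ' t ∈ P)
    (t : unitInterval) : biPath γ γ' t ∈ P := by
  unfold biPath
  split_ifs
  exacts [h _, h' _]

theorem continuous_biPath [TopologicalSpace M] {Z : Type*} [TopologicalSpace Z]
    {F G : Z → unitInterval → M} (hF : Continuous fun z : Z × unitInterval => F z.1 z.2)
    (hG : Continuous fun z : Z × unitInterval => G z.1 z.2) (h : ∀ z, F z 1 = G z 1) :
    Continuous fun z : Z × unitInterval => biPath (F z.1) (G z.1) z.2 := by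
  have e : ∀ k : ℝ → ℝ, Continuous k →
      Continuous fun z : Z × unitInterval => (z.1, projIcc (0 : ℝ) 1 zero_le_one (k z.2)) :=
    fun k hk => continuous_fst.prodMk
      (continuous_projIcc.comp (hk.comp (continuous_subtype_val.comp continuous_snd)))
  refine Continuous.if_le (hF.comp (e (fun t => 2 * t) (by fun_prop)))
    (hG.comp (e (fun t => 2 - 2 * t) (by fun_prop)))
    (continuous_subtype_val.comp continuous_snd) continuous_const fun z hz => ?_
  have h1 : projIcc (0 : ℝ) 1 zero_le_one (2 * z.2) = 1 :=
    projIcc_of_right_le _ (by rw [hz]; norm_num)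
  have h2 : projIcc (0 : ℝ) 1 zero_le_one (2 - 2 * z.2) = 1 :=
    projIcc_of_right_le _ (by rw [hz]; norm_num)
  simp only [h1, h2]
  exact h z.1

variable [TopologicalSpace M] {P : Set M} {γ γ' δ δ' : unitInterval → M}

theorem HomotopicIn.biPath (h : HomotopicIn P γ γ') (k : HomotopicIn P δ δ') (e : γ 1 = δ 1) :
    HomotopicIn P (biPath γ δ) (biPath γ' δ') := by
  obtain ⟨K, hK0, hK1, hKs, hKe, hK⟩ := h
  obtain ⟨L, hL0, hL1, hLs, hLe, hL⟩ := k
  refine ⟨⟨fun z => _root_.biPath (fun t => K (z.1, t)) (fun t => L (z.1, t)) z.2,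
    continuous_biPath (F := fun s t => K (s, t)) (G := fun s t => L (s, t)) K.continuous
      L.continuous fun s => by rw [hKe, hLe, e]⟩, fun t => ?_, fun t => ?_, fun s => ?_, fun s => ?_,
        fun s t => ?_⟩
  · simp only [ContinuousMap.coe_mk, hK0, hL0]
  · simp only [ContinuousMap.coe_mk, hK1, hL1]
  · simp only [ContinuousMap.coe_mk, biPath_zero, hKs]
  · simp only [ContinuousMap.coe_mk, biPath_one, hLs]
  · exact biPath_mem (hK s) (hL s) t

end BiPath

namespace IntegrableSystem

variable {n : ℕ} {X : Type u} [TopologicalSpace X] {U : Opens X} {S : IntegrableSystem n U}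
  {V W Wx Wy : Opens X} {f : Fin n → X → ℝ} {g a a' : X → ℝ} {r p q : S.carrier}

theorem mem_part_of_mem_stratum (hp : p ∈ S.part W) (hq : q ∈ S.stratum p) : q ∈ S.part W := by
  show S.proj q ∈ W
  rw [proj_eq_of_mem_stratum hq]
  exact hp

theorem continuous_flow_comp {Z : Type*} [TopologicalSpace Z] (hg : g ∈ S.smoothSheaf.sec W)
    {τ : Z → ℝ} {k : Z → S.carrier} (hτ : Continuous τ) (hk : Continuous k)
    (hkW : ∀ z, k z ∈ S.part W) : Continuous fun z => S.flow g (τ z) (k z) :=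
  (continuousOn_flow hg).comp_continuous (hτ.prodMk hk) fun z => ⟨mem_univ _, hkW z⟩

theorem flow_mem_stratum_of_mem (hg : g ∈ S.smoothSheaf.sec W) (hp : p ∈ S.part W)
    (hq : q ∈ S.stratum p) (t : ℝ) : S.flow g t q ∈ S.stratum p :=
  mem_stratum_trans hq (flow_mem_stratum hg (mem_part_of_mem_stratum hp hq) t)

theorem _root_.HomotopicIn.flow {γ γ' : unitInterval → S.carrier}
    (h : HomotopicIn (S.stratum p) γ γ') (hg : g ∈ S.smoothSheaf.sec W) (hp : p ∈ S.part W)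
    {τ : unitInterval → ℝ} (hτ : Continuous τ) :
    HomotopicIn (S.stratum p) (fun t => S.flow g (τ t) (γ t)) fun t => S.flow g (τ t) (γ' t) := by
  obtain ⟨K, hK0, hK1, hKs, hKe, hK⟩ := h
  refine ⟨⟨fun z => S.flow g (τ z.2) (K z), continuous_flow_comp hg (hτ.comp continuous_snd)
    K.continuous fun z => mem_part_of_mem_stratum hp (hK z.1 z.2)⟩, fun t => ?_, fun t => ?_,
    fun s => ?_, fun s => ?_, fun s t => flow_mem_stratum_of_mem hg hp (hK s t) _⟩
  · simp only [ContinuousMap.coe_mk, hK0]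
  · simp only [ContinuousMap.coe_mk, hK1]
  · simp only [ContinuousMap.coe_mk, hKs]
  · simp only [ContinuousMap.coe_mk, hKe]

theorem IsRegularAt.hasDisp_biPath (hr : S.IsRegularAt W f r) {γ γ' : unitInterval → S.carrier}
    {d d' : Fin n → ℝ} (hd : S.HasDisp f r γ d) (hd' : S.HasDisp f r γ' d') (e : γ 1 = γ' 1) :
    S.HasDisp f r (biPath γ γ') (d - d') := by
  obtain ⟨η, hη, rfl⟩ := hd
  obtain ⟨η', hη', rfl⟩ := hd'
  -- On each half of the interval, one of the two summands of this lift is constant.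
  refine ⟨⟨fun t => η (projIcc 0 1 zero_le_one (2 * t)) +
    (η' (projIcc 0 1 zero_le_one (2 - 2 * t)) - η' 1), ?_⟩, fun t => ?_, ?_⟩
  · have h1 : Continuous fun t : unitInterval => projIcc (0 : ℝ) 1 zero_le_one (2 * t) :=
      continuous_projIcc.comp (by fun_prop)
    have h2 : Continuous fun t : unitInterval => projIcc (0 : ℝ) 1 zero_le_one (2 - 2 * t) :=
      continuous_projIcc.comp (by fun_prop)
    exact (η.continuous.comp h1).add ((η'.continuous.comp h2).sub continuous_const)
  · simp only [ContinuousMap.coe_mk]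
    unfold biPath
    split_ifs with ht
    · have h2 : projIcc (0 : ℝ) 1 zero_le_one (2 - 2 * t) = 1 :=
        projIcc_of_right_le _ (by linarith)
      rw [h2, sub_self, add_zero, hη]
    · have h1 : projIcc (0 : ℝ) 1 zero_le_one (2 * t) = 1 :=
        projIcc_of_right_le _ (by linarith)
      rw [h1, hη', add_sub_left_comm]
      exact (hr.jointFlow_add_sub ((hη' 1).symm.trans (e.symm.trans (hη 1))) _).symm
  · simp only [ContinuousMap.coe_mk, Icc.coe_one, Icc.coe_zero, mul_one, mul_zero,
      sub_self, sub_zero]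
    have h0 : projIcc (0 : ℝ) 1 zero_le_one 0 = 0 := projIcc_left _
    have h2 : projIcc (0 : ℝ) 1 zero_le_one 2 = 1 := projIcc_of_right_le _ (by norm_num)
    rw [h0, h2]
    abel

/-- Two homeomorphisms with path lifts that are intertwined by time one maps define a continuous
family of loops in the strata: from `p` to the common end of the two paths, and back. -/
theorem exists_isPathLift_id {gx gy : S.carrier → S.carrier}
    {lx ly : S.carrier → C(unitInterval, S.carrier)} (hx : S.IsPathLift Wx gx lx)
    (hy : S.IsPathLift Wy gy ly) (hVx : V ≤ Wx) (hVy : V ≤ Wy) (ha : a ∈ S.smoothSheaf.sec V)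
    (ha' : a' ∈ S.smoothSheaf.sec V)
    (hc : ∀ p ∈ S.part V, S.flow a' 1 (gy p) = gx (S.flow a 1 p)) :
    ∃ l, S.IsPathLift V id l ∧ ∀ p ∈ S.part V, ∀ t, l p t =
      biPath (fun s => S.flow a' s (ly p s))
        (fun s => S.flow a (s - 1) (lx (S.flow a 1 p) s)) t := by
  classical
  have hm : ∀ p ∈ S.part V, S.flow a 1 p ∈ S.part V := fun p hp => flow_mem_part ha hp 1
  have hst : ∀ p ∈ S.part V, S.stratum (S.flow a 1 p) = S.stratum p := fun p hp =>
    stratum_eq (flow_mem_stratum ha hp 1)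
  have hly : ∀ p ∈ S.part V, ∀ t, ly p t ∈ S.part V := fun p hp t =>
    mem_part_of_mem_stratum hp (hy.mem p (hVy hp) t)
  have hlx : ∀ p ∈ S.part V, ∀ t, lx (S.flow a 1 p) t ∈ S.stratum p := fun p hp t => by
    rw [← hst p hp]
    exact hx.mem _ (hVx (hm p hp)) t
  have hend : ∀ p ∈ S.part V, S.flow a' (1 : unitInterval) (ly p 1) =
      S.flow a ((1 : unitInterval) - 1) (lx (S.flow a 1 p) 1) := fun p hp => by
    rw [Icc.coe_one, sub_self, flow_zero, hy.target p (hVy hp),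
      hx.target _ (hVx (hm p hp)), hc p hp]
  have hcont : ∀ p ∈ S.part V, Continuous
      (biPath (fun s => S.flow a' s (ly p s)) fun s => S.flow a (s - 1) (lx (S.flow a 1 p) s)) := by
    intro p hp
    have h := continuous_biPath (Z := Unit) (F := fun _ s => S.flow a' s (ly p s))
      (G := fun _ s => S.flow a (s - 1) (lx (S.flow a 1 p) s))
      (continuous_flow_comp ha' (by fun_prop) (by fun_prop) fun z => hly p hp _)
      (continuous_flow_comp ha (by fun_prop) (by fun_prop) fun z =>
        mem_part_of_mem_stratum hp (hlx p hp _)) fun _ => hend p hp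
    exact h.comp (continuous_const.prodMk continuous_id : Continuous fun t => ((), t))
  refine ⟨fun p => if h : p ∈ S.part V then ⟨_, hcont p h⟩ else ContinuousMap.const _ p, ?_,
    fun p hp t => by simp only [dif_pos hp, ContinuousMap.coe_mk]⟩
  refine ⟨fun p hp => ?_, fun p hp => ?_, fun p hp t => ?_, fun ψ hψ => ?_⟩
  · rw [dif_pos hp]
    rw [ContinuousMap.coe_mk, biPath_zero, Icc.coe_zero, flow_zero, hy.source p (hVy hp)]
  · rw [dif_pos hp]
    rw [ContinuousMap.coe_mk, biPath_one, Icc.coe_zero, hx.source _ (hVx (hm p hp)),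
      ← flow_add_time ha hp]
    norm_num
    exact flow_zero
  · rw [dif_pos hp]
    exact biPath_mem (fun s => flow_mem_stratum_of_mem ha' hp (hy.mem p (hVy hp) s) _)
      (fun s => flow_mem_stratum_of_mem ha hp (hlx p hp s) _) t
  -- continuity: along a path `ψ`, the lifts may be replaced by homotopic ones that depend
  -- continuously on the parameter of `ψ`
  · obtain ⟨H, hH⟩ := hy.continuous ψ fun t => hVy (hψ t)
    obtain ⟨H', hH'⟩ := hx.continuous
      ⟨fun t => S.flow a 1 (ψ t), continuous_flow_comp ha continuous_const ψ.continuous hψ⟩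
      fun t => hVx (hm _ (hψ t))
    have hH'' : ∀ t, HomotopicIn (S.stratum (ψ t)) (fun s => H' (t, s))
        (lx (S.flow a 1 (ψ t))) := fun t => by
      have h := hH' t
      simp only [ContinuousMap.coe_mk, hst _ (hψ t)] at h
      exact h
    have hmem : ∀ {γ γ' : unitInterval → S.carrier} {P : Set S.carrier}, HomotopicIn P γ γ' →
        ∀ s, γ s ∈ P := by
      rintro γ γ' P ⟨K, hK0, -, -, -, hK⟩ s
      rw [← hK0 s]
      exact hK 0 s
    have hends : ∀ {γ γ' : unitInterval → S.carrier} {P : Set S.carrier}, HomotopicIn P γ γ' →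
        γ 1 = γ' 1 := by
      rintro γ γ' P ⟨K, -, hK1, -, hKe, -⟩
      rw [← hK1, hKe]
    have h1 : ∀ t, S.flow a' (1 : unitInterval) (H (t, 1)) =
        S.flow a ((1 : unitInterval) - 1) (H' (t, 1)) := fun t => by
      rw [hends (hH t), hends (hH'' t)]
      exact hend _ (hψ t)
    refine ⟨⟨fun z => biPath (fun s => S.flow a' s (H (z.1, s)))
      (fun s => S.flow a (s - 1) (H' (z.1, s))) z.2, continuous_biPath
        (F := fun t s => S.flow a' s (H (t, s))) (G := fun t s => S.flow a (s - 1) (H' (t, s)))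
        (continuous_flow_comp ha' (by fun_prop) (by fun_prop) fun z =>
          mem_part_of_mem_stratum (hψ z.1) (hmem (hH z.1) z.2))
        (continuous_flow_comp ha (by fun_prop) (by fun_prop) fun z =>
          mem_part_of_mem_stratum (hψ z.1) (hmem (hH'' z.1) z.2)) h1⟩, fun t => ?_⟩
    rw [dif_pos (hψ t)]
    exact ((hH t).flow ha' (hψ t) (τ := fun s => s) (by fun_prop)).biPath
      ((hH'' t).flow ha (hψ t) (τ := fun s => s - 1) (by fun_prop)) (h1 t)

/-- Under the hypothesis on the affine monodromy, the difference of the displacements of two path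
lifts that are intertwined by time one maps is, locally, the differential of a function on the base
which differs from `a' - a` by an integral affine function. -/
theorem AffineMonodromyHyp.exists_hasCoeff (hS : S.AffineMonodromyHyp) (hVU : V ≤ U)
    {gx gy : S.carrier → S.carrier}
    {lx ly : S.carrier → C(unitInterval, S.carrier)} (hx : S.IsPathLift Wx gx lx)
    (hy : S.IsPathLift Wy gy ly) (hVx : V ≤ Wx) (hVy : V ≤ Wy) (ha : a ∈ S.smoothSheaf.sec V)
    (ha' : a' ∈ S.smoothSheaf.sec V)
    (hc : ∀ p ∈ S.part V, S.flow a' 1 (gy p) = gx (S.flow a 1 p)) {x : X} (hxV : x ∈ V) :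
    ∃ V' : Opens X, x ∈ V' ∧ V' ≤ V ∧ ∃ b ∈ S.smoothSheaf.sec V',
      b - (a' - a) ∈ S.affineSheaf.sec V' ∧
      ∀ W f r, S.IsRegularAt W f r → r ∈ S.part V' → ∀ u w,
        S.HasDisp f r (lx (S.flow a 1 r)) u → S.HasDisp f r (ly r) w →
        S.HasCoeff f r b (u - w) := by
  obtain ⟨l, hl, hle⟩ := exists_isPathLift_id hx hy hVx hVy ha ha' hc
  -- Each loop of the family is homotopic to the orbit of the flow of an integral affine `k`.
  obtain ⟨V', hxV', hV', k, hk, hkl⟩ := hS V hVU l hl x hxV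
  have hkI : k ∈ S.affineSheaf.sec V' := AddSubgroup.subset_closure hk
  have ha1 := S.smoothSheaf.anti hV' ha
  have ha2 := S.smoothSheaf.anti hV' ha'
  refine ⟨V', hxV', hV', a' - a - k, sub_mem (sub_mem ha2 ha1) hk.1, ?_,
    fun W f r hr hrV u w hu hw => ?_⟩
  · rw [sub_sub_cancel_left]
    exact neg_mem hkI
  obtain ⟨c, hc1⟩ := hr.exists_hasCoeff ha1 hrV
  obtain ⟨c', hc2⟩ := hr.exists_hasCoeff ha2 hrV
  obtain ⟨d, hd⟩ := hr.exists_hasCoeff hk.1 hrV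
  have h1 := hr.hasDisp_flow hw ha2 hrV hc2 (τ := fun t => t) (by fun_prop)
  have h2 := hr.hasDisp_flow hu ha1 hrV hc1 (τ := fun t => t - 1) (by fun_prop)
  have h3 := hr.hasDisp_biPath h1 h2 (by
    have hrV' := hV' hrV
    have hm := flow_mem_part ha hrV' 1
    rw [hy.target r (hVy hrV'), hx.target _ (hVx hm), Icc.coe_one, sub_self, flow_zero,
      hc r hrV'])
  obtain ⟨γ, hγ, hγ0, -, hγl⟩ := hkl r hrV
  have hγe : ∀ t, γ t = S.flow k t r := fun t => by
    rw [hγ.eq_flow hk.1 (by rw [hγ0]; exact hrV), hγ0]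
  simp only [hγe] at hγl
  have hlr : (l r : unitInterval → S.carrier) =
      biPath (fun s => S.flow a' s (ly r s)) fun s => S.flow a (s - 1) (lx (S.flow a 1 r) s) :=
    funext (hle r (hV' hrV))
  rw [hlr] at hγl
  -- Homotopic paths have the same displacement.
  have h4 := hr.hasDisp_unique hγl (hasDisp_of_hasCoeff hd) h3
  have h5 := hr.hasCoeff_sub (sub_mem ha2 ha1) hk.1 hrV (hr.hasCoeff_sub ha2 ha1 hrV hc2 hc1) hd
  have h6 : c' - c - d = u - w := by
    rw [h4]
    simp only [Icc.coe_one, Icc.coe_zero, sub_zero, sub_self, zero_sub,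
      sub_neg_eq_add, zero_add, one_smul]
    abel
  rwa [h6] at h5

end IntegrableSystem

/-! ### Topologically equivalent systems -/

section Topological

variable {n : ℕ} {X : Type u} [TopologicalSpace X] {O₁ O₂ : Opens X}
  {S₁ : IntegrableSystem n O₁} {S₂ : IntegrableSystem n O₂} {S₀ : IntegrableSystem n (O₁ ⊓ O₂)}

theorem RoughEquiv.map_symm_comp {n : ℕ} {X : Type u} [TopologicalSpace X] {U U' V W : Opens X}
    {S : IntegrableSystem n U} {T : IntegrableSystem n U'} (Φ : RoughEquiv S T V) {x y z : X}
    (hy : y ∈ V) (hz : z ∈ V) (hWy : W ≤ Φ.nbhd y) (hWz : W ≤ Φ.nbhd z)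
    {r : S.carrier} (hr : r ∈ S.part W) :
    (Φ.map x).symm (Φ.map y ((Φ.map y).symm (Φ.map z r))) = (Φ.map x).symm (Φ.map z r) := by
  rw [((Φ.isSymplecto hy).mono hWy).right_inv _ (((Φ.isSymplecto hz).mono hWz).mapsTo hr)]

/-- The relation that a topological equivalence of the systems imposes between the transition maps
of two rough equivalences. -/
theorem flow_topEquiv {Ψ₁ : RoughEquiv S₀ S₁ (O₁ ⊓ O₂)} {Ψ₂ : RoughEquiv S₀ S₂ (O₁ ⊓ O₂)}
    {h : OpenPartialHomeomorph S₁.carrier S₂.carrier} (hs : h.source = S₁.part (O₁ ⊓ O₂))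
    (hh : ∀ p ∈ h.source, S₂.proj (h p) = S₁.proj p) {V : Opens X} {x y : X} (hx : x ∈ O₁ ⊓ O₂)
    (hy : y ∈ O₁ ⊓ O₂) (h₁y : V ≤ Ψ₁.nbhd y) (h₂x : V ≤ Ψ₂.nbhd x)
    (h₂y : V ≤ Ψ₂.nbhd y) {a₁ a₂ : X → ℝ} (ha₁ : S₀.FlowRel V (Ψ₁.map x) (Ψ₁.map y) a₁)
    (ha₂ : S₀.FlowRel V (Ψ₂.map x) (Ψ₂.map y) a₂) {p : S₀.carrier} (hp : p ∈ S₀.part V) :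
    S₀.flow a₂ 1 (((Ψ₂.map y).symm ∘ h ∘ Ψ₁.map y) p) =
      ((Ψ₂.map x).symm ∘ h ∘ Ψ₁.map x) (S₀.flow a₁ 1 p) := by
  have s₁ := (Ψ₁.isSymplecto hy).mono h₁y
  have s₂ := (Ψ₂.isSymplecto hy).mono h₂y
  have hmem : Ψ₁.map y p ∈ h.source := by
    rw [hs]
    show S₁.proj _ ∈ O₁ ⊓ O₂
    rw [s₁.proj _ hp]
    exact S₀.proj_mem p
  have hm : h (Ψ₁.map y p) ∈ S₂.part V := by
    show S₂.proj _ ∈ V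
    rw [hh _ hmem, s₁.proj _ hp]
    exact hp
  have hq := s₂.mapsTo_inv hm
  show S₀.flow a₂ 1 ((Ψ₂.map y).symm (h (Ψ₁.map y p))) =
    (Ψ₂.map x).symm (h (Ψ₁.map x (S₀.flow a₁ 1 p)))
  rw [← (FlowRel.iff_inv ((Ψ₂.isSymplecto hx).mono h₂x) s₂ ha₂.1).1 ha₂ _ hq, Function.comp_apply,
    s₂.right_inv _ hm, ha₁.2 p hp]

/-- If the systems are topologically equivalent, then the difference of the Lagrangian classes
comes from a class with coefficients in closed 1-forms.  The cocycle that represents it is made of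
the differences of the displacements of the path lifts. -/
theorem exists_toZmodR_eq [T2Space X] {Ψ₁ : RoughEquiv S₀ S₁ (O₁ ⊓ O₂)}
    {Ψ₂ : RoughEquiv S₀ S₂ (O₁ ⊓ O₂)} (hS : S₀.AffineMonodromyHyp) (hΨ : TopEquivOverlap Ψ₁ Ψ₂)
    {μ₁ μ₂ : S₀.H1ZmodR (O₁ ⊓ O₂)} (hμ₁ : Ψ₁.IsLagrangianClass μ₁)
    (hμ₂ : Ψ₂.IsLagrangianClass μ₂) :
    ∃ ζ : S₀.H1Z (O₁ ⊓ O₂), S₀.toZmodR (O₁ ⊓ O₂) ζ = μ₂ - μ₁ := by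
  obtain ⟨h, hs, -, hh, hg⟩ := hΨ
  obtain ⟨N₁, hN₁, hNΨ₁, a₁, rfl, ha₁⟩ := (Ψ₁.isLagrangianClass_iff _).1 hμ₁
  obtain ⟨N₂, hN₂, hNΨ₂, a₂, rfl, ha₂⟩ := (Ψ₂.isLagrangianClass_iff _).1 hμ₂
  obtain ⟨NA, hNA, -, hA⟩ := (a₂ - a₁).2
  choose! M hxM hM hadm hl using hg
  have hl' : ∀ x, ∃ l, x ∈ O₁ ⊓ O₂ →
      S₀.IsPathLift (M x) ((Ψ₂.map x).symm ∘ h ∘ Ψ₁.map x) l := fun x => by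
    by_cases hx : x ∈ O₁ ⊓ O₂
    · obtain ⟨l, hl⟩ := hl x hx
      exact ⟨l, fun _ => hl⟩
    · exact ⟨fun p => ContinuousMap.const _ p, fun h => absurd h hx⟩
  choose l hl using hl'
  set A : X → X → X → ℝ := fun x y => (a₂ : X → X → X → ℝ) x y - (a₁ : X → X → X → ℝ) x y
  set τ : X → X → S₀.carrier → S₀.carrier := fun x y r => (Ψ₁.map x).symm (Ψ₁.map y r)
  set N : X → Opens X := fun x => N₁ x ⊓ N₂ x ⊓ (NA x ⊓ M x)
  have hN : IsPointCover (O₁ ⊓ O₂) N := fun x hx =>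
    ⟨⟨⟨(hN₁ x hx).1, (hN₂ x hx).1⟩, (hNA x hx).1, hxM x hx⟩,
      (inf_le_left.trans inf_le_left).trans (hN₁ x hx).2⟩
  have i₁ : ∀ x, N x ≤ N₁ x := fun x => inf_le_left.trans inf_le_left
  have i₂ : ∀ x, N x ≤ N₂ x := fun x => inf_le_left.trans inf_le_right
  have iA : ∀ x, N x ≤ NA x := fun x => inf_le_right.trans inf_le_left
  have iM : ∀ x, N x ≤ M x := fun x => inf_le_right.trans inf_le_right
  have iΨ₁ : ∀ x ∈ O₁ ⊓ O₂, N x ≤ Ψ₁.nbhd x := fun x hx => (i₁ x).trans (hNΨ₁ x hx)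
  have iΨ₂ : ∀ x ∈ O₁ ⊓ O₂, N x ≤ Ψ₂.nbhd x := fun x hx => (i₂ x).trans (hNΨ₂ x hx)
  have hτ : ∀ x ∈ O₁ ⊓ O₂, ∀ y ∈ O₁ ⊓ O₂, ∀ r ∈ S₀.part (N x ⊓ N y), τ x y r ∈ S₀.stratum r :=
    fun x hx y hy r hr => (Ψ₁.admissible x hx y hy).stratum_mem r ⟨iΨ₁ x hx hr.1, iΨ₁ y hy hr.2⟩
  have hdisp : ∀ x ∈ O₁ ⊓ O₂, ∀ W f r, S₀.IsRegularAt W f r → ∀ q ∈ S₀.stratum r,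
      q ∈ S₀.part (N x) → ∃ d, S₀.HasDisp f r (l x q) d := fun x hx W f r hr q hq hqN =>
    hr.exists_hasDisp (l x q).continuous fun t => by
      rw [← stratum_eq hq]
      exact (hl x hx).mem q (iM x hqN) t
  -- After a refinement, for all `x` and `y` there is `b`, congruent to `A x y` modulo integral
  -- affine functions, the differential of which is the difference of the displacements of the
  -- lifts.
  obtain ⟨N', hN', hN'N, hgood⟩ := exists_refinement S₀.paracompact hN
    (fun x y V => ∃ b ∈ S₀.smoothSheaf.sec V, b - A x y ∈ S₀.affineSheaf.sec V ∧
      ∀ W f r, S₀.IsRegularAt W f r → r ∈ S₀.part V → ∀ u w,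
        S₀.HasDisp f r (l x (τ x y r)) u → S₀.HasDisp f r (l y r) w → S₀.HasCoeff f r b (u - w))
    (fun x y V V' hV ⟨b, hb, hbA, hbd⟩ => ⟨b, S₀.smoothSheaf.anti hV hb,
      S₀.affineSheaf.anti hV hbA, fun W f r hr hrV => hbd W f r hr (hV hrV)⟩)
    (fun x y => ⟨0, zero_mem _, S₀.const_le_affine _ fun z hz => hz.elim,
      fun W f r _ hr => hr.elim⟩)
    (fun x hx y hy z hz => by
      have f₁ := (ha₁ x hx y hy).mono (inf_le_inf (i₁ x) (i₁ y))
      have f₂ := (ha₂ x hx y hy).mono (inf_le_inf (i₂ x) (i₂ y))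
      obtain ⟨V, hzV, hV, b, hb, hbA, hbd⟩ := hS.exists_hasCoeff (V := N x ⊓ N y)
        (inf_le_left.trans (hN x hx).2) (hl x hx) (hl y hy)
        (inf_le_left.trans (iM x)) (inf_le_right.trans (iM y)) f₁.1 f₂.1
        (fun p hp => flow_topEquiv hs hh hx hy (inf_le_right.trans (iΨ₁ y hy))
          (inf_le_left.trans (iΨ₂ x hx))
          (inf_le_right.trans (iΨ₂ y hy)) f₁ f₂ hp) hz
      refine ⟨V, hzV, b, hb, hbA, fun W f r hr hrV u w hu hw => hbd W f r hr hrV u w ?_ hw⟩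
      rw [← (FlowRel.iff_inv ((Ψ₁.isSymplecto hx).mono (inf_le_left.trans (iΨ₁ x hx)))
        ((Ψ₁.isSymplecto hy).mono (inf_le_right.trans (iΨ₁ y hy))) f₁.1).1 f₁ r (hV hrV)]
      exact hu)
    (fun x hx y hy j hj V hVx hVy hVj ⟨b, hb, hbA, hbd⟩ ⟨b', hb', hbA', hbd'⟩ => by
      refine ⟨b - b', sub_mem hb hb', ?_, fun W f r hr hrV u w hu hw => ?_⟩
      · have h1 : A y j - A x j + A x y ∈ S₀.affineSheaf.sec V :=
          S₀.affineSheaf.restrict (hA x hx y hy j hj)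
            fun z hz => ⟨⟨iA x (hVx hz), iA y (hVy hz)⟩, iA j (hVj hz)⟩
        have h2 := sub_mem (sub_mem hbA hbA') h1
        have e : b - A x j - (b' - A y j) - (A y j - A x j + A x y) = b - b' - A x y := by abel
        rwa [e] at h2
      · have hm := hτ j hj y hy r ⟨hVj hrV, hVy hrV⟩
        have hm' := mem_stratum_symm hm
        have hr' := hr.of_mem_stratum hm
        have hrV' := mem_part_of_mem_stratum hrV hm
        obtain ⟨v, hv⟩ := hdisp j hj W f _ hr' _ mem_stratum_self (hVj hrV')
        have h1 := hbd W f _ hr' hrV' u v (by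
          rw [show τ x j (τ j y r) = τ x y r from Ψ₁.map_symm_comp hj hy (hVj.trans (iΨ₁ j hj))
            (hVy.trans (iΨ₁ y hy)) hrV]
          exact hr'.hasDisp_of_mem_stratum hm' hu) hv
        have h2 := hbd' W f _ hr' hrV' w v (by
          rw [show τ y j (τ j y r) = τ y y r from Ψ₁.map_symm_comp hj hy (hVj.trans (iΨ₁ j hj))
            (hVy.trans (iΨ₁ y hy)) hrV, show τ y y r = r from
              (Ψ₁.isSymplecto hy).left_inv r (iΨ₁ y hy (hVy hrV))]
          exact hr'.hasDisp_of_mem_stratum hm' hw) hv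
        have h3 := hr.hasCoeff_of_mem_stratum hm (sub_mem hb hb') hrV
          (hr'.hasCoeff_sub hb hb' hrV' h1 h2)
        rwa [sub_sub_sub_cancel_right] at h3)
  choose! b hb hbA hbd using hgood
  -- The differences of displacements add up to zero, so `b` is a cocycle up to constants.
  have hbZ : b ∈ cechZ1 S₀.smoothSheaf (constSheaf X) (O₁ ⊓ O₂) := by
    refine ⟨N', hN', hb, fun x hx y hy z hz => ?_⟩
    set V := N' x ⊓ N' y ⊓ N' z
    have hxy := S₀.smoothSheaf.restrict (V := V) (hb x hx y hy) fun z hz => hz.1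
    have hxz := S₀.smoothSheaf.restrict (V := V) (hb x hx z hz) fun z hz => ⟨hz.1.1, hz.2⟩
    have hyz := S₀.smoothSheaf.restrict (V := V) (hb y hy z hz) fun z hz => ⟨hz.1.2, hz.2⟩
    have e : cechD1 X b x y z = b x y - (b x z - b y z) := by
      show b y z - b x z + b x y = _
      abel
    rw [e]
    refine mem_constSheaf_of_hasCoeff (sub_mem hxy (sub_mem hxz hyz))
      ((inf_le_left.trans inf_le_left).trans (hN' x hx).2) fun W f r hr hrV => ?_
    have jx : V ≤ N x := (inf_le_left.trans inf_le_left).trans (hN'N x)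
    have jy : V ≤ N y := (inf_le_left.trans inf_le_right).trans (hN'N y)
    have jz : V ≤ N z := inf_le_right.trans (hN'N z)
    have hm := hτ y hy z hz r ⟨jy hrV, jz hrV⟩
    have hm' := mem_stratum_symm hm
    have hr' := hr.of_mem_stratum hm
    have hrV' := mem_part_of_mem_stratum hrV hm
    have hmx := hτ x hx z hz r ⟨jx hrV, jz hrV⟩
    obtain ⟨u, hu⟩ := hdisp x hx W f r hr _ hmx (jx (mem_part_of_mem_stratum hrV hmx))
    obtain ⟨v, hv⟩ := hdisp y hy W f r hr _ hm (jy hrV')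
    obtain ⟨w, hw⟩ := hdisp z hz W f r hr _ mem_stratum_self (jz hrV)
    have h1 := hbd x hx z hz W f r hr ⟨hrV.1.1, hrV.2⟩ u w hu hw
    have h2 := hbd y hy z hz W f r hr ⟨hrV.1.2, hrV.2⟩ v w hv hw
    have h3 := hr.hasCoeff_of_mem_stratum hm hxy hrV (hbd x hx y hy W f _ hr' hrV'.1 u v (by
      rw [show τ x y (τ y z r) = τ x z r from Ψ₁.map_symm_comp hy hz (jy.trans (iΨ₁ y hy))
        (jz.trans (iΨ₁ z hz)) hrV]
      exact hr'.hasDisp_of_mem_stratum hm' hu) (hr'.hasDisp_of_mem_stratum hm' hv))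
    have h4 := hr.hasCoeff_sub hxy (sub_mem hxz hyz) hrV h3 (hr.hasCoeff_sub hxz hyz hrV h1 h2)
    rwa [sub_sub_sub_cancel_right, sub_self] at h4
  refine ⟨CechH1.mk _ _ _ ⟨b, hbZ⟩, ?_⟩
  rw [← map_sub]
  refine CechH1.mk_eq_iff.2 ⟨N', hN', 0, fun _ _ => zero_mem _, fun x hx y hy => ?_⟩
  rw [map_zero, sub_zero]
  exact hbA x hx y hy

end Topological

theorem mainTheorem4 {X : Type u} [TopologicalSpace X] [T2Space X] (n : ℕ) (O₁ O₂ : Opens X)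
    (hO : ParacompactSpace ↥(O₁ ⊔ O₂))
    (S₁ : IntegrableSystem n O₁) (S₂ : IntegrableSystem n O₂) (S₀ : IntegrableSystem n (O₁ ⊓ O₂))
    (Ψ₁ : RoughEquiv S₀ S₁ (O₁ ⊓ O₂)) (Ψ₂ : RoughEquiv S₀ S₂ (O₁ ⊓ O₂))
    (h₁ : S₁.SymplectomorphismHyp) (h₂ : S₂.SymplectomorphismHyp) (h₀ : S₀.SymplectomorphismHyp) :
    (∃ μ₁ μ₂ : S₀.H1ZmodR (O₁ ⊓ O₂),
      (∀ c, Ψ₁.IsLagrangianClass c ↔ c = μ₁) ∧ (∀ c, Ψ₂.IsLagrangianClass c ↔ c = μ₂) ∧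
      (Glues Ψ₁ Ψ₂ ↔ μ₂ - μ₁ ∈ sumOfImages Ψ₁ Ψ₂) ∧
      (S₁.FineHyp → S₂.FineHyp → S₀.FineHyp → S₀.AffineMonodromyHyp → TopEquivOverlap Ψ₁ Ψ₂ →
        Function.Bijective (S₀.connectingZ (O₁ ⊓ O₂)) ∧
        ∃ ι : S₀.H2modR (O₁ ⊓ O₂) →+ S₀.H1ZmodR (O₁ ⊓ O₂),
          Function.Injective ι ∧
          (∀ ζ : S₀.H1Z (O₁ ⊓ O₂),
            ι (IntegrableSystem.H2modR.mk S₀ (O₁ ⊓ O₂) (S₀.connectingZ (O₁ ⊓ O₂) ζ)) =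
              S₀.toZmodR (O₁ ⊓ O₂) ζ) ∧
          (∀ d ∈ sumOfImagesH2 Ψ₁ Ψ₂, ι d ∈ sumOfImages Ψ₁ Ψ₂) ∧
          ∃ o : S₀.H2modR (O₁ ⊓ O₂), ι o = μ₂ - μ₁ ∧
            ((QuotientAddGroup.mk o : S₀.H2modR (O₁ ⊓ O₂) ⧸ sumOfImagesH2 Ψ₁ Ψ₂) = 0 →
              Glues Ψ₁ Ψ₂))) ∧
    ((∃ S : IntegrableSystem n (O₁ ⊔ O₂),
        Nonempty (RoughEquiv S₁ S O₁) ∧ Nonempty (RoughEquiv S₂ S O₂)) ↔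
      ∃ (Φ₁ : RoughEquiv S₀ S₁ (O₁ ⊓ O₂)) (Φ₂ : RoughEquiv S₀ S₂ (O₁ ⊓ O₂))
        (μ₁ μ₂ : S₀.H1ZmodR (O₁ ⊓ O₂)),
        Φ₁.IsLagrangianClass μ₁ ∧ Φ₂.IsLagrangianClass μ₂ ∧ μ₂ - μ₁ ∈ sumOfImages Φ₁ Φ₂) := by
  obtain ⟨μ₁, hμ₁⟩ := Ψ₁.exists_isLagrangianClass S₀.paracompact le_rfl h₀
  obtain ⟨μ₂, hμ₂⟩ := Ψ₂.exists_isLagrangianClass S₀.paracompact le_rfl h₀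
  have hglue : Glues Ψ₁ Ψ₂ ↔ μ₂ - μ₁ ∈ sumOfImages Ψ₁ Ψ₂ :=
    ⟨fun h => h.mem_sumOfImages h₁ h₂ h₀ hμ₁ hμ₂, glues_of_mem_sumOfImages hO hμ₁ hμ₂⟩
  refine ⟨⟨μ₁, μ₂, fun c => ⟨fun hc => hc.unique hμ₁, fun hc => hc ▸ hμ₁⟩,
    fun c => ⟨fun hc => hc.unique hμ₂, fun hc => hc ▸ hμ₂⟩, hglue, ?_⟩, ?_⟩
  · intro f₁ f₂ f₀ hS hΨ
    obtain ⟨ζ, hζ⟩ := exists_toZmodR_eq hS hΨ hμ₁ hμ₂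
    have ho := (H2modR.toZmodR_mk f₀ ζ).trans hζ
    refine ⟨f₀.connectingZ_bijective, H2modR.toZmodR f₀, H2modR.toZmodR_injective f₀,
      H2modR.toZmodR_mk f₀, fun d hd => toZmodR_mem_sumOfImages Ψ₁ Ψ₂ f₁ f₂ f₀ hd, _, ho,
      fun h => hglue.2 ?_⟩
    rw [← ho]
    exact toZmodR_mem_sumOfImages Ψ₁ Ψ₂ f₁ f₂ f₀ ((QuotientAddGroup.eq_zero_iff _).1 h)
  · constructor
    · rintro ⟨S, ⟨Θ₁⟩, ⟨Θ₂⟩⟩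
      exact ⟨Ψ₁, exists_roughEquiv_of_glued Ψ₁ h₁ h₂ h₀ Θ₁ Θ₂⟩
    · rintro ⟨Φ₁, Φ₂, ν₁, ν₂, hν₁, hν₂, h⟩
      obtain ⟨S, Θ₁, Θ₂, -⟩ := glues_of_mem_sumOfImages hO hν₁ hν₂ h
      exact ⟨S, ⟨Θ₁⟩, ⟨Θ₂⟩⟩
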